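/- Consider the sine-Gordon equation $f_{tt}-f_{xx}+\sin f=0$ for $f:\mathbb{R}_t\times\mathbb{R}_x\to\mathbb{R}$. Let $H^1_{\sin}(\mathbb{R})=\{u\in L^1_{\rm loc}:\ u_x\in L^2,\ \sin(u/2)\in L^2\}$ and $\mathbf{E}^0_{\sin}=\{f\in C_tH^1_{\sin}:\ \partial_tf\text{ exists and lies in }C_tL^2\}$, and let $H^{m,s}(\mathbb{R})$ ($m,s\ge0$) have norm $\|u\|_{H^{m,s}}=\|(1+x^2)^{s/2}u\|_{H^m}$. For $\beta\in(-1,1)$ and $x_0\in\mathbb{R}$ let $\gamma=(1-\beta^2)^{-1/2}$ and $Q(t,x;\beta,x_0)=4\arctan\big(e^{\gamma(x-\beta t-x_0)}\big)$ (a kink). For $a>0$, $f$ is the Bäcklund transform of $\phi$ by the parameter $a$ if $$f_x-\phi_t=\tfrac1a\sin\tfrac{f+\phi}{2}+a\sin\tfrac{f-\phi}{2},\qquad f_t-\phi_x=\tfrac1a\sin\tfrac{f+\phi}{2}-a\sin\tfrac{f-\phi}{2}.$$ Fix real numbers $m,s\ge0$, $\beta_0\in(-1,1)$ and $x_0\in\mathbb{R}$.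 There is a constant $C_0>0$, depending only on $m,s,\beta_0,x_0$, such that for every $C\ge C_0$ there is $\delta>0$, depending only on $m,s,\beta_0,x_0,C$, with the following property. Let $0<\varepsilon_0<\delta$ and let $f\in\mathbf{E}^0_{\sin}$ be a solution of the sine-Gordon equation with $$\|(f,f_t)(0,\cdot)-(Q,Q_t)(0,\cdot;\beta_0,x_0)\|_{H^{m+1,s}\times H^{m,s}}<\varepsilon_0.$$ Then there is a unique triple $(\beta,y_0,\phi)\in(-1,1)\times\mathbb{R}\times\mathbf{E}^0_{\sin}$ such that $\phi$ is a solution of the sine-Gordon equation, $f$ is the Bäcklund transform of $\phi$ by the parameter $a=\sqrt{\frac{1+\beta}{1-\beta}}$, $$|\beta-\beta_0|+|y_0-x_0|+\|(\phi,\phi_t)(0)\|_{H^{m+1,s}\times H^{m,s}}\le C\varepsilon_0,$$ $$\|(f,f_t)(0,\cdot)-(Q,Q_t)(0,\cdot;\beta,y_0)\|_{H^{m+1,s}\times H^{m,s}}\le C\varepsilon_0,$$ and $$\int_{\mathbb{R}}\big(f(0,x)-Q(0,x;\beta,y_0)\big)\,\mathrm{sech}(\gamma(x-y_0))\,dx=0,\qquad\gamma=(1-\beta^2)^{-1/2}.$$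 -/

import Mathlib

open MeasureTheory Filter
open scoped Topology ENNReal ContDiff FourierTransform

noncomputable section

namespace SineGordon

/-- The Lorentz factor `γ = (1 - β²)^{-1/2}` of a velocity `β ∈ (-1, 1)`. -/
def lorentz (β : ℝ) : ℝ := (Real.sqrt (1 - β ^ 2))⁻¹

/-- The kink `Q(t, x; β, x₀) = 4 arctan (exp (γ (x - β t - x₀)))`. -/
def kink (β x₀ t x : ℝ) : ℝ := 4 * Real.arctan (Real.exp (lorentz β * (x - β * t - x₀)))

/-- The time derivative `Q_t(t, x; β, x₀)` of the kink. -/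
def kinkDt (β x₀ t x : ℝ) : ℝ := deriv (fun τ => kink β x₀ τ x) t

/-- The hyperbolic secant. -/
def sech (x : ℝ) : ℝ := (Real.cosh x)⁻¹

/-- The parameter `a = √((1 + β) / (1 - β))` of the Bäcklund transform with velocity `β`. -/
def backlundParam (β : ℝ) : ℝ := Real.sqrt ((1 + β) / (1 - β))

/-- The function `x ↦ ⟨x⟩^s u(x)` with `⟨x⟩ = √(1 + x²)`, viewed as complex-valued. -/
def weighted (s : ℝ) (u : ℝ → ℝ) (x : ℝ) : ℂ := (((1 + x ^ 2) ^ (s / 2) * u x : ℝ) : ℂ)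

open Classical in
/-- The `H^{m,s}(ℝ)` norm `‖⟨x⟩^s u‖_{H^m}` for `m, s ≥ 0`, with value `∞` if `u` is not in
`H^{m,s}(ℝ)`. The `H^m` norm of `w ∈ L²` is the `L²` norm of `(1 + |2πξ|²)^{m/2} ŵ(ξ)`, with `ŵ` the
`L²` Fourier transform, normalized as `ŵ(ξ) = ∫ e^{-2πixξ} w(x) dx`. -/
def sobolevNorm (m s : ℝ) (u : ℝ → ℝ) : ℝ≥0∞ :=
  if h : MemLp (weighted s u) 2 (volume : Measure ℝ) then
    eLpNorm (fun ξ : ℝ => (((1 + (2 * Real.pi * ξ) ^ 2) ^ (m / 2) : ℝ) : ℂ) *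
      (𝓕 (h.toLp (weighted s u)) : Lp ℂ 2 (volume : Measure ℝ)) ξ) 2 volume
  else ∞

/-- The norm of a pair in `H^{m+1,s}(ℝ) × H^{m,s}(ℝ)`. -/
def pairNorm (m s : ℝ) (u₀ u₁ : ℝ → ℝ) : ℝ≥0∞ := sobolevNorm (m + 1) s u₀ + sobolevNorm m s u₁

/-- `v` is the weak (distributional) derivative of `u` on `ℝ`. -/
def IsWeakDeriv (u v : ℝ → ℝ) : Prop :=
  ∀ ψ : ℝ → ℝ, ContDiff ℝ ∞ ψ → HasCompactSupport ψ →
    ∫ x, u x * deriv ψ x = - ∫ x, v x * ψ x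

/-- The energy space `E⁰_sin` of the sine-Gordon equation: the `f ∈ C_t H¹_sin` whose derivative
`∂_t f` exists and lies in `C_t L²`, where `H¹_sin` is the set of locally integrable `u` with
`u_x ∈ L²` and `sin (u / 2) ∈ L²`. Each `f(t)` is given by its continuous representative. The fields
`dx = f_x` and `dt = f_t` are determined by `f` (as classes in `L²`). -/
structure EnergySpace where
  /-- the function `f(t, x)` -/
  toFun : ℝ → ℝ → ℝ
  /-- the weak derivative `f_x(t) ∈ L²` -/
  dx : ℝ → Lp ℝ 2 (volume : Measure ℝ)
  /-- the time derivative `f_t(t) ∈ L²` -/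
  dt : ℝ → Lp ℝ 2 (volume : Measure ℝ)
  continuous_slice : ∀ t, Continuous (toFun t)
  isWeakDeriv_dx : ∀ t, IsWeakDeriv (toFun t) (dx t)
  continuous_dx : Continuous dx
  memLp_sin : ∀ t, MemLp (fun x => Real.sin (toFun t x / 2)) 2 volume
  continuous_sin : ∀ t, Tendsto
    (fun τ => eLpNorm (fun x => Real.sin (toFun τ x / 2) - Real.sin (toFun t x / 2)) 2 volume)
    (𝓝 t) (𝓝 0)
  hasDeriv_dt : ∀ t, Tendsto
    (fun h : ℝ => eLpNorm (fun x => (toFun (t + h) x - toFun t x) / h - dt t x) 2 volume)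
    (𝓝[≠] 0) (𝓝 0)
  continuous_dt : Continuous dt

/-- `f` solves `f_tt - f_xx + sin f = 0` on `ℝ × ℝ` in the sense of distributions. -/
def IsSolution (f : EnergySpace) : Prop :=
  ∀ ψ : ℝ × ℝ → ℝ, ContDiff ℝ ∞ ψ → HasCompactSupport ψ →
    ∫ p : ℝ × ℝ, (f.toFun p.1 p.2 *
        (iteratedDeriv 2 (fun t => ψ (t, p.2)) p.1 - iteratedDeriv 2 (fun x => ψ (p.1, x)) p.2)
      + Real.sin (f.toFun p.1 p.2) * ψ p) = 0

/-- `f` is the Bäcklund transform of `φ` by the parameter `a`. -/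
def IsBacklund (a : ℝ) (φ f : EnergySpace) : Prop :=
  ∀ t, ∀ᵐ x : ℝ,
    f.dx t x - φ.dt t x - 1 / a * Real.sin ((f.toFun t x + φ.toFun t x) / 2)
      - a * Real.sin ((f.toFun t x - φ.toFun t x) / 2) = 0 ∧
    f.dt t x - φ.dx t x - 1 / a * Real.sin ((f.toFun t x + φ.toFun t x) / 2)
      + a * Real.sin ((f.toFun t x - φ.toFun t x) / 2) = 0

/-- The distance in `H^{m+1,s} × H^{m,s}` of the data `(f, f_t)(0)` to the data
`(Q, Q_t)(0, ·; β, x₀)` of a kink. -/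
def distToKink (m s : ℝ) (f : EnergySpace) (β x₀ : ℝ) : ℝ≥0∞ :=
  pairNorm m s (fun x => f.toFun 0 x - kink β x₀ 0 x) (fun x => f.dt 0 x - kinkDt β x₀ 0 x)

end SineGordon

end

/-! Put `f(0) = Q + u₀`, `f_t(0) = Q_t + u₁`, let `a₀` be the Bäcklund parameter of `β₀` and `c` its
Lorentz factor. At time zero the second Bäcklund equation is a first-order ODE for `φ(0)` in which
only the data and `a` occur. Since `sin(Q/2) = sech` and `cos(Q/2) = -tanh`, its linearization at `φ
= 0`, `a = a₀` reads `φ' = c tanh(c(x - x₀)) φ + (1/a₀² + 1)(a - a₀) sech(c(x - x₀)) + R`, where `R`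
is of first order in `(u₀, u₁)` and otherwise quadratically small. The homogeneous solution `cosh`
is unbounded, so bounded solutions are unique; they exist only under one solvability condition,
orthogonality of the right-hand side to `sech`, and the unknown `a - a₀` meets it because `∫ sech² >
0` (`eq_sol`).

The solution operator is dominated by convolution with `2 e^{-c|x|}` (`enorm_sol_le`), hence is
bounded in the sup norm and in weighted `L²`. A contraction argument produces the pair `(a - a₀,
φ(0))` (`exists_btSol`) and shows that it is the only small one (`exists_btSol_unique`). Reading the
ODE as a formula for `φ'` gains one derivative at a time until `H^{m+1,s}` is reached
(`exists_bootstrap`); real orders are covered by interpolating the multiplication estimates. The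
first Bäcklund equation then gives `φ_t(0)` in `H^{m,s}`. The translation `y₀` does not enter this
ODE: it is chosen afterwards, as the zero of the orthogonality defect, which is strictly increasing
near `x₀` (`exists_translation`).

To propagate in time, pass to `F(t, x) = f(t, x + t)`. The sum of the two Bäcklund equations becomes
`A_t = (2/a) sin(F - A/2)` for `A = F - Φ`, an ordinary differential equation in `L²` with globally
Lipschitz right-hand side; bounds on spatial difference quotients give `A` its derivative in `C_t
L²` (`exists_reg_flow`). The sine-Gordon equation becomes `∂_t (F_t - 2 F_x) = -sin F`, which makes
sense as a derivative in `L²` at energy regularity (`IsSolution.hasDerivAt`). With it, the defect of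
the difference of the Bäcklund equations solves a homogeneous linear equation (`hasDerivAt_defect`);
it vanishes initially, hence always. The same identities show that `φ` solves the sine-Gordon
equation (`exists_isBacklund`).

For uniqueness, the contraction and the monotonicity fix `β`, `y₀` and `φ(0)`
(`exists_initialBT_unique`), and Grönwall applied to the difference of two candidates in the first
Bäcklund equation fixes `φ` at all times (`IsBacklund.unique`). -/

noncomputable section

namespace SineGordon

/-! ### Absolutely continuous functions, weak derivatives and the one-dimensional Sobolev embedding.
-/

/-- `u` is locally absolutely continuous with almost everywhere derivative `v`. -/
def HasACDeriv (u v : ℝ → ℝ) : Prop :=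
  (∀ a b, AbsolutelyContinuousOnInterval u a b) ∧ ∀ᵐ x, HasDerivAt u (v x) x

namespace HasACDeriv

variable {u v u₁ v₁ : ℝ → ℝ}

lemma deriv_ae (h : HasACDeriv u v) : deriv u =ᵐ[volume] v := by
  filter_upwards [h.2] with x hx using hx.deriv

lemma continuous (h : HasACDeriv u v) : Continuous u := by
  rw [continuous_iff_continuousAt]
  intro x
  have := (h.1 (x - 1) (x + 1)).continuousOn
  rw [Set.uIcc_of_le (by linarith)] at this
  exact this.continuousAt (Icc_mem_nhds (by linarith) (by linarith))

lemma intervalIntegrable (h : HasACDeriv u v) (a b : ℝ) : IntervalIntegrable v volume a b :=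
  (h.1 a b).intervalIntegrable_deriv.congr_ae (ae_restrict_of_ae h.deriv_ae)

lemma locallyIntegrable (h : HasACDeriv u v) : LocallyIntegrable v := by
  intro x
  refine ⟨Set.Ioc (x - 1) (x + 1), Ioc_mem_nhds (by linarith) (by linarith), ?_⟩
  have := h.intervalIntegrable (x - 1) (x + 1)
  rwa [intervalIntegrable_iff_integrableOn_Ioc_of_le (by linarith)] at this

lemma aestronglyMeasurable (h : HasACDeriv u v) : AEStronglyMeasurable v volume :=
  h.locallyIntegrable.aestronglyMeasurable

lemma sub_eq_integral (h : HasACDeriv u v) (a b : ℝ) : u b - u a = ∫ x in a..b, v x := by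
  rw [← (h.1 a b).integral_deriv_eq_sub]
  exact intervalIntegral.integral_congr_ae (by filter_upwards [h.deriv_ae] with x hx _ using hx)

lemma congr (h : HasACDeriv u v) (hv : v =ᵐ[volume] v₁) : HasACDeriv u v₁ :=
  ⟨h.1, by filter_upwards [h.2, hv] with x hx hx' using hx' ▸ hx⟩

lemma unique (h : HasACDeriv u v) (h' : HasACDeriv u v₁) : v =ᵐ[volume] v₁ := by
  filter_upwards [h.2, h'.2] with x hx hx' using hx.unique hx'

lemma add (h : HasACDeriv u v) (h' : HasACDeriv u₁ v₁) :
    HasACDeriv (fun x => u x + u₁ x) (fun x => v x + v₁ x) :=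
  ⟨fun a b => (h.1 a b).add (h'.1 a b), by
    filter_upwards [h.2, h'.2] with x hx hx' using hx.add hx'⟩

lemma sub (h : HasACDeriv u v) (h' : HasACDeriv u₁ v₁) :
    HasACDeriv (fun x => u x - u₁ x) (fun x => v x - v₁ x) :=
  ⟨fun a b => (h.1 a b).sub (h'.1 a b), by
    filter_upwards [h.2, h'.2] with x hx hx' using hx.sub hx'⟩

lemma const_mul (c : ℝ) (h : HasACDeriv u v) : HasACDeriv (fun x => c * u x) (fun x => c * v x) :=
  ⟨fun a b => (h.1 a b).const_mul c, by filter_upwards [h.2] with x hx using hx.const_mul c⟩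

lemma mul (h : HasACDeriv u v) (h' : HasACDeriv u₁ v₁) :
    HasACDeriv (fun x => u x * u₁ x) (fun x => v x * u₁ x + u x * v₁ x) :=
  ⟨fun a b => (h.1 a b).mul (h'.1 a b), by
    filter_upwards [h.2, h'.2] with x hx hx' using hx.mul hx'⟩

lemma of_contDiff {u v : ℝ → ℝ} (hu : ∀ x, HasDerivAt u (v x) x) (hv : Continuous v) :
    HasACDeriv u v := by
  have h : ContDiff ℝ 1 u := contDiff_one_iff_deriv.2
    ⟨fun x => (hu x).differentiableAt, by rwa [show deriv u = v from funext fun x => (hu x).deriv]⟩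
  exact ⟨fun a b => h.contDiffOn.absolutelyContinuousOnInterval, ae_of_all _ hu⟩

lemma comp {F F' : ℝ → ℝ} (h : HasACDeriv u v) (hF : ∀ x, HasDerivAt F (F' x) x) {K : NNReal}
    (hK : LipschitzWith K F) : HasACDeriv (fun x => F (u x)) (fun x => F' (u x) * v x) := by
  refine ⟨fun a b => ?_, by filter_upwards [h.2] with x hx using (hF (u x)).comp x hx⟩
  have h1 := h.1 a b
  simp only [AbsolutelyContinuousOnInterval] at *
  refine squeeze_zero (fun t => Finset.sum_nonneg fun i _ => dist_nonneg) (fun t => ?_)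
    (by simpa using h1.const_mul (K : ℝ))
  rw [Finset.mul_sum]
  exact Finset.sum_le_sum fun i _ => hK.dist_le_mul _ _

lemma of_integral {u v : ℝ → ℝ} (hv : LocallyIntegrable v)
    (h : ∀ x, u x = u 0 + ∫ y in (0 : ℝ)..x, v y) : HasACDeriv u v := by
  have hI : ∀ a b, IntervalIntegrable v volume a b := fun a b =>
    (hv.integrableOn_isCompact isCompact_uIcc).intervalIntegrable
  refine ⟨fun a b => ?_, ?_⟩
  -- The primitive starts at `0`, so the interval is first enlarged to contain `0` and restricted at
  -- the end.
  · have h1 := ((hI (min 0 (min a b)) (max 0 (max a b)))).absolutelyContinuousOnInterval_intervalIntegral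
      (c := 0) (by rw [Set.uIcc_of_le (by simp)]; simp)
    have h2 : AbsolutelyContinuousOnInterval (fun _ : ℝ => u 0) (min 0 (min a b)) (max 0 (max a b)) :=
      (contDiff_const (n := 1) (𝕜 := ℝ)).contDiffOn.absolutelyContinuousOnInterval
    have h3 := h2.add h1
    have h4 : (fun _ : ℝ => u 0) + (fun x => ∫ y in (0 : ℝ)..x, v y) = u := by
      ext x; rw [h x]; rfl
    rw [h4] at h3
    refine h3.mono ?_
    rw [Set.uIcc_of_le (a := min 0 (min a b)) (by simp), Set.uIcc]
    exact Set.Icc_subset_Icc (by simp) (by simp)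
  · filter_upwards [LocallyIntegrable.ae_hasDerivAt_integral hv] with x hx
    have : u = fun x => u 0 + ∫ y in (0 : ℝ)..x, v y := funext h
    rw [this]
    exact (hx 0).const_add _

end HasACDeriv

/-- Integration by parts against a compactly supported function. -/
lemma HasACDeriv.integral_eq_zero_of_hasCompactSupport {w w' : ℝ → ℝ} (h : HasACDeriv w w')
    {ψ ψ' : ℝ → ℝ} (hψ : HasACDeriv ψ ψ') (hc : HasCompactSupport ψ) (hc' : HasCompactSupport ψ') :
    ∫ x, w x * ψ' x = - ∫ x, w' x * ψ x := by
  obtain ⟨R, hR⟩ := (hc.isCompact.union hc'.isCompact).isBounded.subset_closedBall 0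
  have hs : ∀ x, x ∉ Set.Ioc (-(|R| + 1)) (|R| + 1) → ψ x = 0 ∧ ψ' x = 0 := by
    intro x hx
    have : x ∉ tsupport ψ ∪ tsupport ψ' := by
      intro hx'
      have := hR hx'
      rw [mem_closedBall_zero_iff, Real.norm_eq_abs] at this
      apply hx
      have h2 := abs_le.1 (this.trans (le_abs_self R))
      constructor <;> linarith
    simp only [Set.mem_union, not_or] at this
    exact ⟨image_eq_zero_of_notMem_tsupport this.1, image_eq_zero_of_notMem_tsupport this.2⟩
  have h1 := (h.mul hψ).sub_eq_integral (-(|R| + 1)) (|R| + 1)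
  have h2 : ψ (|R| + 1) = 0 := by
    by_contra h0
    have hx : |R| + 1 ∈ tsupport ψ := subset_tsupport _ h0
    have := hR (Or.inl hx)
    rw [mem_closedBall_zero_iff, Real.norm_eq_abs, abs_of_nonneg (by positivity)] at this
    linarith [le_abs_self R]
  have h3 : ψ (-(|R| + 1)) = 0 := (hs _ (by simp)).1
  have i1 : IntervalIntegrable (fun x => w' x * ψ x) volume (-(|R| + 1)) (|R| + 1) :=
    (h.intervalIntegrable _ _).mul_continuousOn hψ.continuous.continuousOn
  have i2 : IntervalIntegrable (fun x => w x * ψ' x) volume (-(|R| + 1)) (|R| + 1) :=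
    (hψ.intervalIntegrable _ _).continuousOn_mul h.continuous.continuousOn
  rw [h2, h3, mul_zero, mul_zero, sub_zero, intervalIntegral.integral_add i1 i2,
    intervalIntegral.integral_of_le (by linarith [abs_nonneg R]),
    intervalIntegral.integral_of_le (by linarith [abs_nonneg R]),
    setIntegral_eq_integral_of_forall_compl_eq_zero (fun x hx => by rw [(hs x hx).1, mul_zero]),
    setIntegral_eq_integral_of_forall_compl_eq_zero (fun x hx => by rw [(hs x hx).2, mul_zero])] at h1
  linarith

lemma HasACDeriv.of_contDiff_infty {ψ : ℝ → ℝ} (h : ContDiff ℝ ∞ ψ) : HasACDeriv ψ (deriv ψ) :=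
  .of_contDiff (fun x => (h.differentiable (by simp) x).hasDerivAt) (h.continuous_deriv (by simp))

lemma HasACDeriv.isWeakDeriv {u v : ℝ → ℝ} (h : HasACDeriv u v) : IsWeakDeriv u v :=
  fun _ hψ hc => h.integral_eq_zero_of_hasCompactSupport (.of_contDiff_infty hψ) hc hc.deriv

/-- A test function with integral zero is the derivative of a test function. -/
lemma exists_primitive_of_integral_eq_zero {g : ℝ → ℝ} (hg : ContDiff ℝ ∞ g)
    (hc : HasCompactSupport g) (h0 : ∫ x, g x = 0) :
    ∃ G : ℝ → ℝ, ContDiff ℝ ∞ G ∧ HasCompactSupport G ∧ deriv G = g := by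
  obtain ⟨R, hR⟩ := hc.isCompact.isBounded.subset_closedBall 0
  have hs : ∀ x, |R| < |x| → g x = 0 := by
    intro x hx
    refine image_eq_zero_of_notMem_tsupport fun hx' => ?_
    have := hR hx'
    rw [mem_closedBall_zero_iff, Real.norm_eq_abs] at this
    linarith [le_abs_self R]
  have hd : ∀ x, HasDerivAt (fun x => ∫ y in (-(|R| + 1))..x, g y) (g x) x := fun x =>
    (hg.continuous.integral_hasStrictDerivAt _ x).hasDerivAt
  have hd' : deriv (fun x => ∫ y in (-(|R| + 1))..x, g y) = g := funext fun x => (hd x).deriv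
  refine ⟨fun x => ∫ y in (-(|R| + 1))..x, g y, ?_, ?_, hd'⟩
  · rw [contDiff_infty_iff_deriv, hd']
    exact ⟨fun x => (hd x).differentiableAt, hg⟩
  · refine HasCompactSupport.of_support_subset_isCompact (isCompact_Icc (a := -(|R|+1)) (b := |R|+1)) ?_
    intro x hx
    by_contra hx'
    apply hx
    simp only [Set.mem_Icc, not_and_or, not_le] at hx'
    rcases hx' with hx' | hx'
    · refine intervalIntegral.integral_zero_ae (ae_of_all _ fun y hy => hs y ?_)
      rw [Set.uIoc_of_ge hx'.le] at hy
      rw [lt_abs]; right; linarith [hy.2, abs_nonneg R]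
    · dsimp only
      rw [intervalIntegral.integral_of_le (by linarith [abs_nonneg R]),
        setIntegral_eq_integral_of_forall_compl_eq_zero, h0]
      intro y hy
      simp only [Set.mem_Ioc, not_and_or, not_le, not_lt] at hy
      apply hs
      rw [lt_abs]
      rcases hy with hy | hy
      · right; linarith
      · left; linarith

lemma exists_bump_integral_eq_one : ∃ η : ℝ → ℝ, ContDiff ℝ ∞ η ∧ HasCompactSupport η ∧
    ∫ x, η x = 1 := by
  let b : ContDiffBump (0 : ℝ) := ⟨1, 2, by norm_num, by norm_num⟩
  exact ⟨b.normed volume, b.contDiff_normed, b.hasCompactSupport_normed, b.integral_normed⟩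

lemma integrable_mul_test {u g : ℝ → ℝ} (hu : LocallyIntegrable u)
    (hg : Continuous g) (hc : HasCompactSupport g) : Integrable (fun x => u x * g x) := by
  simpa [mul_comm] using hu.integrable_smul_left_of_hasCompactSupport hg hc

/-- The du Bois-Reymond lemma: for a bump `η` of integral one, `g - (∫ g) η` has integral zero and
so is the derivative of a test function. Hence `∫ u g = (∫ g)(∫ u η)` for every test function `g`.
-/
lemma ae_eq_const_of_isWeakDeriv_zero {u : ℝ → ℝ} (hul : LocallyIntegrable u)
    (h : ∀ ψ : ℝ → ℝ, ContDiff ℝ ∞ ψ → HasCompactSupport ψ → ∫ x, u x * deriv ψ x = 0) :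
    ∃ c, u =ᵐ[volume] fun _ => c := by
  obtain ⟨η, hη, hηc, hη1⟩ := exists_bump_integral_eq_one
  refine ⟨∫ x, u x * η x, ?_⟩
  set c := ∫ x, u x * η x with hc
  refine ae_eq_of_integral_contDiff_smul_eq hul continuous_const.locallyIntegrable ?_
  intro g hg hgc
  have hgi := hg.continuous.integrable_of_hasCompactSupport (μ := (volume : Measure ℝ)) hgc
  have hηi := hη.continuous.integrable_of_hasCompactSupport (μ := (volume : Measure ℝ)) hηc
  obtain ⟨G, hG, hGc, hGd⟩ := exists_primitive_of_integral_eq_zero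
    (g := fun x => g x - (∫ y, g y) * η x) (hg.sub (contDiff_const.mul hη))
    (by simpa [sub_eq_add_neg] using! hgc.add (hηc.mul_left (f := fun _ => (∫ y, g y))).neg)
    (by rw [integral_sub hgi (hηi.const_mul _), integral_const_mul, hη1]; ring)
  have := h G hG hGc
  rw [hGd] at this
  simp only [mul_sub] at this
  rw [integral_sub (integrable_mul_test hul hg.continuous hgc)] at this
  · simp only [smul_eq_mul]
    rw [integral_mul_const]
    have e : ∀ x, u x * ((∫ y, g y) * η x) = (∫ y, g y) * (u x * η x) := fun x => by ring
    simp only [e, integral_const_mul] at this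
    simp only [mul_comm (g _)]
    linarith
  · have := (integrable_mul_test hul hη.continuous hηc).const_mul (∫ y, g y)
    refine this.congr (ae_of_all _ fun x => by ring)

/-- Subtracting the primitive of `v` from `u` leaves a function with zero weak derivative, which is
constant. -/
lemma IsWeakDeriv.exists_hasACDeriv {u v : ℝ → ℝ} (h : IsWeakDeriv u v) (hu : LocallyIntegrable u)
    (hv : LocallyIntegrable v) : ∃ p, HasACDeriv p v ∧ u =ᵐ[volume] p := by
  have hP : HasACDeriv (fun x => ∫ y in (0 : ℝ)..x, v y) v := .of_integral hv (by simp)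
  obtain ⟨c, hc⟩ := ae_eq_const_of_isWeakDeriv_zero
      (u := fun x => u x - ∫ y in (0 : ℝ)..x, v y)
      (hu.sub hP.continuous.locallyIntegrable) (fun ψ hψ hψc => by
    have h1 := h ψ hψ hψc
    have h2 := hP.isWeakDeriv ψ hψ hψc
    have hd := hψ.continuous_deriv (by simp)
    simp only [sub_mul]
    rw [integral_sub, h1, h2, sub_self]
    · exact integrable_mul_test hu hd hψc.deriv
    · exact integrable_mul_test hP.continuous.locallyIntegrable hd hψc.deriv)
  refine ⟨fun x => c + ∫ y in (0 : ℝ)..x, v y, .of_integral hv (by simp), ?_⟩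
  filter_upwards [hc] with x hx
  linarith

lemma IsWeakDeriv.hasACDeriv {u v : ℝ → ℝ} (h : IsWeakDeriv u v) (hu : Continuous u)
    (hv : LocallyIntegrable v) : HasACDeriv u v := by
  obtain ⟨p, hp, he⟩ := h.exists_hasACDeriv hu.locallyIntegrable hv
  rwa [(hu.ae_eq_iff_eq volume hp.continuous).1 he]

/-- Sobolev embedding `H¹ ⊆ L^∞` in one dimension. -/
lemma HasACDeriv.enorm_le {u v : ℝ → ℝ} (h : HasACDeriv u v) (x : ℝ) :
    ‖u x‖ₑ ≤ 2 * (eLpNorm u 2 volume + eLpNorm v 2 volume) := by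
  by_cases hu : eLpNorm u 2 volume = ⊤
  · simp [hu, ENNReal.mul_top]
  by_cases hv : eLpNorm v 2 volume = ⊤
  · simp [hv, ENNReal.mul_top]
  have mu : MemLp u 2 volume := ⟨h.continuous.aestronglyMeasurable, lt_top_iff_ne_top.2 hu⟩
  have mv : MemLp v 2 volume := ⟨h.aestronglyMeasurable, lt_top_iff_ne_top.2 hv⟩
  have hcu := h.continuous
  have iu := mu.integrable_sq
  have iv := mv.integrable_sq
  have eu : (eLpNorm u 2 volume).toReal ^ 2 = ∫ y, u y ^ 2 := by
    rw [← Real.sq_sqrt (integral_nonneg fun y => sq_nonneg (u y)), Real.sqrt_eq_rpow]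
    rw [mu.eLpNorm_eq_integral_rpow_norm (by simp) (by simp), ENNReal.toReal_ofReal (by positivity)]
    simp
  have ev : (eLpNorm v 2 volume).toReal ^ 2 = ∫ y, v y ^ 2 := by
    rw [← Real.sq_sqrt (integral_nonneg fun y => sq_nonneg (v y)), Real.sqrt_eq_rpow]
    rw [mv.eLpNorm_eq_integral_rpow_norm (by simp) (by simp), ENNReal.toReal_ofReal (by positivity)]
    simp
  -- The derivative `2uv` of `u²` is at most `u² + v²`. Averaging the resulting bound over the unit
  -- interval ending at `x` then removes the value at `y`.
  have key : ∀ y ∈ Set.Icc (x - 1) x, u x ^ 2 ≤ u y ^ 2 + ((∫ y, u y ^ 2) + ∫ y, v y ^ 2) := by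
    intro y hy
    have h1 := (h.mul h).sub_eq_integral y x
    have h2 : (∫ z in y..x, (v z * u z + u z * v z)) ≤ ∫ z, (u z ^ 2 + v z ^ 2) := by
      rw [intervalIntegral.integral_of_le hy.2]
      refine le_trans (setIntegral_mono_on ?_ (iu.add iv).integrableOn measurableSet_Ioc
        (fun z _ => ?_)) (setIntegral_le_integral (iu.add iv)
          (ae_of_all _ fun z => add_nonneg (sq_nonneg _) (sq_nonneg _)))
      · exact ((intervalIntegrable_iff_integrableOn_Ioc_of_le hy.2).1
          ((h.mul h).intervalIntegrable y x))
      · show _ ≤ u z ^ 2 + v z ^ 2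
        nlinarith [sq_nonneg (u z - v z)]
    rw [integral_add iu iv] at h2
    nlinarith
  have h3 : u x ^ 2 ≤ 2 * (∫ y, u y ^ 2) + ∫ y, v y ^ 2 := by
    have h4 : (∫ y in (x-1)..x, u x ^ 2) ≤
        ∫ y in (x-1)..x, (u y ^ 2 + ((∫ y, u y ^ 2) + ∫ y, v y ^ 2)) := by
      refine intervalIntegral.integral_mono_on (by linarith) (by simp) ?_ key
      exact ((h.continuous.pow 2).add continuous_const).intervalIntegrable _ _
    rw [intervalIntegral.integral_add ((by fun_prop : Continuous fun y => u y ^ 2).intervalIntegrable _ _) (by simp)] at h4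
    have h5 : (∫ y in (x-1)..x, u y ^ 2) ≤ ∫ y, u y ^ 2 := by
      rw [intervalIntegral.integral_of_le (by linarith)]
      exact setIntegral_le_integral iu (ae_of_all _ fun z => by positivity)
    simp at h4
    linarith
  set A := (eLpNorm u 2 volume).toReal with hA
  set B := (eLpNorm v 2 volume).toReal with hB
  have hA0 : 0 ≤ A := ENNReal.toReal_nonneg
  have hB0 : 0 ≤ B := ENNReal.toReal_nonneg
  have h6 : |u x| ≤ 2 * (A + B) := by
    apply abs_le_of_sq_le_sq _ (by positivity)
    nlinarith [mul_nonneg hA0 hB0, sq_nonneg A, sq_nonneg B]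
  rw [← ENNReal.ofReal_toReal hu, ← ENNReal.ofReal_toReal hv, ← ENNReal.ofReal_add hA0 hB0,
    show (2 : ℝ≥0∞) = ENNReal.ofReal 2 by simp, ← ENNReal.ofReal_mul (by norm_num),
    Real.enorm_eq_ofReal_abs]
  exact ENNReal.ofReal_le_ofReal h6

/-! ### Sobolev norms of real order defined by the `L²` Fourier transform. -/

open Classical in
/-- The `L²` Fourier transform as a function, with value `0` outside `L²`. -/
def ft (v : ℝ → ℂ) : ℝ → ℂ :=
  if h : MemLp v 2 (volume : Measure ℝ) then (𝓕 (h.toLp v) : Lp ℂ 2 (volume : Measure ℝ)) else 0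

/-- The symbol `1 + |2πξ|²`. -/
def symb (ξ : ℝ) : ℝ := 1 + (2 * Real.pi * ξ) ^ 2

lemma one_le_symb (ξ : ℝ) : 1 ≤ symb ξ := by unfold symb; nlinarith [sq_nonneg (2 * Real.pi * ξ)]

lemma symb_pos (ξ : ℝ) : 0 < symb ξ := lt_of_lt_of_le one_pos (one_le_symb ξ)

lemma continuous_symb : Continuous symb := by unfold symb; fun_prop

lemma continuous_symb_rpow (k : ℝ) : Continuous fun ξ => symb ξ ^ k :=
  continuous_symb.rpow_const fun ξ => Or.inl (symb_pos ξ).ne'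

open Classical in
/-- The `H^k` norm of a complex valued function. -/
def hNorm (k : ℝ) (v : ℝ → ℂ) : ℝ≥0∞ :=
  if MemLp v 2 (volume : Measure ℝ) then
    (∫⁻ ξ, ENNReal.ofReal (symb ξ ^ k) * ‖ft v ξ‖ₑ ^ 2) ^ (1 / 2 : ℝ) else ⊤

lemma eLpNorm_two_eq {α : Type*} [MeasurableSpace α] {E : Type*} [NormedAddCommGroup E]
    (μ : Measure α) (f : α → E) : eLpNorm f 2 μ = (∫⁻ x, ‖f x‖ₑ ^ 2 ∂μ) ^ (1 / 2 : ℝ) := by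
  rw [eLpNorm_eq_lintegral_rpow_enorm_toReal (by simp) (by simp)]
  simp

lemma eLpNorm_two_sq {α : Type*} [MeasurableSpace α] {E : Type*} [NormedAddCommGroup E]
    (μ : Measure α) (f : α → E) : eLpNorm f 2 μ ^ 2 = ∫⁻ x, ‖f x‖ₑ ^ 2 ∂μ := by
  rw [eLpNorm_two_eq, ← ENNReal.rpow_natCast, ← ENNReal.rpow_mul]
  simp

lemma sobolevNorm_eq (m s : ℝ) (u : ℝ → ℝ) : sobolevNorm m s u = hNorm m (weighted s u) := by
  unfold sobolevNorm hNorm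
  by_cases h : MemLp (weighted s u) 2 (volume : Measure ℝ)
  · rw [dif_pos h, if_pos h, eLpNorm_two_eq]
    congr 1
    refine lintegral_congr fun ξ => ?_
    unfold ft
    rw [dif_pos h, enorm_mul, mul_pow]
    congr 1
    rw [← ofReal_norm, ← ENNReal.ofReal_pow (norm_nonneg _), Complex.norm_real,
      Real.norm_of_nonneg (by positivity)]
    congr 1
    rw [← Real.rpow_natCast, ← Real.rpow_mul (by positivity)]
    unfold symb
    congr 1
    push_cast; ring
  · rw [dif_neg h, if_neg h]

variable {u v g d : ℝ → ℂ} {k l : ℝ}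

lemma hNorm_of_not_memLp (h : ¬ MemLp v 2 (volume : Measure ℝ)) : hNorm k v = ⊤ := by
  simp [hNorm, h]

lemma memLp_of_hNorm_lt_top (h : hNorm k v ≠ ⊤) : MemLp v 2 (volume : Measure ℝ) := by
  by_contra h'
  exact h (hNorm_of_not_memLp h')

lemma hNorm_sq (h : MemLp v 2 (volume : Measure ℝ)) :
    hNorm k v ^ 2 = ∫⁻ ξ, ENNReal.ofReal (symb ξ ^ k) * ‖ft v ξ‖ₑ ^ 2 := by
  rw [hNorm, if_pos h, ← ENNReal.rpow_natCast, ← ENNReal.rpow_mul]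
  simp

lemma ft_eq (h : MemLp v 2 (volume : Measure ℝ)) :
    ft v = (𝓕 (h.toLp v) : Lp ℂ 2 (volume : Measure ℝ)) := by
  unfold ft; rw [dif_pos h]

lemma measurable_ft (v : ℝ → ℂ) : Measurable (ft v) := by
  unfold ft
  split_ifs with h
  · exact (Lp.stronglyMeasurable _).measurable
  · exact measurable_const

lemma memLp_ft (v : ℝ → ℂ) : MemLp (ft v) 2 (volume : Measure ℝ) := by
  unfold ft
  split_ifs with h
  · exact Lp.memLp _
  · exact MemLp.zero'

lemma lintegral_ft (h : MemLp v 2 (volume : Measure ℝ)) :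
    ∫⁻ ξ, ‖ft v ξ‖ₑ ^ 2 = ∫⁻ x, ‖v x‖ₑ ^ 2 := by
  rw [← eLpNorm_two_sq, ← eLpNorm_two_sq, ft_eq h]
  congr 1
  rw [← Lp.enorm_def, ← eLpNorm_congr_ae h.coeFn_toLp, ← Lp.enorm_def, ← ofReal_norm,
    ← ofReal_norm, Lp.norm_fourier_eq]

lemma ft_congr (h : u =ᵐ[volume] v) : ft u = ft v := by
  by_cases hu : MemLp u 2 (volume : Measure ℝ)
  · have hv := (memLp_congr_ae h).1 hu
    rw [ft_eq hu, ft_eq hv, (MemLp.toLp_eq_toLp_iff hu hv).2 h]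
  · have hv : ¬ MemLp v 2 (volume : Measure ℝ) := fun hv => hu ((memLp_congr_ae h).2 hv)
    unfold ft
    rw [dif_neg hu, dif_neg hv]

lemma hNorm_congr (h : u =ᵐ[volume] v) : hNorm k u = hNorm k v := by
  unfold hNorm
  rw [ft_congr h]
  by_cases hu : MemLp u 2 (volume : Measure ℝ)
  · rw [if_pos hu, if_pos ((memLp_congr_ae h).1 hu)]
  · rw [if_neg hu, if_neg fun hv => hu ((memLp_congr_ae h).2 hv)]

lemma ft_add (hu : MemLp u 2 (volume : Measure ℝ)) (hv : MemLp v 2 (volume : Measure ℝ)) :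
    ft (u + v) =ᵐ[volume] ft u + ft v := by
  rw [ft_eq hu, ft_eq hv, ft_eq (hu.add hv), MemLp.toLp_add, FourierTransform.fourier_add]
  exact Lp.coeFn_add _ _

lemma ft_const_mul (c : ℂ) (hu : MemLp u 2 (volume : Measure ℝ)) :
    ft (fun x => c * u x) =ᵐ[volume] fun ξ => c * ft u ξ := by
  have hcu : MemLp (c • u) 2 (volume : Measure ℝ) := hu.const_smul c
  have : (fun x => c * u x) = c • u := rfl
  rw [this, ft_eq hu, ft_eq hcu, MemLp.toLp_const_smul, FourierTransform.fourier_smul]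
  exact Lp.coeFn_smul _ _

lemma exists_ft_eq {w : ℝ → ℂ} (hw : MemLp w 2 (volume : Measure ℝ)) :
    ∃ v, MemLp v 2 (volume : Measure ℝ) ∧ ft v =ᵐ[volume] w := by
  refine ⟨(𝓕⁻ (hw.toLp w) : Lp ℂ 2 (volume : Measure ℝ)), Lp.memLp _, ?_⟩
  rw [ft_eq (Lp.memLp _), Lp.toLp_coeFn, FourierTransform.fourier_fourierInv_eq]
  exact hw.coeFn_toLp

lemma hNorm_eq_eLpNorm (h : MemLp v 2 (volume : Measure ℝ)) :
    hNorm k v = eLpNorm (fun ξ => ((symb ξ ^ (k / 2) : ℝ) : ℂ) * ft v ξ) 2 volume := by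
  rw [hNorm, if_pos h, eLpNorm_two_eq]
  congr 1
  refine lintegral_congr fun ξ => ?_
  rw [enorm_mul, mul_pow]
  congr 1
  rw [← ofReal_norm, ← ENNReal.ofReal_pow (norm_nonneg _), Complex.norm_real,
    Real.norm_of_nonneg (Real.rpow_nonneg (symb_pos ξ).le _)]
  congr 1
  rw [← Real.rpow_natCast, ← Real.rpow_mul (symb_pos ξ).le]
  congr 1
  push_cast; ring

lemma aesm_weight (k : ℝ) (v : ℝ → ℂ) :
    AEStronglyMeasurable (fun ξ => ((symb ξ ^ (k / 2) : ℝ) : ℂ) * ft v ξ) volume :=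
  ((Complex.continuous_ofReal.comp (continuous_symb_rpow _)).measurable.mul
    (measurable_ft v)).aestronglyMeasurable

lemma hNorm_add_le (u v : ℝ → ℂ) : hNorm k (u + v) ≤ hNorm k u + hNorm k v := by
  by_cases hu : MemLp u 2 (volume : Measure ℝ)
  swap; · simp [hNorm_of_not_memLp hu]
  by_cases hv : MemLp v 2 (volume : Measure ℝ)
  swap; · simp [hNorm_of_not_memLp hv]
  rw [hNorm_eq_eLpNorm hu, hNorm_eq_eLpNorm hv, hNorm_eq_eLpNorm (hu.add hv)]
  refine le_trans (le_of_eq ?_) (eLpNorm_add_le (aesm_weight k u) (aesm_weight k v) (by simp))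
  refine eLpNorm_congr_ae ?_
  filter_upwards [ft_add hu hv] with ξ hξ
  rw [hξ, Pi.add_apply, Pi.add_apply, mul_add]

lemma hNorm_const_mul (c : ℂ) (u : ℝ → ℂ) (hc : c ≠ 0) :
    hNorm k (fun x => c * u x) = ‖c‖ₑ * hNorm k u := by
  by_cases hu : MemLp u 2 (volume : Measure ℝ)
  · rw [hNorm_eq_eLpNorm hu, hNorm_eq_eLpNorm (hu.const_mul c), ← eLpNorm_const_smul]
    refine eLpNorm_congr_ae ?_
    filter_upwards [ft_const_mul c hu] with ξ hξ
    rw [hξ, Pi.smul_apply, smul_eq_mul]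
    ring
  · have h2 : ¬ MemLp (fun x => c * u x) 2 (volume : Measure ℝ) := fun h => hu (by
      refine (h.const_mul c⁻¹).ae_eq (ae_of_all _ fun x => ?_)
      field_simp)
    rw [hNorm_of_not_memLp hu, hNorm_of_not_memLp h2, ENNReal.mul_top (by simpa using hc)]

lemma hNorm_const_mul_le (c : ℂ) (hu : MemLp u 2 (volume : Measure ℝ)) :
    hNorm k (fun x => c * u x) ≤ ‖c‖ₑ * hNorm k u := by
  rw [hNorm_eq_eLpNorm hu, hNorm_eq_eLpNorm (hu.const_mul c), ← eLpNorm_const_smul]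
  refine (eLpNorm_congr_ae ?_).le
  filter_upwards [ft_const_mul c hu] with ξ hξ
  rw [hξ, Pi.smul_apply, smul_eq_mul]
  ring

lemma hNorm_zero (v : ℝ → ℂ) (h : MemLp v 2 (volume : Measure ℝ)) :
    hNorm 0 v = eLpNorm v 2 volume := by
  rw [hNorm, if_pos h, eLpNorm_two_eq, ← lintegral_ft h]
  simp

lemma hNorm_mono (h : k ≤ l) (v : ℝ → ℂ) : hNorm k v ≤ hNorm l v := by
  unfold hNorm
  split_ifs
  · refine ENNReal.rpow_le_rpow (lintegral_mono fun ξ => ?_) (by norm_num)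
    gcongr
    exact one_le_symb ξ
  · exact le_rfl

lemma eLpNorm_le_hNorm (hk : 0 ≤ k) (v : ℝ → ℂ) : eLpNorm v 2 volume ≤ hNorm k v := by
  by_cases hv : MemLp v 2 (volume : Measure ℝ)
  · rw [← hNorm_zero v hv]; exact hNorm_mono hk v
  · simp [hNorm_of_not_memLp hv]

/-! ### Weak derivatives in `L²` and their Fourier transforms. -/

/-- `d` is the weak derivative of `g`, tested against real-valued functions in `H¹`. -/
def HasL2Deriv (g d : ℝ → ℂ) : Prop :=
  ∀ η η' : ℝ → ℝ, HasACDeriv η η' → MemLp η 2 (volume : Measure ℝ) →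
    MemLp η' 2 (volume : Measure ℝ) → ∫ x, (η' x : ℂ) * g x = - ∫ x, (η x : ℂ) * d x

lemma integrable_mul_of_memLp {α : Type*} [MeasurableSpace α] {μ : Measure α} {u v : α → ℂ}
    (hu : MemLp u 2 μ) (hv : MemLp v 2 μ) : Integrable (fun x => u x * v x) μ :=
  hu.integrable_mul hv

/-- The `L²` transform agrees with the transform of tempered distributions, which is defined by
exactly this duality. -/
lemma integral_schwartz_mul_ft (hg : MemLp g 2 (volume : Measure ℝ)) (H : SchwartzMap ℝ ℂ) :
    ∫ ξ, H ξ * ft g ξ = ∫ x, (𝓕 H) x * g x := by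
  have h1 := Lp.fourier_toTemperedDistribution_eq (hg.toLp g)
  have h2 := congrArg (fun T => T H) h1
  simp only [TemperedDistribution.fourier_apply, Lp.toTemperedDistribution_apply, smul_eq_mul] at h2
  rw [ft_eq hg, ← h2]
  exact integral_congr_ae (by filter_upwards [hg.coeFn_toLp] with x hx using by rw [hx])

lemma HasL2Deriv.integral_schwartz (h : HasL2Deriv g d) (hg : MemLp g 2 (volume : Measure ℝ))
    (hd : MemLp d 2 (volume : Measure ℝ)) (ψ : SchwartzMap ℝ ℂ) :
    ∫ x, deriv ψ x * g x = - ∫ x, ψ x * d x := by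
  have hψd : ∀ x, HasDerivAt ψ (SchwartzMap.derivCLM ℂ ℂ ψ x) x := fun x => by
    rw [SchwartzMap.derivCLM_apply]; exact ψ.differentiableAt.hasDerivAt
  have hde : deriv ψ = SchwartzMap.derivCLM ℂ ℂ ψ := funext fun x => (hψd x).deriv
  have m1 : MemLp ψ 2 (volume : Measure ℝ) := ψ.memLp 2 _
  have m2 : MemLp (SchwartzMap.derivCLM ℂ ℂ ψ) 2 (volume : Measure ℝ) := SchwartzMap.memLp _ 2 _
  have c2 : Continuous (SchwartzMap.derivCLM ℂ ℂ ψ) := SchwartzMap.continuous _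
  have hre := h (fun x => (ψ x).re) (fun x => (SchwartzMap.derivCLM ℂ ℂ ψ x).re)
    (.of_contDiff (fun x => (Complex.reCLM.hasFDerivAt.comp_hasDerivAt x (hψd x)))
      (Complex.continuous_re.comp c2)) m1.re m2.re
  have him := h (fun x => (ψ x).im) (fun x => (SchwartzMap.derivCLM ℂ ℂ ψ x).im)
    (.of_contDiff (fun x => (Complex.imCLM.hasFDerivAt.comp_hasDerivAt x (hψd x)))
      (Complex.continuous_im.comp c2)) m1.im m2.im
  have e1 : ∀ (w : ℝ → ℂ) (z : ℝ → ℂ), MemLp w 2 (volume : Measure ℝ) →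
      MemLp z 2 (volume : Measure ℝ) → ∫ x, w x * z x =
      (∫ x, ((w x).re : ℂ) * z x) + Complex.I * ∫ x, ((w x).im : ℂ) * z x := by
    intro w z hw hz
    rw [← integral_const_mul, ← integral_add]
    · refine integral_congr_ae (ae_of_all _ fun x => ?_)
      dsimp only
      conv_lhs => rw [← Complex.re_add_im (w x)]
      ring
    · exact integrable_mul_of_memLp hw.re.ofReal hz
    · exact (integrable_mul_of_memLp hw.im.ofReal hz).const_mul _
  rw [hde, e1 _ _ m2 hg, e1 _ _ m1 hd, hre, him]
  ring

/-- Test the left side against a smooth compactly supported `χ` and move the transform to `χ`. The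
derivative of `𝓕 χ` is minus the transform of `2πiξ χ`, and the minus sign cancels the one from the
integration by parts. -/
lemma HasL2Deriv.ft_ae (h : HasL2Deriv g d) (hg : MemLp g 2 (volume : Measure ℝ))
    (hd : MemLp d 2 (volume : Measure ℝ)) :
    ft d =ᵐ[volume] fun ξ => (2 * Real.pi * ξ * Complex.I : ℂ) * ft g ξ := by
  have hloc : ∀ w : ℝ → ℂ, LocallyIntegrable (ft w) volume := fun w =>
    (memLp_ft w).locallyIntegrable (by norm_num)
  have hloc2 : LocallyIntegrable (fun ξ : ℝ => (2 * Real.pi * ξ * Complex.I : ℂ) * ft g ξ) volume := by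
    simpa using! LocallyIntegrable.continuous_smul (𝕜 := ℂ)
      (g := fun ξ : ℝ => (2 * Real.pi * ξ * Complex.I : ℂ)) (by fun_prop) (hloc g)
  refine ae_eq_of_integral_contDiff_smul_eq (hloc d) hloc2 ?_
  intro χ hχ hχc
  have c1 : HasCompactSupport fun ξ => (χ ξ : ℂ) := hχc.comp_left Complex.ofReal_zero
  have s1 : ContDiff ℝ ∞ fun ξ => (χ ξ : ℂ) := Complex.ofRealCLM.contDiff.comp hχ
  have c2 : HasCompactSupport fun ξ : ℝ => (2 * Real.pi * ξ * Complex.I : ℂ) * (χ ξ : ℂ) :=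
    c1.mul_left
  have s2 : ContDiff ℝ ∞ fun ξ : ℝ => (2 * Real.pi * ξ * Complex.I : ℂ) * (χ ξ : ℂ) :=
    ((contDiff_const.mul Complex.ofRealCLM.contDiff).mul contDiff_const).mul s1
  set H := c1.toSchwartzMap s1
  set K := c2.toSchwartzMap s2
  have hH : ∀ x, H x = χ x := fun x => rfl
  have hK : ∀ x, K x = (2 * Real.pi * x * Complex.I : ℂ) * (χ x : ℂ) := fun x => rfl
  have e1 := integral_schwartz_mul_ft hd H
  have e2 := integral_schwartz_mul_ft hg K
  have e3 := h.integral_schwartz hg hd (𝓕 H)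
  have e4 : deriv ((𝓕 H : SchwartzMap ℝ ℂ) : ℝ → ℂ) = fun x => - (𝓕 K : SchwartzMap ℝ ℂ) x := by
    rw [SchwartzMap.fourier_coe, Real.deriv_fourier]
    · have e5 : (fun x : ℝ => (-2 * Real.pi * Complex.I * x) • H x) = ((-K : SchwartzMap ℝ ℂ) : ℝ → ℂ) := by
        ext y
        rw [neg_apply, smul_eq_mul, hH, hK]
        ring
      rw [e5, ← SchwartzMap.fourier_coe, FourierTransform.fourier_neg]
      rfl
    · exact H.integrable
    · refine (K.integrable.const_mul ((2 * Real.pi * Complex.I)⁻¹)).congr (ae_of_all _ fun x => ?_)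
      have : (2 * Real.pi * Complex.I : ℂ) ≠ 0 := by simp [Real.pi_ne_zero]
      simp only [hK, hH, Complex.real_smul]
      field_simp
  rw [e4] at e3
  simp only [neg_mul, integral_neg, neg_inj] at e3
  calc ∫ x, χ x • ft d x = ∫ x, H x * ft d x := by simp [hH]
    _ = ∫ x, K x * ft g x := by rw [e1, e2, e3]
    _ = _ := integral_congr_ae (ae_of_all _ fun x => by
      simp only [hK, Complex.real_smul]; ring)

/-- Integrability of `w'` makes `w` converge at both ends, and integrability of `w` forces the
limits to vanish. -/
lemma HasACDeriv.integral_deriv_eq_zero {w w' : ℝ → ℝ} (h : HasACDeriv w w')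
    (hw : Integrable w) (hw' : Integrable w') : ∫ x, w' x = 0 := by
  have t1 := intervalIntegral_tendsto_integral_Ioi 0 hw'.integrableOn tendsto_id
  have t2 := intervalIntegral_tendsto_integral_Iic 0 hw'.integrableOn tendsto_id
  simp only [id, ← h.sub_eq_integral] at t1 t2
  have l1 : Tendsto w atTop (𝓝 ((∫ x in Set.Ioi 0, w' x) + w 0)) := by
    simpa using t1.add_const (w 0)
  have l2 : Tendsto w atBot (𝓝 (w 0 - ∫ x in Set.Iic 0, w' x)) := by
    simpa using t2.const_sub (w 0)
  have z1 := IntegrableAtFilter.eq_zero_of_tendsto (hw.integrableAtFilter atTop) (fun s hs => by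
    obtain ⟨b, hb⟩ := mem_atTop_sets.1 hs
    exact measure_mono_top (s₁ := Set.Ici b) (fun x hx => hb x hx) (by simp)) l1
  have z2 := IntegrableAtFilter.eq_zero_of_tendsto (hw.integrableAtFilter atBot) (fun s hs => by
    obtain ⟨b, hb⟩ := mem_atBot_sets.1 hs
    exact measure_mono_top (s₁ := Set.Iic b) (fun x hx => hb x hx) (by simp)) l2
  have := intervalIntegral.integral_Iic_add_Ioi (b := 0) hw'.integrableOn hw'.integrableOn
  linarith

lemma integrable_mul_of_memLp_real {u v : ℝ → ℝ} (hu : MemLp u 2 (volume : Measure ℝ))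
    (hv : MemLp v 2 (volume : Measure ℝ)) : Integrable (fun x => u x * v x) volume :=
  hu.integrable_mul hv

lemma HasACDeriv.hasL2Deriv {u v : ℝ → ℝ} (h : HasACDeriv u v)
    (hu : MemLp u 2 (volume : Measure ℝ)) (hv : MemLp v 2 (volume : Measure ℝ)) :
    HasL2Deriv (fun x => (u x : ℂ)) (fun x => (v x : ℂ)) := by
  intro η η' hη m m'
  have i1 := integrable_mul_of_memLp_real m' hu
  have i2 := integrable_mul_of_memLp_real m hv
  have := (hη.mul h).integral_deriv_eq_zero (integrable_mul_of_memLp_real m hu) (i1.add i2)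
  rw [integral_add i1 i2] at this
  simp only [← Complex.ofReal_mul, integral_complex_ofReal]
  rw [eq_neg_of_add_eq_zero_left this, Complex.ofReal_neg]

lemma integral_conj_mul_ft (hu : MemLp u 2 (volume : Measure ℝ))
    (hv : MemLp v 2 (volume : Measure ℝ)) :
    ∫ ξ, starRingEnd ℂ (ft u ξ) * ft v ξ = ∫ x, starRingEnd ℂ (u x) * v x := by
  have h := Lp.inner_fourier_eq (hu.toLp u) (hv.toLp v)
  rw [L2.inner_def, L2.inner_def] at h
  rw [ft_eq hu, ft_eq hv]
  simp only [RCLike.inner_apply] at h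
  simp only [mul_comm (starRingEnd ℂ _)]
  rw [h]
  refine integral_congr_ae ?_
  filter_upwards [hu.coeFn_toLp, hv.coeFn_toLp] with x h1 h2
  rw [h1, h2]

/-- By Parseval both sides are integrals over frequencies, where the factor `2πiξ` moves from one
function to the other at the cost of a conjugation, hence of a sign. -/
lemma hasL2Deriv_of_ft (hg : MemLp g 2 (volume : Measure ℝ)) (hd : MemLp d 2 (volume : Measure ℝ))
    (h : ft d =ᵐ[volume] fun ξ => (2 * Real.pi * ξ * Complex.I : ℂ) * ft g ξ) :
    HasL2Deriv g d := by
  intro η η' hη m m'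
  have e := (hη.hasL2Deriv m m').ft_ae m.ofReal m'.ofReal
  have e1 := integral_conj_mul_ft m'.ofReal hg
  have e2 := integral_conj_mul_ft m.ofReal hd
  simp only [RCLike.ofReal_eq_complex_ofReal, Complex.conj_ofReal] at e1 e2 e
  rw [← e1, ← e2, ← integral_neg]
  refine integral_congr_ae ?_
  filter_upwards [e, h] with ξ h1 h2
  rw [h1, h2]
  simp only [map_mul, Complex.conj_ofReal, Complex.conj_I, map_ofNat]
  ring

/-- The symbol is `1 + (2πξ)²`, so the identity is exact for every real `k`. All inductions on the
order of regularity below rest on it. -/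
lemma hNorm_succ_sq (h : HasL2Deriv g d) (hg : MemLp g 2 (volume : Measure ℝ))
    (hd : MemLp d 2 (volume : Measure ℝ)) : hNorm (k + 1) g ^ 2 = hNorm k g ^ 2 + hNorm k d ^ 2 := by
  rw [hNorm_sq hg, hNorm_sq hg, hNorm_sq hd, ← lintegral_add_left]
  · refine lintegral_congr_ae ?_
    filter_upwards [h.ft_ae hg hd] with ξ hξ
    rw [hξ, enorm_mul, mul_pow, ← mul_assoc, ← add_mul]
    congr 1
    rw [← ofReal_norm, ← ENNReal.ofReal_pow (norm_nonneg _),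
      ← ENNReal.ofReal_mul (Real.rpow_nonneg (symb_pos ξ).le _),
      ← ENNReal.ofReal_add (Real.rpow_nonneg (symb_pos ξ).le _)
        (mul_nonneg (Real.rpow_nonneg (symb_pos ξ).le _) (by positivity)),
      Real.rpow_add (symb_pos ξ), Real.rpow_one]
    congr 1
    have : ‖(2 * Real.pi * ξ * Complex.I : ℂ)‖ ^ 2 = (2 * Real.pi * ξ) ^ 2 := by
      rw [norm_mul, Complex.norm_I, mul_one, show (2 * Real.pi * ξ : ℂ) = ((2 * Real.pi * ξ : ℝ) : ℂ)
        by push_cast; ring, Complex.norm_real, Real.norm_eq_abs, sq_abs]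
    rw [this]
    nth_rewrite 2 [symb]
    ring
  · exact ((continuous_symb_rpow _).measurable.ennreal_ofReal).mul ((measurable_ft g).enorm.pow_const _)

/-- As `|2πξ|` is at most the square root of the symbol, `2πiξ ĝ` lies in `L²`; its inverse
transform is the derivative. -/
lemma exists_hasL2Deriv (h : hNorm 1 g ≠ ⊤) : ∃ d, MemLp d 2 (volume : Measure ℝ) ∧ HasL2Deriv g d := by
  have hg := memLp_of_hNorm_lt_top h
  have hw : MemLp (fun ξ : ℝ => (2 * Real.pi * ξ * Complex.I : ℂ) * ft g ξ) 2 (volume : Measure ℝ) := by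
    have m1 : MemLp (fun ξ => ((symb ξ ^ ((1:ℝ) / 2) : ℝ) : ℂ) * ft g ξ) 2 (volume : Measure ℝ) :=
      ⟨aesm_weight _ _, by rw [← hNorm_eq_eLpNorm hg]; exact lt_top_iff_ne_top.2 h⟩
    refine m1.mono ?_ (ae_of_all _ fun ξ => ?_)
    · exact ((by fun_prop : Continuous fun ξ : ℝ => (2 * Real.pi * ξ * Complex.I : ℂ)).measurable.mul
        (measurable_ft g)).aestronglyMeasurable
    · rw [norm_mul _ (ft g ξ), norm_mul _ (ft g ξ)]
      refine mul_le_mul_of_nonneg_right ?_ (norm_nonneg _)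
      rw [norm_mul, Complex.norm_I, mul_one, show (2 * Real.pi * ξ : ℂ) = ((2 * Real.pi * ξ : ℝ) : ℂ)
        by push_cast; ring, Complex.norm_real, Complex.norm_real, ← Real.sqrt_eq_rpow,
        Real.norm_of_nonneg (Real.sqrt_nonneg _), Real.norm_eq_abs]
      apply Real.abs_le_sqrt
      unfold symb
      linarith
  obtain ⟨d, hd, hde⟩ := exists_ft_eq hw
  exact ⟨d, hd, hasL2Deriv_of_ft hg hd hde⟩

/-- The pointwise derivative and the derivative coming from the Fourier side have the same pairings
with test functions, so they agree almost everywhere. -/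
lemma HasACDeriv.memLp_deriv {u u' : ℝ → ℝ} (h : HasACDeriv u u')
    (hu : hNorm 1 (fun x => (u x : ℂ)) ≠ ⊤) : MemLp u' 2 (volume : Measure ℝ) := by
  obtain ⟨d, hd, hder⟩ := exists_hasL2Deriv hu
  have hdr : MemLp (fun x => (d x).re) 2 (volume : Measure ℝ) := hd.re
  refine hdr.ae_eq ?_
  refine ae_eq_of_integral_contDiff_smul_eq (hdr.locallyIntegrable (by norm_num))
    h.locallyIntegrable ?_
  intro ψ hψ hψc
  have c1 := hψ.continuous
  have c2 := hψ.continuous_deriv (by simp)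
  have m1 : MemLp ψ 2 (volume : Measure ℝ) := c1.memLp_of_hasCompactSupport hψc
  have m2 : MemLp (deriv ψ) 2 (volume : Measure ℝ) := c2.memLp_of_hasCompactSupport hψc.deriv
  have e1 := hder ψ _ (.of_contDiff_infty hψ) m1 m2
  have e2 := h.isWeakDeriv ψ hψ hψc
  simp only [smul_eq_mul]
  have e3 := congrArg Complex.re e1
  rw [Complex.neg_re] at e3
  simp only [← Complex.ofReal_mul, integral_complex_ofReal, Complex.ofReal_re] at e3
  have e4 : ∫ x, ψ x * (d x).re = (∫ x, (ψ x : ℂ) * d x).re := by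
    have := integral_re (integrable_mul_of_memLp m1.ofReal hd)
    simpa using this
  rw [e4]
  simp only [mul_comm (ψ _)]
  simp only [mul_comm (u _)] at e2
  linarith

/-! ### Real interpolation between `L²` and `H^N`. -/

section Interpolation

/-- This scaling integral expresses the intermediate power `X ^ θ` as a superposition of the
truncations `min 1 (r X)`; it converges at `0` because `θ < 1` and at infinity because `θ > 0`. -/
lemma lintegral_min_mul_rpow {θ X : ℝ} (h0 : 0 < θ) (h1 : θ < 1) (hX : 0 < X) :
    ∫⁻ r in Set.Ioi (0 : ℝ), ENNReal.ofReal (min 1 (r * X) * r ^ (-θ - 1)) =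
      ENNReal.ofReal (X ^ θ * (1 / (1 - θ) + 1 / θ)) := by
  have hX' : 0 < 1 / X := by positivity
  rw [← Set.Ioc_union_Ioi_eq_Ioi hX'.le, lintegral_union measurableSet_Ioi
    (Set.Ioc_disjoint_Ioi le_rfl)]
  have e1 : ∫⁻ r in Set.Ioc 0 (1 / X), ENNReal.ofReal (min 1 (r * X) * r ^ (-θ - 1)) =
      ∫⁻ r in Set.Ioc 0 (1 / X), ENNReal.ofReal (X * r ^ (-θ)) := by
    refine setLIntegral_congr_fun measurableSet_Ioc fun r hr => ?_
    have : r * X ≤ 1 := by rw [← le_div_iff₀ hX]; exact hr.2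
    rw [min_eq_right this]
    congr 1
    rw [Real.rpow_sub_one hr.1.ne']
    have := hr.1.ne'
    field_simp
  have e2 : ∫⁻ r in Set.Ioi (1 / X), ENNReal.ofReal (min 1 (r * X) * r ^ (-θ - 1)) =
      ∫⁻ r in Set.Ioi (1 / X), ENNReal.ofReal (r ^ (-θ - 1)) := by
    refine setLIntegral_congr_fun measurableSet_Ioi fun r hr => ?_
    have : 1 ≤ r * X := by rw [← div_le_iff₀ hX]; exact (Set.mem_Ioi.1 hr).le
    rw [min_eq_left this, one_mul]
  have i1 : IntegrableOn (fun r : ℝ => X * r ^ (-θ)) (Set.Ioc 0 (1 / X)) := by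
    have := (intervalIntegral.intervalIntegrable_rpow' (a := 0) (b := 1 / X) (r := -θ)
      (by linarith)).const_mul X
    rwa [intervalIntegrable_iff_integrableOn_Ioc_of_le hX'.le] at this
  have i2 : IntegrableOn (fun r : ℝ => r ^ (-θ - 1)) (Set.Ioi (1 / X)) :=
    integrableOn_Ioi_rpow_of_lt (by linarith) hX'
  rw [e1, e2, ← ofReal_integral_eq_lintegral_ofReal i1, ← ofReal_integral_eq_lintegral_ofReal i2,
    ← ENNReal.ofReal_add]
  · congr 1
    rw [integral_Ioi_rpow_of_lt (by linarith) hX', ← intervalIntegral.integral_of_le hX'.le,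
      intervalIntegral.integral_const_mul, integral_rpow (Or.inl (by linarith)),
      Real.zero_rpow (by linarith), one_div, Real.inv_rpow hX.le, Real.inv_rpow hX.le,
      ← Real.rpow_neg hX.le, ← Real.rpow_neg hX.le]
    have e3 : X * X ^ (-(-θ + 1)) = X ^ θ := by
      nth_rewrite 1 [← Real.rpow_one X]
      rw [← Real.rpow_add hX]; congr 1; ring
    have e4 : X ^ (-(-θ - 1 + 1)) = X ^ θ := by congr 1; ring
    rw [e4, sub_zero, mul_div_assoc', e3, show -θ + 1 = 1 - θ by ring, show -θ - 1 + 1 = -θ by ring]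
    have : 1 - θ ≠ 0 := by linarith
    field_simp
  · exact integral_nonneg_of_ae ((ae_restrict_iff' measurableSet_Ioc).2 (ae_of_all _ fun r hr =>
      mul_nonneg hX.le (Real.rpow_nonneg hr.1.le _)))
  · exact integral_nonneg_of_ae ((ae_restrict_iff' measurableSet_Ioi).2 (ae_of_all _ fun r hr =>
      Real.rpow_nonneg (hX'.le.trans (Set.mem_Ioi.1 hr).le) _))
  · exact (ae_restrict_iff' measurableSet_Ioi).2 (ae_of_all _ fun r hr =>
      Real.rpow_nonneg (hX'.le.trans (Set.mem_Ioi.1 hr).le) _)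
  · exact (ae_restrict_iff' measurableSet_Ioc).2 (ae_of_all _ fun r hr =>
      mul_nonneg hX.le (Real.rpow_nonneg hr.1.le _))

/-- Interpolation between `L²` and `H^N` for multiplication operators. -/
lemma hNorm_mul_interp {χ : ℝ → ℂ} {N θ : ℝ} (hθ0 : 0 < θ) (hθ1 : θ < 1) {A : ℝ≥0∞} (hA : A ≠ ⊤)
    (hχ : ∀ v, MemLp v 2 (volume : Measure ℝ) → MemLp (fun x => χ x * v x) 2 (volume : Measure ℝ))
    (h0 : ∀ v, MemLp v 2 (volume : Measure ℝ) → hNorm 0 (fun x => χ x * v x) ≤ A * hNorm 0 v)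
    (h1 : ∀ v, MemLp v 2 (volume : Measure ℝ) → hNorm N (fun x => χ x * v x) ≤ A * hNorm N v)
    {v : ℝ → ℂ} (hv : MemLp v 2 (volume : Measure ℝ)) :
    hNorm (θ * N) (fun x => χ x * v x) ≤ 2 * A * hNorm (θ * N) v := by
  set X : ℝ → ℝ := fun ξ => symb ξ ^ N with hXdef
  have hX : ∀ ξ, 0 < X ξ := fun ξ => Real.rpow_pos_of_pos (symb_pos ξ) _
  have hXc : Continuous X := continuous_symb_rpow N
  -- A quadratic K-functional of the couple `(L², H^N)`: integrated against `r ^ (-θ - 1)` it gives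
  -- the squared `H^{θN}` norm up to a constant that is the same on both sides.
  let Kf : ℝ → (ℝ → ℂ) → ℝ≥0∞ := fun r w =>
    ∫⁻ ξ, ENNReal.ofReal (min 1 (r * X ξ)) * ‖ft w ξ‖ₑ ^ 2
  have step1 : ∀ r, 0 < r → Kf r (fun x => χ x * v x) ≤ 2 * A ^ 2 * Kf r v := by
    intro r hr
    -- The function is split by frequency. On `S` the minimum is `r X`, which the `H^N` bound pays
    -- for; off `S` it is `1`, which the `L²` bound pays for. For `v` itself the splitting loses
    -- nothing, and for the product only the factor `2` from squaring a sum.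
    let S : Set ℝ := {ξ | r * X ξ ≤ 1}
    have hS : MeasurableSet S := measurableSet_le (by fun_prop) (by fun_prop)
    obtain ⟨v1, m1, e1⟩ := exists_ft_eq ((memLp_ft v).indicator hS)
    have m2 : MemLp (v - v1) 2 (volume : Measure ℝ) := hv.sub m1
    have e2 : ft (v - v1) =ᵐ[volume] Sᶜ.indicator (ft v) := by
      have := ft_add m1 m2
      rw [add_sub_cancel] at this
      filter_upwards [this, e1] with ξ h2 h3
      rw [Pi.add_apply, h3] at h2
      by_cases hξ : ξ ∈ S
      · rw [Set.indicator_of_mem hξ] at h2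
        rw [Set.indicator_of_notMem (by simpa using hξ)]
        simpa using h2
      · rw [Set.indicator_of_notMem hξ] at h2
        rw [Set.indicator_of_mem (by simpa using hξ), h2, zero_add]
    have e3 : ft (fun x => χ x * v x) =ᵐ[volume]
        ft (fun x => χ x * v1 x) + ft (fun x => χ x * (v - v1) x) := by
      have := ft_add (hχ _ m1) (hχ _ m2)
      refine (Eq.eventuallyEq (congrArg ft ?_)).trans this
      ext x
      simp
      ring
    have b1 : Kf r (fun x => χ x * v x) ≤
        2 * (ENNReal.ofReal r * hNorm N (fun x => χ x * v1 x) ^ 2)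
          + 2 * hNorm 0 (fun x => χ x * (v - v1) x) ^ 2 := by
      rw [hNorm_sq (hχ _ m1), hNorm_sq (hχ _ m2), ← lintegral_const_mul' _ _ (by simp),
        ← lintegral_const_mul' _ _ (by simp), ← lintegral_const_mul' _ _ (by simp),
        ← lintegral_add_left]
      · refine lintegral_mono_ae ?_
        filter_upwards [e3] with ξ hξ
        rw [hξ, Pi.add_apply]
        have c1 : ENNReal.ofReal (min 1 (r * X ξ)) ≤ ENNReal.ofReal r * ENNReal.ofReal (X ξ) := by
          rw [← ENNReal.ofReal_mul hr.le]; exact ENNReal.ofReal_le_ofReal (min_le_right _ _)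
        have c2 : ENNReal.ofReal (min 1 (r * X ξ)) ≤ ENNReal.ofReal (symb ξ ^ (0:ℝ)) := by
          rw [Real.rpow_zero]; exact ENNReal.ofReal_le_ofReal (min_le_left _ _)
        set p := ft (fun x => χ x * v1 x) ξ
        set q := ft (fun x => χ x * (v - v1) x) ξ
        have c3 : ‖p + q‖ₑ ^ 2 ≤ 2 * ‖p‖ₑ ^ 2 + 2 * ‖q‖ₑ ^ 2 := by
          have h4 : ‖p + q‖ ^ 2 ≤ 2 * ‖p‖ ^ 2 + 2 * ‖q‖ ^ 2 := by
            nlinarith [norm_add_le p q, sq_nonneg (‖p‖ - ‖q‖), norm_nonneg (p + q)]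
          simp only [← ofReal_norm]
          rw [← ENNReal.ofReal_pow (norm_nonneg _), ← ENNReal.ofReal_pow (norm_nonneg _),
            ← ENNReal.ofReal_pow (norm_nonneg _), show (2 : ℝ≥0∞) = ENNReal.ofReal 2 by simp,
            ← ENNReal.ofReal_mul (by norm_num), ← ENNReal.ofReal_mul (by norm_num),
            ← ENNReal.ofReal_add (by positivity) (by positivity)]
          exact ENNReal.ofReal_le_ofReal h4
        calc ENNReal.ofReal (min 1 (r * X ξ)) * ‖p + q‖ₑ ^ 2
            ≤ ENNReal.ofReal (min 1 (r * X ξ)) * (2 * ‖p‖ₑ ^ 2 + 2 * ‖q‖ₑ ^ 2) := by gcongr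
          _ = 2 * (ENNReal.ofReal (min 1 (r * X ξ)) * ‖p‖ₑ ^ 2)
              + 2 * (ENNReal.ofReal (min 1 (r * X ξ)) * ‖q‖ₑ ^ 2) := by ring
          _ ≤ 2 * (ENNReal.ofReal r * ENNReal.ofReal (X ξ) * ‖p‖ₑ ^ 2)
              + 2 * (ENNReal.ofReal (symb ξ ^ (0:ℝ)) * ‖q‖ₑ ^ 2) := by gcongr
          _ = _ := by rw [mul_assoc (ENNReal.ofReal r)]
      · have := (measurable_ft (fun x => χ x * v1 x)).enorm.pow_const 2
        have h5 : Measurable fun ξ => ENNReal.ofReal (symb ξ ^ N) := hXc.measurable.ennreal_ofReal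
        exact ((h5.mul this).const_mul _).const_mul _
    have b2 : Kf r v = ENNReal.ofReal r * hNorm N v1 ^ 2 + hNorm 0 (v - v1) ^ 2 := by
      rw [hNorm_sq m1, hNorm_sq m2, ← lintegral_const_mul' _ _ (by simp), ← lintegral_add_left]
      · refine lintegral_congr_ae ?_
        filter_upwards [e1, e2] with ξ h2 h3
        rw [h2, h3]
        by_cases hξ : ξ ∈ S
        · rw [Set.indicator_of_mem hξ, Set.indicator_of_notMem (by simpa using hξ),
            min_eq_right hξ, ENNReal.ofReal_mul hr.le]
          simp [hXdef, mul_assoc]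
        · have : 1 ≤ r * X ξ := (not_le.1 hξ).le
          rw [Set.indicator_of_notMem hξ, Set.indicator_of_mem (by simpa using hξ), min_eq_left this]
          simp
      · have := (measurable_ft v1).enorm.pow_const 2
        have h5 : Measurable fun ξ => ENNReal.ofReal (symb ξ ^ N) := hXc.measurable.ennreal_ofReal
        exact (h5.mul this).const_mul _
    calc _ ≤ _ := b1
      _ ≤ 2 * (ENNReal.ofReal r * (A * hNorm N v1) ^ 2) + 2 * (A * hNorm 0 (v - v1)) ^ 2 := by
        gcongr
        · exact h1 _ m1
        · exact h0 _ m2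
      _ = _ := by rw [b2]; ring
  set c : ℝ := 1 / (1 - θ) + 1 / θ
  have hc : 0 < c := by
    have : 0 < 1 - θ := by linarith
    positivity
  have step2 : ∀ w, MemLp w 2 (volume : Measure ℝ) →
      ∫⁻ r in Set.Ioi (0 : ℝ), ENNReal.ofReal (r ^ (-θ - 1)) * Kf r w =
        ENNReal.ofReal c * hNorm (θ * N) w ^ 2 := by
    intro w hw
    have hm := measurable_ft w
    calc ∫⁻ r in Set.Ioi (0 : ℝ), ENNReal.ofReal (r ^ (-θ - 1)) * Kf r w
        = ∫⁻ r in Set.Ioi (0 : ℝ), ∫⁻ ξ, ENNReal.ofReal (r ^ (-θ - 1)) *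
            (ENNReal.ofReal (min 1 (r * X ξ)) * ‖ft w ξ‖ₑ ^ 2) := by
          refine lintegral_congr fun r => ?_
          rw [lintegral_const_mul' _ _ (by simp)]
      _ = ∫⁻ ξ, ∫⁻ r in Set.Ioi (0 : ℝ), ENNReal.ofReal (r ^ (-θ - 1)) *
            (ENNReal.ofReal (min 1 (r * X ξ)) * ‖ft w ξ‖ₑ ^ 2) := by
          refine lintegral_lintegral_swap (Measurable.aemeasurable ?_)
          have q1 : Measurable fun p : ℝ × ℝ => ENNReal.ofReal (p.1 ^ (-θ - 1)) :=
            (measurable_fst.pow_const _).ennreal_ofReal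
          have q2 : Measurable fun p : ℝ × ℝ => ENNReal.ofReal (min 1 (p.1 * X p.2)) :=
            (by fun_prop : Continuous fun p : ℝ × ℝ => min 1 (p.1 * X p.2)).measurable.ennreal_ofReal
          have q3 : Measurable fun p : ℝ × ℝ => ‖ft w p.2‖ₑ ^ 2 :=
            (hm.comp measurable_snd).enorm.pow_const 2
          exact q1.mul (q2.mul q3)
      _ = ∫⁻ ξ, ENNReal.ofReal c * (ENNReal.ofReal (symb ξ ^ (θ * N)) * ‖ft w ξ‖ₑ ^ 2) := by
          refine lintegral_congr fun ξ => ?_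
          have : ∀ r ∈ Set.Ioi (0:ℝ), ENNReal.ofReal (r ^ (-θ - 1)) *
              (ENNReal.ofReal (min 1 (r * X ξ)) * ‖ft w ξ‖ₑ ^ 2) =
              ENNReal.ofReal (min 1 (r * X ξ) * r ^ (-θ - 1)) * ‖ft w ξ‖ₑ ^ 2 := by
            intro r hr
            have hr' : (0:ℝ) < r := hr
            rw [ENNReal.ofReal_mul (le_min zero_le_one (mul_pos hr' (hX ξ)).le)]
            ring
          rw [setLIntegral_congr_fun measurableSet_Ioi this, lintegral_mul_const' _ _ (by simp),
            lintegral_min_mul_rpow hθ0 hθ1 (hX ξ), ENNReal.ofReal_mul (Real.rpow_nonneg (hX ξ).le _),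
            hXdef, ← Real.rpow_mul (symb_pos ξ).le, mul_comm N θ]
          ring
      _ = _ := by rw [lintegral_const_mul' _ _ (by simp), hNorm_sq hw]
  have step3 : ENNReal.ofReal c * hNorm (θ * N) (fun x => χ x * v x) ^ 2 ≤
      ENNReal.ofReal c * (2 * A ^ 2 * hNorm (θ * N) v ^ 2) := by
    rw [← step2 _ (hχ v hv), mul_left_comm, ← step2 v hv]
    rw [← lintegral_const_mul' _ _ (ENNReal.mul_ne_top (by simp) (ENNReal.pow_ne_top hA))]
    refine setLIntegral_mono' measurableSet_Ioi fun r hr => ?_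
    rw [mul_left_comm]
    gcongr
    exact step1 r hr
  rw [ENNReal.mul_le_mul_iff_right (by simpa using hc) (by simp)] at step3
  rw [← ENNReal.pow_le_pow_left_iff two_ne_zero]
  refine step3.trans ?_
  rw [mul_pow, mul_pow]
  gcongr
  norm_num

end Interpolation

/-! ### The product rule and the multiplication estimate in `H^k`. -/

variable {u v g d : ℝ → ℂ} {k l : ℝ}

lemma HasL2Deriv.congr {g₁ d₁ : ℝ → ℂ} (h : HasL2Deriv g d) (hg : g =ᵐ[volume] g₁)
    (hd : d =ᵐ[volume] d₁) : HasL2Deriv g₁ d₁ := by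
  intro η η' hη m m'
  have := h η η' hη m m'
  rw [integral_congr_ae (f := fun x => (η' x : ℂ) * g x) (g := fun x => (η' x : ℂ) * g₁ x)
      (by filter_upwards [hg] with x hx using by rw [hx]),
    integral_congr_ae (f := fun x => (η x : ℂ) * d x) (g := fun x => (η x : ℂ) * d₁ x)
      (by filter_upwards [hd] with x hx using by rw [hx])] at this
  exact this

lemma HasL2Deriv.add {g₁ d₁ : ℝ → ℂ} (h : HasL2Deriv g d) (h₁ : HasL2Deriv g₁ d₁)
    (mg : MemLp g 2 (volume : Measure ℝ)) (md : MemLp d 2 (volume : Measure ℝ))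
    (mg₁ : MemLp g₁ 2 (volume : Measure ℝ)) (md₁ : MemLp d₁ 2 (volume : Measure ℝ)) :
    HasL2Deriv (fun x => g x + g₁ x) (fun x => d x + d₁ x) := by
  intro η η' hη m m'
  have e1 := h η η' hη m m'
  have e2 := h₁ η η' hη m m'
  simp only [mul_add]
  have i1 := integral_add (integrable_mul_of_memLp m'.ofReal mg) (integrable_mul_of_memLp m'.ofReal mg₁)
  have i2 := integral_add (integrable_mul_of_memLp m.ofReal md) (integrable_mul_of_memLp m.ofReal md₁)
  simp only [RCLike.ofReal_eq_complex_ofReal] at i1 i2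
  rw [i1, i2, e1, e2]; ring

lemma HasL2Deriv.const_mul (c : ℂ) (h : HasL2Deriv g d) :
    HasL2Deriv (fun x => c * g x) (fun x => c * d x) := by
  intro η η' hη m m'
  have e1 := h η η' hη m m'
  simp only [mul_left_comm _ c, integral_const_mul]
  rw [e1]; ring

/-- A function in `H¹` has a representative with absolutely continuous real and imaginary parts. -/
lemma HasL2Deriv.exists_hasACDeriv (h : HasL2Deriv g d) (mg : MemLp g 2 (volume : Measure ℝ))
    (md : MemLp d 2 (volume : Measure ℝ)) :
    ∃ p p' q q' : ℝ → ℝ, HasACDeriv p p' ∧ HasACDeriv q q' ∧ MemLp p 2 (volume : Measure ℝ) ∧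
      MemLp p' 2 (volume : Measure ℝ) ∧ MemLp q 2 (volume : Measure ℝ) ∧
      MemLp q' 2 (volume : Measure ℝ) ∧ (∀ᵐ x, g x = p x + Complex.I * q x) ∧
      ∀ᵐ x, d x = p' x + Complex.I * q' x := by
  have key : ∀ ψ : ℝ → ℝ, ContDiff ℝ ∞ ψ → HasCompactSupport ψ →
      ∫ x, ((deriv ψ x : ℝ) : ℂ) * g x = - ∫ x, (ψ x : ℂ) * d x := fun ψ hψ hψc =>
    h ψ _ (.of_contDiff_infty hψ) (hψ.continuous.memLp_of_hasCompactSupport hψc)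
      ((hψ.continuous_deriv (by simp)).memLp_of_hasCompactSupport hψc.deriv)
  have int : ∀ (ψ : ℝ → ℝ) (w : ℝ → ℂ), Continuous ψ → HasCompactSupport ψ →
      MemLp w 2 (volume : Measure ℝ) → Integrable (fun x => (ψ x : ℂ) * w x) := fun ψ w hψ hc hw =>
    integrable_mul_of_memLp (hψ.memLp_of_hasCompactSupport hc).ofReal hw
  have h1 : IsWeakDeriv (fun x => (g x).re) (fun x => (d x).re) := by
    intro ψ hψ hψc
    have e := congrArg Complex.re (key ψ hψ hψc)
    have i1 := integral_re (int _ _ (hψ.continuous_deriv (by simp)) hψc.deriv mg)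
    have i2 := integral_re (int _ _ hψ.continuous hψc md)
    simp at i1 i2 e
    simp only [mul_comm _ (ψ _), mul_comm _ (deriv ψ _)]
    linarith
  have h2 : IsWeakDeriv (fun x => (g x).im) (fun x => (d x).im) := by
    intro ψ hψ hψc
    have e := congrArg Complex.im (key ψ hψ hψc)
    have i1 := integral_im (int _ _ (hψ.continuous_deriv (by simp)) hψc.deriv mg)
    have i2 := integral_im (int _ _ hψ.continuous hψc md)
    simp at i1 i2 e
    simp only [mul_comm _ (ψ _), mul_comm _ (deriv ψ _)]
    linarith
  have mgr : MemLp (fun x => (g x).re) 2 (volume : Measure ℝ) := mg.re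
  have mgi : MemLp (fun x => (g x).im) 2 (volume : Measure ℝ) := mg.im
  have mdr : MemLp (fun x => (d x).re) 2 (volume : Measure ℝ) := md.re
  have mdi : MemLp (fun x => (d x).im) 2 (volume : Measure ℝ) := md.im
  obtain ⟨p, hp, ep⟩ := h1.exists_hasACDeriv (mgr.locallyIntegrable (by norm_num))
    (mdr.locallyIntegrable (by norm_num))
  obtain ⟨q, hq, eq⟩ := h2.exists_hasACDeriv (mgi.locallyIntegrable (by norm_num))
    (mdi.locallyIntegrable (by norm_num))
  refine ⟨p, _, q, _, hp, hq, mgr.ae_eq ep, mdr, mgi.ae_eq eq, mdi, ?_, ?_⟩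
  · filter_upwards [ep, eq] with x h1 h2
    rw [← h1, ← h2, mul_comm, Complex.re_add_im]
  · refine ae_of_all _ fun x => ?_
    rw [mul_comm, Complex.re_add_im]

lemma eLpNorm_le_hNorm_one (h : HasL2Deriv g d) (mg : MemLp g 2 (volume : Measure ℝ))
    (md : MemLp d 2 (volume : Measure ℝ)) : eLpNorm d 2 volume ≤ hNorm 1 g := by
  rw [← ENNReal.pow_le_pow_left_iff two_ne_zero, show (1 : ℝ) = 0 + 1 by norm_num,
    hNorm_succ_sq h mg md, hNorm_zero _ md]
  exact le_add_self

lemma hNorm_deriv_le (h : HasL2Deriv g d) (mg : MemLp g 2 (volume : Measure ℝ))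
    (md : MemLp d 2 (volume : Measure ℝ)) : hNorm k d ≤ hNorm (k + 1) g := by
  rw [← ENNReal.pow_le_pow_left_iff two_ne_zero, hNorm_succ_sq h mg md]
  exact le_add_self

lemma hNorm_succ_le (h : HasL2Deriv g d) (mg : MemLp g 2 (volume : Measure ℝ))
    (md : MemLp d 2 (volume : Measure ℝ)) : hNorm (k + 1) g ≤ hNorm k g + hNorm k d := by
  rw [← ENNReal.pow_le_pow_left_iff two_ne_zero, hNorm_succ_sq h mg md, add_sq]
  gcongr
  exact le_self_add

/-- The real Sobolev embedding is applied to the real and the imaginary part; each contributes `2 (1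
+ 1)` to the constant. -/
lemma ae_enorm_le_hNorm_one (mg : hNorm 1 g ≠ ⊤) : ∀ᵐ x, ‖g x‖ₑ ≤ 8 * hNorm 1 g := by
  obtain ⟨d, md, hd⟩ := exists_hasL2Deriv mg
  have mg' := memLp_of_hNorm_lt_top mg
  obtain ⟨p, p', q, q', hp, hq, mp, mp', mq, mq', e1, e2⟩ := hd.exists_hasACDeriv mg' md
  have b1 : eLpNorm p 2 volume ≤ hNorm 1 g := by
    refine le_trans (eLpNorm_mono_ae ?_) (eLpNorm_le_hNorm zero_le_one g)
    filter_upwards [e1] with x hx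
    have : p x = (g x).re := by simp [hx]
    rw [this, Real.norm_eq_abs]
    exact Complex.abs_re_le_norm _
  have b2 : eLpNorm q 2 volume ≤ hNorm 1 g := by
    refine le_trans (eLpNorm_mono_ae ?_) (eLpNorm_le_hNorm zero_le_one g)
    filter_upwards [e1] with x hx
    have : q x = (g x).im := by simp [hx]
    rw [this, Real.norm_eq_abs]
    exact Complex.abs_im_le_norm _
  have b3 : eLpNorm p' 2 volume ≤ hNorm 1 g := by
    refine le_trans (eLpNorm_mono_ae ?_) (eLpNorm_le_hNorm_one hd mg' md)
    filter_upwards [e2] with x hx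
    have : p' x = (d x).re := by simp [hx]
    rw [this, Real.norm_eq_abs]
    exact Complex.abs_re_le_norm _
  have b4 : eLpNorm q' 2 volume ≤ hNorm 1 g := by
    refine le_trans (eLpNorm_mono_ae ?_) (eLpNorm_le_hNorm_one hd mg' md)
    filter_upwards [e2] with x hx
    have : q' x = (d x).im := by simp [hx]
    rw [this, Real.norm_eq_abs]
    exact Complex.abs_im_le_norm _
  filter_upwards [e1] with x hx
  have c1 : ‖g x‖ₑ ≤ ‖p x‖ₑ + ‖q x‖ₑ := by
    rw [hx]
    refine (enorm_add_le _ _).trans ?_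
    rw [enorm_mul]
    simp [← ofReal_norm]
  calc ‖g x‖ₑ ≤ 2 * (eLpNorm p 2 volume + eLpNorm p' 2 volume) +
        2 * (eLpNorm q 2 volume + eLpNorm q' 2 volume) :=
        c1.trans (add_le_add (hp.enorm_le x) (hq.enorm_le x))
    _ ≤ 2 * (hNorm 1 g + hNorm 1 g) + 2 * (hNorm 1 g + hNorm 1 g) := by gcongr
    _ = 8 * hNorm 1 g := by ring

lemma eLpNorm_mul_le {C : ℝ≥0∞} (hC : C ≠ ⊤) (hu : ∀ᵐ x, ‖u x‖ₑ ≤ C) :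
    eLpNorm (fun x => u x * g x) 2 volume ≤ C * eLpNorm g 2 volume := by
  rw [← ENNReal.pow_le_pow_left_iff two_ne_zero, mul_pow, eLpNorm_two_sq, eLpNorm_two_sq]
  rw [← lintegral_const_mul' _ _ (ENNReal.pow_ne_top hC)]
  refine lintegral_mono_ae ?_
  filter_upwards [hu] with x hx
  rw [enorm_mul, mul_pow]
  gcongr

lemma memLp_mul {C : ℝ≥0∞} (hC : C ≠ ⊤) (hu : ∀ᵐ x, ‖u x‖ₑ ≤ C) (mu : AEStronglyMeasurable u volume)
    (mg : MemLp g 2 (volume : Measure ℝ)) : MemLp (fun x => u x * g x) 2 (volume : Measure ℝ) :=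
  ⟨mu.mul mg.1, (eLpNorm_mul_le hC hu).trans_lt (ENNReal.mul_lt_top (lt_top_iff_ne_top.2 hC) mg.2)⟩

lemma HasL2Deriv.mul_ofReal {p p' q q' : ℝ → ℝ} (hp : HasACDeriv p p') (hq : HasACDeriv q q')
    (m1 : MemLp p 2 (volume : Measure ℝ)) (m2 : MemLp p' 2 (volume : Measure ℝ))
    (m3 : MemLp q 2 (volume : Measure ℝ)) (m4 : MemLp q' 2 (volume : Measure ℝ)) :
    HasL2Deriv (fun x => (p x : ℂ) * q x) (fun x => (p' x : ℂ) * q x + p x * q' x) ∧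
      MemLp (fun x => (p x : ℂ) * q x) 2 (volume : Measure ℝ) ∧
      MemLp (fun x => (p' x : ℂ) * q x + p x * q' x) 2 (volume : Measure ℝ) := by
  have n1 : 2 * (eLpNorm p 2 volume + eLpNorm p' 2 volume) ≠ ⊤ :=
    ENNReal.mul_ne_top (by simp) (ENNReal.add_ne_top.2 ⟨m1.2.ne, m2.2.ne⟩)
  have n2 : 2 * (eLpNorm q 2 volume + eLpNorm q' 2 volume) ≠ ⊤ :=
    ENNReal.mul_ne_top (by simp) (ENNReal.add_ne_top.2 ⟨m3.2.ne, m4.2.ne⟩)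
  have c1 : ∀ᵐ x, ‖(p x : ℂ)‖ₑ ≤ 2 * (eLpNorm p 2 volume + eLpNorm p' 2 volume) :=
    ae_of_all _ fun x => by simpa [← ofReal_norm] using hp.enorm_le x
  have c2 : ∀ᵐ x, ‖(q x : ℂ)‖ₑ ≤ 2 * (eLpNorm q 2 volume + eLpNorm q' 2 volume) :=
    ae_of_all _ fun x => by simpa [← ofReal_norm] using hq.enorm_le x
  have k1 := memLp_mul (g := fun x => (q x : ℂ)) n1 c1 m1.ofReal.1 m3.ofReal
  have k2 := memLp_mul (g := fun x => (q' x : ℂ)) n1 c1 m1.ofReal.1 m4.ofReal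
  have k3 := memLp_mul (g := fun x => (p' x : ℂ)) n2 c2 m3.ofReal.1 m2.ofReal
  simp only [mul_comm (q _ : ℂ) (p' _)] at k3
  refine ⟨?_, k1, k3.add k2⟩
  have := (hp.mul hq).hasL2Deriv (by simpa using k1.re) (by simpa using (k3.add k2).re)
  simpa using this

/-- The product rule in `H¹`. -/
lemma HasL2Deriv.mul (h : HasL2Deriv u v) (h' : HasL2Deriv g d)
    (mu : MemLp u 2 (volume : Measure ℝ)) (mv : MemLp v 2 (volume : Measure ℝ))
    (mg : MemLp g 2 (volume : Measure ℝ)) (md : MemLp d 2 (volume : Measure ℝ)) :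
    HasL2Deriv (fun x => u x * g x) (fun x => v x * g x + u x * d x) := by
  obtain ⟨p, p', q, q', hp, hq, mp, mp', mq, mq', e1, e2⟩ := h.exists_hasACDeriv mu mv
  obtain ⟨r, r', s, s', hr, hs, mr, mr', ms, ms', e3, e4⟩ := h'.exists_hasACDeriv mg md
  obtain ⟨a1, a2, a3⟩ := mul_ofReal hp hr mp mp' mr mr'
  obtain ⟨b1, b2, b3⟩ := mul_ofReal hp hs mp mp' ms ms'
  obtain ⟨c1, c2, c3⟩ := mul_ofReal hq hr mq mq' mr mr'
  obtain ⟨d1, d2, d3⟩ := mul_ofReal hq hs mq mq' ms ms'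
  have t1 := (a1.add (d1.const_mul (-1)) a2 a3 (d2.const_mul _) (d3.const_mul _))
  have t2 := (b1.add c1 b2 b3 c2 c3).const_mul Complex.I
  refine (t1.add t2 (a2.add (d2.const_mul _)) (a3.add (d3.const_mul _)) ((b2.add c2).const_mul _)
    ((b3.add c3).const_mul _)).congr ?_ ?_
  · filter_upwards [e1, e3] with x h1 h2
    rw [h1, h2]
    linear_combination -(q x * s x : ℂ) * Complex.I_sq
  · filter_upwards [e1, e2, e3, e4] with x h1 h2 h3 h4
    rw [h1, h2, h3, h4]
    linear_combination -(q' x * s x + q x * s' x : ℂ) * Complex.I_sq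

lemma hNorm_ne_top_mono (h : k ≤ l) (hl : hNorm l g ≠ ⊤) : hNorm k g ≠ ⊤ :=
  ne_top_of_le_ne_top hl (hNorm_mono h g)

lemma memLp_mul_of_hNorm (hu : hNorm 1 u ≠ ⊤) (mg : MemLp g 2 (volume : Measure ℝ)) :
    MemLp (fun x => u x * g x) 2 (volume : Measure ℝ) :=
  memLp_mul (ENNReal.mul_ne_top (by simp) hu) (ae_enorm_le_hNorm_one hu)
    (memLp_of_hNorm_lt_top hu).1 mg

lemma hNorm_zero_mul_le (hu : hNorm 1 u ≠ ⊤) (mg : MemLp g 2 (volume : Measure ℝ)) :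
    hNorm 0 (fun x => u x * g x) ≤ 8 * hNorm 1 u * hNorm 0 g := by
  rw [hNorm_zero _ mg, hNorm_zero _ (memLp_mul_of_hNorm hu mg)]
  exact eLpNorm_mul_le (ENNReal.mul_ne_top (by simp) hu) (ae_enorm_le_hNorm_one hu)

/-- By the Leibniz rule the norm of order `k + 1` is controlled by the `H^k` norms of `u g`, `u' g`
and `u g'`, hence the factor three. The undifferentiated factor is placed in `H^{max(k,1)}`, which
is affordable since `max k 1 ≤ k + 1`. -/
lemma hNorm_succ_mul_le {A : ℝ≥0∞} (hk : 0 ≤ k)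
    (hM : ∀ u g : ℝ → ℂ, hNorm (max k 1) u ≠ ⊤ → hNorm k g ≠ ⊤ →
      hNorm k (fun x => u x * g x) ≤ A * hNorm (max k 1) u * hNorm k g)
    (hu : hNorm (k + 1) u ≠ ⊤) (hg : hNorm (k + 1) g ≠ ⊤) :
    hNorm (k + 1) (fun x => u x * g x) ≤ (3 * A) * hNorm (k + 1) u * hNorm (k + 1) g := by
  have hk1 : max k 1 ≤ k + 1 := by simp [hk]
  have u1 := hNorm_ne_top_mono (by linarith : 1 ≤ k + 1) hu
  have g1 := hNorm_ne_top_mono (by linarith : 1 ≤ k + 1) hg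
  obtain ⟨v, mv, hv⟩ := exists_hasL2Deriv u1
  obtain ⟨d, md, hd⟩ := exists_hasL2Deriv g1
  have mu := memLp_of_hNorm_lt_top u1
  have mg := memLp_of_hNorm_lt_top g1
  have hp := hv.mul hd mu mv mg md
  have m1 := memLp_mul_of_hNorm u1 mg
  have m2 := memLp_mul_of_hNorm g1 mv
  have m3 := memLp_mul_of_hNorm u1 md
  simp only [mul_comm (g _)] at m2
  refine (hNorm_succ_le hp m1 (m2.add m3)).trans ?_
  have kv := hNorm_deriv_le (k := k) hv mu mv
  have kd := hNorm_deriv_le (k := k) hd mg md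
  have uk := hNorm_ne_top_mono hk1 hu
  have gk := hNorm_ne_top_mono hk1 hg
  have i1 := hM u g uk (hNorm_ne_top_mono (by linarith) hg)
  have i2 := hM g v gk (ne_top_of_le_ne_top hu kv)
  have i3 := hM u d uk (ne_top_of_le_ne_top hg kd)
  simp only [mul_comm (g _)] at i2
  have i4 := hNorm_add_le (k := k) (fun x => v x * g x) (fun x => u x * d x)
  calc _ ≤ A * hNorm (max k 1) u * hNorm k g + (A * hNorm (max k 1) g * hNorm k v
        + A * hNorm (max k 1) u * hNorm k d) := add_le_add i1 (i4.trans (add_le_add i2 i3))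
    _ ≤ A * hNorm (k + 1) u * hNorm (k + 1) g + (A * hNorm (k + 1) g * hNorm (k + 1) u
        + A * hNorm (k + 1) u * hNorm (k + 1) g) := by
      gcongr
      · exact hNorm_mono hk1 u
      · exact hNorm_mono (by linarith) g
      · exact hNorm_mono hk1 g
      · exact hNorm_mono hk1 u
    _ = _ := by ring

/-- The multiplication `H^{max(k,1)} × H^k → H^k` is bounded for real `k ≥ 0`. -/
lemma exists_hNorm_mul_le (n : ℕ) : ∀ k : ℝ, 0 ≤ k → k ≤ n + 1 → ∃ A : ℝ≥0∞, A ≠ ⊤ ∧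
    ∀ u g : ℝ → ℂ, hNorm (max k 1) u ≠ ⊤ → hNorm k g ≠ ⊤ →
      hNorm k (fun x => u x * g x) ≤ A * hNorm (max k 1) u * hNorm k g := by
  have base1 : ∀ u g : ℝ → ℂ, hNorm 1 u ≠ ⊤ → hNorm 1 g ≠ ⊤ →
      hNorm 1 (fun x => u x * g x) ≤ (3 * 8) * hNorm 1 u * hNorm 1 g := by
    intro u g hu hg
    have := hNorm_succ_mul_le (k := 0) (A := 8) (u := u) (g := g) le_rfl (fun u g hu hg => by
      rw [max_eq_right zero_le_one] at hu ⊢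
      exact hNorm_zero_mul_le hu (memLp_of_hNorm_lt_top hg)) (by simpa using hu) (by simpa using hg)
    simpa using this
  induction n with
  | zero =>
    intro k hk0 hk1
    rw [Nat.cast_zero, zero_add] at hk1
    rw [max_eq_right hk1]
    refine ⟨2 * 25, by finiteness, fun u g hu hg => ?_⟩
    have mg := memLp_of_hNorm_lt_top hg
    rcases hk0.eq_or_lt with rfl | hk0
    · refine (hNorm_zero_mul_le hu mg).trans ?_
      gcongr
      norm_num
    rcases hk1.eq_or_lt with rfl | hk1
    · refine (base1 u g hu hg).trans (mul_le_mul_left (mul_le_mul_left ?_ _) _)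
      norm_num
    -- Interpolation asks for the bound at every `v` in `L²`. For `v` outside `H¹` the right-hand
    -- side must be infinite, which fails when the norm of `u` is zero.
    by_cases hu0 : hNorm 1 u = 0
    · have : (fun x => u x * g x) =ᵐ[volume] fun x => 0 * g x := by
        filter_upwards [ae_enorm_le_hNorm_one hu] with x hx
        rw [hu0, mul_zero] at hx
        rw [show u x = 0 by simpa using hx]
      rw [hNorm_congr this, hu0]
      simpa using hNorm_const_mul_le (k := k) 0 mg
    have := hNorm_mul_interp (N := 1) (χ := u) (A := 25 * hNorm 1 u) hk0 hk1
      (ENNReal.mul_ne_top (by simp) hu) (fun v hv => memLp_mul_of_hNorm hu hv)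
      (fun v hv => (hNorm_zero_mul_le hu hv).trans (by gcongr; norm_num))
      (fun v hv => by
        by_cases hv1 : hNorm 1 v = ⊤
        · rw [hv1, ENNReal.mul_top (by simpa using hu0)]
          exact le_top
        · exact (base1 u v hu hv1).trans (by gcongr; norm_num)) mg
    rw [mul_one] at this
    simpa [mul_assoc] using this
  | succ n ih =>
    intro k hk0 hk1
    by_cases hk : k ≤ n + 1
    · exact ih k hk0 hk
    have hn : (0 : ℝ) ≤ n := n.cast_nonneg
    push_cast at hk1
    rw [not_le] at hk
    obtain ⟨A, hA, h⟩ := ih (k - 1) (by linarith) (by linarith)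
    refine ⟨3 * A, ENNReal.mul_ne_top (by simp) hA, fun u g hu hg => ?_⟩
    rw [max_eq_left (by linarith)] at hu ⊢
    have := hNorm_succ_mul_le (u := u) (g := g) (by linarith) h (by simpa using hu) (by simpa using hg)
    simpa using this

/-! ### Bounded smooth functions as multipliers. -/

/-- Functions with `n` derivatives, all bounded. -/
def BddSmooth : ℕ → (ℝ → ℝ) → Prop
  | 0, χ => Continuous χ ∧ ∃ C, ∀ x, |χ x| ≤ C
  | n + 1, χ => (∃ C, ∀ x, |χ x| ≤ C) ∧ ∃ χ', (∀ x, HasDerivAt χ (χ' x) x) ∧ BddSmooth n χ'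

namespace BddSmooth

variable {n : ℕ} {χ ρ : ℝ → ℝ}

lemma bdd (h : BddSmooth n χ) : ∃ C, ∀ x, |χ x| ≤ C := by
  cases n with
  | zero => exact h.2
  | succ n => exact h.1

lemma continuous (h : BddSmooth n χ) : Continuous χ := by
  cases n with
  | zero => exact h.1
  | succ n =>
    obtain ⟨-, χ', hd, -⟩ := h
    exact continuous_iff_continuousAt.2 fun x => (hd x).continuousAt

lemma pred (h : BddSmooth (n + 1) χ) : BddSmooth n χ := by
  induction n generalizing χ with
  | zero => exact ⟨h.continuous, h.1⟩
  | succ n ih =>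
    obtain ⟨hb, χ', hd, h'⟩ := h
    exact ⟨hb, χ', hd, ih h'⟩

lemma const (n : ℕ) (c : ℝ) : BddSmooth n fun _ => c := by
  induction n generalizing c with
  | zero => exact ⟨continuous_const, |c|, fun _ => le_rfl⟩
  | succ n ih => exact ⟨⟨|c|, fun _ => le_rfl⟩, fun _ => 0, fun x => hasDerivAt_const x c, ih 0⟩

lemma add (h : BddSmooth n χ) (h' : BddSmooth n ρ) : BddSmooth n fun x => χ x + ρ x := by
  obtain ⟨C, hC⟩ := h.bdd
  obtain ⟨D, hD⟩ := h'.bdd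
  have hb : ∃ C, ∀ x, |χ x + ρ x| ≤ C :=
    ⟨C + D, fun x => (abs_add_le _ _).trans (add_le_add (hC x) (hD x))⟩
  induction n generalizing χ ρ C D with
  | zero => exact ⟨h.1.add h'.1, hb⟩
  | succ n ih =>
    obtain ⟨-, χ', hd, k⟩ := h
    obtain ⟨-, ρ', hd', k'⟩ := h'
    obtain ⟨C', hC'⟩ := k.bdd
    obtain ⟨D', hD'⟩ := k'.bdd
    exact ⟨hb, _, fun x => (hd x).add (hd' x), ih k k' C' hC' D' hD'
      ⟨C' + D', fun x => (abs_add_le _ _).trans (add_le_add (hC' x) (hD' x))⟩⟩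

lemma mul (h : BddSmooth n χ) (h' : BddSmooth n ρ) : BddSmooth n fun x => χ x * ρ x := by
  induction n generalizing χ ρ with
  | zero =>
    obtain ⟨C, hC⟩ := h.bdd
    obtain ⟨D, hD⟩ := h'.bdd
    refine ⟨h.1.mul h'.1, C * D, fun x => ?_⟩
    rw [abs_mul]
    exact mul_le_mul (hC x) (hD x) (abs_nonneg _) ((abs_nonneg _).trans (hC x))
  | succ n ih =>
    obtain ⟨C, hC⟩ := h.bdd
    obtain ⟨D, hD⟩ := h'.bdd
    have p := h.pred
    have p' := h'.pred
    obtain ⟨-, χ', hd, k⟩ := h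
    obtain ⟨-, ρ', hd', k'⟩ := h'
    refine ⟨⟨C * D, fun x => ?_⟩, _, fun x => (hd x).mul (hd' x), (ih k p').add (ih p k')⟩
    rw [abs_mul]
    exact mul_le_mul (hC x) (hD x) (abs_nonneg _) ((abs_nonneg _).trans (hC x))

lemma const_mul (c : ℝ) (h : BddSmooth n χ) : BddSmooth n fun x => c * χ x := (const n c).mul h

lemma comp_affine (h : BddSmooth n χ) (a b : ℝ) : BddSmooth n fun x => χ (a * (x - b)) := by
  induction n generalizing χ with
  | zero => exact ⟨h.1.comp (by fun_prop), h.2.imp fun C hC x => hC _⟩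
  | succ n ih =>
    obtain ⟨hb, χ', hd, k⟩ := h
    refine ⟨hb.imp fun C hC x => hC _, fun x => a * χ' (a * (x - b)), fun x => ?_,
      (ih k).const_mul a⟩
    have h1 : HasDerivAt (fun x => a * (x - b)) a x := by
      simpa using ((hasDerivAt_id x).sub_const b).const_mul a
    exact (HasDerivAt.comp x (hd (a * (x - b))) h1).congr_deriv (mul_comm _ _)

end BddSmooth

variable {u v g d : ℝ → ℂ} {k l : ℝ}

/-- If `η` is an admissible test function then so is `η χ`, and testing `g` against it is the
product rule. -/
lemma HasL2Deriv.real_mul {χ χ' : ℝ → ℝ} (h : HasL2Deriv g d) (hχ : HasACDeriv χ χ')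
    (hc : ∃ C, ∀ x, |χ x| ≤ C) (hc' : ∃ C, ∀ x, |χ' x| ≤ C)
    (mg : MemLp g 2 (volume : Measure ℝ)) (md : MemLp d 2 (volume : Measure ℝ)) :
    HasL2Deriv (fun x => (χ x : ℂ) * g x) (fun x => (χ' x : ℂ) * g x + χ x * d x) := by
  obtain ⟨C, hC⟩ := hc
  obtain ⟨D, hD⟩ := hc'
  intro η η' hη m m'
  have hm : ∀ (η : ℝ → ℝ), MemLp η 2 (volume : Measure ℝ) →
      MemLp (fun x => η x * χ x) 2 (volume : Measure ℝ) := fun η m =>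
    (m.const_mul C).mono (m.1.mul hχ.continuous.aestronglyMeasurable) (ae_of_all _ fun x => by
      rw [norm_mul, norm_mul, mul_comm]
      gcongr
      exact (hC x).trans (le_abs_self C))
  have hm' : MemLp (fun x => η x * χ' x) 2 (volume : Measure ℝ) :=
    (m.const_mul D).mono (m.1.mul hχ.aestronglyMeasurable) (ae_of_all _ fun x => by
      rw [norm_mul, norm_mul, mul_comm]
      gcongr
      exact (hD x).trans (le_abs_self D))
  have e := h _ _ (hη.mul hχ) (hm η m) ((hm η' m').add hm')
  have i1 := integrable_mul_of_memLp (hm η' m').ofReal mg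
  have i2 := integrable_mul_of_memLp hm'.ofReal mg
  have i3 := integrable_mul_of_memLp (hm η m).ofReal md
  have e1 := integral_add i1 i2
  have e2 := integral_add i2 i3
  simp only [RCLike.ofReal_eq_complex_ofReal, Complex.ofReal_mul, Complex.ofReal_add, add_mul] at e1 e2 e
  rw [e1] at e
  simp only [mul_add, ← mul_assoc]
  rw [e2]
  linear_combination e

/-- Multiplication by a bounded smooth function is bounded on `H^k`. -/
lemma exists_hNorm_bddSmooth_mul_le (n : ℕ) : ∀ (χ : ℝ → ℝ), BddSmooth (n + 1) χ → ∀ k : ℝ, 0 ≤ k →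
    k ≤ n + 1 → ∃ A : ℝ≥0∞, A ≠ ⊤ ∧ ∀ g : ℝ → ℂ, MemLp g 2 (volume : Measure ℝ) →
      hNorm k (fun x => (χ x : ℂ) * g x) ≤ A * hNorm k g := by
  have bm : ∀ (χ : ℝ → ℝ), BddSmooth 0 χ → ∀ g : ℝ → ℂ, MemLp g 2 (volume : Measure ℝ) →
      MemLp (fun x => (χ x : ℂ) * g x) 2 (volume : Measure ℝ) := by
    intro χ hχ g mg
    obtain ⟨C, hC⟩ := hχ.2
    refine memLp_mul (C := ENNReal.ofReal C) (by simp) (ae_of_all _ fun x => ?_)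
      (Complex.continuous_ofReal.comp hχ.1).aestronglyMeasurable mg
    rw [← ofReal_norm]
    exact ENNReal.ofReal_le_ofReal (by simpa using hC x)
  have b0 : ∀ (χ : ℝ → ℝ), BddSmooth 0 χ → ∃ A : ℝ≥0∞, A ≠ ⊤ ∧ ∀ g : ℝ → ℂ,
      MemLp g 2 (volume : Measure ℝ) → hNorm 0 (fun x => (χ x : ℂ) * g x) ≤ A * hNorm 0 g := by
    intro χ hχ
    obtain ⟨C, hC⟩ := hχ.2
    refine ⟨ENNReal.ofReal C, by simp, fun g mg => ?_⟩
    rw [hNorm_zero _ mg, hNorm_zero _ (bm χ hχ g mg)]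
    refine eLpNorm_mul_le (by simp) (ae_of_all _ fun x => ?_)
    rw [← ofReal_norm]
    exact ENNReal.ofReal_le_ofReal (by simpa using hC x)
  have bz : ∀ n (χ : ℝ → ℝ), BddSmooth n χ → BddSmooth 0 χ := fun n χ h => ⟨h.continuous, h.bdd⟩
  have step : ∀ (χ χ' : ℝ → ℝ) (k : ℝ) (A B : ℝ≥0∞), 0 ≤ k → A ≠ ⊤ → B ≠ ⊤ → BddSmooth 0 χ →
      BddSmooth 0 χ' → (∀ x, HasDerivAt χ (χ' x) x) →
      (∀ g : ℝ → ℂ, MemLp g 2 (volume : Measure ℝ) →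
        hNorm k (fun x => (χ x : ℂ) * g x) ≤ A * hNorm k g) →
      (∀ g : ℝ → ℂ, MemLp g 2 (volume : Measure ℝ) →
        hNorm k (fun x => (χ' x : ℂ) * g x) ≤ B * hNorm k g) →
      ∀ g : ℝ → ℂ, MemLp g 2 (volume : Measure ℝ) →
        hNorm (k + 1) (fun x => (χ x : ℂ) * g x) ≤ (2 * A + B + 1) * hNorm (k + 1) g := by
    intro χ χ' k A B hk hA hB h0 h0' hd h1 h2 g mg
    -- The summand `1` in the constant keeps it nonzero, so that the bound is trivial when the norm
    -- is infinite.
    by_cases hg : hNorm (k + 1) g = ⊤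
    · rw [hg, ENNReal.mul_top (by simp)]
      exact le_top
    obtain ⟨d, md, hder⟩ := exists_hasL2Deriv (hNorm_ne_top_mono (by linarith : 1 ≤ k + 1) hg)
    have hm := hder.real_mul (.of_contDiff hd h0'.1) h0.2 h0'.2 mg md
    refine (hNorm_succ_le hm (bm χ h0 g mg) ((bm χ' h0' g mg).add (bm χ h0 d md))).trans ?_
    have i4 := hNorm_add_le (k := k) (fun x => (χ' x : ℂ) * g x) (fun x => χ x * d x)
    have gk := hNorm_mono (by linarith : k ≤ k + 1) g
    have dk := hNorm_deriv_le (k := k) hder mg md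
    calc _ ≤ A * hNorm k g + (B * hNorm k g + A * hNorm k d) :=
          add_le_add (h1 g mg) (i4.trans (add_le_add (h2 g mg) (h1 d md)))
      _ ≤ A * hNorm (k + 1) g + (B * hNorm (k + 1) g + A * hNorm (k + 1) g) := by gcongr
      _ = (2 * A + B) * hNorm (k + 1) g := by ring
      _ ≤ _ := mul_le_mul_left le_self_add _
  induction n with
  | zero =>
    intro χ hχ k hk0 hk1
    rw [Nat.cast_zero, zero_add] at hk1
    obtain ⟨A, hA, h0⟩ := b0 χ (bz _ _ hχ)
    have hχ' := hχ
    obtain ⟨-, χ', hd, hχ2⟩ := hχ'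
    obtain ⟨B, hB, h1⟩ := b0 χ' hχ2
    have b1 := step χ χ' 0 A B le_rfl hA hB (bz _ _ hχ) hχ2 hd h0 h1
    rw [zero_add] at b1
    refine ⟨2 * (2 * A + B + 1), by finiteness, fun g mg => ?_⟩
    have le1 : A ≤ 2 * A + B + 1 := by
      rw [two_mul, add_assoc, add_assoc]; exact le_self_add
    have le2 : 2 * A + B + 1 ≤ 2 * (2 * A + B + 1) := by
      rw [two_mul (2 * A + B + 1)]; exact le_self_add
    rcases hk0.eq_or_lt with rfl | hk0
    · exact (h0 g mg).trans (mul_le_mul_left (le1.trans le2) _)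
    rcases hk1.eq_or_lt with rfl | hk1
    · exact (b1 g mg).trans (mul_le_mul_left le2 _)
    have := hNorm_mul_interp (N := 1) (χ := fun x => (χ x : ℂ)) (A := 2 * A + B + 1) hk0 hk1
      (by finiteness) (fun v hv => bm χ (bz _ _ hχ) v hv)
      (fun v hv => (h0 v hv).trans (mul_le_mul_left le1 _)) (fun v hv => b1 v hv) mg
    rwa [mul_one] at this
  | succ n ih =>
    intro χ hχ k hk0 hk1
    by_cases hk : k ≤ n + 1
    · exact ih χ hχ.pred k hk0 hk
    have hn : (0 : ℝ) ≤ n := n.cast_nonneg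
    push_cast at hk1
    rw [not_le] at hk
    have hp := hχ.pred
    have hz := bz _ _ hχ
    obtain ⟨-, χ', hd, hχ2⟩ := hχ
    obtain ⟨A, hA, h0⟩ := ih χ hp (k - 1) (by linarith) (by linarith)
    obtain ⟨B, hB, h1⟩ := ih χ' hχ2 (k - 1) (by linarith) (by linarith)
    refine ⟨2 * A + B + 1, by finiteness, fun g mg => ?_⟩
    have := step χ χ' (k - 1) A B (by linarith) hA hB hz (bz _ _ hχ2) hd h0 h1 g mg
    rwa [sub_add_cancel] at this

/-! ### Weights -/

/-- The weight `⟨x⟩^s`. -/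
def wt (s x : ℝ) : ℝ := (1 + x ^ 2) ^ (s / 2)

lemma wt_pos (s x : ℝ) : 0 < wt s x := Real.rpow_pos_of_pos (by positivity) _

lemma one_le_wt {s : ℝ} (hs : 0 ≤ s) (x : ℝ) : 1 ≤ wt s x :=
  Real.one_le_rpow (by nlinarith [sq_nonneg x]) (by linarith)

lemma wt_neg_mul (s x : ℝ) : wt (-s) x * wt s x = 1 := by
  unfold wt
  rw [← Real.rpow_add (by positivity), show -s / 2 + s / 2 = 0 by ring, Real.rpow_zero]

lemma continuous_wt (s : ℝ) : Continuous (wt s) := by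
  unfold wt
  exact Continuous.rpow_const (by fun_prop) fun x => Or.inl (by positivity)

/-- The function `x / ⟨x⟩²`. -/
def wtLog (x : ℝ) : ℝ := x / (1 + x ^ 2)

lemma hasDerivAt_wt (s x : ℝ) : HasDerivAt (wt s) (s * wtLog x * wt s x) x := by
  have h1 : HasDerivAt (fun x : ℝ => 1 + x ^ 2) (2 * x) x := by
    simpa using (hasDerivAt_pow 2 x).const_add 1
  have h2 := h1.rpow_const (p := s / 2) (Or.inl (by positivity))
  refine h2.congr_deriv ?_
  unfold wtLog wt
  rw [Real.rpow_sub_one (by positivity)]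
  field_simp

/-- The functions `x/⟨x⟩²` and `1/⟨x⟩²` are bounded, and their derivatives are polynomials in the
two of them; the induction therefore treats both together. -/
lemma bddSmooth_wtLog (n : ℕ) : BddSmooth n wtLog := by
  have hb1 : ∀ x : ℝ, |wtLog x| ≤ 1 := fun x => by
    unfold wtLog
    rw [abs_div, abs_of_pos (by positivity : 0 < 1 + x ^ 2), div_le_one (by positivity)]
    nlinarith [sq_nonneg (|x| - 1), sq_abs x]
  have hb2 : ∀ x : ℝ, |(1 + x ^ 2)⁻¹| ≤ 1 := fun x => by
    rw [abs_of_pos (by positivity)]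
    exact inv_le_one_of_one_le₀ (by nlinarith [sq_nonneg x])
  have hd1 : ∀ x, HasDerivAt wtLog ((1 + x ^ 2)⁻¹ + (-2) * (wtLog x * wtLog x)) x := fun x => by
    have h1 : HasDerivAt (fun x : ℝ => 1 + x ^ 2) (2 * x) x := by
      simpa using (hasDerivAt_pow 2 x).const_add 1
    refine ((hasDerivAt_id x).div h1 (by positivity)).congr_deriv ?_
    unfold wtLog
    simp only [id]
    field_simp
    ring
  have hd2 : ∀ x : ℝ, HasDerivAt (fun x : ℝ => (1 + x ^ 2)⁻¹) ((-2) * (wtLog x * (1 + x ^ 2)⁻¹)) x :=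
    fun x => by
    have h1 : HasDerivAt (fun x : ℝ => 1 + x ^ 2) (2 * x) x := by
      simpa using (hasDerivAt_pow 2 x).const_add 1
    refine (h1.inv (by positivity)).congr_deriv ?_
    unfold wtLog
    field_simp
  have key : ∀ n, BddSmooth n wtLog ∧ BddSmooth n (fun x : ℝ => (1 + x ^ 2)⁻¹) := by
    intro n
    induction n with
    | zero => exact ⟨⟨continuous_iff_continuousAt.2 fun x => (hd1 x).continuousAt, 1, hb1⟩,
        ⟨continuous_iff_continuousAt.2 fun x => (hd2 x).continuousAt, 1, hb2⟩⟩
    | succ n ih =>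
      exact ⟨⟨⟨1, hb1⟩, _, hd1, ih.2.add ((ih.1.mul ih.1).const_mul _)⟩,
        ⟨⟨1, hb2⟩, _, hd2, (ih.1.mul ih.2).const_mul _⟩⟩
  exact (key n).1

/-- The logarithmic derivative of a weight is a multiple of `wtLog`, so each derivative is a bounded
smooth multiple of the weight. -/
lemma bddSmooth_wt_neg {s : ℝ} (hs : 0 ≤ s) (n : ℕ) : BddSmooth n (wt (-s)) := by
  have hb : ∀ x, |wt (-s) x| ≤ 1 := fun x => by
    rw [abs_of_pos (wt_pos _ _)]
    nlinarith [wt_neg_mul s x, one_le_wt hs x, wt_pos (-s) x]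
  induction n with
  | zero => exact ⟨continuous_wt _, 1, hb⟩
  | succ n ih => exact ⟨⟨1, hb⟩, _, hasDerivAt_wt (-s), ((bddSmooth_wtLog n).const_mul _).mul ih⟩

/-! ### Calculus in the weighted spaces `H^{k,s}`: products, derivatives, composition with sine and
cosine. -/

section Weighted

variable {s : ℝ} {u v u' w : ℝ → ℝ}

lemma weighted_eq (s : ℝ) (u : ℝ → ℝ) : weighted s u = fun x => ((wt s x * u x : ℝ) : ℂ) := rfl

lemma memLp_weighted_iff : MemLp (weighted s u) 2 (volume : Measure ℝ) ↔
    MemLp (fun x => wt s x * u x) 2 (volume : Measure ℝ) :=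
  ⟨fun h => by simpa [weighted_eq] using h.re, fun h => h.ofReal⟩

lemma eLpNorm_weighted : eLpNorm (weighted s u) 2 volume = eLpNorm (fun x => wt s x * u x) 2 volume :=
  eLpNorm_congr_norm_ae (ae_of_all _ fun x => by rw [weighted_eq]; simp)

lemma sobolevNorm_congr (h : u =ᵐ[volume] v) : sobolevNorm k s u = sobolevNorm k s v := by
  rw [sobolevNorm_eq, sobolevNorm_eq]
  refine hNorm_congr ?_
  filter_upwards [h] with x hx
  simp only [weighted_eq, hx]

lemma sobolevNorm_mono (h : k ≤ l) : sobolevNorm k s u ≤ sobolevNorm l s u := by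
  rw [sobolevNorm_eq, sobolevNorm_eq]; exact hNorm_mono h _

lemma memLp_of_sobolevNorm (h : sobolevNorm k s u ≠ ⊤) :
    MemLp (fun x => wt s x * u x) 2 (volume : Measure ℝ) := by
  rw [sobolevNorm_eq] at h
  exact memLp_weighted_iff.1 (memLp_of_hNorm_lt_top h)

lemma sobolevNorm_zero (h : MemLp (fun x => wt s x * u x) 2 (volume : Measure ℝ)) :
    sobolevNorm 0 s u = eLpNorm (fun x => wt s x * u x) 2 volume := by
  rw [sobolevNorm_eq, hNorm_zero _ (memLp_weighted_iff.2 h), eLpNorm_weighted]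

lemma sobolevNorm_zero_le (hu : AEStronglyMeasurable u volume) :
    sobolevNorm 0 s u ≤ eLpNorm (fun x => wt s x * u x) 2 volume := by
  by_cases h : eLpNorm (fun x => wt s x * u x) 2 volume = ⊤
  · rw [h]; exact le_top
  · exact (sobolevNorm_zero ⟨(continuous_wt s).aestronglyMeasurable.mul hu, lt_top_iff_ne_top.2 h⟩).le

lemma eLpNorm_weight_le (hk : 0 ≤ k) : eLpNorm (fun x => wt s x * u x) 2 volume ≤ sobolevNorm k s u := by
  rw [sobolevNorm_eq, ← eLpNorm_weighted]; exact eLpNorm_le_hNorm hk _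

lemma eLpNorm_le_sobolevNorm (hs : 0 ≤ s) (hk : 0 ≤ k) : eLpNorm u 2 volume ≤ sobolevNorm k s u := by
  refine le_trans (eLpNorm_mono fun x => ?_) (eLpNorm_weight_le hk)
  rw [norm_mul, Real.norm_of_nonneg (wt_pos s x).le]
  exact le_mul_of_one_le_left (norm_nonneg _) (one_le_wt hs x)

lemma sobolevNorm_add_le (u v : ℝ → ℝ) :
    sobolevNorm k s (fun x => u x + v x) ≤ sobolevNorm k s u + sobolevNorm k s v := by
  simp only [sobolevNorm_eq]
  refine le_trans (le_of_eq (congrArg _ ?_)) (hNorm_add_le _ _)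
  ext x
  simp only [weighted_eq, Pi.add_apply]
  push_cast; ring

lemma sobolevNorm_const_mul_le (c : ℝ) (hu : sobolevNorm k s u ≠ ⊤) :
    sobolevNorm k s (fun x => c * u x) ≤ ENNReal.ofReal |c| * sobolevNorm k s u := by
  rw [sobolevNorm_eq] at hu
  have := hNorm_const_mul_le (k := k) (c : ℂ) (memLp_of_hNorm_lt_top hu)
  rw [sobolevNorm_eq, sobolevNorm_eq]
  refine le_trans (le_of_eq (congrArg _ ?_)) (this.trans (le_of_eq ?_))
  · ext x
    simp only [weighted_eq]
    push_cast; ring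
  · rw [← ofReal_norm, Complex.norm_real, Real.norm_eq_abs]

lemma sobolevNorm_neg : sobolevNorm k s (fun x => - u x) = sobolevNorm k s u := by
  have := hNorm_const_mul (k := k) (-1 : ℂ) (weighted s u) (by norm_num)
  rw [sobolevNorm_eq, sobolevNorm_eq]
  simp only [enorm_neg, enorm_one, one_mul] at this
  rw [← this]
  congr 1
  ext x
  simp only [weighted_eq]
  push_cast; ring

lemma sobolevNorm_sub_le (u v : ℝ → ℝ) :
    sobolevNorm k s (fun x => u x - v x) ≤ sobolevNorm k s u + sobolevNorm k s v := by
  simp only [sub_eq_add_neg]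
  rw [← sobolevNorm_neg (u := v)]
  exact sobolevNorm_add_le _ _

lemma exists_sobolevNorm_bddSmooth_mul_le {χ : ℝ → ℝ} (hχ : ∀ n, BddSmooth n χ) (s : ℝ)
    (hk : 0 ≤ k) : ∃ A : ℝ≥0∞, A ≠ ⊤ ∧ ∀ u : ℝ → ℝ, sobolevNorm k s u ≠ ⊤ →
      sobolevNorm k s (fun x => χ x * u x) ≤ A * sobolevNorm k s u := by
  obtain ⟨A, hA, h⟩ := exists_hNorm_bddSmooth_mul_le ⌈k⌉₊ χ (hχ _) k hk
    ((Nat.le_ceil k).trans (by linarith))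
  refine ⟨A, hA, fun u hu => ?_⟩
  rw [sobolevNorm_eq] at hu ⊢
  rw [sobolevNorm_eq]
  refine le_trans (le_of_eq (congrArg _ ?_)) (h _ (memLp_of_hNorm_lt_top hu))
  ext x
  simp only [weighted_eq]
  push_cast; ring

/-- Removing the weight is multiplication by `⟨x⟩^{-s}`, a bounded smooth function. -/
lemma exists_hNorm_le_sobolevNorm (hs : 0 ≤ s) (hk : 0 ≤ k) : ∃ A : ℝ≥0∞, A ≠ ⊤ ∧ ∀ u : ℝ → ℝ,
    sobolevNorm k s u ≠ ⊤ → hNorm k (fun x => (u x : ℂ)) ≤ A * sobolevNorm k s u := by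
  obtain ⟨A, hA, h⟩ := exists_hNorm_bddSmooth_mul_le ⌈k⌉₊ _ (bddSmooth_wt_neg hs _) k hk
    ((Nat.le_ceil k).trans (by linarith))
  refine ⟨A, hA, fun u hu => ?_⟩
  rw [sobolevNorm_eq] at hu ⊢
  refine le_trans (le_of_eq (congrArg _ ?_)) (h _ (memLp_of_hNorm_lt_top hu))
  ext x
  rw [weighted_eq, ← Complex.ofReal_mul, ← mul_assoc, wt_neg_mul, one_mul]

/-- The weight is left entirely on the second factor; the first is estimated without it. -/
lemma exists_sobolevNorm_mul_le (hs : 0 ≤ s) (hk : 0 ≤ k) : ∃ A : ℝ≥0∞, A ≠ ⊤ ∧ ∀ u v : ℝ → ℝ,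
    sobolevNorm (max k 1) s u ≠ ⊤ → sobolevNorm k s v ≠ ⊤ →
      sobolevNorm k s (fun x => u x * v x) ≤ A * sobolevNorm (max k 1) s u * sobolevNorm k s v := by
  obtain ⟨A, hA, h⟩ := exists_hNorm_mul_le ⌈k⌉₊ k hk ((Nat.le_ceil k).trans (by linarith))
  obtain ⟨B, hB, h'⟩ := exists_hNorm_le_sobolevNorm (s := s) hs (le_max_of_le_left hk : 0 ≤ max k 1)
  refine ⟨A * B, ENNReal.mul_ne_top hA hB, fun u v hu hv => ?_⟩
  have hu' := h' u hu
  have := h (fun x => (u x : ℂ)) (weighted s v)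
    (ne_top_of_le_ne_top (ENNReal.mul_ne_top hB hu) hu') (by rwa [sobolevNorm_eq] at hv)
  rw [sobolevNorm_eq k s (fun x => u x * v x), sobolevNorm_eq k s v]
  refine le_trans (le_of_eq (congrArg _ ?_)) (this.trans ?_)
  · ext x
    simp only [weighted_eq]
    push_cast; ring
  · rw [mul_assoc A B]
    gcongr

lemma HasACDeriv.wt_mul (h : HasACDeriv u u') (s : ℝ) :
    HasACDeriv (fun x => wt s x * u x) (fun x => s * wtLog x * (wt s x * u x) + wt s x * u' x) := by
  have hc : Continuous fun x => s * wtLog x * wt s x :=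
    (continuous_const.mul (bddSmooth_wtLog 0).continuous).mul (continuous_wt s)
  refine ((HasACDeriv.of_contDiff (hasDerivAt_wt s) hc).mul h).congr (ae_of_all _ fun x => ?_)
  ring

/-- The derivative of `⟨x⟩^s u` is `⟨x⟩^s (u' + s (x/⟨x⟩²) u)`, and the extra factor is a bounded
multiplier. Nothing is assumed finite: this is how regularity is gained in the bootstrap. -/
lemma exists_sobolevNorm_succ_le (s : ℝ) (hk : 0 ≤ k) : ∃ A : ℝ≥0∞, A ≠ ⊤ ∧ ∀ u u' : ℝ → ℝ,
    HasACDeriv u u' → sobolevNorm (k + 1) s u ≤ A * (sobolevNorm k s u + sobolevNorm k s u') := by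
  obtain ⟨B, hB, h⟩ := exists_sobolevNorm_bddSmooth_mul_le
    (fun n => (bddSmooth_wtLog n).const_mul s) s hk
  refine ⟨1 + B, by finiteness, fun u u' hu => ?_⟩
  by_cases h1 : sobolevNorm k s u = ⊤
  · rw [h1, top_add, ENNReal.mul_top (by simp)]; exact le_top
  by_cases h2 : sobolevNorm k s u' = ⊤
  · rw [h2, add_top, ENNReal.mul_top (by simp)]; exact le_top
  have m1 := memLp_of_sobolevNorm h1
  have m2 := memLp_of_sobolevNorm h2
  have h3 := h u h1
  have m3 := memLp_of_sobolevNorm (ne_top_of_le_ne_top (ENNReal.mul_ne_top hB h1) h3)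
  have e : (fun x => s * wtLog x * (wt s x * u x) + wt s x * u' x) =
      fun x => wt s x * (s * wtLog x * u x + u' x) := by ext x; ring
  have hd := hu.wt_mul s
  rw [e] at hd
  have m4 : MemLp (fun x => wt s x * (s * wtLog x * u x + u' x)) 2 (volume : Measure ℝ) := by
    simp only [mul_add]; exact m3.add m2
  have h4 := hNorm_succ_le (k := k) (hd.hasL2Deriv m1 m4) m1.ofReal m4.ofReal
  have h5 := sobolevNorm_add_le (k := k) (s := s) (fun x => s * wtLog x * u x) u'
  rw [sobolevNorm_eq (k + 1)]
  calc _ ≤ sobolevNorm k s u + sobolevNorm k s (fun x => s * wtLog x * u x + u' x) := by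
        rw [sobolevNorm_eq, sobolevNorm_eq]; exact h4
    _ ≤ sobolevNorm k s u + (B * sobolevNorm k s u + sobolevNorm k s u') := by
        gcongr; exact h5.trans (by gcongr)
    _ = (1 + B) * sobolevNorm k s u + 1 * sobolevNorm k s u' := by ring
    _ ≤ (1 + B) * sobolevNorm k s u + (1 + B) * sobolevNorm k s u' := by
        gcongr; exact le_self_add
    _ = _ := by ring

/-- The same formula solved for `⟨x⟩^s u'`. Finiteness of the norm is what places the pointwise
derivative in `L²`. -/
lemma exists_sobolevNorm_deriv_le (s : ℝ) (hk : 0 ≤ k) : ∃ A : ℝ≥0∞, A ≠ ⊤ ∧ ∀ u u' : ℝ → ℝ,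
    HasACDeriv u u' → sobolevNorm (k + 1) s u ≠ ⊤ →
      sobolevNorm k s u' ≤ A * sobolevNorm (k + 1) s u := by
  obtain ⟨B, hB, h⟩ := exists_sobolevNorm_bddSmooth_mul_le
    (fun n => (bddSmooth_wtLog n).const_mul s) s hk
  refine ⟨1 + B, by finiteness, fun u u' hu h1 => ?_⟩
  have h0 : sobolevNorm k s u ≤ sobolevNorm (k + 1) s u := sobolevNorm_mono (by linarith)
  have hk1 := ne_top_of_le_ne_top h1 h0
  have m1 := memLp_of_sobolevNorm h1
  have e : (fun x => s * wtLog x * (wt s x * u x) + wt s x * u' x) =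
      fun x => wt s x * (s * wtLog x * u x + u' x) := by ext x; ring
  have hd := hu.wt_mul s
  rw [e] at hd
  have hn : hNorm 1 (fun x => ((wt s x * u x : ℝ) : ℂ)) ≠ ⊤ := by
    rw [sobolevNorm_eq] at h1
    exact hNorm_ne_top_mono (by linarith) h1
  have m4 := hd.memLp_deriv hn
  have h4 := hNorm_deriv_le (k := k) (hd.hasL2Deriv m1 m4) m1.ofReal m4.ofReal
  have h5 : sobolevNorm k s (fun x => s * wtLog x * u x + u' x) ≤ sobolevNorm (k + 1) s u := by
    rw [sobolevNorm_eq, sobolevNorm_eq]; exact h4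
  have h6 := sobolevNorm_sub_le (k := k) (s := s) (fun x => s * wtLog x * u x + u' x)
    (fun x => s * wtLog x * u x)
  simp only [add_sub_cancel_left] at h6
  calc _ ≤ sobolevNorm (k + 1) s u + B * sobolevNorm k s u := h6.trans (add_le_add h5 (h u hk1))
    _ ≤ sobolevNorm (k + 1) s u + B * sobolevNorm (k + 1) s u := by gcongr
    _ = _ := by ring

lemma exists_enorm_le_sobolevNorm (hs : 0 ≤ s) : ∃ A : ℝ≥0∞, A ≠ ⊤ ∧ ∀ u u' : ℝ → ℝ,
    HasACDeriv u u' → ∀ x, ‖u x‖ₑ ≤ A * sobolevNorm 1 s u := by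
  obtain ⟨A, hA, h⟩ := exists_sobolevNorm_deriv_le s (le_refl (0 : ℝ))
  refine ⟨2 * (1 + A), by finiteness, fun u u' hu x => ?_⟩
  rw [zero_add] at h
  by_cases h1 : sobolevNorm 1 s u = ⊤
  · rw [h1, ENNReal.mul_top (by simp)]; exact le_top
  calc _ ≤ _ := hu.enorm_le x
    _ ≤ 2 * (sobolevNorm 1 s u + A * sobolevNorm 1 s u) := by
      gcongr
      · exact eLpNorm_le_sobolevNorm hs zero_le_one
      · exact (eLpNorm_le_sobolevNorm hs le_rfl).trans (h u u' hu h1)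
    _ = _ := by ring

lemma lipschitzWith_sin : LipschitzWith 1 Real.sin :=
  lipschitzWith_of_nnnorm_deriv_le Real.differentiable_sin fun x => by
    rw [Real.deriv_sin, ← NNReal.coe_le_coe]; simpa using Real.abs_cos_le_one x

lemma lipschitzWith_cos : LipschitzWith 1 Real.cos :=
  lipschitzWith_of_nnnorm_deriv_le Real.differentiable_cos fun x => by
    rw [Real.deriv_cos, ← NNReal.coe_le_coe]; simpa using Real.abs_sin_le_one x

lemma abs_sin_sub_sin_le (a b : ℝ) : |Real.sin a - Real.sin b| ≤ |a - b| := by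
  simpa [Real.dist_eq] using lipschitzWith_sin.dist_le_mul a b

lemma abs_cos_sub_cos_le (a b : ℝ) : |Real.cos a - Real.cos b| ≤ |a - b| := by
  simpa [Real.dist_eq] using lipschitzWith_cos.dist_le_mul a b

lemma HasACDeriv.sin (h : HasACDeriv u u') :
    HasACDeriv (fun x => Real.sin (u x)) (fun x => Real.cos (u x) * u' x) :=
  h.comp Real.hasDerivAt_sin lipschitzWith_sin

lemma HasACDeriv.cos (h : HasACDeriv u u') :
    HasACDeriv (fun x => Real.cos (u x)) (fun x => - Real.sin (u x) * u' x) :=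
  h.comp Real.hasDerivAt_cos lipschitzWith_cos

lemma hasACDeriv_const (c : ℝ) : HasACDeriv (fun _ => c) (fun _ => 0) :=
  .of_contDiff (fun x => hasDerivAt_const x c) continuous_const

lemma HasACDeriv.cos_sub_one (h : HasACDeriv u u') :
    HasACDeriv (fun x => Real.cos (u x) - 1) (fun x => - Real.sin (u x) * u' x) := by
  simpa using h.cos.sub (hasACDeriv_const 1)

/-- Domination of weighted `L²` norms. -/
lemma sobolevNorm_zero_le_of_abs_le (hu : AEStronglyMeasurable u volume) (h : ∀ x, |u x| ≤ |v x|) :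
    sobolevNorm 0 s u ≤ sobolevNorm 0 s v :=
  (sobolevNorm_zero_le hu).trans ((eLpNorm_mono fun x => by
    simp only [norm_mul, Real.norm_eq_abs]
    exact mul_le_mul_of_nonneg_left (h x) (abs_nonneg _)).trans (eLpNorm_weight_le le_rfl))

/-- Composition with `sin` and `cos - 1` in `H^{k,s}`, `k ≥ 1`. -/
lemma exists_sobolevNorm_sin_le (hs : 0 ≤ s) (n : ℕ) : ∀ k : ℝ, 1 ≤ k → k ≤ n + 1 →
    ∃ A : ℝ≥0∞, A ≠ ⊤ ∧ ∀ u u' : ℝ → ℝ, HasACDeriv u u' → sobolevNorm k s u ≤ 1 →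
      sobolevNorm k s (fun x => Real.sin (u x)) ≤ A * sobolevNorm k s u ∧
      sobolevNorm k s (fun x => Real.cos (u x) - 1) ≤ A * sobolevNorm k s u := by
  induction n with
  | zero =>
    intro k h1 h2
    obtain rfl : k = 1 := le_antisymm (by simpa using h2) h1
    obtain ⟨A, hA, ha⟩ := exists_sobolevNorm_succ_le s (le_refl (0 : ℝ))
    obtain ⟨B, hB, hb⟩ := exists_sobolevNorm_deriv_le s (le_refl (0 : ℝ))
    rw [zero_add] at ha hb
    refine ⟨A * (1 + B), by finiteness, fun u u' hu hu1 => ?_⟩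
    have hu0 : sobolevNorm 1 s u ≠ ⊤ := ne_top_of_le_ne_top (by simp) hu1
    have hm : sobolevNorm 0 s u ≤ sobolevNorm 1 s u := sobolevNorm_mono zero_le_one
    have hd := hb u u' hu hu0
    -- At order one no product estimate is needed: `sin` and `cos - 1` vanish at zero and are
    -- 1-Lipschitz, so the compositions and their derivatives are dominated pointwise.
    have key : ∀ w w' : ℝ → ℝ, HasACDeriv w w' → (∀ x, |w x| ≤ |u x|) → (∀ x, |w' x| ≤ |u' x|) →
        sobolevNorm 1 s w ≤ A * (1 + B) * sobolevNorm 1 s u := by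
      intro w w' hw e1 e2
      calc _ ≤ A * (sobolevNorm 0 s w + sobolevNorm 0 s w') := ha w w' hw
        _ ≤ A * (sobolevNorm 1 s u + B * sobolevNorm 1 s u) := by
          gcongr
          · exact (sobolevNorm_zero_le_of_abs_le hw.continuous.aestronglyMeasurable e1).trans hm
          · exact (sobolevNorm_zero_le_of_abs_le hw.aestronglyMeasurable e2).trans hd
        _ = _ := by ring
    constructor
    · refine key _ _ hu.sin (fun x => by simpa using abs_sin_sub_sin_le (u x) 0) (fun x => ?_)
      rw [abs_mul]
      exact mul_le_of_le_one_left (abs_nonneg _) (Real.abs_cos_le_one _)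
    · refine key _ _ hu.cos_sub_one (fun x => by simpa using abs_cos_sub_cos_le (u x) 0) (fun x => ?_)
      rw [abs_mul, abs_neg]
      exact mul_le_of_le_one_left (abs_nonneg _) (Real.abs_sin_le_one _)
  | succ n ih =>
    intro k h1 h2
    by_cases hk : k ≤ n + 1
    · exact ih k h1 hk
    have hn : (0 : ℝ) ≤ n := n.cast_nonneg
    push_cast at h2
    rw [not_le] at hk
    have hk0 : 0 ≤ k - 1 := by linarith
    have hmk : max (k - 1) 1 ≤ k := max_le (by linarith) h1
    obtain ⟨A, hA, ha⟩ := ih (max (k - 1) 1) (le_max_right _ _) (max_le (by linarith) (by linarith))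
    obtain ⟨B, hB, hb⟩ := exists_sobolevNorm_succ_le s hk0
    obtain ⟨D, hD, hd⟩ := exists_sobolevNorm_deriv_le s hk0
    obtain ⟨M, hM, hm⟩ := exists_sobolevNorm_mul_le (s := s) hs hk0
    rw [sub_add_cancel] at hb hd
    refine ⟨B * (A + (D + M * A * D)), by finiteness, fun u u' hu hu1 => ?_⟩
    have hu0 : sobolevNorm k s u ≠ ⊤ := ne_top_of_le_ne_top (by simp) hu1
    have hmo : sobolevNorm (max (k - 1) 1) s u ≤ sobolevNorm k s u := sobolevNorm_mono hmk
    obtain ⟨a1, a2⟩ := ha u u' hu (hmo.trans hu1)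
    have a3 := a1.trans (mul_le_mul_right hmo A)
    have a4 := a2.trans (mul_le_mul_right hmo A)
    have a5 := (sobolevNorm_mono (le_max_left (k - 1) 1)).trans a3
    have a6 := (sobolevNorm_mono (le_max_left (k - 1) 1)).trans a4
    have d1 := hd u u' hu hu0
    have hAu : A * sobolevNorm k s u ≠ ⊤ := by finiteness
    have hDu : D * sobolevNorm k s u ≠ ⊤ := by finiteness
    have m1 := hm _ u' (ne_top_of_le_ne_top hAu a3) (ne_top_of_le_ne_top hDu d1)
    have m2 := hm _ u' (ne_top_of_le_ne_top hAu a4) (ne_top_of_le_ne_top hDu d1)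
    -- The products are quadratic in `u`; the assumption that its norm is at most one turns the
    -- bound into a linear one.
    have fin : ∀ N : ℝ≥0∞, N ≤ A * sobolevNorm k s u → M * N * sobolevNorm (k - 1) s u' ≤
        M * A * D * sobolevNorm k s u := by
      intro N hN
      calc _ ≤ M * (A * 1) * (D * sobolevNorm k s u) := by gcongr; exact hN.trans (by gcongr)
        _ = _ := by ring
    constructor
    · calc _ ≤ _ := hb _ _ hu.sin
        _ ≤ B * (A * sobolevNorm k s u + (D * sobolevNorm k s u + M * A * D * sobolevNorm k s u)) := by
          gcongr
          -- The function `cos u` does not decay, so the product estimate is applied to `cos u - 1`.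
          have : (fun x => Real.cos (u x) * u' x) = fun x => u' x + (Real.cos (u x) - 1) * u' x := by
            ext x; ring
          rw [this]
          exact (sobolevNorm_add_le _ _).trans (add_le_add d1 (m2.trans (fin _ a4)))
        _ = _ := by ring
    · calc _ ≤ _ := hb _ _ hu.cos_sub_one
        _ ≤ B * (A * sobolevNorm k s u + (0 + M * A * D * sobolevNorm k s u)) := by
          gcongr
          have : (fun x => - Real.sin (u x) * u' x) = fun x => - (Real.sin (u x) * u' x) := by
            ext x; ring
          rw [this, sobolevNorm_neg, zero_add]
          exact m1.trans (fin _ a3)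
        _ = B * (A + M * A * D) * sobolevNorm k s u := by ring
        _ ≤ _ := by gcongr; exact le_add_self

end Weighted

/-! ### The kink -/

lemma sech_pos (x : ℝ) : 0 < sech x := inv_pos.2 (Real.cosh_pos x)

lemma sech_le_one (x : ℝ) : sech x ≤ 1 := inv_le_one_of_one_le₀ (Real.one_le_cosh x)

lemma exp_abs_le_cosh (x : ℝ) : Real.exp |x| ≤ 2 * Real.cosh x := by
  rw [← Real.cosh_abs, Real.cosh_eq]
  linarith [Real.exp_pos (-|x|)]

lemma cosh_le_exp_abs (x : ℝ) : Real.cosh x ≤ Real.exp |x| := by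
  rw [← Real.cosh_abs, Real.cosh_eq]
  have : Real.exp (-|x|) ≤ Real.exp |x| := Real.exp_le_exp.2 (by linarith [abs_nonneg x])
  linarith

lemma sech_le_exp (x : ℝ) : sech x ≤ 2 * Real.exp (-|x|) := by
  unfold sech
  rw [inv_le_iff_one_le_mul₀ (Real.cosh_pos x)]
  have := mul_le_mul_of_nonneg_left (exp_abs_le_cosh x) (Real.exp_pos (-|x|)).le
  rw [← Real.exp_add, neg_add_cancel, Real.exp_zero] at this
  linarith

lemma continuous_sech : Continuous sech :=
  Real.continuous_cosh.inv₀ fun x => (Real.cosh_pos x).ne'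

/-- The hyperbolic tangent. -/
def tanh (x : ℝ) : ℝ := Real.sinh x * sech x

lemma hasDerivAt_sech (x : ℝ) : HasDerivAt sech (-1 * (tanh x * sech x)) x := by
  refine ((Real.hasDerivAt_cosh x).inv (Real.cosh_pos x).ne').congr_deriv ?_
  have := Real.cosh_pos x
  unfold tanh sech
  field_simp

lemma hasDerivAt_tanh (x : ℝ) : HasDerivAt tanh (sech x * sech x) x := by
  refine ((Real.hasDerivAt_sinh x).mul (hasDerivAt_sech x)).congr_deriv ?_
  have := Real.cosh_pos x
  have h := Real.cosh_sq x
  unfold tanh sech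
  field_simp
  linarith

lemma tanh_sq (x : ℝ) : tanh x ^ 2 = 1 - sech x ^ 2 := by
  have := Real.cosh_pos x
  have h := Real.cosh_sq x
  unfold tanh sech
  field_simp
  linarith

lemma abs_tanh_le (x : ℝ) : |tanh x| ≤ 1 := by
  rw [← sq_le_one_iff_abs_le_one, tanh_sq]
  nlinarith [sq_nonneg (sech x)]

lemma bddSmooth_sech_tanh (n : ℕ) : BddSmooth n sech ∧ BddSmooth n tanh := by
  have h1 : ∃ C, ∀ x, |sech x| ≤ C := ⟨1, fun x => by rw [abs_of_pos (sech_pos x)]; exact sech_le_one x⟩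
  induction n with
  | zero => exact ⟨⟨continuous_sech, h1⟩, Real.continuous_sinh.mul continuous_sech, 1, abs_tanh_le⟩
  | succ n ih =>
    exact ⟨⟨h1, _, hasDerivAt_sech, (ih.2.mul ih.1).const_mul _⟩,
      ⟨1, abs_tanh_le⟩, _, hasDerivAt_tanh, ih.1.mul ih.1⟩

/-- The mean value theorem for `cosh` between the points, with derivative bounded by the larger
value of `cosh`. The Lipschitz bound keeps a decaying factor, which is integrable in the argument
for the translation parameter. -/
lemma abs_sech_sub_sech_le (x y : ℝ) : |sech x - sech y| ≤ |x - y| * (sech x + sech y) := by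
  have key : ∀ x y : ℝ, |x| ≤ |y| → |sech x - sech y| ≤ |x - y| * (sech x + sech y) := by
    intro x y h
    have hc : |Real.cosh y - Real.cosh x| ≤ Real.cosh y * |y - x| := by
      refine Convex.norm_image_sub_le_of_norm_hasDerivWithin_le (s := Set.Icc (-|y|) |y|)
        (f' := Real.sinh) (fun z _ => (Real.hasDerivAt_cosh z).hasDerivWithinAt) (fun z hz => ?_)
        (convex_Icc _ _) (abs_le.1 h) (abs_le.1 le_rfl)
      have h1 : Real.cosh z ≤ Real.cosh y := Real.cosh_le_cosh.2 (abs_le.2 hz)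
      refine (abs_le_of_sq_le_sq ?_ (Real.cosh_pos z).le).trans h1
      rw [Real.cosh_sq]; linarith
    have hx := Real.cosh_pos x
    have hy := Real.cosh_pos y
    have e : sech x - sech y = (Real.cosh y - Real.cosh x) * (sech x * sech y) := by
      unfold sech; field_simp
    have e2 : Real.cosh y * sech y = 1 := mul_inv_cancel₀ hy.ne'
    rw [e, abs_mul, abs_of_pos (mul_pos (sech_pos x) (sech_pos y))]
    calc _ ≤ Real.cosh y * |y - x| * (sech x * sech y) :=
          mul_le_mul_of_nonneg_right hc (mul_pos (sech_pos x) (sech_pos y)).le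
      _ = |y - x| * sech x * (Real.cosh y * sech y) := by ring
      _ = |x - y| * sech x := by rw [e2, mul_one, abs_sub_comm]
      _ ≤ _ := mul_le_mul_of_nonneg_left (by linarith [sech_pos y]) (abs_nonneg _)
  rcases le_total |x| |y| with h | h
  · exact key x y h
  · rw [abs_sub_comm, abs_sub_comm x, add_comm]; exact key y x h

lemma sin_two_arctan_exp (z : ℝ) : Real.sin (2 * Real.arctan (Real.exp z)) = sech z := by
  rw [Real.sin_two_mul, Real.sin_arctan, Real.cos_arctan]
  have h : (0 : ℝ) < 1 + Real.exp z ^ 2 := by positivity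
  have e : Real.exp (-z) * Real.exp z = 1 := by rw [← Real.exp_add]; simp
  have e0 := Real.exp_pos z
  have e1 := Real.exp_pos (-z)
  unfold sech
  rw [Real.cosh_eq]
  field_simp
  rw [Real.sq_sqrt h.le]
  linear_combination e

lemma cos_two_arctan_exp (z : ℝ) : Real.cos (2 * Real.arctan (Real.exp z)) = - tanh z := by
  rw [Real.cos_two_mul, Real.cos_sq_arctan]
  have h : (0 : ℝ) < 1 + Real.exp z ^ 2 := by positivity
  have e : Real.exp (-z) * Real.exp z = 1 := by rw [← Real.exp_add]; simp
  have e0 := Real.exp_pos z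
  have e1 := Real.exp_pos (-z)
  unfold tanh sech
  rw [Real.cosh_eq, Real.sinh_eq]
  field_simp
  linear_combination (-2 * Real.exp z) * e

/-- The profile `4 arctan (exp z)` of the kink. -/
def profile (z : ℝ) : ℝ := 4 * Real.arctan (Real.exp z)

lemma hasDerivAt_profile (z : ℝ) : HasDerivAt profile (2 * sech z) z := by
  refine (((Real.hasDerivAt_exp z).arctan).const_mul 4).congr_deriv ?_
  have h : (0 : ℝ) < 1 + Real.exp z ^ 2 := by positivity
  have e : Real.exp (-z) * Real.exp z = 1 := by rw [← Real.exp_add]; simp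
  have e0 := Real.exp_pos z
  have e1 := Real.exp_pos (-z)
  unfold sech
  rw [Real.cosh_eq]
  field_simp
  linear_combination 4 * e

lemma kink_zero (β y x : ℝ) : kink β y 0 x = profile (lorentz β * (x - y)) := by
  unfold kink profile; simp

/-- With its companion for the cosine, this turns the trigonometric coefficients of the Bäcklund
equations at the kink into hyperbolic ones. -/
lemma sin_half_profile (z : ℝ) : Real.sin (profile z / 2) = sech z := by
  rw [← sin_two_arctan_exp]; unfold profile; ring_nf

lemma cos_half_profile (z : ℝ) : Real.cos (profile z / 2) = - tanh z := by
  rw [← cos_two_arctan_exp]; unfold profile; ring_nf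

lemma hasDerivAt_profile_affine (c y x : ℝ) :
    HasDerivAt (fun x => profile (c * (x - y))) (2 * c * sech (c * (x - y))) x := by
  have h1 : HasDerivAt (fun x => c * (x - y)) c x := by
    simpa using ((hasDerivAt_id x).sub_const y).const_mul c
  have := HasDerivAt.comp x (hasDerivAt_profile (c * (x - y))) h1
  exact this.congr_deriv (by ring)

lemma hasDerivAt_sech_affine (c y x : ℝ) : HasDerivAt (fun x => sech (c * (x - y)))
    (-c * (tanh (c * (x - y)) * sech (c * (x - y)))) x := by
  have h1 : HasDerivAt (fun x => c * (x - y)) c x := by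
    simpa using ((hasDerivAt_id x).sub_const y).const_mul c
  have := HasDerivAt.comp x (hasDerivAt_sech (c * (x - y))) h1
  exact this.congr_deriv (by ring)

lemma continuous_profile : Continuous profile :=
  continuous_iff_continuousAt.2 fun x => (hasDerivAt_profile x).continuousAt

lemma continuous_tanh : Continuous tanh := (bddSmooth_sech_tanh 0).2.continuous

lemma kinkDt_zero (β y x : ℝ) :
    kinkDt β y 0 x = -2 * β * lorentz β * sech (lorentz β * (x - y)) := by
  have h1 : HasDerivAt (fun τ => lorentz β * (x - β * τ - y)) (lorentz β * -β) 0 := by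
    have := (((hasDerivAt_id (0 : ℝ)).const_mul β).const_sub x).sub_const y
    simpa using this.const_mul (lorentz β)
  have h2 := (HasDerivAt.comp (0 : ℝ) (hasDerivAt_profile _) h1).deriv
  have e : (fun τ => kink β y τ x) = profile ∘ fun τ => lorentz β * (x - β * τ - y) := rfl
  unfold kinkDt
  rw [e, h2, mul_zero, sub_zero]
  ring

/-! ### The relations between velocity, Lorentz factor and Bäcklund parameter. -/

section Param

variable {β : ℝ}

lemma backlundParam_pos (hβ : β ∈ Set.Ioo (-1 : ℝ) 1) : 0 < backlundParam β :=
  Real.sqrt_pos.2 (div_pos (by linarith [hβ.1]) (by linarith [hβ.2]))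

lemma backlundParam_sq (hβ : β ∈ Set.Ioo (-1 : ℝ) 1) :
    backlundParam β ^ 2 = (1 + β) / (1 - β) :=
  Real.sq_sqrt (div_pos (by linarith [hβ.1]) (by linarith [hβ.2])).le

lemma one_le_lorentz (hβ : β ∈ Set.Ioo (-1 : ℝ) 1) : 1 ≤ lorentz β := by
  have h : 0 < 1 - β ^ 2 := by nlinarith [hβ.1, hβ.2]
  refine (one_le_inv₀ (Real.sqrt_pos.2 h)).2 ?_
  rw [Real.sqrt_le_one]
  nlinarith

lemma lorentz_eq (hβ : β ∈ Set.Ioo (-1 : ℝ) 1) : lorentz β = backlundParam β / (1 + β) := by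
  have h1 : 0 < 1 + β := by linarith [hβ.1]
  have h2 : 0 < 1 - β := by linarith [hβ.2]
  have hl : 0 ≤ lorentz β := zero_le_one.trans (one_le_lorentz hβ)
  have h3 : lorentz β ^ 2 = (1 - β ^ 2)⁻¹ := by
    unfold lorentz
    rw [inv_pow, Real.sq_sqrt (by nlinarith)]
  refine (pow_left_inj₀ hl (div_nonneg (backlundParam_pos hβ).le h1.le) two_ne_zero).1 ?_
  rw [h3, div_pow, backlundParam_sq hβ, show 1 - β ^ 2 = (1 + β) * (1 - β) by ring]
  field_simp

/-- Together with the formula for `1/a - a`, this says that the kink is the Bäcklund transform of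
zero: `Q_x = 2γ sech` and `Q_t = -2βγ sech`, while `sin(Q/2) = sech`. -/
lemma param_add (hβ : β ∈ Set.Ioo (-1 : ℝ) 1) :
    backlundParam β + 1 / backlundParam β = 2 * lorentz β := by
  have h1 : 0 < 1 + β := by linarith [hβ.1]
  have h2 : 0 < 1 - β := by linarith [hβ.2]
  have h3 := backlundParam_pos hβ
  have h4 := backlundParam_sq hβ
  rw [lorentz_eq hβ]
  rw [eq_div_iff h2.ne'] at h4
  field_simp
  linear_combination -h4

lemma param_sub (hβ : β ∈ Set.Ioo (-1 : ℝ) 1) :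
    1 / backlundParam β - backlundParam β = -2 * β * lorentz β := by
  have h1 : 0 < 1 + β := by linarith [hβ.1]
  have h2 : 0 < 1 - β := by linarith [hβ.2]
  have h3 := backlundParam_pos hβ
  have h4 := backlundParam_sq hβ
  rw [lorentz_eq hβ]
  rw [eq_div_iff h2.ne'] at h4
  field_simp
  linear_combination -h4

lemma lorentz_eq_param (hβ : β ∈ Set.Ioo (-1 : ℝ) 1) :
    lorentz β = (backlundParam β + 1 / backlundParam β) / 2 := by rw [param_add hβ]; ring

/-- The velocity with a given Bäcklund parameter. -/
lemma exists_backlundParam_eq {a a₀ : ℝ} (ha : 0 < a) (ha₀ : 0 < a₀) {β₀ : ℝ}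
    (hβ₀ : β₀ ∈ Set.Ioo (-1 : ℝ) 1) (h₀ : backlundParam β₀ = a₀) :
    ∃ β ∈ Set.Ioo (-1 : ℝ) 1, backlundParam β = a ∧ |β - β₀| ≤ 2 * |a - a₀| := by
  have h4 := backlundParam_sq hβ₀
  have h2 : 0 < 1 - β₀ := by linarith [hβ₀.2]
  -- Solving `a² = (1 + β)/(1 - β)` for `β`; the same rational function of `a` is the witness, and
  -- it is 2-Lipschitz on the positive half-line.
  have e0 : β₀ = (a₀ ^ 2 - 1) / (a₀ ^ 2 + 1) := by
    rw [h₀, eq_div_iff h2.ne'] at h4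
    rw [eq_div_iff (by positivity)]
    linear_combination -h4
  have hp : 0 < a ^ 2 + 1 := by positivity
  have hq : 0 < a₀ ^ 2 + 1 := by positivity
  refine ⟨(a ^ 2 - 1) / (a ^ 2 + 1), ⟨?_, ?_⟩, ?_, ?_⟩
  · rw [lt_div_iff₀ hp]; nlinarith
  · rw [div_lt_one hp]; linarith
  · unfold backlundParam
    rw [show (1 + (a ^ 2 - 1) / (a ^ 2 + 1)) / (1 - (a ^ 2 - 1) / (a ^ 2 + 1)) = a ^ 2 by
      field_simp; ring, Real.sqrt_sq ha.le]
  · rw [e0]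
    have e : (a ^ 2 - 1) / (a ^ 2 + 1) - (a₀ ^ 2 - 1) / (a₀ ^ 2 + 1) =
        (a - a₀) * (2 * (a + a₀) / ((a ^ 2 + 1) * (a₀ ^ 2 + 1))) := by
      field_simp; ring
    rw [e, abs_mul, mul_comm 2 |a - a₀|]
    refine mul_le_mul_of_nonneg_left ?_ (abs_nonneg _)
    rw [abs_of_pos (by positivity), div_le_iff₀ (by positivity)]
    nlinarith [sq_nonneg (a - 1), sq_nonneg (a₀ - 1), mul_pos ha ha₀, mul_pos (sq_pos_of_pos ha) (sq_pos_of_pos ha₀)]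

lemma backlundParam_injOn {β β' : ℝ} (hβ : β ∈ Set.Ioo (-1 : ℝ) 1) (hβ' : β' ∈ Set.Ioo (-1 : ℝ) 1)
    (h : backlundParam β = backlundParam β') : β = β' := by
  have h1 := backlundParam_sq hβ
  rw [h, backlundParam_sq hβ', div_eq_div_iff (by linarith [hβ'.2]) (by linarith [hβ.2])] at h1
  linarith

lemma continuousAt_backlundParam (hβ : β ∈ Set.Ioo (-1 : ℝ) 1) : ContinuousAt backlundParam β := by
  unfold backlundParam
  refine Real.continuous_sqrt.continuousAt.comp (ContinuousAt.div (by fun_prop) (by fun_prop) ?_)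
  linarith [hβ.2]

end Param

/-! ### Exponentially decaying functions -/

lemma integrable_exp_neg_mul_abs {c : ℝ} (hc : 0 < c) : Integrable fun x : ℝ => Real.exp (-(c * |x|)) := by
  have h : IntegrableOn (fun x : ℝ => Real.exp (-(c * |x|))) (Set.Ioi 0) := by
    refine (integrableOn_exp_mul_Ioi (neg_lt_zero.2 hc) 0).congr_fun (fun x hx => ?_) measurableSet_Ioi
    simp only [abs_of_pos hx.out, neg_mul]
  have h' : IntegrableOn (fun x : ℝ => Real.exp (-(c * |x|))) (Set.Iic 0) := by
    refine (integrableOn_exp_mul_Iic hc 0).congr_fun (fun x hx => ?_) measurableSet_Iic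
    simp only [abs_of_nonpos hx.out, mul_neg, neg_neg]
  have := h'.union h
  rwa [Set.Iic_union_Ioi, integrableOn_univ] at this

/-- `⟨x⟩^s ≤ C ⟨y⟩^s e^{c|x - y|}`. -/
lemma exists_wt_le {s c : ℝ} (hs : 0 ≤ s) (hc : 0 < c) :
    ∃ C : ℝ, 0 < C ∧ ∀ x y, wt s x ≤ C * wt s y * Real.exp (c * |x - y|) := by
  obtain ⟨n, hn⟩ := exists_nat_ge (s / 2)
  obtain ⟨M, hM0, hM⟩ : ∃ M : ℝ, 0 < M ∧ ∀ t : ℝ, 0 ≤ t → (2 * (1 + t ^ 2)) ^ n ≤ M * Real.exp (c * t) := by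
    refine ⟨(2 * n).factorial / c ^ (2 * n) * 4 ^ n + 4 ^ n, by positivity, fun t ht => ?_⟩
    have h1 : (c * t) ^ (2 * n) / (2 * n).factorial ≤ Real.exp (c * t) :=
      Real.pow_div_factorial_le_exp _ (by positivity) _
    have h2 : t ^ (2 * n) ≤ (2 * n).factorial / c ^ (2 * n) * Real.exp (c * t) := by
      rw [div_mul_eq_mul_div, le_div_iff₀ (by positivity)]
      rw [div_le_iff₀ (by positivity), mul_pow] at h1
      linarith
    have h3 : (1 : ℝ) ≤ Real.exp (c * t) := Real.one_le_exp (by positivity)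
    have h4 : (2 * (1 + t ^ 2)) ^ n ≤ 4 ^ n * (t ^ (2 * n) + 1) := by
      rw [pow_mul]
      rcases le_total 1 (t ^ 2) with h | h
      · calc _ ≤ (4 * t ^ 2) ^ n := pow_le_pow_left₀ (by positivity) (by linarith) n
          _ = 4 ^ n * (t ^ 2) ^ n := mul_pow _ _ _
          _ ≤ _ := by gcongr; linarith
      · calc _ ≤ (4 : ℝ) ^ n := by gcongr; linarith
          _ = 4 ^ n * (0 + 1) := by ring
          _ ≤ _ := by gcongr; positivity
    calc _ ≤ _ := h4
      _ ≤ 4 ^ n * ((2 * n).factorial / c ^ (2 * n) * Real.exp (c * t) + Real.exp (c * t)) := by gcongr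
      _ = _ := by ring
  refine ⟨M, hM0, fun x y => ?_⟩
  -- Peetre's inequality; the remaining power of the difference is absorbed by the exponential.
  have h1 : 1 + x ^ 2 ≤ (1 + y ^ 2) * (2 * (1 + |x - y| ^ 2)) := by
    rw [sq_abs]
    nlinarith [sq_nonneg (x - 2 * y), mul_nonneg (sq_nonneg y) (sq_nonneg (x - y)), sq_nonneg y]
  have h2 : (1 : ℝ) ≤ 2 * (1 + |x - y| ^ 2) := by nlinarith [sq_nonneg |x - y|]
  calc wt s x ≤ ((1 + y ^ 2) * (2 * (1 + |x - y| ^ 2))) ^ (s / 2) :=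
        Real.rpow_le_rpow (by positivity) h1 (by positivity)
    _ = wt s y * (2 * (1 + |x - y| ^ 2)) ^ (s / 2) := Real.mul_rpow (by positivity) (by positivity)
    _ ≤ wt s y * (2 * (1 + |x - y| ^ 2)) ^ (n : ℝ) := by
        gcongr
        exact (wt_pos s y).le
    _ ≤ wt s y * (M * Real.exp (c * |x - y|)) := by
        rw [Real.rpow_natCast]
        exact mul_le_mul_of_nonneg_left (hM _ (abs_nonneg _)) (wt_pos s y).le
    _ = _ := by ring

lemma memLp_exp_neg_mul_abs {c : ℝ} (hc : 0 < c) (y : ℝ) :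
    MemLp (fun x : ℝ => Real.exp (-(c * |x - y|))) 2 (volume : Measure ℝ) := by
  rw [memLp_two_iff_integrable_sq (by fun_prop)]
  refine ((integrable_exp_neg_mul_abs (mul_pos two_pos hc)).comp_sub_right y).congr
    (ae_of_all _ fun x => ?_)
  simp only
  rw [← Real.exp_nat_mul]
  congr 1
  push_cast; ring

lemma memLp_wt_mul_exp {s c : ℝ} (hs : 0 ≤ s) (hc : 0 < c) (y : ℝ) :
    MemLp (fun x : ℝ => wt s x * Real.exp (-(c * |x - y|))) 2 (volume : Measure ℝ) := by
  obtain ⟨C, hC0, hC⟩ := exists_wt_le hs (half_pos hc)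
  refine ((memLp_exp_neg_mul_abs (half_pos hc) y).const_mul (C * wt s y)).mono
    ((continuous_wt s).mul (by fun_prop)).aestronglyMeasurable (ae_of_all _ fun x => ?_)
  have hw := wt_pos s x
  have hy := wt_pos s y
  rw [Real.norm_of_nonneg (by positivity), Real.norm_of_nonneg (by positivity)]
  calc _ ≤ C * wt s y * Real.exp (c / 2 * |x - y|) * Real.exp (-(c * |x - y|)) := by
        gcongr; exact hC x y
    _ = _ := by rw [mul_assoc _ (Real.exp _), ← Real.exp_add]; ring_nf

lemma memLp_wt_mul_sech {s c : ℝ} (hs : 0 ≤ s) (hc : 0 < c) (y : ℝ) :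
    MemLp (fun x : ℝ => wt s x * sech (c * (x - y))) 2 (volume : Measure ℝ) := by
  refine ((memLp_wt_mul_exp hs hc y).const_mul 2).mono ((continuous_wt s).mul
    (continuous_sech.comp (by fun_prop))).aestronglyMeasurable (ae_of_all _ fun x => ?_)
  have hw := wt_pos s x
  have h := sech_le_exp (c * (x - y))
  have h0 := sech_pos (c * (x - y))
  rw [abs_mul, abs_of_pos hc] at h
  rw [Real.norm_of_nonneg (by positivity), Real.norm_of_nonneg (by positivity)]
  calc _ ≤ wt s x * (2 * Real.exp (-(c * |x - y|))) := by gcongr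
    _ = _ := by ring

lemma integrable_sech {c : ℝ} (hc : 0 < c) (y : ℝ) : Integrable fun x : ℝ => sech (c * (x - y)) := by
  refine (((integrable_exp_neg_mul_abs hc).comp_sub_right y).const_mul 2).mono
    (continuous_sech.comp (by fun_prop)).aestronglyMeasurable (ae_of_all _ fun x => ?_)
  have h := sech_le_exp (c * (x - y))
  have h0 := sech_pos (c * (x - y))
  rw [abs_mul, abs_of_pos hc] at h
  rw [Real.norm_of_nonneg (by positivity), Real.norm_of_nonneg (by positivity)]
  exact h

lemma memLp_sech {c : ℝ} (hc : 0 < c) (y : ℝ) :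
    MemLp (fun x : ℝ => sech (c * (x - y))) 2 (volume : Measure ℝ) := by
  have := memLp_wt_mul_sech le_rfl hc y
  simpa [wt] using this

/-- The derivative of `sech` is a bounded smooth multiple of `sech`, so integer orders follow by
induction, and real orders by monotonicity in the order. -/
lemma sobolevNorm_sech_ne_top {s c : ℝ} (hs : 0 ≤ s) (hc : 0 < c) (y k : ℝ) :
    sobolevNorm k s (fun x => sech (c * (x - y))) ≠ ⊤ := by
  have key : ∀ n : ℕ, sobolevNorm n s (fun x => sech (c * (x - y))) ≠ ⊤ := by
    intro n
    induction n with
    | zero =>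
      rw [Nat.cast_zero, sobolevNorm_zero (memLp_wt_mul_sech hs hc y)]
      exact (memLp_wt_mul_sech hs hc y).2.ne
    | succ n ih =>
      obtain ⟨A, hA, h⟩ := exists_sobolevNorm_succ_le s (n.cast_nonneg : (0 : ℝ) ≤ n)
      obtain ⟨B, hB, h'⟩ := exists_sobolevNorm_bddSmooth_mul_le (χ := fun x => -c * tanh (c * (x - y)))
        (fun n => ((bddSmooth_sech_tanh n).2.comp_affine c y).const_mul _) s (n.cast_nonneg : (0 : ℝ) ≤ n)
      have hd : HasACDeriv (fun x => sech (c * (x - y)))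
          (fun x => -c * tanh (c * (x - y)) * sech (c * (x - y))) := by
        refine .of_contDiff (fun x => (hasDerivAt_sech_affine c y x).congr_deriv (by ring)) ?_
        exact ((continuous_const.mul (continuous_tanh.comp (by fun_prop))).mul
          (continuous_sech.comp (by fun_prop)))
      have h1 := h' _ ih
      have h2 := ne_top_of_le_ne_top (ENNReal.mul_ne_top hB ih) h1
      push_cast
      exact ne_top_of_le_ne_top (ENNReal.mul_ne_top hA (ENNReal.add_ne_top.2 ⟨ih, h2⟩)) (h _ _ hd)
  exact ne_top_of_le_ne_top (key ⌈k⌉₊) (sobolevNorm_mono (Nat.le_ceil k))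

/-! ### The equation `φ' = c tanh(c (x - x₀)) φ + R` -/

lemma enorm_real_eq (x : ℝ) : ‖x‖ₑ = ENNReal.ofReal |x| := by
  rw [← ofReal_norm, Real.norm_eq_abs]

/-- Young's inequality `L¹ * L² ⊆ L²`. -/
lemma lintegral_conv_sq_le {k F : ℝ → ℝ≥0∞} (hk : Measurable k) (hF : AEMeasurable F) :
    ∫⁻ x, (∫⁻ y, k (x - y) * F y) ^ 2 ≤ (∫⁻ x, k x) ^ 2 * ∫⁻ x, F x ^ 2 := by
  have hmx : ∀ x, Measurable fun y => k (x - y) := fun x => hk.comp (measurable_const.sub measurable_id)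
  have mass : ∀ x, ∫⁻ y, k (x - y) = ∫⁻ y, k y := fun x => lintegral_sub_left_eq_self k x
  have mass' : ∀ y, ∫⁻ x, k (x - y) = ∫⁻ x, k x := fun y => lintegral_sub_right_eq_self k y
  -- Cauchy–Schwarz for `F` and the constant `1` with respect to the measure of density `k (x - ·)`.
  have key : ∀ x, (∫⁻ y, k (x - y) * F y) ^ 2 ≤ (∫⁻ y, k y) * ∫⁻ y, k (x - y) * F y ^ 2 := by
    intro x
    have hF' : AEMeasurable F (volume.withDensity fun y => k (x - y)) :=
      hF.mono_ac (withDensity_absolutelyContinuous _ _)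
    have h := ENNReal.lintegral_mul_le_Lp_mul_Lq (volume.withDensity fun y => k (x - y))
      (Real.HolderConjugate.two_two) hF' (aemeasurable_const (b := (1 : ℝ≥0∞)))
    simp only [Pi.mul_apply, mul_one, ENNReal.rpow_two] at h
    rw [lintegral_withDensity_eq_lintegral_mul₀ (hmx x).aemeasurable hF,
      lintegral_withDensity_eq_lintegral_mul₀ (hmx x).aemeasurable (hF.pow_const 2),
      lintegral_withDensity_eq_lintegral_mul₀ (hmx x).aemeasurable aemeasurable_const] at h
    simp only [Pi.mul_apply, one_pow, mul_one, mass] at h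
    calc _ ≤ ((∫⁻ y, k (x - y) * F y ^ 2) ^ (1 / 2 : ℝ) * (∫⁻ y, k y) ^ (1 / 2 : ℝ)) ^ 2 := by gcongr
      _ = _ := by
        rw [mul_pow, ← ENNReal.rpow_natCast, ← ENNReal.rpow_natCast, ← ENNReal.rpow_mul,
          ← ENNReal.rpow_mul]
        norm_num
        rw [mul_comm]
  have hm2 : AEMeasurable (Function.uncurry fun x y => k (x - y) * F y ^ 2) (volume.prod volume) :=
    (hk.comp (measurable_fst.sub measurable_snd)).aemeasurable.mul
      ((hF.pow_const 2).comp_quasiMeasurePreserving Measure.quasiMeasurePreserving_snd)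
  calc _ ≤ ∫⁻ x, (∫⁻ y, k y) * ∫⁻ y, k (x - y) * F y ^ 2 := lintegral_mono key
    _ = (∫⁻ y, k y) * ∫⁻ x, ∫⁻ y, k (x - y) * F y ^ 2 :=
      lintegral_const_mul'' _ hm2.lintegral_prod_right'
    _ = (∫⁻ y, k y) * ∫⁻ y, ∫⁻ x, k (x - y) * F y ^ 2 := by rw [lintegral_lintegral_swap hm2]
    _ = (∫⁻ y, k y) * ∫⁻ y, (∫⁻ x, k x) * F y ^ 2 := by
      congr 1
      refine lintegral_congr fun y => ?_
      rw [lintegral_mul_const _ (show Measurable fun x => k (x - y) from hk.comp (by fun_prop)), mass']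
    _ = _ := by rw [lintegral_const_mul'' _ (hF.pow_const 2), sq, mul_assoc]

lemma eLpNorm_le_of_enorm_le_conv {k : ℝ → ℝ≥0∞} (hk : Measurable k) {v w : ℝ → ℝ}
    (hw : AEStronglyMeasurable w volume) (h : ∀ x, ‖v x‖ₑ ≤ ∫⁻ y, k (x - y) * ‖w y‖ₑ) :
    eLpNorm v 2 volume ≤ (∫⁻ x, k x) * eLpNorm w 2 volume := by
  rw [← ENNReal.pow_le_pow_left_iff two_ne_zero, mul_pow, eLpNorm_two_sq, eLpNorm_two_sq]
  exact (lintegral_mono fun x => pow_le_pow_left' (h x) 2).trans (lintegral_conv_sq_le hk hw.enorm)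

/-- The exponential kernel `2 e^{-c|x|}`. -/
def expKer (c x : ℝ) : ℝ≥0∞ := ENNReal.ofReal (2 * Real.exp (-(c * |x|)))

/-- The convolution of `|R|` with the exponential kernel. -/
def expConv (c : ℝ) (R : ℝ → ℝ) (x : ℝ) : ℝ≥0∞ := ∫⁻ y, expKer c (x - y) * ‖R y‖ₑ

section Linear

variable {c κ x₀ : ℝ} {R R₁ R₂ : ℝ → ℝ}

lemma measurable_expKer : Measurable (expKer c) := by
  unfold expKer; fun_prop

lemma lintegral_expKer_ne_top (hc : 0 < c) : ∫⁻ x, expKer c x ≠ ⊤ := by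
  unfold expKer
  exact (((integrable_exp_neg_mul_abs hc).const_mul 2).lintegral_lt_top).ne

lemma expConv_add_le (h₁ : AEStronglyMeasurable R₁ volume) (x : ℝ) :
    expConv c (fun y => R₁ y + R₂ y) x ≤ expConv c R₁ x + expConv c R₂ x := by
  unfold expConv
  rw [← lintegral_add_left']
  · refine lintegral_mono fun y => ?_
    rw [← mul_add]
    gcongr
    exact enorm_add_le _ _
  · exact (measurable_expKer.comp (measurable_const.sub measurable_id)).aemeasurable.mul h₁.enorm

lemma exists_expConv_le_of_bdd (hc : 0 < c) : ∃ C : ℝ, 0 < C ∧ ∀ (R : ℝ → ℝ) (M : ℝ), 0 ≤ M →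
    (∀ y, |R y| ≤ M) → ∀ x, expConv c R x ≤ ENNReal.ofReal (C * M) := by
  refine ⟨(∫⁻ x, expKer c x).toReal + 1, by positivity, fun R M hM hR x => ?_⟩
  have hk := lintegral_expKer_ne_top hc
  calc _ ≤ ∫⁻ y, expKer c (x - y) * ENNReal.ofReal M := by
        refine lintegral_mono fun y => ?_
        rw [enorm_real_eq]
        gcongr
        exact hR y
    _ = (∫⁻ y, expKer c y) * ENNReal.ofReal M := by
        rw [lintegral_mul_const _ (show Measurable fun y => expKer c (x - y) from
            measurable_expKer.comp (by fun_prop)),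
          lintegral_sub_left_eq_self (expKer c) x]
    _ ≤ _ := by
        rw [ENNReal.ofReal_mul (by positivity)]
        gcongr
        rw [ENNReal.le_ofReal_iff_toReal_le hk (by positivity)]
        linarith

lemma exists_expConv_le_eLpNorm (hc : 0 < c) : ∃ C : ℝ, 0 < C ∧ ∀ R : ℝ → ℝ,
    AEStronglyMeasurable R volume → ∀ x, expConv c R x ≤ ENNReal.ofReal C * eLpNorm R 2 volume := by
  have hk := (memLp_exp_neg_mul_abs hc 0).const_mul 2
  simp only [sub_zero] at hk
  have hk1 := hk.2.ne
  refine ⟨(eLpNorm (fun x => 2 * Real.exp (-(c * |x|))) 2 volume).toReal + 1, by positivity,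
    fun R hR x => ?_⟩
  have h := ENNReal.lintegral_mul_le_Lp_mul_Lq volume (Real.HolderConjugate.two_two)
    (measurable_expKer.comp (measurable_const.sub measurable_id)).aemeasurable
    (f := fun y => expKer c (x - y)) hR.enorm
  simp only [Pi.mul_apply, ENNReal.rpow_two] at h
  rw [lintegral_sub_left_eq_self (fun y => expKer c y ^ 2) x, ← eLpNorm_two_eq] at h
  refine h.trans ?_
  gcongr
  rw [ENNReal.le_ofReal_iff_toReal_le _ (by positivity)]
  · rw [eLpNorm_two_eq]
    have : ∀ y, expKer c y ^ 2 = ‖2 * Real.exp (-(c * |y|))‖ₑ ^ 2 := fun y => by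
      rw [enorm_real_eq, abs_of_pos (by positivity)]; rfl
    simp only [this]
    linarith
  · have : ∀ y, expKer c y ^ 2 = ‖2 * Real.exp (-(c * |y|))‖ₑ ^ 2 := fun y => by
      rw [enorm_real_eq, abs_of_pos (by positivity)]; rfl
    simp only [this]
    rwa [← eLpNorm_two_eq]

/-- The right-hand sides for which the linear equation is solved. -/
structure Admissible (c : ℝ) (R : ℝ → ℝ) : Prop where
  meas : AEStronglyMeasurable R volume
  fin : ∀ x, expConv c R x ≠ ⊤

lemma enorm_sech_mul_le (hc : 0 < c) (y : ℝ) :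
    ‖sech (c * (y - x₀)) * R y‖ₑ ≤ expKer c (x₀ - y) * ‖R y‖ₑ := by
  rw [enorm_mul]
  gcongr
  have h := sech_le_exp (c * (y - x₀))
  rw [abs_mul, abs_of_pos hc, abs_sub_comm] at h
  rw [enorm_real_eq, abs_of_pos (sech_pos _)]
  exact ENNReal.ofReal_le_ofReal h

lemma lintegral_sech_mul_le (hc : 0 < c) :
    ∫⁻ y, ‖sech (c * (y - x₀)) * R y‖ₑ ≤ expConv c R x₀ := lintegral_mono (enorm_sech_mul_le hc)

lemma continuous_sech_affine (c x₀ : ℝ) : Continuous fun x => sech (c * (x - x₀)) :=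
  continuous_sech.comp (by fun_prop)

namespace Admissible

lemma integrable (h : Admissible c R) (hc : 0 < c) (x₀ : ℝ) :
    Integrable fun y => sech (c * (y - x₀)) * R y :=
  ⟨(continuous_sech_affine c x₀).aestronglyMeasurable.mul h.meas,
    (lintegral_sech_mul_le hc).trans_lt (lt_top_iff_ne_top.2 (h.fin x₀))⟩

lemma add (h₁ : Admissible c R₁) (h₂ : Admissible c R₂) : Admissible c fun x => R₁ x + R₂ x :=
  ⟨h₁.meas.add h₂.meas, fun x => ne_top_of_le_ne_top (ENNReal.add_ne_top.2 ⟨h₁.fin x, h₂.fin x⟩)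
    (expConv_add_le h₁.meas x)⟩

lemma const_mul (a : ℝ) (h : Admissible c R) : Admissible c fun x => a * R x := by
  refine ⟨h.meas.const_mul a, fun x => ?_⟩
  have : expConv c (fun x => a * R x) x = ‖a‖ₑ * expConv c R x := by
    unfold expConv
    rw [← lintegral_const_mul' _ _ (by simp)]
    refine lintegral_congr fun y => ?_
    rw [enorm_mul]; ring
  rw [this]
  exact ENNReal.mul_ne_top (by simp) (h.fin x)

lemma sub (h₁ : Admissible c R₁) (h₂ : Admissible c R₂) : Admissible c fun x => R₁ x - R₂ x := by
  simpa [sub_eq_add_neg] using h₁.add (h₂.const_mul (-1))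

/-- Both this case and the bounded one occur in the source term: the datum `u₁` is only square
integrable, and the nonlinear remainder of a bounded function is only known to be bounded. -/
lemma of_memLp (hc : 0 < c) (h : MemLp R 2 (volume : Measure ℝ)) : Admissible c R := by
  obtain ⟨C, -, hC⟩ := exists_expConv_le_eLpNorm hc
  exact ⟨h.1, fun x => ne_top_of_le_ne_top (ENNReal.mul_ne_top (by simp) h.2.ne) (hC R h.1 x)⟩

lemma of_bdd (hc : 0 < c) (hm : AEStronglyMeasurable R volume) {M : ℝ} (hM : ∀ x, |R x| ≤ M) :
    Admissible c R := by
  obtain ⟨C, -, hC⟩ := exists_expConv_le_of_bdd hc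
  exact ⟨hm, fun x => ne_top_of_le_ne_top (by simp)
    (hC R M ((abs_nonneg _).trans (hM 0)) hM x)⟩

lemma sech (hc : 0 < c) (x₀ : ℝ) : Admissible c fun x => sech (c * (x - x₀)) :=
  of_memLp hc (memLp_sech hc x₀)

end Admissible

/-- `∫ sech²`. -/
def sechSq (c x₀ : ℝ) : ℝ := ∫ x, sech (c * (x - x₀)) * sech (c * (x - x₀))

lemma sechSq_pos (hc : 0 < c) : 0 < sechSq c x₀ := by
  have hi : Integrable fun x => sech (c * (x - x₀)) * sech (c * (x - x₀)) :=
    (Admissible.sech hc x₀).integrable hc x₀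
  unfold sechSq
  rw [integral_pos_iff_support_of_nonneg (fun x => mul_self_nonneg _) hi]
  have : Function.support (fun x => sech (c * (x - x₀)) * sech (c * (x - x₀))) = Set.univ := by
    ext x
    simp [(sech_pos (c * (x - x₀))).ne']
  rw [this]
  simp

/-- The multiplier making `R + κ proj R sech` orthogonal to `sech`. -/
def proj (c κ x₀ : ℝ) (R : ℝ → ℝ) : ℝ := -(κ * sechSq c x₀)⁻¹ * ∫ y, sech (c * (y - x₀)) * R y

/-- The right-hand side corrected to be orthogonal to `sech`. -/
def corr (c κ x₀ : ℝ) (R : ℝ → ℝ) (x : ℝ) : ℝ := R x + κ * proj c κ x₀ R * sech (c * (x - x₀))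

/-- The bounded solution of `φ' = c tanh(c (x - x₀)) φ + corr R`. -/
def sol (c κ x₀ : ℝ) (R : ℝ → ℝ) (x : ℝ) : ℝ :=
  Real.cosh (c * (x - x₀)) * ∫ y in Set.Iic x, sech (c * (y - x₀)) * corr c κ x₀ R y

lemma Admissible.corr (h : Admissible c R) (hc : 0 < c) (κ x₀ : ℝ) :
    Admissible c (corr c κ x₀ R) := h.add ((Admissible.sech hc x₀).const_mul _)

/-- The solvability condition. It lets the integral over `(-∞, x]` in `sol` be replaced by minus the
integral over `(x, ∞)`, which keeps `sol` bounded on the right. -/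
lemma integral_sech_mul_corr (hc : 0 < c) (hκ : 0 < κ) (h : Admissible c R) :
    ∫ y, sech (c * (y - x₀)) * corr c κ x₀ R y = 0 := by
  have hq := sechSq_pos (x₀ := x₀) hc
  have e : ∀ y, sech (c * (y - x₀)) * corr c κ x₀ R y = sech (c * (y - x₀)) * R y +
      κ * proj c κ x₀ R * (sech (c * (y - x₀)) * sech (c * (y - x₀))) := fun y => by
    unfold corr; ring
  simp only [e]
  rw [integral_add (h.integrable hc x₀) (((Admissible.sech hc x₀).integrable hc x₀).const_mul _),
    integral_const_mul]
  change _ + κ * proj c κ x₀ R * sechSq c x₀ = 0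
  unfold proj
  field_simp
  ring

lemma proj_sub (hc : 0 < c) (h₁ : Admissible c R₁) (h₂ : Admissible c R₂) :
    proj c κ x₀ (fun x => R₁ x - R₂ x) = proj c κ x₀ R₁ - proj c κ x₀ R₂ := by
  unfold proj
  simp only [mul_sub (sech _)]
  rw [integral_sub (h₁.integrable hc x₀) (h₂.integrable hc x₀)]
  ring

lemma corr_sub (hc : 0 < c) (h₁ : Admissible c R₁) (h₂ : Admissible c R₂) (x : ℝ) :
    corr c κ x₀ (fun x => R₁ x - R₂ x) x = corr c κ x₀ R₁ x - corr c κ x₀ R₂ x := by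
  unfold corr
  rw [proj_sub hc h₁ h₂]
  ring

lemma sol_sub (hc : 0 < c) (h₁ : Admissible c R₁) (h₂ : Admissible c R₂) (x : ℝ) :
    sol c κ x₀ (fun x => R₁ x - R₂ x) x = sol c κ x₀ R₁ x - sol c κ x₀ R₂ x := by
  unfold sol
  simp only [corr_sub hc h₁ h₂, mul_sub (sech _)]
  rw [integral_sub ((h₁.corr hc κ x₀).integrable hc x₀).integrableOn
    ((h₂.corr hc κ x₀).integrable hc x₀).integrableOn]
  ring

lemma hasACDeriv_cosh_affine (c x₀ : ℝ) : HasACDeriv (fun x => Real.cosh (c * (x - x₀)))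
    (fun x => c * Real.sinh (c * (x - x₀))) := by
  refine .of_contDiff (fun x => ?_) (by fun_prop)
  have h1 : HasDerivAt (fun x => c * (x - x₀)) c x := by
    simpa using ((hasDerivAt_id x).sub_const x₀).const_mul c
  have := HasDerivAt.comp x (Real.hasDerivAt_cosh (c * (x - x₀))) h1
  exact this.congr_deriv (mul_comm _ _)

lemma hasACDeriv_integral_Iic {w : ℝ → ℝ} (hw : Integrable w) :
    HasACDeriv (fun x => ∫ y in Set.Iic x, w y) w := by
  refine .of_integral hw.locallyIntegrable fun x => ?_
  rw [← intervalIntegral.integral_Iic_sub_Iic hw.integrableOn hw.integrableOn]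
  ring

lemma hasACDeriv_sol (hc : 0 < c) (h : Admissible c R) : HasACDeriv (sol c κ x₀ R)
    (fun x => c * tanh (c * (x - x₀)) * sol c κ x₀ R x + corr c κ x₀ R x) := by
  refine ((hasACDeriv_cosh_affine c x₀).mul
    (hasACDeriv_integral_Iic ((h.corr hc κ x₀).integrable hc x₀))).congr (ae_of_all _ fun x => ?_)
  have := Real.cosh_pos (c * (x - x₀))
  simp only [sol, tanh, sech]
  field_simp

/-- A bounded solution is given by `sol`. -/
lemma eq_sol (hc : 0 < c) (hκ : 0 < κ) (h : Admissible c R) {φ φ' : ℝ → ℝ} {M b : ℝ}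
    (hφ : HasACDeriv φ φ') (hM : ∀ x, |φ x| ≤ M)
    (he : ∀ᵐ x, φ' x = c * tanh (c * (x - x₀)) * φ x + R x + κ * b * sech (c * (x - x₀))) :
    b = proj c κ x₀ R ∧ ∀ x, φ x = sol c κ x₀ R x := by
  have hq := sechSq_pos (x₀ := x₀) hc
  have hA : Admissible c fun x => R x + κ * b * sech (c * (x - x₀)) :=
    h.add ((Admissible.sech hc x₀).const_mul _)
  have hi := hA.integrable hc x₀
  -- `sech` is the integrating factor: it cancels the `tanh` term.
  have hw : HasACDeriv (fun x => sech (c * (x - x₀)) * φ x)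
      (fun x => sech (c * (x - x₀)) * (R x + κ * b * sech (c * (x - x₀)))) := by
    refine ((HasACDeriv.of_contDiff (hasDerivAt_sech_affine c x₀) ?_).mul hφ).congr ?_
    · exact continuous_const.mul ((continuous_tanh.comp (by fun_prop)).mul (continuous_sech_affine c x₀))
    · filter_upwards [he] with x hx
      rw [hx]; ring
  have hφi : Integrable fun x => sech (c * (x - x₀)) * φ x :=
    (Admissible.of_bdd hc hφ.continuous.aestronglyMeasurable hM).integrable hc x₀
  -- Since `φ` is bounded, `sech · φ` is integrable and its derivative has total integral zero. This
  -- one equation determines `b`.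
  have h0 := hw.integral_deriv_eq_zero hφi hi
  have hb : b = proj c κ x₀ R := by
    have e : ∀ y, sech (c * (y - x₀)) * (R y + κ * b * sech (c * (y - x₀))) =
      sech (c * (y - x₀)) * R y + κ * b * (sech (c * (y - x₀)) * sech (c * (y - x₀))) :=
        fun y => by ring
    simp only [e] at h0
    rw [integral_add (h.integrable hc x₀) (((Admissible.sech hc x₀).integrable hc x₀).const_mul _),
      integral_const_mul] at h0
    change _ + κ * b * sechSq c x₀ = 0 at h0
    unfold proj
    field_simp
    linarith
  refine ⟨hb, fun x => ?_⟩
  have hc' : ∀ y, corr c κ x₀ R y = R y + κ * b * sech (c * (y - x₀)) := fun y => by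
    unfold corr; rw [hb]
  -- Integrating from `-∞`, where the boundary term vanishes because `φ` is bounded, gives the
  -- formula for `φ`.
  have t1 := intervalIntegral_tendsto_integral_Iic x hi.integrableOn tendsto_id
  simp only [id, ← hw.sub_eq_integral] at t1
  have t2 : Tendsto (fun y => sech (c * (y - x₀)) * φ y) atBot (𝓝 0) := by
    have t3 : Tendsto (fun y => 2 * Real.exp (-(c * |y - x₀|)) * M) atBot (𝓝 0) := by
      have h1 : Tendsto (fun y : ℝ => c * |y - x₀|) atBot atTop :=
        (tendsto_abs_atBot_atTop.comp (tendsto_atBot_add_const_right _ (-x₀) tendsto_id)).const_mul_atTop hc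
      simpa using ((Real.tendsto_exp_neg_atTop_nhds_zero.comp h1).const_mul 2).mul_const M
    refine squeeze_zero_norm (fun y => ?_) t3
    have h := sech_le_exp (c * (y - x₀))
    rw [abs_mul c, abs_of_pos hc] at h
    rw [norm_mul, Real.norm_of_nonneg (sech_pos _).le]
    exact mul_le_mul h (hM y) (norm_nonneg _) (by positivity)
  have h3 := tendsto_nhds_unique t1 (t2.const_sub _)
  unfold sol
  simp only [hc', h3]
  have := Real.cosh_pos (c * (x - x₀))
  simp only [sech]
  field_simp
  ring

/-- If `y` lies beyond `x` as seen from `x₀`, the decay of `sech` from `x₀` to `y` compensates the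
growth of `cosh` from `x₀` to `x` and leaves decay from `x` to `y`. -/
lemma sech_le_mul {x y : ℝ} (hc : 0 < c) (h : |x - x₀| + |x - y| ≤ |y - x₀|) :
    Real.cosh (c * (x - x₀)) * sech (c * (y - x₀)) ≤ 2 * Real.exp (-(c * |x - y|)) := by
  have h1 := cosh_le_exp_abs (c * (x - x₀))
  have h2 := sech_le_exp (c * (y - x₀))
  rw [abs_mul, abs_of_pos hc] at h1 h2
  calc _ ≤ Real.exp (c * |x - x₀|) * (2 * Real.exp (-(c * |y - x₀|))) :=
        mul_le_mul h1 h2 (sech_pos _).le (Real.exp_pos _).le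
    _ = 2 * Real.exp (c * |x - x₀| + -(c * |y - x₀|)) := by rw [Real.exp_add]; ring
    _ ≤ _ := by
      gcongr
      nlinarith [mul_le_mul_of_nonneg_left h hc.le]

/-- The kernel bound for `sol`. -/
lemma enorm_sol_le (hc : 0 < c) (hκ : 0 < κ) (h : Admissible c R) (x : ℝ) :
    ‖sol c κ x₀ R x‖ₑ ≤ expConv c (corr c κ x₀ R) x := by
  set g := corr c κ x₀ R with hg
  have hi := (h.corr hc κ x₀).integrable hc x₀
  have h0 := integral_sech_mul_corr (x₀ := x₀) hc hκ h
  have main : ∀ s : Set ℝ, MeasurableSet s → (∀ y ∈ s, |x - x₀| + |x - y| ≤ |y - x₀|) →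
      ‖Real.cosh (c * (x - x₀)) * ∫ y in s, sech (c * (y - x₀)) * g y‖ₑ ≤ expConv c g x := by
    intro s hs hsy
    rw [← integral_const_mul]
    refine (enorm_integral_le_lintegral_enorm _).trans ?_
    refine le_trans (setLIntegral_mono' hs fun y hy => ?_) (setLIntegral_le_lintegral s _)
    rw [← mul_assoc, enorm_mul]
    gcongr
    have := mul_pos (Real.cosh_pos (c * (x - x₀))) (sech_pos (c * (y - x₀)))
    rw [enorm_real_eq, abs_of_pos this]
    exact ENNReal.ofReal_le_ofReal (sech_le_mul hc (hsy y hy))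
  -- The integral is taken over the half-line starting at `x` that points away from `x₀`; to the
  -- right of `x₀` this uses the solvability condition.
  rcases le_total x x₀ with hx | hx
  · refine main (Set.Iic x) measurableSet_Iic fun y hy => ?_
    have hy' : y ≤ x := hy
    rw [abs_of_nonpos (by linarith), abs_of_nonneg (by linarith), abs_of_nonpos (by linarith)]
    linarith
  · have e : ∫ y in Set.Iic x, sech (c * (y - x₀)) * g y = -∫ y in Set.Ioi x, sech (c * (y - x₀)) * g y := by
      have := intervalIntegral.integral_Iic_add_Ioi (b := x) hi.integrableOn hi.integrableOn
      rw [h0] at this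
      linarith
    unfold sol
    rw [← hg, e, mul_neg, enorm_neg]
    refine main (Set.Ioi x) measurableSet_Ioi fun y hy => ?_
    have hy' : x < y := hy
    rw [abs_of_nonneg (by linarith), abs_of_neg (by linarith), abs_of_pos (by linarith)]
    linarith

lemma exists_abs_proj_le (hc : 0 < c) (hκ : 0 < κ) (x₀ : ℝ) : ∃ C : ℝ, 0 < C ∧ ∀ R, Admissible c R →
    ‖proj c κ x₀ R‖ₑ ≤ ENNReal.ofReal C * expConv c R x₀ := by
  have hq := sechSq_pos (x₀ := x₀) hc
  refine ⟨(κ * sechSq c x₀)⁻¹, by positivity, fun R hR => ?_⟩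
  unfold proj
  rw [enorm_mul, enorm_neg]
  refine mul_le_mul' ?_ ((enorm_integral_le_lintegral_enorm _).trans (lintegral_sech_mul_le hc))
  rw [enorm_real_eq, abs_of_pos (by positivity)]

lemma expConv_corr_le (h : Admissible c R) (x : ℝ) : expConv c (corr c κ x₀ R) x ≤ expConv c R x +
    ‖κ * proj c κ x₀ R‖ₑ * expConv c (fun x => sech (c * (x - x₀))) x := by
  refine (expConv_add_le h.meas x).trans (add_le_add le_rfl (le_of_eq ?_))
  unfold expConv
  rw [← lintegral_const_mul' _ _ enorm_ne_top]
  refine lintegral_congr fun y => ?_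
  rw [enorm_mul]; ring

/-- Sup-norm bounds for the linear problem. -/
lemma exists_abs_sol_le (hc : 0 < c) (hκ : 0 < κ) (x₀ : ℝ) : ∃ C : ℝ, 0 < C ∧ ∀ R, Admissible c R →
    ∀ η : ℝ, 0 ≤ η → (∀ x, expConv c R x ≤ ENNReal.ofReal η) →
      |proj c κ x₀ R| ≤ C * η ∧ ∀ x, |sol c κ x₀ R x| ≤ C * η := by
  obtain ⟨A, hA, ha⟩ := exists_abs_proj_le hc hκ x₀
  obtain ⟨B, hB, hb⟩ := exists_expConv_le_of_bdd hc
  refine ⟨A + 1 + κ * A * B, by positivity, fun R hR η hη h => ?_⟩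
  have h1 : |proj c κ x₀ R| ≤ A * η := by
    rw [← ENNReal.ofReal_le_ofReal_iff (by positivity), ← enorm_real_eq, ENNReal.ofReal_mul hA.le]
    exact (ha R hR).trans (by gcongr; exact h x₀)
  have hp : 0 ≤ κ * A * B * η := by positivity
  refine ⟨h1.trans (by nlinarith), fun x => ?_⟩
  have h2 : |sol c κ x₀ R x| ≤ η + κ * (A * η) * (B * 1) := by
    rw [← ENNReal.ofReal_le_ofReal_iff (by positivity), ← enorm_real_eq,
      ENNReal.ofReal_add hη (by positivity), ENNReal.ofReal_mul (by positivity)]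
    refine (enorm_sol_le hc hκ hR x).trans ((expConv_corr_le hR x).trans ?_)
    refine add_le_add (h x) (mul_le_mul' ?_ (hb _ 1 zero_le_one (fun y => ?_) x))
    · rw [enorm_real_eq, abs_mul, abs_of_pos hκ]
      exact ENNReal.ofReal_le_ofReal (by gcongr)
    · rw [abs_of_pos (sech_pos _)]; exact sech_le_one _
  nlinarith [mul_nonneg hA.le hη]

/-- Weighted `L²` bounds for the linear problem. -/
lemma exists_eLpNorm_sol_le (hc : 0 < c) (hκ : 0 < κ) (x₀ : ℝ) {s : ℝ} (hs : 0 ≤ s) :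
    ∃ C : ℝ, 0 < C ∧ ∀ R, Admissible c R →
      eLpNorm (fun x => wt s x * sol c κ x₀ R x) 2 volume ≤
        ENNReal.ofReal C * eLpNorm (fun x => wt s x * R x) 2 volume := by
  obtain ⟨A, hA, ha⟩ := exists_abs_proj_le hc hκ x₀
  obtain ⟨B, hB, hb⟩ := exists_expConv_le_eLpNorm hc
  -- Moving the weight from `x` to `y` costs half of the exponential decay; Young's inequality is
  -- applied with the other half.
  obtain ⟨W, hW, hw⟩ := exists_wt_le hs (half_pos hc)
  have hk := lintegral_expKer_ne_top (half_pos hc)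
  have hS := (memLp_wt_mul_sech hs hc x₀).2.ne
  set N := eLpNorm (fun x => wt s x * sech (c * (x - x₀))) 2 volume with hN
  set D : ℝ≥0∞ := (ENNReal.ofReal W * ∫⁻ x, expKer (c / 2) x) *
    (1 + ENNReal.ofReal κ * ENNReal.ofReal A * ENNReal.ofReal B * N) with hD
  have hDt : D ≠ ⊤ := by finiteness
  refine ⟨D.toReal + 1, by positivity, fun R hR => ?_⟩
  have hRm : AEStronglyMeasurable (fun x => wt s x * R x) volume :=
    (continuous_wt s).aestronglyMeasurable.mul hR.meas
  have hR2 : eLpNorm R 2 volume ≤ eLpNorm (fun x => wt s x * R x) 2 volume :=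
    eLpNorm_mono fun x => by
      rw [norm_mul, Real.norm_of_nonneg (wt_pos s x).le]
      exact le_mul_of_one_le_left (norm_nonneg _) (one_le_wt hs x)
  have h1 : ‖proj c κ x₀ R‖ₑ ≤ ENNReal.ofReal A * (ENNReal.ofReal B *
      eLpNorm (fun x => wt s x * R x) 2 volume) :=
    (ha R hR).trans (mul_le_mul' le_rfl ((hb R hR.meas x₀).trans (mul_le_mul' le_rfl hR2)))
  have h2 : eLpNorm (fun x => wt s x * corr c κ x₀ R x) 2 volume ≤
      (1 + ENNReal.ofReal κ * ENNReal.ofReal A * ENNReal.ofReal B * N) *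
        eLpNorm (fun x => wt s x * R x) 2 volume := by
    have e : (fun x => wt s x * corr c κ x₀ R x) = (fun x => wt s x * R x) +
        (κ * proj c κ x₀ R) • fun x => wt s x * sech (c * (x - x₀)) := by
      ext x
      simp only [corr, Pi.add_apply, Pi.smul_apply, smul_eq_mul]
      ring
    rw [e]
    refine (eLpNorm_add_le hRm ((memLp_wt_mul_sech hs hc x₀).1.const_smul _) (by norm_num)).trans ?_
    rw [eLpNorm_const_smul, enorm_mul, add_mul, one_mul, enorm_real_eq κ, abs_of_pos hκ]
    refine add_le_add le_rfl ?_
    calc _ ≤ ENNReal.ofReal κ * (ENNReal.ofReal A * (ENNReal.ofReal B *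
          eLpNorm (fun x => wt s x * R x) 2 volume)) * N := by gcongr
      _ = _ := by ring
  have h3 := eLpNorm_le_of_enorm_le_conv (k := fun x => ENNReal.ofReal W * expKer (c / 2) x)
    (v := fun x => wt s x * sol c κ x₀ R x) (w := fun x => wt s x * corr c κ x₀ R x)
    (measurable_const.mul measurable_expKer)
    ((continuous_wt s).aestronglyMeasurable.mul (hR.corr hc κ x₀).meas) fun x => by
      rw [enorm_mul]
      refine (mul_le_mul' le_rfl (enorm_sol_le hc hκ hR x)).trans ?_
      unfold expConv
      rw [← lintegral_const_mul' _ _ (by simp)]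
      refine lintegral_mono fun y => ?_
      simp only
      rw [enorm_mul, ← mul_assoc, ← mul_assoc]
      refine mul_le_mul' ?_ le_rfl
      rw [enorm_real_eq, enorm_real_eq, abs_of_pos (wt_pos _ _), abs_of_pos (wt_pos _ _)]
      unfold expKer
      have := wt_pos s y
      have := wt_pos s x
      rw [← ENNReal.ofReal_mul (by positivity), ← ENNReal.ofReal_mul (by positivity),
        ← ENNReal.ofReal_mul (by positivity)]
      refine ENNReal.ofReal_le_ofReal ?_
      calc _ ≤ W * wt s y * Real.exp (c / 2 * |x - y|) * (2 * Real.exp (-(c * |x - y|))) := by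
            gcongr; exact hw x y
        _ = W * wt s y * 2 * Real.exp (c / 2 * |x - y| + -(c * |x - y|)) := by
            rw [Real.exp_add]; ring
        _ = W * (2 * Real.exp (-(c / 2 * |x - y|))) * wt s y := by ring_nf
        _ ≤ _ := le_rfl
  rw [lintegral_const_mul' _ _ (by simp)] at h3
  calc _ ≤ _ := h3
    _ ≤ (ENNReal.ofReal W * ∫⁻ x, expKer (c / 2) x) * ((1 + ENNReal.ofReal κ * ENNReal.ofReal A *
        ENNReal.ofReal B * N) * eLpNorm (fun x => wt s x * R x) 2 volume) := by gcongr
    _ = D * eLpNorm (fun x => wt s x * R x) 2 volume := by rw [hD]; ring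
    _ ≤ _ := by
      gcongr
      rw [ENNReal.le_ofReal_iff_toReal_le hDt (by positivity)]
      linarith

end Linear

/-! ### The Bäcklund transform at time zero near a kink -/

/-- The remainder of the Bäcklund equation for `φ_x` linearized at a kink, at a point where the kink
takes the value `2θ`. -/
def btRem (a₀ a θ u φ : ℝ) : ℝ :=
  (1 / a₀ - a₀) * Real.sin θ - 1 / a * Real.sin (θ + (u + φ) / 2) + a * Real.sin (θ + (u - φ) / 2)
    + (a₀ + 1 / a₀) / 2 * Real.cos θ * φ - (1 / a₀ ^ 2 + 1) * (a - a₀) * Real.sin θ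

/-- The mean value inequality for `t ↦ sin (θ + t) - t cos θ`, whose derivative is at most `r` in
absolute value on `[-r, r]`. The factor `r` is the source of the contraction. -/
lemma abs_sin_sub_sin_sub_le (θ p q r : ℝ) (hp : |p| ≤ r) (hq : |q| ≤ r) :
    |Real.sin (θ + p) - Real.sin (θ + q) - Real.cos θ * (p - q)| ≤ r * |p - q| := by
  have h := Convex.norm_image_sub_le_of_norm_hasDerivWithin_le (s := Set.Icc (-r) r) (C := r)
    (f := fun t => Real.sin (θ + t) - Real.cos θ * t) (f' := fun t => Real.cos (θ + t) - Real.cos θ)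
    (fun z _ => (by
      have h1 := (Real.hasDerivAt_sin (θ + z)).comp z ((hasDerivAt_id z).const_add θ)
      have h2 := h1.sub ((hasDerivAt_id z).const_mul (Real.cos θ))
      simp only [mul_one] at h2
      exact h2.hasDerivWithinAt))
    (fun z hz => (abs_cos_sub_cos_le _ _).trans (by simpa using abs_le.2 hz))
    (convex_Icc _ _) (abs_le.1 hq) (abs_le.1 hp)
  simp only [Real.norm_eq_abs] at h
  convert h using 2
  ring

section Rem

variable {a₀ : ℝ}

lemma inv_bounds {a r : ℝ} (h0 : 0 < a₀) (hr : r ≤ a₀ / 2) (ha : |a - a₀| ≤ r) :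
    0 < a ∧ a ≤ 2 * a₀ ∧ 1 / a ≤ 2 / a₀ ∧ |1 / a₀ - 1 / a| ≤ 2 / a₀ ^ 2 * |a - a₀| := by
  obtain ⟨h1, h2⟩ := abs_le.1 ha
  have ha0 : 0 < a := by linarith
  have h3 : 1 / a ≤ 2 / a₀ := by rw [div_le_div_iff₀ ha0 h0]; linarith
  refine ⟨ha0, by linarith, h3, ?_⟩
  have : 1 / a₀ - 1 / a = (a - a₀) * (1 / a₀ * (1 / a)) := by field_simp
  rw [this, abs_mul, mul_comm, abs_of_pos (by positivity)]
  gcongr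
  calc 1 / a₀ * (1 / a) ≤ 1 / a₀ * (2 / a₀) := by gcongr
    _ = _ := by ring

/-- The remainder has no linear part in `(φ, a - a₀)` at `u = 0`, so its Lipschitz constant on the
ball of radius `r` is of order `r`. The two variables are changed one after the other. -/
lemma exists_btRem_lipschitz (h0 : 0 < a₀) : ∃ C : ℝ, 0 < C ∧ ∀ r a a' θ u φ φ' : ℝ, r ≤ a₀ / 2 →
    |a - a₀| ≤ r → |a' - a₀| ≤ r → |u| ≤ r → |φ| ≤ r → |φ'| ≤ r →
    |btRem a₀ a θ u φ - btRem a₀ a' θ u φ'| ≤ C * r * (|φ - φ'| + |a - a'|) := by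
  refine ⟨1 / a₀ + a₀ + 1 + 1 / a₀ ^ 2 + (4 / a₀ ^ 2 + 12 / a₀ ^ 3 + 1), by positivity, ?_⟩
  intro r a a' θ u φ φ' hr ha ha' hu hφ hφ'
  have hr0 : 0 ≤ r := (abs_nonneg _).trans ha
  obtain ⟨p1, p2, p3, p4⟩ := inv_bounds h0 hr ha
  obtain ⟨q1, q2, q3, q4⟩ := inv_bounds h0 hr ha'
  have half : ∀ u φ : ℝ, |u| ≤ r → |φ| ≤ r → |(u + φ) / 2| ≤ r ∧ |(u - φ) / 2| ≤ r := by
    intro u φ hu hφ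
    rw [abs_le] at *
    rw [abs_le]
    constructor <;> constructor <;> linarith [hu.1, hu.2, hφ.1, hφ.2]
  have e1 := abs_sin_sub_sin_sub_le θ _ _ r (half u φ hu hφ).1 (half u φ' hu hφ').1
  have e2 := abs_sin_sub_sin_sub_le θ _ _ r (half u φ hu hφ).2 (half u φ' hu hφ').2
  rw [show (u + φ) / 2 - (u + φ') / 2 = (φ - φ') / 2 by ring, abs_div, abs_two] at e1
  rw [show (u - φ) / 2 - (u - φ') / 2 = -((φ - φ') / 2) by ring, abs_neg, abs_div, abs_two] at e2
  set D := |φ - φ'| with hD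
  have hD0 : 0 ≤ D := abs_nonneg _
  have first : |btRem a₀ a θ u φ - btRem a₀ a θ u φ'| ≤ (1 / a₀ + a₀ + 1 + 1 / a₀ ^ 2) * r * D := by
    -- Two Taylor remainders of the sine, and the error from replacing `a + 1/a` by `a₀ + 1/a₀` in
    -- the linear coefficient.
    have e : btRem a₀ a θ u φ - btRem a₀ a θ u φ' =
        -(1 / a * (Real.sin (θ + (u + φ) / 2) - Real.sin (θ + (u + φ') / 2) -
          Real.cos θ * ((φ - φ') / 2))) +
        a * (Real.sin (θ + (u - φ) / 2) - Real.sin (θ + (u - φ') / 2) -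
          Real.cos θ * (-((φ - φ') / 2))) +
        Real.cos θ * ((φ - φ') / 2) * ((a₀ - a) + (1 / a₀ - 1 / a)) := by
      unfold btRem; ring
    rw [e]
    refine (abs_add_le _ _).trans ((add_le_add (abs_add_le _ _) le_rfl).trans ?_)
    rw [abs_neg, abs_mul, abs_mul a, abs_mul, abs_mul, abs_div _ (2 : ℝ), abs_two,
      abs_of_pos p1, abs_of_pos (one_div_pos.2 p1), ← hD]
    have h1 : 1 / a * |Real.sin (θ + (u + φ) / 2) - Real.sin (θ + (u + φ') / 2) -
          Real.cos θ * ((φ - φ') / 2)| ≤ 2 / a₀ * (r * (D / 2)) := by gcongr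
    have h2 : a * |Real.sin (θ + (u - φ) / 2) - Real.sin (θ + (u - φ') / 2) -
          Real.cos θ * (-((φ - φ') / 2))| ≤ 2 * a₀ * (r * (D / 2)) := by gcongr
    have h3 : |(a₀ - a) + (1 / a₀ - 1 / a)| ≤ r + 2 / a₀ ^ 2 * r := by
      refine (abs_add_le _ _).trans (add_le_add (by rwa [abs_sub_comm]) (p4.trans ?_))
      gcongr
    have h4 : |Real.cos θ| * (D / 2) * |(a₀ - a) + (1 / a₀ - 1 / a)| ≤
        1 * (D / 2) * (r + 2 / a₀ ^ 2 * r) := by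
      gcongr
      exact Real.abs_cos_le_one θ
    have h5 : 0 ≤ r * D := by positivity
    calc _ ≤ 2 / a₀ * (r * (D / 2)) + 2 * a₀ * (r * (D / 2)) + 1 * (D / 2) * (r + 2 / a₀ ^ 2 * r) :=
          add_le_add (add_le_add h1 h2) h4
      _ = (1 / a₀ + a₀ + 1 / 2 + 1 / a₀ ^ 2) * (r * D) := by field_simp; ring
      _ ≤ (1 / a₀ + a₀ + 1 + 1 / a₀ ^ 2) * (r * D) := by gcongr; norm_num
      _ = _ := by ring
  have second : |btRem a₀ a θ u φ' - btRem a₀ a' θ u φ'| ≤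
      (4 / a₀ ^ 2 + 12 / a₀ ^ 3 + 1) * r * |a - a'| := by
    set p := (u + φ') / 2 with hp
    set q := (u - φ') / 2 with hq
    have hpr : |p| ≤ r := (half u φ' hu hφ').1
    have hqr : |q| ≤ r := (half u φ' hu hφ').2
    -- After factoring out `a - a'`, the bracket vanishes for `p = q = 0` and `a = a' = a₀`.
    have e : btRem a₀ a θ u φ' - btRem a₀ a' θ u φ' =
        (1 / a * (1 / a') * (Real.sin (θ + p) - Real.sin θ) +
          (1 / a * (1 / a') - 1 / a₀ ^ 2) * Real.sin θ
          + (Real.sin (θ + q) - Real.sin θ)) * (a - a') := by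
      unfold btRem
      rw [← hp, ← hq]
      field_simp
      ring
    rw [e, abs_mul]
    refine mul_le_mul_of_nonneg_right ?_ (abs_nonneg _)
    have h1 : |Real.sin (θ + p) - Real.sin θ| ≤ r := (abs_sin_sub_sin_le _ _).trans (by simpa using hpr)
    have h2 : |Real.sin (θ + q) - Real.sin θ| ≤ r := (abs_sin_sub_sin_le _ _).trans (by simpa using hqr)
    have h3 : 1 / a * (1 / a') ≤ 2 / a₀ * (2 / a₀) := by gcongr
    have h4 : |1 / a * (1 / a') - 1 / a₀ ^ 2| ≤ 12 / a₀ ^ 3 * r := by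
      have e3 : 1 / a * (1 / a') - 1 / a₀ ^ 2 = 1 / a * (1 / a' - 1 / a₀) + 1 / a₀ * (1 / a - 1 / a₀) := by
        ring
      rw [e3]
      refine (abs_add_le _ _).trans ?_
      rw [abs_mul, abs_mul, abs_of_pos (one_div_pos.2 p1), abs_of_pos (one_div_pos.2 h0),
        abs_sub_comm, abs_sub_comm (1 / a)]
      calc _ ≤ 2 / a₀ * (2 / a₀ ^ 2 * r) + 1 / a₀ * (2 / a₀ ^ 2 * r) := by
            gcongr
            · exact q4.trans (by gcongr)
            · exact p4.trans (by gcongr)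
        _ = 6 / a₀ ^ 3 * r := by field_simp; ring
        _ ≤ _ := by gcongr; norm_num
    refine (abs_add_le _ _).trans ((add_le_add (abs_add_le _ _) h2).trans ?_)
    rw [abs_mul (1 / a * (1 / a')), abs_mul _ (Real.sin θ),
      abs_of_pos (mul_pos (one_div_pos.2 p1) (one_div_pos.2 q1))]
    calc _ ≤ 2 / a₀ * (2 / a₀) * r + 12 / a₀ ^ 3 * r * 1 + r := by
          gcongr
          exact Real.abs_sin_le_one θ
      _ = _ := by ring
  have hA : 0 ≤ |a - a'| := abs_nonneg _
  calc _ = |(btRem a₀ a θ u φ - btRem a₀ a θ u φ') + (btRem a₀ a θ u φ' - btRem a₀ a' θ u φ')| := by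
        ring_nf
    _ ≤ _ := abs_add_le _ _
    _ ≤ _ := add_le_add first second
    _ ≤ _ := by
      have k1 : 0 ≤ (1 / a₀ + a₀ + 1 + 1 / a₀ ^ 2) * r * |a - a'| := by positivity
      have k2 : 0 ≤ (4 / a₀ ^ 2 + 12 / a₀ ^ 3 + 1) * r * D := by positivity
      linarith

/-- The term that is quadratic in `a - a₀` alone carries the factor `sin θ`, which is `sech` at the
kink. Hence every term lies in the weighted `L²` space; a bound by constants would not suffice
there. -/
lemma exists_abs_btRem_le (h0 : 0 < a₀) : ∃ C : ℝ, 0 < C ∧ ∀ r a θ u φ : ℝ, r ≤ a₀ / 2 →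
    |a - a₀| ≤ r → |u| ≤ r → |φ| ≤ r →
    |btRem a₀ a θ u φ| ≤ C * (|u| + r * |φ| + r * |a - a₀| * |Real.sin θ|) := by
  obtain ⟨C, hC, h⟩ := exists_btRem_lipschitz h0
  refine ⟨C + (1 / a₀ + a₀) + 2 / a₀ ^ 3, by positivity, ?_⟩
  intro r a θ u φ hr ha hu hφ
  have hr0 : 0 ≤ r := (abs_nonneg _).trans ha
  obtain ⟨p1, p2, p3, p4⟩ := inv_bounds h0 hr ha
  have h1 := h r a a θ u φ 0 hr ha ha hu hφ (by simpa using hr0)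
  rw [sub_zero, sub_self, abs_zero, add_zero] at h1
  have h2 : |btRem a₀ a θ u 0 - btRem a₀ a θ 0 0| ≤ (1 / a₀ + a₀) * |u| := by
    have e : btRem a₀ a θ u 0 - btRem a₀ a θ 0 0 = -(1 / a * (Real.sin (θ + u / 2) - Real.sin θ)) +
        a * (Real.sin (θ + u / 2) - Real.sin θ) := by unfold btRem; ring_nf
    have h3 : |Real.sin (θ + u / 2) - Real.sin θ| ≤ |u| / 2 :=
      (abs_sin_sub_sin_le _ _).trans (by simp [abs_div])
    rw [e]
    refine (abs_add_le _ _).trans ?_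
    rw [abs_neg, abs_mul, abs_mul, abs_of_pos p1, abs_of_pos (one_div_pos.2 p1)]
    calc _ ≤ 2 / a₀ * (|u| / 2) + 2 * a₀ * (|u| / 2) := by gcongr
      _ = _ := by ring
  have h4 : |btRem a₀ a θ 0 0| ≤ 2 / a₀ ^ 3 * (r * |a - a₀| * |Real.sin θ|) := by
    have e : btRem a₀ a θ 0 0 = 1 / a₀ * (1 / a - 1 / a₀) * (a - a₀) * Real.sin θ := by
      unfold btRem
      simp only [add_zero, sub_zero, zero_div, mul_zero]
      field_simp
      ring
    rw [e, abs_mul, abs_mul, abs_mul, abs_of_pos (one_div_pos.2 h0), abs_sub_comm]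
    calc _ ≤ 1 / a₀ * (2 / a₀ ^ 2 * r) * |a - a₀| * |Real.sin θ| := by
          gcongr
          exact p4.trans (by gcongr)
      _ = _ := by field_simp
  have k1 : 0 ≤ r * |φ| := by positivity
  have k2 : 0 ≤ r * |a - a₀| * |Real.sin θ| := by positivity
  have k3 := abs_nonneg u
  have k4 : 0 < 1 / a₀ + a₀ := by positivity
  have k5 : 0 < 2 / a₀ ^ 3 := by positivity
  calc _ = |(btRem a₀ a θ u φ - btRem a₀ a θ u 0) + ((btRem a₀ a θ u 0 - btRem a₀ a θ 0 0) +
        btRem a₀ a θ 0 0)| := by ring_nf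
    _ ≤ _ := (abs_add_le _ _).trans (add_le_add h1 ((abs_add_le _ _).trans (add_le_add h2 h4)))
    _ ≤ _ := by
      nlinarith [mul_nonneg k4.le k1, mul_nonneg k4.le k2, mul_nonneg k5.le k1, mul_nonneg k5.le k3,
        mul_nonneg hC.le k3, mul_nonneg hC.le k2]

lemma btRem_bdd (a₀ a : ℝ) {M : ℝ} : ∃ C, ∀ θ u φ, |φ| ≤ M → |btRem a₀ a θ u φ| ≤ C := by
  refine ⟨|1 / a₀ - a₀| * 1 + |1 / a| * 1 + |a| * 1 + |(a₀ + 1 / a₀) / 2| * 1 * M +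
    |(1 / a₀ ^ 2 + 1) * (a - a₀)| * 1, fun θ u φ hφ => ?_⟩
  unfold btRem
  refine (abs_sub _ _).trans (add_le_add ((abs_add_le _ _).trans (add_le_add
    ((abs_add_le _ _).trans (add_le_add ((abs_sub _ _).trans (add_le_add ?_ ?_)) ?_)) ?_)) ?_)
  · rw [abs_mul]; gcongr; exact Real.abs_sin_le_one _
  · rw [abs_mul]; gcongr; exact Real.abs_sin_le_one _
  · rw [abs_mul]; gcongr; exact Real.abs_sin_le_one _
  · rw [abs_mul, abs_mul]; gcongr; exact Real.abs_cos_le_one _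
  · rw [abs_mul]; gcongr; exact Real.abs_sin_le_one _

end Rem

/-! ### The fixed point argument for the initial value of `φ` and the Bäcklund parameter. -/

section FixedPoint

/-- The rate `(a + 1/a)/2` of the kink with Bäcklund parameter `a`. -/
def rate (a : ℝ) : ℝ := (a + 1 / a) / 2

lemma rate_pos {a : ℝ} (ha : 0 < a) : 0 < rate a := by unfold rate; positivity

/-- The coefficient of the variation of the Bäcklund parameter. -/
def paramCoeff (a : ℝ) : ℝ := 1 / a ^ 2 + 1

lemma paramCoeff_pos (a : ℝ) : 0 < paramCoeff a := by unfold paramCoeff; positivity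

variable {a₀ x₀ a b b' : ℝ} {u₀ u₁ φ ψ φ' ψ' : ℝ → ℝ}

/-- The source term of the Bäcklund equation for `φ_x` at time zero linearized at a kink. -/
def btSource (a₀ x₀ : ℝ) (u₀ u₁ : ℝ → ℝ) (a : ℝ) (φ : ℝ → ℝ) (x : ℝ) : ℝ :=
  u₁ x + btRem a₀ a (profile (rate a₀ * (x - x₀)) / 2) (u₀ x) (φ x)

/-- The Bäcklund equation at time zero for `φ` with derivative `φ'` and parameter `a₀ + b`, in
linearized form. -/
def IsBTSol (a₀ x₀ : ℝ) (u₀ u₁ : ℝ → ℝ) (b : ℝ) (φ φ' : ℝ → ℝ) : Prop :=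
  HasACDeriv φ φ' ∧ ∀ᵐ x, φ' x = rate a₀ * tanh (rate a₀ * (x - x₀)) * φ x +
    btSource a₀ x₀ u₀ u₁ (a₀ + b) φ x + paramCoeff a₀ * b * sech (rate a₀ * (x - x₀))

lemma continuous_btRem (hu : Continuous u₀) (hφ : Continuous φ) :
    Continuous fun x => btRem a₀ a (profile (rate a₀ * (x - x₀)) / 2) (u₀ x) (φ x) := by
  have := continuous_profile
  unfold btRem
  fun_prop

lemma admissible_btRem (h0 : 0 < a₀) (hu : Continuous u₀) (hφ : Continuous φ) {M : ℝ}
    (hM : ∀ x, |φ x| ≤ M) : Admissible (rate a₀)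
      fun x => btRem a₀ a (profile (rate a₀ * (x - x₀)) / 2) (u₀ x) (φ x) := by
  obtain ⟨C, hC⟩ := btRem_bdd a₀ a (M := M)
  exact .of_bdd (rate_pos h0) (continuous_btRem hu hφ).aestronglyMeasurable fun x => hC _ _ _ (hM x)

lemma admissible_btSource (h0 : 0 < a₀) (hu : Continuous u₀)
    (hu₁ : MemLp u₁ 2 (volume : Measure ℝ)) (hφ : Continuous φ) {M : ℝ} (hM : ∀ x, |φ x| ≤ M) :
    Admissible (rate a₀) (btSource a₀ x₀ u₀ u₁ a φ) :=
  (Admissible.of_memLp (rate_pos h0) hu₁).add (admissible_btRem h0 hu hφ hM)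

/-- Contraction estimate for the Bäcklund equation at time zero. -/
lemma exists_btSource_contraction (h0 : 0 < a₀) (x₀ : ℝ) : ∃ r₀ : ℝ, 0 < r₀ ∧ ∀ r, r ≤ r₀ →
    ∀ u₀ u₁ : ℝ → ℝ, Continuous u₀ →
    (∀ x, |u₀ x| ≤ r) → MemLp u₁ 2 (volume : Measure ℝ) → ∀ (φ ψ : ℝ → ℝ) (b b' D : ℝ),
    Continuous φ → Continuous ψ → (∀ x, |φ x| ≤ r) → (∀ x, |ψ x| ≤ r) → |b| ≤ r → |b'| ≤ r →
    (∀ x, |φ x - ψ x| ≤ D) → |b - b'| ≤ D →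
    |proj (rate a₀) (paramCoeff a₀) x₀ (btSource a₀ x₀ u₀ u₁ (a₀ + b) φ) -
      proj (rate a₀) (paramCoeff a₀) x₀ (btSource a₀ x₀ u₀ u₁ (a₀ + b') ψ)| ≤ D / 2 ∧
    ∀ x, |sol (rate a₀) (paramCoeff a₀) x₀ (btSource a₀ x₀ u₀ u₁ (a₀ + b) φ) x -
      sol (rate a₀) (paramCoeff a₀) x₀ (btSource a₀ x₀ u₀ u₁ (a₀ + b') ψ) x| ≤ D / 2 := by
  have hc := rate_pos h0
  obtain ⟨A, hA, ha⟩ := exists_abs_sol_le hc (paramCoeff_pos a₀) x₀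
  obtain ⟨B, hB, hb⟩ := exists_expConv_le_of_bdd hc
  obtain ⟨L, hL, hl⟩ := exists_btRem_lipschitz h0
  -- The three estimates compose to `2 A B L r D`, which is at most `D / 2` for this radius.
  refine ⟨min (a₀ / 2) (1 / (4 * (A * B * L))), by positivity, ?_⟩
  intro r hr u₀ u₁ hu hur hu₁ φ ψ b b' D hφ hψ hφr hψr hbr hbr' hD hDb
  have hr1 := hr.trans (min_le_left _ _)
  have hr2 := hr.trans (min_le_right _ _)
  have hr0 : 0 ≤ r := (abs_nonneg _).trans hbr
  have hD0 : 0 ≤ D := (abs_nonneg _).trans hDb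
  have s1 := admissible_btSource (x₀ := x₀) (a := a₀ + b) h0 hu hu₁ hφ hφr
  have s2 := admissible_btSource (x₀ := x₀) (a := a₀ + b') h0 hu hu₁ hψ hψr
  have hbd : ∀ x, |btSource a₀ x₀ u₀ u₁ (a₀ + b) φ x - btSource a₀ x₀ u₀ u₁ (a₀ + b') ψ x| ≤
      L * r * (2 * D) := by
    intro x
    have h1 := hl r (a₀ + b) (a₀ + b') (profile (rate a₀ * (x - x₀)) / 2) (u₀ x) (φ x) (ψ x) hr1
      (by simpa using hbr) (by simpa using hbr') (hur x) (hφr x) (hψr x)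
    unfold btSource
    rw [add_sub_add_left_eq_sub]
    refine h1.trans ?_
    gcongr
    rw [add_sub_add_left_eq_sub]
    linarith [hD x]
  have h2 := hb _ _ (by positivity) hbd
  have h3 := ha _ (s1.sub s2) _ (by positivity) h2
  rw [proj_sub hc s1 s2] at h3
  simp only [sol_sub hc s1 s2] at h3
  have h4 : A * (B * (L * r * (2 * D))) ≤ D / 2 := by
    have : r * (4 * (A * B * L)) ≤ 1 := by rwa [← le_div_iff₀ (by positivity)]
    nlinarith
  exact ⟨h3.1.trans h4, fun x => (h3.2 x).trans h4⟩

/-- Uniqueness of the small solution of the Bäcklund equation at time zero. -/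
lemma exists_btSol_unique (h0 : 0 < a₀) (x₀ : ℝ) : ∃ r : ℝ, 0 < r ∧ ∀ u₀ u₁ : ℝ → ℝ, Continuous u₀ →
    (∀ x, |u₀ x| ≤ r) → MemLp u₁ 2 (volume : Measure ℝ) → ∀ (φ φ' ψ ψ' : ℝ → ℝ) (b b' : ℝ),
    IsBTSol a₀ x₀ u₀ u₁ b φ φ' → IsBTSol a₀ x₀ u₀ u₁ b' ψ ψ' → (∀ x, |φ x| ≤ r) → (∀ x, |ψ x| ≤ r) →
    |b| ≤ r → |b'| ≤ r → b = b' ∧ φ = ψ := by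
  obtain ⟨r, hr, h⟩ := exists_btSource_contraction h0 x₀
  refine ⟨r, hr, fun u₀ u₁ hu hur hu₁ φ φ' ψ ψ' b b' hφ hψ hφr hψr hbr hbr' => ?_⟩
  have hc := rate_pos h0
  have hκ := paramCoeff_pos a₀
  obtain ⟨p1, p2⟩ := eq_sol hc hκ (admissible_btSource h0 hu hu₁ hφ.1.continuous hφr) hφ.1 hφr hφ.2
  obtain ⟨q1, q2⟩ := eq_sol hc hκ (admissible_btSource h0 hu hu₁ hψ.1.continuous hψr) hψ.1 hψr hψ.2
  have step : ∀ D, (∀ x, |φ x - ψ x| ≤ D) → |b - b'| ≤ D →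
      (∀ x, |φ x - ψ x| ≤ D / 2) ∧ |b - b'| ≤ D / 2 := by
    intro D h1 h2
    obtain ⟨k1, k2⟩ := h r le_rfl u₀ u₁ hu hur hu₁ φ ψ b b' D hφ.1.continuous hψ.1.continuous hφr hψr
      hbr hbr' h1 h2
    rw [← p1, ← q1] at k1
    simp only [← p2, ← q2] at k2
    exact ⟨k2, k1⟩
  -- By `eq_sol` both pairs are fixed points of the solution map, so the a priori distance `2r` can
  -- be halved indefinitely.
  have iter : ∀ n : ℕ, (∀ x, |φ x - ψ x| ≤ 2 * r * (1 / 2) ^ n) ∧ |b - b'| ≤ 2 * r * (1 / 2) ^ n := by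
    intro n
    induction n with
    | zero =>
      constructor
      · intro x; have := abs_sub (φ x) (ψ x); have := hφr x; have := hψr x; simp only [pow_zero]; linarith
      · have := abs_sub b b'; simp only [pow_zero]; linarith
    | succ n ih =>
      have e : 2 * r * (1 / 2 : ℝ) ^ (n + 1) = 2 * r * (1 / 2) ^ n / 2 := by ring
      rw [e]
      exact step _ ih.1 ih.2
  have lim : Tendsto (fun n : ℕ => 2 * r * (1 / 2 : ℝ) ^ n) atTop (𝓝 0) := by
    simpa using (tendsto_pow_atTop_nhds_zero_of_lt_one (by norm_num : (0 : ℝ) ≤ 1 / 2)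
      (by norm_num)).const_mul (2 * r)
  constructor
  · have := ge_of_tendsto' lim fun n => (iter n).2
    exact sub_eq_zero.1 (abs_nonpos_iff.1 this)
  · ext x
    have := ge_of_tendsto' lim fun n => (iter n).1 x
    exact sub_eq_zero.1 (abs_nonpos_iff.1 this)

/-- Bounds for the linear solution operator applied to the source term. -/
lemma exists_btSource_bounds (h0 : 0 < a₀) (x₀ : ℝ) {s : ℝ} (hs : 0 ≤ s) : ∃ K : ℝ, 0 < K ∧
    ∀ r, r ≤ a₀ / 2 → ∀ u₀ u₁ : ℝ → ℝ, Continuous u₀ → MemLp u₁ 2 (volume : Measure ℝ) →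
    ∀ (η : ℝ), 0 ≤ η → η ≤ r → (∀ x, |u₀ x| ≤ η) → eLpNorm u₁ 2 volume ≤ ENNReal.ofReal η →
    ∀ (φ : ℝ → ℝ) (b μ : ℝ), Continuous φ → μ ≤ r → (∀ x, |φ x| ≤ μ) → |b| ≤ μ →
    (|proj (rate a₀) (paramCoeff a₀) x₀ (btSource a₀ x₀ u₀ u₁ (a₀ + b) φ)| ≤ K * (η + r * μ) ∧
    ∀ x, |sol (rate a₀) (paramCoeff a₀) x₀ (btSource a₀ x₀ u₀ u₁ (a₀ + b) φ) x| ≤ K * (η + r * μ)) ∧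
    ∀ n, 0 ≤ n → eLpNorm (fun x => wt s x * u₀ x) 2 volume ≤ ENNReal.ofReal η →
      eLpNorm (fun x => wt s x * u₁ x) 2 volume ≤ ENNReal.ofReal η →
      eLpNorm (fun x => wt s x * φ x) 2 volume ≤ ENNReal.ofReal n →
      eLpNorm (fun x => wt s x *
        sol (rate a₀) (paramCoeff a₀) x₀ (btSource a₀ x₀ u₀ u₁ (a₀ + b) φ) x) 2 volume ≤
        ENNReal.ofReal (K * (η + r * n + r * μ)) := by
  have hc := rate_pos h0
  have hκ := paramCoeff_pos a₀
  obtain ⟨A, hA, ha⟩ := exists_abs_sol_le hc hκ x₀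
  obtain ⟨B, hB, hb⟩ := exists_expConv_le_of_bdd hc
  obtain ⟨B', hB', hb'⟩ := exists_expConv_le_eLpNorm hc
  obtain ⟨L, hL, hl⟩ := exists_abs_btRem_le h0
  obtain ⟨W, hW, hw⟩ := exists_eLpNorm_sol_le hc hκ x₀ hs
  have hSm := memLp_wt_mul_sech hs hc x₀
  set N := (eLpNorm (fun x => wt s x * sech (rate a₀ * (x - x₀))) 2 volume).toReal with hN
  have hN0 : 0 ≤ N := ENNReal.toReal_nonneg
  have hN' : eLpNorm (fun x => wt s x * sech (rate a₀ * (x - x₀))) 2 volume = ENNReal.ofReal N :=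
    (ENNReal.ofReal_toReal hSm.2.ne).symm
  refine ⟨A * (B' + B * L * 2) + W * (1 + L + L * N), by positivity, ?_⟩
  intro r hr u₀ u₁ hu hu₁ η hη hηr hu0 hu1 φ b μ hφ hμr hφμ hbμ
  have hμ0 : 0 ≤ μ := (abs_nonneg _).trans hbμ
  have hr0 : 0 ≤ r := hη.trans hηr
  have hadm := admissible_btSource (x₀ := x₀) (a := a₀ + b) h0 hu hu₁ hφ hφμ
  -- One pointwise bound serves twice: with `sech ≤ 1` for the sup norm, and as it stands for the
  -- weighted `L²` norm.
  have pt : ∀ x, |btRem a₀ (a₀ + b) (profile (rate a₀ * (x - x₀)) / 2) (u₀ x) (φ x)| ≤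
      L * (|u₀ x| + r * |φ x| + r * μ * sech (rate a₀ * (x - x₀))) := by
    intro x
    have h1 := hl r (a₀ + b) (profile (rate a₀ * (x - x₀)) / 2) (u₀ x) (φ x) hr
      (by simpa using hbμ.trans hμr) ((hu0 x).trans hηr) ((hφμ x).trans hμr)
    rw [sin_half_profile, abs_of_pos (sech_pos _), add_sub_cancel_left] at h1
    refine h1.trans ?_
    have := (sech_pos (rate a₀ * (x - x₀))).le
    gcongr
  have pt2 : ∀ x, |btRem a₀ (a₀ + b) (profile (rate a₀ * (x - x₀)) / 2) (u₀ x) (φ x)| ≤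
      L * (η + r * μ + r * μ * 1) := fun x => (pt x).trans (by
    gcongr
    · exact hu0 x
    · exact hφμ x
    · exact sech_le_one _)
  have e1 : ∀ x, expConv (rate a₀) (btSource a₀ x₀ u₀ u₁ (a₀ + b) φ) x ≤
      ENNReal.ofReal ((B' + B * L * 2) * (η + r * μ)) := by
    intro x
    refine (expConv_add_le hu₁.1 x).trans ((add_le_add ((hb' u₁ hu₁.1 x).trans
      (mul_le_mul' le_rfl hu1)) (hb _ _ (by positivity) pt2 x)).trans ?_)
    rw [← ENNReal.ofReal_mul hB'.le, ← ENNReal.ofReal_add (by positivity) (by positivity)]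
    refine ENNReal.ofReal_le_ofReal ?_
    have : 0 ≤ B' * (r * μ) := by positivity
    have : 0 ≤ B * L * η := by positivity
    nlinarith
  have e2 := ha _ hadm _ (by positivity) e1
  have e3 : A * ((B' + B * L * 2) * (η + r * μ)) ≤
      (A * (B' + B * L * 2) + W * (1 + L + L * N)) * (η + r * μ) := by
    rw [← mul_assoc]
    refine mul_le_mul_of_nonneg_right (le_add_of_nonneg_right (by positivity)) (by positivity)
  refine ⟨⟨e2.1.trans e3, fun x => (e2.2 x).trans e3⟩, fun n hn w0 w1 wφ => ?_⟩
  have hφm : AEStronglyMeasurable (fun x => wt s x * φ x) volume :=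
    ((continuous_wt s).mul hφ).aestronglyMeasurable
  have hum : AEStronglyMeasurable (fun x => wt s x * u₀ x) volume :=
    ((continuous_wt s).mul hu).aestronglyMeasurable
  have hu1m : AEStronglyMeasurable (fun x => wt s x * u₁ x) volume :=
    (continuous_wt s).aestronglyMeasurable.mul hu₁.1
  have hrem : eLpNorm (fun x => wt s x *
      btRem a₀ (a₀ + b) (profile (rate a₀ * (x - x₀)) / 2) (u₀ x) (φ x)) 2 volume ≤
      ENNReal.ofReal (L * (η + r * n + r * μ * N)) := by
    have f1 : eLpNorm (fun x => wt s x *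
      btRem a₀ (a₀ + b) (profile (rate a₀ * (x - x₀)) / 2) (u₀ x) (φ x)) 2 volume ≤
      eLpNorm (L • ((fun x => ‖wt s x * u₀ x‖) + r • (fun x => ‖wt s x * φ x‖) +
        (r * μ) • (fun x => wt s x * sech (rate a₀ * (x - x₀))))) 2 volume := by
      refine eLpNorm_mono_real fun x => ?_
      simp only [Pi.smul_apply, Pi.add_apply, smul_eq_mul, norm_mul, Real.norm_eq_abs,
        abs_of_pos (wt_pos s x)]
      have h1 := mul_le_mul_of_nonneg_left (pt x) (wt_pos s x).le
      refine h1.trans (le_of_eq ?_)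
      ring
    refine f1.trans ?_
    rw [eLpNorm_const_smul]
    have f2 := eLpNorm_add_le (μ := volume) (p := 2) (hum.norm.add (hφm.norm.const_smul r))
      (hSm.1.const_smul (r * μ)) (by norm_num)
    have f3 := eLpNorm_add_le (μ := volume) (p := 2) hum.norm (hφm.norm.const_smul r) (by norm_num)
    rw [eLpNorm_const_smul, eLpNorm_norm, eLpNorm_norm] at f3
    rw [eLpNorm_const_smul] at f2
    calc _ ≤ ‖L‖ₑ * ((eLpNorm (fun x => wt s x * u₀ x) 2 volume +
          ‖r‖ₑ * eLpNorm (fun x => wt s x * φ x) 2 volume) +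
          ‖r * μ‖ₑ * eLpNorm (fun x => wt s x * sech (rate a₀ * (x - x₀))) 2 volume) :=
          mul_le_mul' le_rfl (f2.trans (add_le_add f3 le_rfl))
      _ ≤ ENNReal.ofReal L * ((ENNReal.ofReal η + ENNReal.ofReal r * ENNReal.ofReal n) +
          ENNReal.ofReal (r * μ) * ENNReal.ofReal N) := by
          rw [hN', enorm_real_eq, enorm_real_eq, enorm_real_eq, abs_of_pos hL, abs_of_nonneg hr0,
            abs_of_nonneg (by positivity)]
          gcongr
      _ = _ := by
          rw [← ENNReal.ofReal_mul hr0, ← ENNReal.ofReal_mul (by positivity),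
            ← ENNReal.ofReal_add (by positivity) (by positivity),
            ← ENNReal.ofReal_add (by positivity) (by positivity), ← ENNReal.ofReal_mul hL.le]
  have hsrc : eLpNorm (fun x => wt s x * btSource a₀ x₀ u₀ u₁ (a₀ + b) φ x) 2 volume ≤
      ENNReal.ofReal η + ENNReal.ofReal (L * (η + r * n + r * μ * N)) := by
    have e : (fun x => wt s x * btSource a₀ x₀ u₀ u₁ (a₀ + b) φ x) = (fun x => wt s x * u₁ x) +
        fun x => wt s x * btRem a₀ (a₀ + b) (profile (rate a₀ * (x - x₀)) / 2) (u₀ x) (φ x) := by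
      ext x; simp only [btSource, Pi.add_apply]; ring
    rw [e]
    refine (eLpNorm_add_le hu1m ((continuous_wt s).mul
      (continuous_btRem hu hφ)).aestronglyMeasurable (by norm_num)).trans (add_le_add w1 hrem)
  refine (hw _ hadm).trans ((mul_le_mul' le_rfl hsrc).trans ?_)
  rw [← ENNReal.ofReal_add hη (by positivity), ← ENNReal.ofReal_mul hW.le]
  refine ENNReal.ofReal_le_ofReal ?_
  have hrn : 0 ≤ r * n := by positivity
  have hrμ : 0 ≤ r * μ := by positivity
  calc W * (η + L * (η + r * n + r * μ * N)) ≤ W * (1 + L + L * N) * (η + r * n + r * μ) := by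
        have : 0 ≤ η + r * n + r * μ + L * r * μ + L * N * (η + r * n) - η := by
          have : 0 ≤ L * r * μ + L * N * (η + r * n) := by positivity
          linarith
        rw [mul_assoc W]
        refine mul_le_mul_of_nonneg_left ?_ hW.le
        nlinarith
    _ ≤ _ := by
        refine mul_le_mul_of_nonneg_right (le_add_of_nonneg_left (by positivity)) (by positivity)

/-- Existence of a small solution of the Bäcklund equation at time zero. -/
lemma exists_btSol (h0 : 0 < a₀) (x₀ : ℝ) {s : ℝ} (hs : 0 ≤ s) : ∃ r C : ℝ, 0 < r ∧ 0 < C ∧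
    ∀ (u₀ u₁ : ℝ → ℝ) (η : ℝ), Continuous u₀ → MemLp u₁ 2 (volume : Measure ℝ) → 0 ≤ η → η ≤ r →
    (∀ x, |u₀ x| ≤ η) → eLpNorm (fun x => wt s x * u₀ x) 2 volume ≤ ENNReal.ofReal η →
    eLpNorm (fun x => wt s x * u₁ x) 2 volume ≤ ENNReal.ofReal η →
    ∃ (b : ℝ) (φ φ' : ℝ → ℝ), IsBTSol a₀ x₀ u₀ u₁ b φ φ' ∧ |b| ≤ C * η ∧ (∀ x, |φ x| ≤ C * η) ∧
      eLpNorm (fun x => wt s x * φ x) 2 volume ≤ ENNReal.ofReal (C * η) := by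
  obtain ⟨r₀, hr₀, hcon⟩ := exists_btSource_contraction h0 x₀
  obtain ⟨K, hK, hbd⟩ := exists_btSource_bounds h0 x₀ hs
  have hc := rate_pos h0
  have hκ := paramCoeff_pos a₀
  set r := min (min r₀ (a₀ / 2)) (min 1 (1 / (8 * K))) with hr
  have hrp : 0 < r := by positivity
  have r1 : r ≤ r₀ := (min_le_left _ _).trans (min_le_left _ _)
  have r2 : r ≤ a₀ / 2 := (min_le_left _ _).trans (min_le_right _ _)
  have r3 : r ≤ 1 := (min_le_right _ _).trans (min_le_left _ _)
  have r4 : K * r ≤ 1 / 8 := by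
    have := (min_le_right _ _).trans (min_le_right _ _) |> hr.le.trans
    rw [le_div_iff₀ (by positivity)] at this
    linarith
  refine ⟨min r (r / (2 * K)), 4 * K + 1, by positivity, by positivity, ?_⟩
  intro u₀ u₁ η hu hu₁ hη hηr hu0 w0 w1
  have hη1 : η ≤ r := hηr.trans (min_le_left _ _)
  have hη2 : K * η ≤ r / 2 := by
    have := hηr.trans (min_le_right _ _)
    rw [le_div_iff₀ (by positivity)] at this
    linarith
  have hu1 : eLpNorm u₁ 2 volume ≤ ENNReal.ofReal η := by
    refine le_trans (eLpNorm_mono fun x => ?_) w1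
    rw [norm_mul, Real.norm_of_nonneg (wt_pos s x).le]
    exact le_mul_of_one_le_left (norm_nonneg _) (one_le_wt hs x)
  have hur : ∀ x, |u₀ x| ≤ r := fun x => (hu0 x).trans hη1
  have B := hbd r r2 u₀ u₁ hu hu₁ η hη hη1 hu0 hu1
  set S : ℝ → (ℝ → ℝ) → ℝ → ℝ := fun b φ =>
    sol (rate a₀) (paramCoeff a₀) x₀ (btSource a₀ x₀ u₀ u₁ (a₀ + b) φ) with hS
  set P : ℝ → (ℝ → ℝ) → ℝ := fun b φ =>
    proj (rate a₀) (paramCoeff a₀) x₀ (btSource a₀ x₀ u₀ u₁ (a₀ + b) φ) with hP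
  have adm : ∀ (b : ℝ) (φ : BoundedContinuousFunction ℝ ℝ),
      Admissible (rate a₀) (btSource a₀ x₀ u₀ u₁ (a₀ + b) φ) := fun b φ =>
    admissible_btSource h0 hu hu₁ φ.continuous (M := ‖φ‖) fun x => φ.norm_coe_le_norm x
  -- The solution is known to be bounded only on the ball; elsewhere the map gets the irrelevant
  -- value `0`.
  have ex : ∀ q : BoundedContinuousFunction ℝ ℝ × ℝ, ∃ ψ : BoundedContinuousFunction ℝ ℝ,
      ‖q.1‖ ≤ r → |q.2| ≤ r → ∀ x, ψ x = S q.2 q.1 x := by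
    intro q
    by_cases hq : ‖q.1‖ ≤ r ∧ |q.2| ≤ r
    · have h1 := (B q.1 q.2 r q.1.continuous le_rfl
        (fun x => (q.1.norm_coe_le_norm x).trans hq.1) hq.2).1.2
      exact ⟨.ofNormedAddCommGroup (S q.2 q.1) (hasACDeriv_sol hc (adm _ _)).continuous _ h1,
        fun _ _ x => rfl⟩
    · exact ⟨0, fun h h' => absurd ⟨h, h'⟩ hq⟩
  choose Ψ hΨ using ex
  let F : BoundedContinuousFunction ℝ ℝ × ℝ → BoundedContinuousFunction ℝ ℝ × ℝ :=
    fun q => (Ψ q, P q.2 q.1)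
  -- The contraction takes place in the sup norm. The weighted `L²` bound is carried along as an
  -- invariant, which survives uniform limits by lower semicontinuity of the norm.
  let Z : Set (BoundedContinuousFunction ℝ ℝ × ℝ) := {q | (‖q.1‖ ≤ r ∧ |q.2| ≤ r) ∧
    eLpNorm (fun x => wt s x * q.1 x) 2 volume ≤ ENNReal.ofReal 1}
  have hZ : IsClosed Z := by
    refine IsClosed.inter ?_ ?_
    · exact (isClosed_le (continuous_norm.comp continuous_fst) continuous_const).inter
        (isClosed_le (continuous_abs.comp continuous_snd) continuous_const)
    · refine IsSeqClosed.isClosed fun q p hq hqp => ?_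
      refine Lp.eLpNorm_le_of_ae_tendsto (u := atTop) (f := fun n x => wt s x * (q n).1 x)
        (Eventually.of_forall fun n => hq n)
        (fun n => ((continuous_wt s).mul (q n).1.continuous).aestronglyMeasurable)
        (ae_of_all _ fun x => ?_)
      have h1 := (((continuous_apply x).comp BoundedContinuousFunction.continuous_coe).tendsto p.1).comp
        ((continuous_fst.tendsto p).comp hqp)
      exact h1.const_mul _
  have maps : Set.MapsTo F Z Z := by
    rintro ⟨φ, b⟩ ⟨⟨h1, h2⟩, h3⟩
    have hx := fun x => (φ.norm_coe_le_norm x).trans h1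
    obtain ⟨⟨k1, k2⟩, k3⟩ := B φ b r φ.continuous le_rfl hx h2
    have k4 := k3 1 zero_le_one w0 w1 h3
    have hb : K * (η + r * r) ≤ r := by nlinarith
    refine ⟨⟨(BoundedContinuousFunction.norm_le hrp.le).2 fun x => ?_, k1.trans hb⟩, ?_⟩
    · change ‖Ψ (φ, b) x‖ ≤ r
      rw [hΨ _ h1 h2]
      exact (k2 x).trans hb
    · change eLpNorm (fun x => wt s x * Ψ (φ, b) x) 2 volume ≤ _
      simp only [hΨ _ h1 h2]
      refine k4.trans (ENNReal.ofReal_le_ofReal ?_)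
      nlinarith
  have contr : ContractingWith (1 / 2) (maps.restrict F Z Z) := by
    refine ⟨by norm_num, LipschitzWith.of_dist_le_mul ?_⟩
    rintro ⟨⟨φ, b⟩, ⟨h1, h2⟩, h3⟩ ⟨⟨ψ, b'⟩, ⟨h1', h2'⟩, h3'⟩
    have hx := fun x => (φ.norm_coe_le_norm x).trans h1
    have hx' := fun x => (ψ.norm_coe_le_norm x).trans h1'
    set D := dist ((φ, b) : BoundedContinuousFunction ℝ ℝ × ℝ) (ψ, b') with hD
    have d1 : ∀ x, |φ x - ψ x| ≤ D := fun x =>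
      (φ.dist_coe_le_dist x).trans (le_max_left (dist φ ψ) (dist b b'))
    have d2 : |b - b'| ≤ D := le_max_right (dist φ ψ) (dist b b')
    obtain ⟨k1, k2⟩ := hcon r r1 u₀ u₁ hu hur hu₁ φ ψ b b' D φ.continuous ψ.continuous hx hx' h2 h2' d1 d2
    have hD0 : 0 ≤ D := dist_nonneg
    have e : ((1 / 2 : NNReal) : ℝ) * D = D / 2 := by push_cast; ring
    change max (dist (Ψ (φ, b)) (Ψ (ψ, b'))) (dist (P b φ) (P b' ψ)) ≤ ((1 / 2 : NNReal) : ℝ) * D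
    rw [e]
    refine max_le ((BoundedContinuousFunction.dist_le (by positivity)).2 fun x => ?_) k1
    rw [hΨ _ h1 h2, hΨ _ h1' h2']
    exact k2 x
  have h0Z : ((0, 0) : BoundedContinuousFunction ℝ ℝ × ℝ) ∈ Z := by
    refine ⟨⟨by simpa using hrp.le, by simpa using hrp.le⟩, ?_⟩
    simp
  obtain ⟨⟨φ, b⟩, ⟨⟨h1, h2⟩, h3⟩, hfix, -⟩ :=
    contr.exists_fixedPoint' hZ.isComplete maps h0Z (edist_ne_top _ _)
  have hφ : ∀ x, φ x = S b φ x := fun x => by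
    rw [← hΨ (φ, b) h1 h2 x]
    exact congrArg (fun q : BoundedContinuousFunction ℝ ℝ × ℝ => q.1 x) hfix.symm
  have hbP : b = P b φ := congrArg Prod.snd hfix.symm
  have hac := hasACDeriv_sol (κ := paramCoeff a₀) (x₀ := x₀) hc (adm b φ)
  have hfun : sol (rate a₀) (paramCoeff a₀) x₀ (btSource a₀ x₀ u₀ u₁ (a₀ + b) φ) = φ :=
    (funext hφ).symm
  rw [hfun] at hac
  set μ := max ‖φ‖ |b| with hμ
  have hμ0 : 0 ≤ μ := (norm_nonneg φ).trans (le_max_left _ _)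
  obtain ⟨⟨k1, k2⟩, k3⟩ := B φ b μ φ.continuous (max_le h1 h2)
    (fun x => (φ.norm_coe_le_norm x).trans (le_max_left _ _)) (le_max_right _ _)
  -- The fixed point is estimated a second time by its own size `μ`; as `K r ≤ 1/8`, the last term
  -- is absorbed and the bound becomes linear in `η`.
  have hμb : μ ≤ K * (η + r * μ) := by
    refine max_le ((BoundedContinuousFunction.norm_le (by positivity)).2 fun x => ?_) ?_
    · rw [hφ x]; exact k2 x
    · conv_lhs => rw [hbP]
      exact k1
  have hμη : μ ≤ 2 * K * η := by nlinarith
  have hKη : 0 ≤ K * η := by positivity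
  refine ⟨b, φ, _, ⟨hac, ae_of_all _ fun x => ?_⟩, ?_, fun x => ?_, ?_⟩
  · rw [corr, ← add_assoc]
    change _ + paramCoeff a₀ * P b φ * _ = _
    rw [← hbP]
  · exact (le_max_right ‖φ‖ |b|).trans (by nlinarith)
  · exact ((φ.norm_coe_le_norm x).trans (le_max_left ‖φ‖ |b|)).trans (by nlinarith)
  · have hne : eLpNorm (fun x => wt s x * φ x) 2 volume ≠ ⊤ := ne_top_of_le_ne_top (by simp) h3
    set n := (eLpNorm (fun x => wt s x * φ x) 2 volume).toReal with hn
    have hn0 : 0 ≤ n := ENNReal.toReal_nonneg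
    have hn' : eLpNorm (fun x => wt s x * φ x) 2 volume = ENNReal.ofReal n :=
      (ENNReal.ofReal_toReal hne).symm
    have k4 := k3 n hn0 w0 w1 hn'.le
    simp only [hfun] at k4
    rw [hn', ENNReal.ofReal_le_ofReal_iff (by positivity)] at k4
    rw [hn']
    refine ENNReal.ofReal_le_ofReal ?_
    have h5 : K * r * n ≤ 1 / 8 * n := by gcongr
    have h6 : K * r * μ ≤ 1 / 8 * (2 * K * η) := by gcongr
    nlinarith

end FixedPoint

/-! ### Regularity of the solution at time zero -/

/-- The increment `sin (θ + α) - sin θ` at a kink taking the value `2θ`. -/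
def kinkIncr (c x₀ : ℝ) (α : ℝ → ℝ) (x : ℝ) : ℝ :=
  sech (c * (x - x₀)) * (Real.cos (α x) - 1) - tanh (c * (x - x₀)) * Real.sin (α x)

section Bootstrap

variable {c x₀ s k m : ℝ} {α α' : ℝ → ℝ}

lemma sin_half_profile_add (z α : ℝ) : Real.sin (profile z / 2 + α) =
    sech z + (sech z * (Real.cos α - 1) - tanh z * Real.sin α) := by
  rw [Real.sin_add, sin_half_profile, cos_half_profile]
  ring

lemma continuous_kinkIncr (hα : Continuous α) : Continuous (kinkIncr c x₀ α) := by
  have := continuous_sech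
  have := continuous_tanh
  unfold kinkIncr
  fun_prop

lemma abs_kinkIncr_le (x : ℝ) : |kinkIncr c x₀ α x| ≤ 2 * |α x| := by
  unfold kinkIncr
  refine (abs_sub _ _).trans ?_
  rw [abs_mul, abs_mul, abs_of_pos (sech_pos _)]
  have h1 : |Real.cos (α x) - 1| ≤ |α x| := by simpa using abs_cos_sub_cos_le (α x) 0
  have h2 : |Real.sin (α x)| ≤ |α x| := by simpa using abs_sin_sub_sin_le (α x) 0
  have := sech_le_one (c * (x - x₀))
  calc _ ≤ 1 * |α x| + 1 * |α x| := by
        gcongr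
        exact abs_tanh_le _
    _ = _ := by ring

/-- The starting point of the bootstrap: pointwise domination requires neither smallness nor
derivatives of `α`. -/
lemma sobolevNorm_kinkIncr_zero_le (hα : Continuous α) (h : sobolevNorm 0 s α ≠ ⊤) :
    sobolevNorm 0 s (kinkIncr c x₀ α) ≤ 2 * sobolevNorm 0 s α := by
  have h1 := sobolevNorm_zero_le_of_abs_le (s := s) (continuous_kinkIncr (c := c) (x₀ := x₀) hα).aestronglyMeasurable
    (v := fun x => 2 * α x) fun x => by simpa [abs_mul] using abs_kinkIncr_le (c := c) (x₀ := x₀) (α := α) x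
  refine h1.trans ((sobolevNorm_const_mul_le 2 h).trans (le_of_eq ?_))
  simp

/-- The increment is a combination of `sin α` and `cos α - 1` with bounded smooth coefficients. -/
lemma exists_sobolevNorm_kinkIncr_le (c x₀ : ℝ) (hs : 0 ≤ s) (hk : 0 ≤ k) : ∃ A : ℝ≥0∞, A ≠ ⊤ ∧
    ∀ α α' : ℝ → ℝ, HasACDeriv α α' → sobolevNorm (max k 1) s α ≤ 1 →
      sobolevNorm k s (kinkIncr c x₀ α) ≤ A * sobolevNorm (max k 1) s α := by
  obtain ⟨A, hA, ha⟩ := exists_sobolevNorm_sin_le hs ⌈max k 1⌉₊ (max k 1) (le_max_right _ _)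
    ((Nat.le_ceil _).trans (by linarith))
  obtain ⟨B, hB, hb⟩ := exists_sobolevNorm_bddSmooth_mul_le
    (fun n => (bddSmooth_sech_tanh n).1.comp_affine c x₀) s hk
  obtain ⟨D, hD, hd⟩ := exists_sobolevNorm_bddSmooth_mul_le
    (fun n => (bddSmooth_sech_tanh n).2.comp_affine c x₀) s hk
  refine ⟨B * A + D * A, by finiteness, fun α α' hα h1 => ?_⟩
  obtain ⟨a1, a2⟩ := ha α α' hα h1
  have hf : A * sobolevNorm (max k 1) s α ≠ ⊤ :=
    ENNReal.mul_ne_top hA (ne_top_of_le_ne_top (by simp) h1)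
  have a1' := (sobolevNorm_mono (le_max_left k 1)).trans a1
  have a2' := (sobolevNorm_mono (le_max_left k 1)).trans a2
  refine (sobolevNorm_sub_le _ _).trans ?_
  calc _ ≤ B * (A * sobolevNorm (max k 1) s α) + D * (A * sobolevNorm (max k 1) s α) :=
        add_le_add ((hb _ (ne_top_of_le_ne_top hf a2')).trans (mul_le_mul' le_rfl a2'))
          ((hd _ (ne_top_of_le_ne_top hf a1')).trans (mul_le_mul' le_rfl a1'))
    _ = _ := by ring

/-- The right-hand side of the Bäcklund equations at time zero. -/
def btRhs (c x₀ : ℝ) (w : ℝ → ℝ) (e c₁ c₂ : ℝ) (u φ : ℝ → ℝ) (x : ℝ) : ℝ :=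
  w x + e * sech (c * (x - x₀)) + (c₁ * kinkIncr c x₀ (fun x => (1 / 2) * (u x + φ x)) x +
    c₂ * kinkIncr c x₀ (fun x => (1 / 2) * (u x - φ x)) x)

lemma sobolevNorm_half_le {u φ : ℝ → ℝ} {η : ℝ≥0∞} (hη : η ≠ ⊤) (hu : sobolevNorm k s u ≤ η)
    (hφ : sobolevNorm k s φ ≤ η) : sobolevNorm k s (fun x => (1 / 2) * (u x + φ x)) ≤ η ∧
      sobolevNorm k s (fun x => (1 / 2) * (u x - φ x)) ≤ η := by
  have h2 : ENNReal.ofReal |1 / 2| * (η + η) = η := by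
    rw [← two_mul, ← mul_assoc, abs_of_pos (by norm_num), one_div, ENNReal.ofReal_inv_of_pos (by norm_num)]
    simp [ENNReal.inv_mul_cancel]
  have ht : η + η ≠ ⊤ := by finiteness
  have p := (sobolevNorm_add_le (k := k) (s := s) u φ).trans (add_le_add hu hφ)
  have q := (sobolevNorm_sub_le (k := k) (s := s) u φ).trans (add_le_add hu hφ)
  exact ⟨((sobolevNorm_const_mul_le _ (ne_top_of_le_ne_top ht p)).trans (mul_le_mul' le_rfl p)).trans h2.le,
    ((sobolevNorm_const_mul_le _ (ne_top_of_le_ne_top ht q)).trans (mul_le_mul' le_rfl q)).trans h2.le⟩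

lemma sobolevNorm_btRhs_le {w u φ : ℝ → ℝ} {e c₁ c₂ M : ℝ} {η A : ℝ≥0∞}
    (hη : η ≠ ⊤) (hA : A ≠ ⊤) (hs : 0 ≤ s) (hc : 0 < c)
    (h₁ : |c₁| ≤ M) (h₂ : |c₂| ≤ M) (hw : sobolevNorm k s w ≤ η) (he : ENNReal.ofReal |e| ≤ η)
    (hp : sobolevNorm k s (kinkIncr c x₀ (fun x => (1 / 2) * (u x + φ x))) ≤ A * η)
    (hq : sobolevNorm k s (kinkIncr c x₀ (fun x => (1 / 2) * (u x - φ x))) ≤ A * η) :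
    sobolevNorm k s (btRhs c x₀ w e c₁ c₂ u φ) ≤ (1 + sobolevNorm k s (fun x => sech (c * (x - x₀))) +
      2 * ENNReal.ofReal M * A) * η := by
  have hS := sobolevNorm_sech_ne_top hs hc x₀ k
  have ht : A * η ≠ ⊤ := by finiteness
  unfold btRhs
  calc _ ≤ _ := (sobolevNorm_add_le _ _).trans (add_le_add (sobolevNorm_add_le _ _)
          (sobolevNorm_add_le _ _))
    _ ≤ (η + η * sobolevNorm k s (fun x => sech (c * (x - x₀)))) +
        (ENNReal.ofReal M * (A * η) + ENNReal.ofReal M * (A * η)) := by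
      refine add_le_add (add_le_add hw ?_) (add_le_add ?_ ?_)
      · exact (sobolevNorm_const_mul_le _ hS).trans (mul_le_mul' he le_rfl)
      · exact (sobolevNorm_const_mul_le _ (ne_top_of_le_ne_top ht hp)).trans
          (mul_le_mul' (ENNReal.ofReal_le_ofReal h₁) hp)
      · exact (sobolevNorm_const_mul_le _ (ne_top_of_le_ne_top ht hq)).trans
          (mul_le_mul' (ENNReal.ofReal_le_ofReal h₂) hq)
    _ = _ := by ring

/-- The general coefficients allow one estimate for three expressions: `φ_x` and `φ_t` at time zero,
and the derivatives of the difference of two kinks. -/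
lemma exists_sobolevNorm_btRhs_le (hc : 0 < c) (x₀ : ℝ) (hs : 0 ≤ s) (hk : 0 ≤ k) (M : ℝ) :
    ∃ A : ℝ≥0∞, A ≠ ⊤ ∧ ∀ (w u u' φ φ' : ℝ → ℝ) (e c₁ c₂ : ℝ) (η : ℝ≥0∞), η ≤ 1 →
      HasACDeriv u u' → HasACDeriv φ φ' → |c₁| ≤ M → |c₂| ≤ M → sobolevNorm k s w ≤ η →
      ENNReal.ofReal |e| ≤ η → sobolevNorm (max k 1) s u ≤ η → sobolevNorm (max k 1) s φ ≤ η →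
      sobolevNorm k s (btRhs c x₀ w e c₁ c₂ u φ) ≤ A * η := by
  obtain ⟨A, hA, ha⟩ := exists_sobolevNorm_kinkIncr_le c x₀ hs hk
  have hS := sobolevNorm_sech_ne_top hs hc x₀ k
  refine ⟨1 + sobolevNorm k s (fun x => sech (c * (x - x₀))) + 2 * ENNReal.ofReal M * A,
    by finiteness, fun w u u' φ φ' e c₁ c₂ η h1 hu hφ h₁ h₂ hw he hun hφn => ?_⟩
  have hη : η ≠ ⊤ := ne_top_of_le_ne_top (by simp) h1
  obtain ⟨p, q⟩ := sobolevNorm_half_le hη hun hφn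
  exact sobolevNorm_btRhs_le hη hA hs hc h₁ h₂ hw he
    ((ha _ _ ((hu.add hφ).const_mul _) (p.trans h1)).trans (mul_le_mul' le_rfl p))
    ((ha _ _ ((hu.sub hφ).const_mul _) (q.trans h1)).trans (mul_le_mul' le_rfl q))

/-- Elliptic regularity for the Bäcklund equation at time zero. -/
lemma exists_bootstrap (hc : 0 < c) (x₀ : ℝ) (hs : 0 ≤ s) (hm : 0 ≤ m) (M : ℝ) :
    ∃ C δ : ℝ≥0∞, C ≠ ⊤ ∧ δ ≠ 0 ∧ ∀ (w u u' φ φ' : ℝ → ℝ) (e c₁ c₂ : ℝ) (η : ℝ≥0∞), η ≤ δ →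
      HasACDeriv u u' → HasACDeriv φ φ' → |c₁| ≤ M → |c₂| ≤ M → sobolevNorm m s w ≤ η →
      ENNReal.ofReal |e| ≤ η → sobolevNorm (m + 1) s u ≤ η → sobolevNorm 0 s φ ≤ η →
      φ' =ᵐ[volume] btRhs c x₀ w e c₁ c₂ u φ → sobolevNorm (m + 1) s φ ≤ C * η := by
  -- Each step puts the regularity already known into the right-hand side and gains at most one
  -- order. The cut-off at `m + 1` is the order supported by `w` and `u`, and `⌈m⌉₊` steps reach it.
  have key : ∀ n : ℕ, ∃ C δ : ℝ≥0∞, C ≠ ⊤ ∧ 1 ≤ C ∧ δ ≠ 0 ∧ δ ≤ 1 ∧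
      ∀ (w u u' φ φ' : ℝ → ℝ) (e c₁ c₂ : ℝ) (η : ℝ≥0∞),
      η ≤ δ → HasACDeriv u u' → HasACDeriv φ φ' → |c₁| ≤ M → |c₂| ≤ M → sobolevNorm m s w ≤ η →
      ENNReal.ofReal |e| ≤ η → sobolevNorm (m + 1) s u ≤ η → sobolevNorm 0 s φ ≤ η →
      φ' =ᵐ[volume] btRhs c x₀ w e c₁ c₂ u φ → sobolevNorm (min (n + 1) (m + 1)) s φ ≤ C * η := by
    intro n
    induction n with
    | zero =>
      obtain ⟨A, hA, ha⟩ := exists_sobolevNorm_succ_le s (le_refl (0 : ℝ))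
      have hS := sobolevNorm_sech_ne_top hs hc x₀ 0
      refine ⟨A * (1 + (1 + sobolevNorm 0 s (fun x => sech (c * (x - x₀))) +
        2 * ENNReal.ofReal M * 2)) + 1, 1, by finiteness, le_add_self, one_ne_zero, le_rfl, ?_⟩
      intro w u u' φ φ' e c₁ c₂ η hη1 hu hφ h₁ h₂ hw he hun hφn hE
      have hη : η ≠ ⊤ := ne_top_of_le_ne_top (by simp) hη1
      obtain ⟨p, q⟩ := sobolevNorm_half_le hη ((sobolevNorm_mono (by linarith)).trans hun) hφn
      have p' := sobolevNorm_kinkIncr_zero_le (c := c) (x₀ := x₀)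
        ((hu.add hφ).const_mul (1 / 2)).continuous (ne_top_of_le_ne_top hη p)
      have q' := sobolevNorm_kinkIncr_zero_le (c := c) (x₀ := x₀)
        ((hu.sub hφ).const_mul (1 / 2)).continuous (ne_top_of_le_ne_top hη q)
      have h3 := sobolevNorm_btRhs_le (x₀ := x₀) hη (by simp : (2 : ℝ≥0∞) ≠ ⊤) hs hc h₁ h₂
        ((sobolevNorm_mono hm).trans hw) he (p'.trans (mul_le_mul' le_rfl p))
        (q'.trans (mul_le_mul' le_rfl q))
      rw [← sobolevNorm_congr hE] at h3
      have h4 := ha φ φ' hφ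
      have e1 : min (((0 : ℕ) : ℝ) + 1) (m + 1) = 0 + 1 := by
        rw [Nat.cast_zero, min_eq_left (by linarith)]
      rw [e1]
      calc _ ≤ _ := h4
        _ ≤ A * (η + (1 + sobolevNorm 0 s (fun x => sech (c * (x - x₀))) +
          2 * ENNReal.ofReal M * 2) * η) := mul_le_mul' le_rfl (add_le_add hφn h3)
        _ = (A * (1 + (1 + sobolevNorm 0 s (fun x => sech (c * (x - x₀))) +
          2 * ENNReal.ofReal M * 2))) * η := by ring
        _ ≤ _ := mul_le_mul' le_self_add le_rfl
    | succ n ih =>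
      obtain ⟨C, δ, hC, hC1, hδ, hδ1, ih⟩ := ih
      set k : ℝ := min ((n + 1 : ℕ) + 1 : ℝ) (m + 1) - 1 with hkdef
      have hn : (0 : ℝ) ≤ n := n.cast_nonneg
      have hk0 : 0 ≤ k := by
        rw [hkdef, sub_nonneg]; push_cast; exact le_min (by linarith) (by linarith)
      have hkm : k ≤ m := by
        rw [hkdef, sub_le_iff_le_add]; exact min_le_right _ _
      have hkn : max k 1 ≤ min (n + 1 : ℝ) (m + 1) := by
        refine max_le (le_min ?_ (by linarith)) (le_min (by linarith) (by linarith))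
        rw [hkdef, sub_le_iff_le_add]; push_cast; exact min_le_left _ _
      obtain ⟨A, hA, ha⟩ := exists_sobolevNorm_succ_le s hk0
      obtain ⟨B, hB, hb⟩ := exists_sobolevNorm_btRhs_le hc x₀ hs hk0 M
      -- The radius `C⁻¹` keeps the previous bound `C η` at most one, as the composition estimate
      -- requires.
      refine ⟨A * (1 + B) * C + 1, min δ C⁻¹, by finiteness, le_add_self, ?_, (min_le_left _ _).trans hδ1, ?_⟩
      · exact (lt_min (pos_iff_ne_zero.2 hδ) (ENNReal.inv_pos.2 hC)).ne'
      intro w u u' φ φ' e c₁ c₂ η hη1 hu hφ h₁ h₂ hw he hun hφn hE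
      have h1 := ih w u u' φ φ' e c₁ c₂ η (hη1.trans (min_le_left _ _)) hu hφ h₁ h₂ hw he hun hφn hE
      have hCη : C * η ≤ 1 := by
        calc _ ≤ C * C⁻¹ := mul_le_mul' le_rfl (hη1.trans (min_le_right _ _))
          _ ≤ 1 := ENNReal.mul_inv_le_one C
      have hη' : η ≤ C * η := le_mul_of_one_le_left' hC1
      have h2 : sobolevNorm (max k 1) s φ ≤ C * η := (sobolevNorm_mono hkn).trans h1
      have h3 := hb w u u' φ φ' e c₁ c₂ (C * η) hCη hu hφ h₁ h₂
        (((sobolevNorm_mono hkm).trans hw).trans hη') (he.trans hη')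
        (((sobolevNorm_mono (hkn.trans (min_le_right _ _))).trans hun).trans hη') h2
      rw [← sobolevNorm_congr hE] at h3
      have h4 := ha φ φ' hφ
      rw [show k + 1 = min ((n + 1 : ℕ) + 1 : ℝ) (m + 1) by rw [hkdef]; ring] at h4
      calc _ ≤ _ := h4
        _ ≤ A * (C * η + B * (C * η)) := mul_le_mul' le_rfl
            (add_le_add ((sobolevNorm_mono (le_max_left k 1)).trans h2) h3)
        _ = A * (1 + B) * C * η := by ring
        _ ≤ _ := mul_le_mul' le_self_add le_rfl
  obtain ⟨C, δ, hC, -, hδ, -, h⟩ := key ⌈m⌉₊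
  refine ⟨C, δ, hC, hδ, ?_⟩
  intro w u u' φ φ' e c₁ c₂ η hη1 hu hφ h₁ h₂ hw he hun hφn hE
  have := h w u u' φ φ' e c₁ c₂ η hη1 hu hφ h₁ h₂ hw he hun hφn hE
  rwa [min_eq_right (by linarith [Nat.le_ceil m])] at this

end Bootstrap

/-! ### Dependence of the kink on its parameters -/

lemma abs_profile_sub_le {z w B : ℝ} (h : ∀ ζ ∈ Set.uIcc w z, sech ζ ≤ B) :
    |profile z - profile w| ≤ 2 * B * |z - w| :=
  Convex.norm_image_sub_le_of_norm_hasDerivWithin_le (s := Set.uIcc w z)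
    (fun ζ _ => (hasDerivAt_profile ζ).hasDerivWithinAt)
    (fun ζ hζ => by
      rw [Real.norm_of_nonneg (by have := sech_pos ζ; positivity)]
      linarith [h ζ hζ]) (convex_uIcc _ _) Set.left_mem_uIcc Set.right_mem_uIcc

lemma abs_profile_sub_le' (z w : ℝ) : |profile z - profile w| ≤ 2 * |z - w| := by
  simpa using abs_profile_sub_le (z := z) (w := w) (B := 1) fun ζ _ => sech_le_one ζ

lemma abs_profile_le (z : ℝ) : |profile z| ≤ 2 * Real.pi := by
  unfold profile
  rw [abs_of_nonneg (by have := Real.arctan_nonneg.2 (Real.exp_pos z).le; positivity)]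
  linarith [Real.arctan_lt_pi_div_two (Real.exp z)]

lemma lorentz_eq_rate {β : ℝ} (hβ : β ∈ Set.Ioo (-1 : ℝ) 1) : lorentz β = rate (backlundParam β) :=
  lorentz_eq_param hβ

lemma abs_rate_sub_le {a₀ a r : ℝ} (h0 : 0 < a₀) (hr : r ≤ a₀ / 2) (ha : |a - a₀| ≤ r) :
    |rate a - rate a₀| ≤ (1 + 1 / a₀ ^ 2) * |a - a₀| := by
  obtain ⟨-, -, -, h⟩ := inv_bounds h0 hr ha
  have e : rate a - rate a₀ = (a - a₀) / 2 + -((1 / a₀ - 1 / a) / 2) := by unfold rate; ring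
  rw [e]
  refine (abs_add_le _ _).trans ?_
  rw [abs_neg, abs_div, abs_div, abs_two]
  have h1 := abs_nonneg (a - a₀)
  calc _ ≤ |a - a₀| / 2 + 2 / a₀ ^ 2 * |a - a₀| / 2 := by gcongr
    _ = (1 / 2 + 1 / a₀ ^ 2) * |a - a₀| := by ring
    _ ≤ _ := by gcongr; norm_num

/-- Exponential decay of the difference of two kinks. -/
lemma exists_abs_kink_sub_le {c₀ : ℝ} (h0 : 0 < c₀) (x₀ : ℝ) : ∃ K r : ℝ, 0 < K ∧ 0 < r ∧
    ∀ c y d : ℝ, |c - c₀| ≤ d → |y - x₀| ≤ d → d ≤ r → ∀ x,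
      |profile (c * (x - y)) - profile (c₀ * (x - x₀))| ≤ K * d * Real.exp (-(c₀ / 4 * |x - x₀|)) := by
  refine ⟨4 * Real.exp 1 * ((1 + 2 * c₀) * (1 + 4 / c₀)), min (c₀ / 2) (1 / (1 + 2 * c₀)) ⊓ (c₀ / (2 * (1 + 2 * c₀))),
    by positivity, by positivity, ?_⟩
  intro c y d hc hy hd x
  have hd0 : 0 ≤ d := (abs_nonneg _).trans hc
  have hd1 : d ≤ c₀ / 2 := hd.trans ((min_le_left _ _).trans (min_le_left _ _))
  have hd2 : d * (1 + 2 * c₀) ≤ 1 := by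
    have := hd.trans ((min_le_left _ _).trans (min_le_right _ _))
    rwa [le_div_iff₀ (by positivity)] at this
  have hcc : |c| ≤ 2 * c₀ := by
    rw [abs_le] at hc ⊢; constructor <;> linarith [hc.1, hc.2]
  set t := |x - x₀| with ht
  have ht0 : 0 ≤ t := abs_nonneg _
  have hzz : |c * (x - y) - c₀ * (x - x₀)| ≤ d * (t + 2 * c₀) := by
    have e : c * (x - y) - c₀ * (x - x₀) = (c - c₀) * (x - x₀) + -(c * (y - x₀)) := by ring
    rw [e]
    refine (abs_add_le _ _).trans ?_
    rw [abs_neg, abs_mul, abs_mul]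
    calc _ ≤ d * t + 2 * c₀ * d := by gcongr
      _ = _ := by ring
  have hz2 : |c * (x - y) - c₀ * (x - x₀)| ≤ c₀ / 2 * t + 1 := by
    refine hzz.trans ?_
    nlinarith
  -- Intermediate points differ from `c₀ (x - x₀)` by at most `c₀ |x - x₀| / 2 + 1`, so half of the
  -- decay rate survives in the mean value theorem.
  have h1 : ∀ ζ ∈ Set.uIcc (c₀ * (x - x₀)) (c * (x - y)),
      sech ζ ≤ 2 * (Real.exp 1 * Real.exp (-(c₀ / 2 * t))) := by
    intro ζ hζ
    have h2 := (Set.abs_sub_left_of_mem_uIcc hζ).trans hz2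
    have h3 : c₀ * t ≤ |ζ| + |ζ - c₀ * (x - x₀)| := by
      have := abs_sub ζ (ζ - c₀ * (x - x₀))
      rwa [sub_sub_cancel, abs_mul, abs_of_pos h0] at this
    refine (sech_le_exp ζ).trans ?_
    rw [← Real.exp_add]
    gcongr
    linarith
  refine (abs_profile_sub_le h1).trans ?_
  have h4 : t + 2 * c₀ ≤ (1 + 2 * c₀) * (1 + t) := by nlinarith
  -- Varying the rate produces a factor growing linearly in `|x - x₀|`; absorbing it costs another
  -- quarter of the rate.
  have h5 : 1 + t ≤ (1 + 4 / c₀) * Real.exp (c₀ / 4 * t) := by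
    have := Real.add_one_le_exp (c₀ / 4 * t)
    have h6 : (1 : ℝ) ≤ Real.exp (c₀ / 4 * t) := Real.one_le_exp (by positivity)
    have h7 : t = 4 / c₀ * (c₀ / 4 * t) := by field_simp
    have h8 : t ≤ 4 / c₀ * Real.exp (c₀ / 4 * t) := by
      conv_lhs => rw [h7]
      gcongr
      linarith
    linarith
  calc _ ≤ 2 * (2 * (Real.exp 1 * Real.exp (-(c₀ / 2 * t)))) *
        (d * ((1 + 2 * c₀) * ((1 + 4 / c₀) * Real.exp (c₀ / 4 * t)))) := by
        gcongr
        exact hzz.trans (mul_le_mul_of_nonneg_left (h4.trans (by gcongr)) hd0)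
    _ = 4 * Real.exp 1 * ((1 + 2 * c₀) * (1 + 4 / c₀)) * d *
        Real.exp (-(c₀ / 2 * t) + c₀ / 4 * t) := by rw [Real.exp_add]; ring
    _ = _ := by ring_nf

lemma profile_affine_hasACDeriv (c y : ℝ) : HasACDeriv (fun x => profile (c * (x - y)))
    (fun x => 2 * c * sech (c * (x - y))) :=
  .of_contDiff (hasDerivAt_profile_affine c y) (continuous_const.mul (continuous_sech_affine c y))

set_option maxHeartbeats 800000 in
/-- The kink depends on its parameters in a Lipschitz way in `H^{m+1,s} × H^{m,s}`. -/
lemma exists_pairNorm_kink_sub_le {m s : ℝ} (hm : 0 ≤ m) (hs : 0 ≤ s) {β₀ : ℝ}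
    (hβ₀ : β₀ ∈ Set.Ioo (-1 : ℝ) 1) (x₀ : ℝ) : ∃ K r : ℝ, 0 < K ∧ 0 < r ∧
    ∀ β y d : ℝ, β ∈ Set.Ioo (-1 : ℝ) 1 → |backlundParam β - backlundParam β₀| ≤ d →
      |y - x₀| ≤ d → d ≤ r → pairNorm m s (fun x => kink β₀ x₀ 0 x - kink β y 0 x)
        (fun x => kinkDt β₀ x₀ 0 x - kinkDt β y 0 x) ≤ ENNReal.ofReal (K * d) := by
  set a₀ := backlundParam β₀ with ha₀
  have h0 : 0 < a₀ := backlundParam_pos hβ₀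
  have hc := rate_pos h0
  obtain ⟨K₁, r₁, hK₁, hr₁, hk⟩ := exists_abs_kink_sub_le hc x₀
  set M : ℝ := 4 * a₀ + 4 / a₀ with hM
  obtain ⟨C, δ, hC, hδ, hb⟩ := exists_bootstrap hc x₀ hs hm M
  obtain ⟨A, hA, ha⟩ := exists_sobolevNorm_btRhs_le hc x₀ hs hm M
  have hN := memLp_wt_mul_exp hs (by positivity : 0 < rate a₀ / 4) x₀
  set N := (eLpNorm (fun x => wt s x * Real.exp (-(rate a₀ / 4 * |x - x₀|))) 2 volume).toReal with hNd
  have hN0 : 0 ≤ N := ENNReal.toReal_nonneg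
  have hN' : eLpNorm (fun x => wt s x * Real.exp (-(rate a₀ / 4 * |x - x₀|))) 2 volume =
    ENNReal.ofReal N := (ENNReal.ofReal_toReal hN.2.ne).symm
  set L : ℝ := 1 + 1 / a₀ ^ 2 with hL
  have hL1 : 1 ≤ L := by rw [hL]; have : 0 < 1 / a₀ ^ 2 := by positivity
                         linarith
  set G : ℝ := K₁ * N * L + 2 * L + 1 with hG
  have hG0 : 0 < G := by positivity
  obtain ⟨δ', hδ', hδδ'⟩ : ∃ δ' : ℝ, 0 < δ' ∧ ENNReal.ofReal δ' ≤ δ := by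
    refine ⟨(min δ 1).toReal, ENNReal.toReal_pos (lt_min (pos_iff_ne_zero.2 hδ) one_pos).ne' (by simp), ?_⟩
    rw [ENNReal.ofReal_toReal (by simp)]
    exact min_le_left _ _
  set P : ℝ := (C + 1).toReal with hP
  have hP1 : 1 ≤ P := by
    rw [hP, ← ENNReal.toReal_one]
    exact ENNReal.toReal_mono (by finiteness) le_add_self
  have hCP : C ≤ ENNReal.ofReal P := by
    rw [hP, ENNReal.ofReal_toReal (by finiteness)]; exact le_self_add
  refine ⟨P * G + A.toReal * (P * G), min (a₀ / 2) (r₁ / L) ⊓ min (δ' / G) (1 / (P * G)), by positivity,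
    by positivity, ?_⟩
  intro β y d hβ had hyd hdr
  have hd0 : 0 ≤ d := (abs_nonneg _).trans had
  have d1 : d ≤ a₀ / 2 := hdr.trans ((min_le_left _ _).trans (min_le_left _ _))
  have d2 : L * d ≤ r₁ := by
    have := hdr.trans ((min_le_left _ _).trans (min_le_right _ _))
    rw [le_div_iff₀ (by positivity)] at this; linarith
  have d3 : G * d ≤ δ' := by
    have := hdr.trans ((min_le_right _ _).trans (min_le_left _ _))
    rw [le_div_iff₀ (by positivity)] at this; linarith
  have d4 : P * (G * d) ≤ 1 := by
    have := hdr.trans ((min_le_right _ _).trans (min_le_right _ _))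
    rw [le_div_iff₀ (by positivity)] at this; linarith
  set a := backlundParam β with ha'
  obtain ⟨ap, a2, a3, a4⟩ := inv_bounds h0 d1 had
  have hrate := abs_rate_sub_le h0 d1 had
  have hrate' : |rate a - rate a₀| ≤ L * d := hrate.trans (by gcongr)
  have hyL : |y - x₀| ≤ L * d := hyd.trans (by nlinarith)
  -- The difference of two kinks itself solves an equation `φ' = btRhs …` with zero data, because
  -- `sech` at the second kink is `sech` at the first plus a kink increment in `φ / 2`. Its
  -- exponential decay gives the weighted `L²` bound, and the bootstrap does the rest.
  set φ : ℝ → ℝ := fun x => profile (rate a * (x - y)) - profile (rate a₀ * (x - x₀)) with hφ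
  have pt := hk (rate a) y (L * d) hrate' hyL d2
  have hac := (profile_affine_hasACDeriv (rate a) y).sub (profile_affine_hasACDeriv (rate a₀) x₀)
  have hsech : ∀ x, sech (rate a * (x - y)) = sech (rate a₀ * (x - x₀)) +
      kinkIncr (rate a₀) x₀ (fun x => (1 / 2) * (0 + φ x)) x := fun x => by
    rw [← sin_half_profile (rate a * (x - y)), kinkIncr, ← sin_half_profile_add]
    congr 1
    simp only [hφ]
    ring
  have e0 : (fun x => 2 * rate a * sech (rate a * (x - y)) - 2 * rate a₀ * sech (rate a₀ * (x - x₀))) =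
      btRhs (rate a₀) x₀ (fun _ => 0) (2 * rate a - 2 * rate a₀) (2 * rate a) 0 (fun _ => 0) φ := by
    ext x
    rw [hsech x]
    unfold btRhs
    ring
  have z0 : ∀ k, sobolevNorm k s (fun _ => (0 : ℝ)) = 0 := by
    intro k
    have h1 : sobolevNorm k s (fun _ : ℝ => (0 : ℝ)) ≤ 0 := by
      have h2 := sobolevNorm_const_mul_le (k := k) (s := s) 0 (sobolevNorm_sech_ne_top hs one_pos 0 k)
      simpa using h2
    exact le_antisymm h1 zero_le
  have hφ0 : sobolevNorm 0 s φ ≤ ENNReal.ofReal (G * d) := by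
    refine (sobolevNorm_zero_le hac.continuous.aestronglyMeasurable).trans ?_
    have h1 : eLpNorm (fun x => wt s x * φ x) 2 volume ≤
        eLpNorm ((K₁ * (L * d)) • fun x => wt s x * Real.exp (-(rate a₀ / 4 * |x - x₀|))) 2 volume := by
      refine eLpNorm_mono_real fun x => ?_
      rw [norm_mul, Real.norm_of_nonneg (wt_pos s x).le, Pi.smul_apply, smul_eq_mul]
      calc _ ≤ wt s x * (K₁ * (L * d) * Real.exp (-(rate a₀ / 4 * |x - x₀|))) :=
            mul_le_mul_of_nonneg_left (pt x) (wt_pos s x).le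
        _ = _ := by ring
    refine h1.trans ?_
    rw [eLpNorm_const_smul, hN', enorm_real_eq, abs_of_nonneg (by positivity),
      ← ENNReal.ofReal_mul (by positivity)]
    refine ENNReal.ofReal_le_ofReal ?_
    have h2 : 0 ≤ (2 * L + 1) * d := by positivity
    have h3 : G * d = K₁ * (L * d) * N + (2 * L + 1) * d := by rw [hG]; ring
    linarith
  have c1 : |2 * rate a| ≤ M := by
    have e : 2 * rate a = a + 1 / a := by unfold rate; ring
    rw [e, abs_of_pos (by positivity), hM]
    have : 2 / a₀ ≤ 4 / a₀ := by gcongr; norm_num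
    linarith
  have c2 : |1 / a - a| ≤ M := by
    refine (abs_sub _ _).trans ?_
    rw [abs_of_pos ap, abs_of_pos (by positivity), hM]
    have : 2 / a₀ ≤ 4 / a₀ := by gcongr; norm_num
    linarith
  have hM0 : |(0 : ℝ)| ≤ M := by rw [abs_zero]; positivity
  have hGd : ∀ t : ℝ, |t| ≤ 2 * (L * d) → ENNReal.ofReal |t| ≤ ENNReal.ofReal (G * d) := fun t ht => by
    refine ENNReal.ofReal_le_ofReal (ht.trans ?_)
    have h2 : 0 ≤ (K₁ * N * L + 1) * d := by positivity
    have h3 : G * d = 2 * (L * d) + (K₁ * N * L + 1) * d := by rw [hG]; ring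
    linarith
  have e1 : |2 * rate a - 2 * rate a₀| ≤ 2 * (L * d) := by
    rw [← mul_sub, abs_mul, abs_two]; gcongr
  have e2 : |(1 / a₀ - a₀) - (1 / a - a)| ≤ 2 * (L * d) := by
    have e : (1 / a₀ - a₀) - (1 / a - a) = (a - a₀) + (1 / a₀ - 1 / a) := by ring
    rw [e]
    refine (abs_add_le _ _).trans ((add_le_add had (a4.trans (mul_le_mul_of_nonneg_left had (by positivity)))).trans ?_)
    rw [hL]
    have : 2 / a₀ ^ 2 * d = 2 * (1 / a₀ ^ 2 * d) := by ring
    rw [this]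
    have : 0 ≤ 1 / a₀ ^ 2 * d := by positivity
    nlinarith
  have hb1 := hb (fun _ => 0) (fun _ => 0) (fun _ => 0) φ _ _ _ 0 (ENNReal.ofReal (G * d))
    ((ENNReal.ofReal_le_ofReal d3).trans hδδ') (hasACDeriv_const 0) hac c1 hM0 (by rw [z0]; exact zero_le)
    (hGd _ e1) (by rw [z0]; exact zero_le) hφ0 (ae_of_all _ fun x => congrFun e0 x)
  have hb2 : sobolevNorm (m + 1) s φ ≤ ENNReal.ofReal (P * (G * d)) := by
    rw [ENNReal.ofReal_mul (by positivity)]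
    exact hb1.trans (mul_le_mul' hCP le_rfl)
  have hPG : ENNReal.ofReal (G * d) ≤ ENNReal.ofReal (P * (G * d)) :=
    ENNReal.ofReal_le_ofReal (le_mul_of_one_le_left (by positivity) hP1)
  have hb3 := ha (fun _ => 0) (fun _ => 0) (fun _ => 0) φ _ ((1 / a₀ - a₀) - (1 / a - a)) (-(1 / a - a)) 0
    (ENNReal.ofReal (P * (G * d))) (by rw [← ENNReal.ofReal_one]; exact ENNReal.ofReal_le_ofReal d4)
    (hasACDeriv_const 0) hac (by rwa [abs_neg]) hM0 (by rw [z0]; exact zero_le)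
    ((hGd _ e2).trans hPG) (by rw [z0]; exact zero_le)
    ((sobolevNorm_mono (max_le (by linarith) (by linarith))).trans hb2)
  have f1 : (fun x => kink β₀ x₀ 0 x - kink β y 0 x) = fun x => - φ x := by
    ext x
    rw [kink_zero, kink_zero, lorentz_eq_rate hβ, lorentz_eq_rate hβ₀]
    simp only [hφ]
    ring
  have f2 : (fun x => kinkDt β₀ x₀ 0 x - kinkDt β y 0 x) = btRhs (rate a₀) x₀ (fun _ => 0)
      ((1 / a₀ - a₀) - (1 / a - a)) (-(1 / a - a)) 0 (fun _ => 0) φ := by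
    ext x
    rw [kinkDt_zero, kinkDt_zero, ← param_sub hβ, ← param_sub hβ₀, lorentz_eq_rate hβ, lorentz_eq_rate hβ₀,
      ← ha₀, ← ha', hsech x]
    unfold btRhs
    ring
  unfold pairNorm
  rw [f1, f2, sobolevNorm_neg]
  refine (add_le_add hb2 hb3).trans (le_of_eq ?_)
  rw [← ENNReal.ofReal_toReal hA, ← ENNReal.ofReal_mul ENNReal.toReal_nonneg,
    ← ENNReal.ofReal_add (by positivity) (by positivity)]
  congr 1
  rw [ENNReal.toReal_ofReal ENNReal.toReal_nonneg]
  ring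

/-! ### The translation parameter -/

/-- The defect in the orthogonality condition determining the translation parameter. -/
def orthDefect (F : ℝ → ℝ) (c y : ℝ) : ℝ := ∫ x, (F x - profile (c * (x - y))) * sech (c * (x - y))

section Translation

variable {c : ℝ} {F u : ℝ → ℝ}

lemma integrable_mul_sech (hc : 0 < c) (y : ℝ) {g : ℝ → ℝ} (hg : Continuous g) {M : ℝ}
    (hM : ∀ x, |g x| ≤ M) : Integrable fun x => g x * sech (c * (x - y)) :=
  (integrable_sech hc y).bdd_mul hg.aestronglyMeasurable (ae_of_all _ hM)

lemma sech_le_of_le {c c' x : ℝ} (hc : 0 < c) (h : c ≤ c') : sech (c' * x) ≤ sech (c * x) := by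
  refine inv_anti₀ (Real.cosh_pos _) ?_
  rw [Real.cosh_le_cosh, abs_mul, abs_mul, abs_of_pos hc, abs_of_pos (hc.trans_le h)]
  gcongr

lemma two_sech_mul_le_profile_sub {R w w' : ℝ} (hw : |w| ≤ R) (hw' : |w'| ≤ R) (h : w ≤ w') :
    2 * sech R * (w' - w) ≤ profile w' - profile w := by
  refine Convex.mul_sub_le_image_sub_of_le_deriv (convex_Icc (-R) R) continuous_profile.continuousOn
    (fun x _ => (hasDerivAt_profile x).differentiableAt.differentiableWithinAt) (fun x hx => ?_) w
    (abs_le.1 hw) w' (abs_le.1 hw') h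
  rw [interior_Icc] at hx
  rw [(hasDerivAt_profile x).deriv]
  have h1 : |x| ≤ |R| := (abs_le.2 ⟨hx.1.le, hx.2.le⟩).trans (le_abs_self R)
  have : sech R ≤ sech x := inv_anti₀ (Real.cosh_pos _) (Real.cosh_le_cosh.2 h1)
  linarith

set_option maxHeartbeats 1000000 in
/-- Existence and uniqueness of the translation parameter. -/
lemma exists_translation {c₀ : ℝ} (h0 : 0 < c₀) (x₀ : ℝ) : ∃ r K : ℝ, 0 < r ∧ 0 < K ∧
    ∀ (u : ℝ → ℝ) (c η : ℝ), Continuous u → (∀ x, |u x| ≤ η) → η ≤ r → |c - c₀| ≤ r →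
      (∃ y, |y - x₀| ≤ K * (η + |c - c₀|) ∧
        orthDefect (fun x => profile (c₀ * (x - x₀)) + u x) c y = 0) ∧
      ∀ y y', |y - x₀| ≤ 1 → |y' - x₀| ≤ 1 →
        orthDefect (fun x => profile (c₀ * (x - x₀)) + u x) c y = 0 →
        orthDefect (fun x => profile (c₀ * (x - x₀)) + u x) c y' = 0 → y = y' := by
  set I : ℝ := ∫ x, sech (c₀ / 2 * (x - 0)) with hI
  have hc2 : 0 < c₀ / 2 := by positivity
  have hI0 : 0 ≤ I := integral_nonneg fun x => (sech_pos _).le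
  have hi1 : Integrable fun x : ℝ => |x| * sech (c₀ / 2 * (x - 0)) := by
    refine ((integrable_exp_neg_mul_abs (by positivity : 0 < c₀ / 4)).const_mul (8 / c₀)).mono
      (continuous_abs.mul (continuous_sech_affine _ _)).aestronglyMeasurable (ae_of_all _ fun x => ?_)
    have h1 := sech_le_exp (c₀ / 2 * (x - 0))
    rw [sub_zero, abs_mul, abs_of_pos hc2] at h1
    have h2 : c₀ / 4 * |x| ≤ Real.exp (c₀ / 4 * |x|) := by linarith [Real.add_one_le_exp (c₀ / 4 * |x|)]
    have h3 := (sech_pos (c₀ / 2 * x)).le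
    rw [sub_zero, Real.norm_of_nonneg (by positivity), Real.norm_of_nonneg (by positivity)]
    calc _ ≤ |x| * (2 * Real.exp (-(c₀ / 2 * |x|))) := by gcongr
      _ = 8 / c₀ * ((c₀ / 4 * |x|) * Real.exp (-(c₀ / 2 * |x|))) := by field_simp; ring
      _ ≤ 8 / c₀ * (Real.exp (c₀ / 4 * |x|) * Real.exp (-(c₀ / 2 * |x|))) := by gcongr
      _ = _ := by rw [← Real.exp_add]; ring_nf
  set I₁ : ℝ := ∫ x : ℝ, |x| * sech (c₀ / 2 * (x - 0)) with hI₁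
  have hI₁0 : 0 ≤ I₁ := integral_nonneg fun x => mul_nonneg (abs_nonneg _) (sech_pos _).le
  set S : ℝ := sech (2 * c₀) with hS
  have hS0 : 0 < S := sech_pos _
  set κ : ℝ := 2 * c₀ * S * S with hκ
  have hκ0 : 0 < κ := by positivity
  set Q : ℝ := I + 2 * I₁ + 1 with hQ
  have hQ0 : 0 < Q := by positivity
  -- The first bound keeps `c` between `c₀ / 2` and `3 c₀ / 2`, the second lets the perturbation `u`
  -- destroy at most half of the monotonicity, and the third keeps the zero within distance one of
  -- `x₀`.
  refine ⟨min (c₀ / 2) (κ / (8 * c₀ * I + 1)) ⊓ (κ / (4 * Q)), 2 * Q / κ, by positivity, by positivity, ?_⟩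
  intro u c η hu hη hηr hcr
  have hη0 : 0 ≤ η := (abs_nonneg _).trans (hη 0)
  have hc1 : |c - c₀| ≤ c₀ / 2 := hcr.trans ((min_le_left _ _).trans (min_le_left _ _))
  obtain ⟨hcl, hcu⟩ := abs_le.1 hc1
  have hc : 0 < c := by linarith
  have hη1 : η * (8 * c₀ * I + 1) ≤ κ := by
    have := hηr.trans ((min_le_left _ _).trans (min_le_right _ _))
    rwa [le_div_iff₀ (by positivity)] at this
  have hsI : ∀ y, ∫ x, sech (c * (x - y)) ≤ I := by
    intro y
    rw [integral_sub_right_eq_self (fun x => sech (c * x)) y]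
    refine integral_mono (by simpa using integrable_sech hc 0) (integrable_sech hc2 0) fun x => ?_
    simp only [sub_zero]
    exact sech_le_of_le hc2 (by linarith)
  have hp0 : Continuous fun x => profile (c₀ * (x - x₀)) := continuous_profile.comp (by fun_prop)
  have hpb : ∀ y, Integrable fun x => profile (c₀ * (x + y - x₀)) * sech (c * (x - 0)) := fun y =>
    integrable_mul_sech hc 0 (continuous_profile.comp (by fun_prop)) fun x => abs_profile_le _
  have hub : ∀ y, Integrable fun x => u x * sech (c * (x - y)) := fun y =>
    integrable_mul_sech hc y hu hη
  have hcb : Integrable fun x => profile (c * (x - 0)) * sech (c * (x - 0)) :=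
    integrable_mul_sech hc 0 (continuous_profile.comp (by fun_prop)) fun x => abs_profile_le _
  set J : ℝ → ℝ := orthDefect (fun x => profile (c₀ * (x - x₀)) + u x) c with hJ
  -- After a shift by `y` the self-interaction of the moving kink no longer depends on `y`, and in
  -- the main term `y` occurs only inside the increasing function `profile`.
  have split : ∀ y, J y = (∫ x, profile (c₀ * (x + y - x₀)) * sech (c * (x - 0))) +
      (∫ x, u x * sech (c * (x - y))) - ∫ x, profile (c * (x - 0)) * sech (c * (x - 0)) := by
    intro y
    have i1 : Integrable fun x => profile (c₀ * (x - x₀)) * sech (c * (x - y)) :=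
      integrable_mul_sech hc y hp0 fun x => abs_profile_le _
    have i2 : Integrable fun x => profile (c * (x - y)) * sech (c * (x - y)) :=
      integrable_mul_sech hc y (continuous_profile.comp (by fun_prop)) fun x => abs_profile_le _
    have e1 : ∀ x, (profile (c₀ * (x - x₀)) + u x - profile (c * (x - y))) * sech (c * (x - y)) =
        profile (c₀ * (x - x₀)) * sech (c * (x - y)) + u x * sech (c * (x - y)) -
          profile (c * (x - y)) * sech (c * (x - y)) := fun x => by ring
    simp only [hJ, orthDefect, e1]
    rw [integral_sub (by exact i1.add (hub y)) i2, integral_add i1 (hub y)]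
    rw [← integral_add_right_eq_self (fun x => profile (c₀ * (x - x₀)) * sech (c * (x - y))) y,
      ← integral_add_right_eq_self (fun x => profile (c * (x - y)) * sech (c * (x - y))) y]
    simp only [add_sub_cancel_right, sub_zero]
  -- Two-sided bounds on difference quotients replace differentiability: the lower one gives
  -- uniqueness and the sign change, the upper one continuity. The main term grows at rate at least
  -- `κ`, already from `x` in `[-1, 1]`.
  have hinc : ∀ y y', |y - x₀| ≤ 1 → |y' - x₀| ≤ 1 → y ≤ y' →
      κ / 2 * (y' - y) ≤ J y' - J y ∧ J y' - J y ≤ (2 * c₀ * I + κ) * (y' - y) := by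
    intro y y' hy hy' hle
    have hyy : 0 ≤ y' - y := by linarith
    have hU : |(∫ x, u x * sech (c * (x - y'))) - ∫ x, u x * sech (c * (x - y))| ≤
        κ / 2 * (y' - y) := by
      rw [← integral_sub (hub y') (hub y), ← Real.norm_eq_abs]
      have hi : Integrable fun x => η * (c * (y' - y) * (sech (c * (x - y')) + sech (c * (x - y)))) :=
        (((integrable_sech hc y').add (integrable_sech hc y)).const_mul _).const_mul _
      refine le_trans (norm_integral_le_of_norm_le hi (ae_of_all _ fun x => ?_)) ?_
      · rw [← mul_sub, norm_mul]
        refine mul_le_mul (hη x) ?_ (norm_nonneg _) hη0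
        refine (abs_sech_sub_sech_le _ _).trans (le_of_eq ?_)
        rw [show c * (x - y') - c * (x - y) = -(c * (y' - y)) by ring, abs_neg,
          abs_of_nonneg (by positivity)]
      · rw [integral_const_mul, integral_const_mul, integral_add (integrable_sech hc y') (integrable_sech hc y)]
        have h1 := hsI y
        have h2 := hsI y'
        calc _ ≤ η * (2 * c₀ * (y' - y) * (I + I)) := by
              gcongr
              · exact add_nonneg (integral_nonneg fun x => (sech_pos _).le)
                  (integral_nonneg fun x => (sech_pos _).le)
              · linarith
          _ = (η * (4 * c₀ * I)) * (y' - y) := by ring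
          _ ≤ κ / 2 * (y' - y) := by
              gcongr
              linarith
    have hA1 : κ * (y' - y) ≤ (∫ x, profile (c₀ * (x + y' - x₀)) * sech (c * (x - 0))) -
        ∫ x, profile (c₀ * (x + y - x₀)) * sech (c * (x - 0)) := by
      rw [← integral_sub (hpb y') (hpb y)]
      have hi : Integrable ((Set.Icc (-1 : ℝ) 1).indicator fun _ => κ * (y' - y)) :=
        (integrable_indicator_iff measurableSet_Icc).2
          (integrableOn_const (by simp))
      have hle1 : ∫ x, (Set.Icc (-1 : ℝ) 1).indicator (fun _ => κ * (y' - y)) x ≤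
          ∫ x, profile (c₀ * (x + y' - x₀)) * sech (c * (x - 0)) -
            profile (c₀ * (x + y - x₀)) * sech (c * (x - 0)) := by
        refine integral_mono hi ((hpb y').sub (hpb y)) fun x => ?_
        simp only
        rw [← sub_mul]
        have hmono : profile (c₀ * (x + y - x₀)) ≤ profile (c₀ * (x + y' - x₀)) := by
          refine monotone_of_deriv_nonneg (fun z => (hasDerivAt_profile z).differentiableAt)
            (fun z => ?_) ?_
          · rw [(hasDerivAt_profile z).deriv]
            have := sech_pos z
            positivity
          · gcongr
        by_cases hx : x ∈ Set.Icc (-1 : ℝ) 1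
        · rw [Set.indicator_of_mem hx]
          have hx1 : |x| ≤ 1 := abs_le.2 hx
          have hb : ∀ z, |z - x₀| ≤ 1 → |c₀ * (x + z - x₀)| ≤ 2 * c₀ := by
            intro z hz
            rw [abs_mul, abs_of_pos h0, add_sub_assoc]
            have := abs_add_le x (z - x₀)
            nlinarith
          have h1 := two_sech_mul_le_profile_sub (hb y hy) (hb y' hy') (by gcongr)
          have h2 : S ≤ sech (c * (x - 0)) := by
            refine inv_anti₀ (Real.cosh_pos _) (Real.cosh_le_cosh.2 ?_)
            rw [sub_zero, abs_mul, abs_of_pos hc, abs_of_pos (mul_pos two_pos h0)]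
            nlinarith [abs_nonneg x]
          rw [show c₀ * (x + y' - x₀) - c₀ * (x + y - x₀) = c₀ * (y' - y) by ring] at h1
          calc κ * (y' - y) = 2 * S * (c₀ * (y' - y)) * S := by rw [hκ]; ring
            _ ≤ _ := mul_le_mul h1 h2 hS0.le (by linarith)
        · rw [Set.indicator_of_notMem hx]
          exact mul_nonneg (by linarith) (sech_pos _).le
      refine le_trans ?_ hle1
      rw [integral_indicator_const _ measurableSet_Icc, Real.volume_real_Icc, smul_eq_mul]
      have : 0 ≤ κ * (y' - y) := by positivity
      norm_num
      linarith
    have hA2 : (∫ x, profile (c₀ * (x + y' - x₀)) * sech (c * (x - 0))) -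
        (∫ x, profile (c₀ * (x + y - x₀)) * sech (c * (x - 0))) ≤ 2 * c₀ * I * (y' - y) := by
      rw [← integral_sub (hpb y') (hpb y)]
      calc _ ≤ ∫ x, 2 * c₀ * (y' - y) * sech (c * (x - 0)) := by
            refine integral_mono ((hpb y').sub (hpb y)) ((integrable_sech hc 0).const_mul _) fun x => ?_
            simp only
            rw [← sub_mul]
            refine mul_le_mul_of_nonneg_right ?_ (sech_pos _).le
            refine (le_abs_self _).trans ((abs_profile_sub_le' _ _).trans (le_of_eq ?_))
            rw [show c₀ * (x + y' - x₀) - c₀ * (x + y - x₀) = c₀ * (y' - y) by ring,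
              abs_of_nonneg (by positivity)]
            ring
        _ = 2 * c₀ * (y' - y) * ∫ x, sech (c * (x - 0)) := integral_const_mul _ _
        _ ≤ 2 * c₀ * (y' - y) * I := by gcongr; exact hsI 0
        _ = _ := by ring
    rw [split y, split y']
    rw [abs_le] at hU
    constructor
    · linarith [hU.1]
    · linarith [hU.2, mul_nonneg hκ0.le hyy]
  constructor
  · have hJ0 : |J x₀| ≤ Q * (η + |c - c₀|) := by
      have hi : Integrable fun x => η * sech (c * (x - x₀)) +
          2 * |c - c₀| * (|x - x₀| * sech (c₀ / 2 * (x - x₀ - 0))) :=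
        ((integrable_sech hc x₀).const_mul η).add ((hi1.comp_sub_right x₀).const_mul _)
      rw [← Real.norm_eq_abs]
      refine le_trans (norm_integral_le_of_norm_le hi (ae_of_all _ fun x => ?_)) ?_
      · have h1 : |profile (c₀ * (x - x₀)) + u x - profile (c * (x - x₀))| ≤
            η + 2 * |c - c₀| * |x - x₀| := by
          rw [show profile (c₀ * (x - x₀)) + u x - profile (c * (x - x₀)) =
            u x + (profile (c₀ * (x - x₀)) - profile (c * (x - x₀))) by ring]
          refine (abs_add_le _ _).trans (add_le_add (hη x) ((abs_profile_sub_le' _ _).trans (le_of_eq ?_)))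
          rw [← sub_mul, abs_mul, abs_sub_comm c₀, mul_assoc]
        have h2 : sech (c * (x - x₀)) ≤ sech (c₀ / 2 * (x - x₀ - 0)) := by
          rw [sub_zero]; exact sech_le_of_le hc2 (by linarith)
        have h3 := (sech_pos (c * (x - x₀))).le
        rw [norm_mul, Real.norm_of_nonneg h3]
        calc _ ≤ (η + 2 * |c - c₀| * |x - x₀|) * sech (c * (x - x₀)) :=
              mul_le_mul_of_nonneg_right h1 h3
          _ = η * sech (c * (x - x₀)) + 2 * |c - c₀| * (|x - x₀| * sech (c * (x - x₀))) := by ring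
          _ ≤ _ := by gcongr
      · rw [integral_add ((integrable_sech hc x₀).const_mul η) ((hi1.comp_sub_right x₀).const_mul _),
          integral_const_mul, integral_const_mul,
          integral_sub_right_eq_self (fun x => |x| * sech (c₀ / 2 * (x - 0))) x₀]
        have h1 := hsI x₀
        have h2 := abs_nonneg (c - c₀)
        calc _ ≤ η * I + 2 * |c - c₀| * I₁ := by gcongr
          _ ≤ Q * (η + |c - c₀|) := by
            have : 0 ≤ η * (2 * I₁ + 1) + |c - c₀| * (I + 1) := by positivity
            rw [hQ]; linarith
    -- At this distance the growth `κ ρ / 2` equals the bound for the defect at `x₀`, so the defect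
    -- changes sign on `[x₀ - ρ, x₀ + ρ]`.
    set ρ : ℝ := 2 * Q / κ * (η + |c - c₀|) with hρ
    have hρ0 : 0 ≤ ρ := by positivity
    have hρ1 : ρ ≤ 1 := by
      have h1 : η ≤ κ / (4 * Q) := hηr.trans (min_le_right _ _)
      have h2 : |c - c₀| ≤ κ / (4 * Q) := hcr.trans (min_le_right _ _)
      calc ρ ≤ 2 * Q / κ * (κ / (4 * Q) + κ / (4 * Q)) := by rw [hρ]; gcongr
        _ = 1 := by field_simp; norm_num
    have hκρ : κ / 2 * ρ = Q * (η + |c - c₀|) := by rw [hρ]; field_simp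
    have near : ∀ y ∈ Set.Icc (x₀ - ρ) (x₀ + ρ), |y - x₀| ≤ ρ := fun y hy => by
      rw [abs_le]; constructor <;> linarith [hy.1, hy.2]
    have hcont : ContinuousOn J (Set.Icc (x₀ - ρ) (x₀ + ρ)) := by
      refine (LipschitzOnWith.of_dist_le_mul (K := (2 * c₀ * I + κ).toNNReal) fun y hy y' hy' => ?_).continuousOn
      rw [Real.coe_toNNReal _ (by positivity), Real.dist_eq, Real.dist_eq]
      rcases le_total y y' with h | h
      · have := hinc y y' ((near y hy).trans hρ1) ((near y' hy').trans hρ1) h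
        have h2 : 0 ≤ κ / 2 * (y' - y) := mul_nonneg (by positivity) (by linarith)
        rw [abs_sub_comm, abs_sub_comm y, abs_of_nonneg (by linarith [this.1]), abs_of_nonneg (by linarith)]
        exact this.2
      · have := hinc y' y ((near y' hy').trans hρ1) ((near y hy).trans hρ1) h
        have h2 : 0 ≤ κ / 2 * (y - y') := mul_nonneg (by positivity) (by linarith)
        rw [abs_of_nonneg (by linarith [this.1]), abs_of_nonneg (by linarith)]
        exact this.2
    have hx0 : |x₀ - x₀| ≤ 1 := by simp
    have up := (hinc x₀ (x₀ + ρ) hx0 (by rwa [add_sub_cancel_left, abs_of_nonneg hρ0]) (by linarith)).1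
    have dn := (hinc (x₀ - ρ) x₀ (by rwa [sub_sub_cancel_left, abs_neg, abs_of_nonneg hρ0]) hx0
      (by linarith)).1
    rw [add_sub_cancel_left, hκρ] at up
    rw [sub_sub_cancel, hκρ] at dn
    obtain ⟨l, h⟩ := abs_le.1 hJ0
    obtain ⟨y, hy, hy0⟩ := intermediate_value_Icc (by linarith) hcont
      (show (0 : ℝ) ∈ Set.Icc (J (x₀ - ρ)) (J (x₀ + ρ)) from ⟨by linarith, by linarith⟩)
    exact ⟨y, near y hy, hy0⟩
  · have key : ∀ y y', |y - x₀| ≤ 1 → |y' - x₀| ≤ 1 → J y = 0 → J y' = 0 → y ≤ y' → y = y' := by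
      intro y y' hy hy' h h' hle
      have := (hinc y y' hy hy' hle).1
      rw [h, h', sub_zero] at this
      have h3 : y' - y ≤ 0 := nonpos_of_mul_nonpos_right this (by positivity)
      linarith
    intro y y' hy hy' h h'
    rcases le_total y y' with hle | hle
    · exact key y y' hy hy' h h' hle
    · exact (key y' y hy' hy h' h hle).symm

end Translation

/-! ### Solving the Bäcklund equations at time zero -/

lemma EnergySpace.hasACDeriv (f : EnergySpace) (t : ℝ) : HasACDeriv (f.toFun t) (f.dx t) :=
  (f.isWeakDeriv_dx t).hasACDeriv (f.continuous_slice t)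
    ((Lp.memLp (f.dx t)).locallyIntegrable (by norm_num))

/-- The equation for `φ_x` in the Bäcklund transform at time zero. -/
def IsInitialBT (f : EnergySpace) (a : ℝ) (φ φ' : ℝ → ℝ) : Prop :=
  HasACDeriv φ φ' ∧ ∀ᵐ x, f.dt 0 x - φ' x - 1 / a * Real.sin ((f.toFun 0 x + φ x) / 2) +
    a * Real.sin ((f.toFun 0 x - φ x) / 2) = 0

/-- The deviation of `f(0)` from a kink. -/
def dev₀ (f : EnergySpace) (β x₀ x : ℝ) : ℝ := f.toFun 0 x - kink β x₀ 0 x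

/-- The deviation of `f_t(0)` from a kink. -/
def dev₁ (f : EnergySpace) (β x₀ x : ℝ) : ℝ := f.dt 0 x - kinkDt β x₀ 0 x

section Initial

variable {f : EnergySpace} {β₀ x₀ m s : ℝ}

lemma hasACDeriv_kink (β y : ℝ) : HasACDeriv (kink β y 0)
    (fun x => 2 * lorentz β * sech (lorentz β * (x - y))) := by
  have e : kink β y 0 = fun x => profile (lorentz β * (x - y)) := funext fun x => kink_zero β y x
  rw [e]
  exact profile_affine_hasACDeriv _ _

lemma hasACDeriv_dev₀ (f : EnergySpace) (β y : ℝ) : HasACDeriv (dev₀ f β y)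
    (fun x => f.dx 0 x - 2 * lorentz β * sech (lorentz β * (x - y))) :=
  (f.hasACDeriv 0).sub (hasACDeriv_kink β y)

lemma memLp_dev₁ (f : EnergySpace) {β : ℝ} (hβ : β ∈ Set.Ioo (-1 : ℝ) 1) (y : ℝ) :
    MemLp (dev₁ f β y) 2 (volume : Measure ℝ) := by
  have h : MemLp (fun x => kinkDt β y 0 x) 2 (volume : Measure ℝ) := by
    simp only [kinkDt_zero]
    exact (memLp_sech (zero_lt_one.trans_le (one_le_lorentz hβ)) y).const_mul _
  exact (Lp.memLp (f.dt 0)).sub h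

lemma distToKink_eq (f : EnergySpace) (m s β y : ℝ) :
    distToKink m s f β y = sobolevNorm (m + 1) s (dev₀ f β y) + sobolevNorm m s (dev₁ f β y) := rfl

lemma toFun_eq_dev (hβ₀ : β₀ ∈ Set.Ioo (-1 : ℝ) 1) (x : ℝ) : f.toFun 0 x =
    profile (rate (backlundParam β₀) * (x - x₀)) + dev₀ f β₀ x₀ x := by
  unfold dev₀
  rw [kink_zero, lorentz_eq_rate hβ₀]
  ring

/-- No approximation is made: `btRem` was defined as whatever is left after the linear terms at the
kink have been extracted. -/
lemma isInitialBT_iff (hβ₀ : β₀ ∈ Set.Ioo (-1 : ℝ) 1) {b : ℝ} {φ φ' : ℝ → ℝ} :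
    IsInitialBT f (backlundParam β₀ + b) φ φ' ↔
      IsBTSol (backlundParam β₀) x₀ (dev₀ f β₀ x₀) (dev₁ f β₀ x₀) b φ φ' := by
  refine and_congr_right fun _ => eventually_congr (Eventually.of_forall fun x => ?_)
  set c := rate (backlundParam β₀) with hc
  have e1 : (f.toFun 0 x + φ x) / 2 =
      profile (c * (x - x₀)) / 2 + (dev₀ f β₀ x₀ x + φ x) / 2 := by
    rw [toFun_eq_dev (x₀ := x₀) hβ₀]; ring
  have e2 : (f.toFun 0 x - φ x) / 2 =
      profile (c * (x - x₀)) / 2 + (dev₀ f β₀ x₀ x - φ x) / 2 := by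
    rw [toFun_eq_dev (x₀ := x₀) hβ₀]; ring
  have e3 : dev₁ f β₀ x₀ x = f.dt 0 x - (1 / backlundParam β₀ - backlundParam β₀) * sech (c * (x - x₀)) := by
    unfold dev₁
    rw [kinkDt_zero, ← param_sub hβ₀, lorentz_eq_rate hβ₀]
  unfold btSource btRem paramCoeff
  rw [e1, e2, e3, sin_half_profile, cos_half_profile, ← hc, add_sub_cancel_left]
  have e4 : rate (backlundParam β₀) = (backlundParam β₀ + 1 / backlundParam β₀) / 2 := rfl
  rw [← e4, ← hc]
  constructor <;> intro h <;> linear_combination -h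

/-- The expressions for `φ_x` and `φ_t` in the two Bäcklund equations, in the form to which the
Sobolev estimates for `btRhs` apply. -/
lemma isInitialBT_iff_btRhs (hβ₀ : β₀ ∈ Set.Ioo (-1 : ℝ) 1) {a : ℝ} {φ : ℝ → ℝ} (x : ℝ) :
    (f.dt 0 x - 1 / a * Real.sin ((f.toFun 0 x + φ x) / 2) + a * Real.sin ((f.toFun 0 x - φ x) / 2) =
      btRhs (rate (backlundParam β₀)) x₀ (dev₁ f β₀ x₀)
        ((1 / backlundParam β₀ - backlundParam β₀) - (1 / a - a)) (-(1 / a)) a (dev₀ f β₀ x₀) φ x) ∧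
    (f.dx 0 x - 1 / a * Real.sin ((f.toFun 0 x + φ x) / 2) - a * Real.sin ((f.toFun 0 x - φ x) / 2) =
      btRhs (rate (backlundParam β₀)) x₀
        (fun x => f.dx 0 x - 2 * lorentz β₀ * sech (lorentz β₀ * (x - x₀)))
        (2 * rate (backlundParam β₀) - 2 * rate a) (-(1 / a)) (-a) (dev₀ f β₀ x₀) φ x) := by
  set c := rate (backlundParam β₀) with hc
  have e1 : (f.toFun 0 x + φ x) / 2 =
      profile (c * (x - x₀)) / 2 + (1 / 2) * (dev₀ f β₀ x₀ x + φ x) := by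
    rw [toFun_eq_dev (x₀ := x₀) hβ₀]; ring
  have e2 : (f.toFun 0 x - φ x) / 2 =
      profile (c * (x - x₀)) / 2 + (1 / 2) * (dev₀ f β₀ x₀ x - φ x) := by
    rw [toFun_eq_dev (x₀ := x₀) hβ₀]; ring
  have e3 : dev₁ f β₀ x₀ x = f.dt 0 x - (1 / backlundParam β₀ - backlundParam β₀) * sech (c * (x - x₀)) := by
    unfold dev₁
    rw [kinkDt_zero, ← param_sub hβ₀, lorentz_eq_rate hβ₀]
  have e4 : 2 * rate a = a + 1 / a := by unfold rate; ring
  unfold btRhs kinkIncr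
  rw [e1, e2, e3, sin_half_profile_add, sin_half_profile_add, lorentz_eq_rate hβ₀, ← hc, e4]
  constructor <;> ring

lemma integral_eq_orthDefect (hβ₀ : β₀ ∈ Set.Ioo (-1 : ℝ) 1) {β : ℝ} (hβ : β ∈ Set.Ioo (-1 : ℝ) 1) (y : ℝ) :
    ∫ x, (f.toFun 0 x - kink β y 0 x) * sech (lorentz β * (x - y)) =
      orthDefect (fun x => profile (rate (backlundParam β₀) * (x - x₀)) + dev₀ f β₀ x₀ x)
        (rate (backlundParam β)) y := by
  unfold orthDefect
  simp only [← toFun_eq_dev hβ₀, kink_zero, lorentz_eq_rate hβ]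

set_option maxHeartbeats 2000000 in
/-- Solution of the Bäcklund equations at time zero near a kink. -/
theorem exists_initialBT (hm : 0 ≤ m) (hs : 0 ≤ s) (hβ₀ : β₀ ∈ Set.Ioo (-1 : ℝ) 1) (x₀ : ℝ) :
    ∃ C r : ℝ, 0 < C ∧ 0 < r ∧ ∀ (f : EnergySpace) (ε : ℝ), 0 < ε → ε < r →
      distToKink m s f β₀ x₀ < ENNReal.ofReal ε →
      ∃ β ∈ Set.Ioo (-1 : ℝ) 1, ∃ (y : ℝ) (φ φ' : ℝ → ℝ), IsInitialBT f (backlundParam β) φ φ' ∧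
        |β - β₀| + |y - x₀| ≤ C * ε ∧ sobolevNorm (m + 1) s φ ≤ ENNReal.ofReal (C * ε) ∧
        sobolevNorm m s (fun x => f.dx 0 x -
          1 / backlundParam β * Real.sin ((f.toFun 0 x + φ x) / 2) -
          backlundParam β * Real.sin ((f.toFun 0 x - φ x) / 2)) ≤ ENNReal.ofReal (C * ε) ∧
        distToKink m s f β y ≤ ENNReal.ofReal (C * ε) ∧
        ∫ x, (f.toFun 0 x - kink β y 0 x) * sech (lorentz β * (x - y)) = 0 := by
  set a₀ := backlundParam β₀ with ha₀
  have h0 : 0 < a₀ := backlundParam_pos hβ₀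
  have hc := rate_pos h0
  obtain ⟨r₁, C₁, hr₁, hC₁, hsol⟩ := exists_btSol h0 x₀ hs
  obtain ⟨r₂, C₂, hr₂, hC₂, htr⟩ := exists_translation hc x₀
  obtain ⟨C₃, r₃, hC₃, hr₃, hkd⟩ := exists_pairNorm_kink_sub_le hm hs hβ₀ x₀
  set M : ℝ := 2 * a₀ + 2 / a₀ with hM
  obtain ⟨C₄, δ₄, hC₄, hδ₄, hboot⟩ := exists_bootstrap hc x₀ hs hm M
  obtain ⟨A₅, hA₅, hrhs⟩ := exists_sobolevNorm_btRhs_le hc x₀ hs hm M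
  obtain ⟨A₆, hA₆, hsup⟩ := exists_enorm_le_sobolevNorm hs
  obtain ⟨A₇, hA₇, hder⟩ := exists_sobolevNorm_deriv_le s hm
  -- constants
  set P₄ : ℝ := (C₄ + 1).toReal with hP₄
  have hP₄1 : 1 ≤ P₄ := by
    rw [hP₄, ← ENNReal.toReal_one]
    exact ENNReal.toReal_mono (by finiteness) le_add_self
  have hC₄P : C₄ ≤ ENNReal.ofReal P₄ := by
    rw [hP₄, ENNReal.ofReal_toReal (by finiteness)]; exact le_self_add
  set P₇ : ℝ := (A₇ + 1).toReal with hP₇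
  have hP₇1 : 1 ≤ P₇ := by
    rw [hP₇, ← ENNReal.toReal_one]
    exact ENNReal.toReal_mono (by finiteness) le_add_self
  have hA₇P : A₇ ≤ ENNReal.ofReal P₇ := by
    rw [hP₇, ENNReal.ofReal_toReal (by finiteness)]; exact le_self_add
  have hA₅P : A₅ ≤ ENNReal.ofReal A₅.toReal := (ENNReal.ofReal_toReal hA₅).ge
  have hA₆P : A₆ ≤ ENNReal.ofReal A₆.toReal := (ENNReal.ofReal_toReal hA₆).ge
  obtain ⟨δ, hδ, hδδ⟩ : ∃ δ : ℝ, 0 < δ ∧ ENNReal.ofReal δ ≤ δ₄ := by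
    refine ⟨(min δ₄ 1).toReal, ENNReal.toReal_pos (lt_min (pos_iff_ne_zero.2 hδ₄) one_pos).ne' (by simp), ?_⟩
    rw [ENNReal.ofReal_toReal (by simp)]
    exact min_le_left _ _
  set L : ℝ := 1 + 1 / a₀ ^ 2 with hL
  have hL1 : 1 ≤ L := by
    have : 0 < 1 / a₀ ^ 2 := by positivity
    rw [hL]; linarith
  set N : ℝ := A₆.toReal + 1 with hN
  have hN1 : 1 ≤ N := by have := ENNReal.toReal_nonneg (a := A₆); rw [hN]; linarith
  set D : ℝ := C₁ * N with hD
  have hD0 : 0 < D := by positivity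
  set E : ℝ := 2 * (L * D) + N with hE
  have hE1 : 1 ≤ E := by have : 0 < 2 * (L * D) := by positivity
                         rw [hE]; linarith
  set H : ℝ := D + C₂ * (N + L * D) with hH
  have hH0 : 0 < H := by positivity
  set G : ℝ := P₇ * (P₄ * E) with hG
  have hPE : 1 ≤ P₄ * E := by nlinarith
  have hG1 : 1 ≤ G := by nlinarith
  have hDE : D ≤ E := by rw [hE]; nlinarith
  -- One summand for each estimate: the two parameters, `φ`, `φ_t`, and the distance to the new
  -- kink.
  set C : ℝ := (2 * D + C₂ * (N + L * D)) + P₄ * E + A₅.toReal * G + (1 + C₃ * H) with hCd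
  have hA50 : 0 ≤ A₅.toReal := ENNReal.toReal_nonneg
  refine ⟨C, min (min (r₁ / N) (a₀ / 2 / D)) (min (r₂ / N) (r₂ / (L * D))) ⊓
    min (min (r₃ / H) (δ / E)) (1 / G), by positivity, by positivity, ?_⟩
  intro f ε hε hεr hdist
  have q : ∀ {b c : ℝ}, 0 < c → ε < b / c → c * ε ≤ b := fun {b c} hc h => by
    rw [lt_div_iff₀ hc] at h; linarith
  obtain ⟨hεr1, hεr2⟩ := lt_min_iff.1 hεr
  obtain ⟨hεa, hεb⟩ := lt_min_iff.1 hεr1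
  obtain ⟨hεc, hεd⟩ := lt_min_iff.1 hεr2
  have t1 := q (by positivity) (lt_min_iff.1 hεa).1
  have t2 := q (by positivity) (lt_min_iff.1 hεa).2
  have t3 := q (by positivity) (lt_min_iff.1 hεb).1
  have t4 := q (by positivity) (lt_min_iff.1 hεb).2
  have t5 := q (by positivity) (lt_min_iff.1 hεc).1
  have t6 := q (by positivity) (lt_min_iff.1 hεc).2
  have t7 := q (by positivity) hεd
  set u₀ := dev₀ f β₀ x₀ with hu₀
  set u₁ := dev₁ f β₀ x₀ with hu₁
  have hu0ac := hasACDeriv_dev₀ f β₀ x₀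
  rw [distToKink_eq] at hdist
  have x0 : sobolevNorm (m + 1) s u₀ ≤ ENNReal.ofReal ε := le_self_add.trans hdist.le
  have x1 : sobolevNorm m s u₁ ≤ ENNReal.ofReal ε := le_add_self.trans hdist.le
  have hNε : ENNReal.ofReal ε ≤ ENNReal.ofReal (N * ε) := ENNReal.ofReal_le_ofReal (by nlinarith)
  have hsup0 : ∀ x, |u₀ x| ≤ N * ε := fun x => by
    rw [← ENNReal.ofReal_le_ofReal_iff (by positivity), ← enorm_real_eq]
    calc _ ≤ A₆ * sobolevNorm 1 s u₀ := hsup u₀ _ hu0ac x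
      _ ≤ ENNReal.ofReal N * ENNReal.ofReal ε :=
        mul_le_mul' (hA₆P.trans (ENNReal.ofReal_le_ofReal (by linarith)))
          ((sobolevNorm_mono (by linarith)).trans x0)
      _ = _ := (ENNReal.ofReal_mul (by positivity)).symm
  -- The factor `N` bounds the Sobolev embedding constant, so that `N ε` controls the sup norm of
  -- `u₀` as well.
  obtain ⟨b, φ, φ', hbt, hb, hφb, hφw⟩ := hsol u₀ u₁ (N * ε) hu0ac.continuous
    (memLp_dev₁ f hβ₀ x₀) (by positivity) t1 hsup0
    (((eLpNorm_weight_le (by linarith)).trans x0).trans hNε)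
    (((eLpNorm_weight_le hm).trans x1).trans hNε)
  rw [← mul_assoc, ← hD] at hb hφw
  have hba : |a₀ + b - a₀| ≤ D * ε := by simpa using hb
  obtain ⟨ap, a2, a3, a4⟩ := inv_bounds h0 t2 hba
  have hrate := abs_rate_sub_le h0 t2 hba
  -- The velocity is read off from the Bäcklund parameter `a₀ + b`; only then is the translation
  -- chosen, for the rate of the new kink.
  obtain ⟨β, hβ, hβa, hββ⟩ := exists_backlundParam_eq ap h0 hβ₀ rfl
  rw [add_sub_cancel_left] at hββ hrate
  have hrate' : |rate (a₀ + b) - rate a₀| ≤ L * D * ε := by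
    rw [mul_assoc]; exact hrate.trans (by gcongr)
  obtain ⟨⟨y, hy, hy0⟩, -⟩ := htr u₀ (rate (a₀ + b)) (N * ε) hu0ac.continuous hsup0 t3 (hrate'.trans t4)
  have hy' : |y - x₀| ≤ C₂ * (N + L * D) * ε := hy.trans (by
    calc _ ≤ C₂ * (N * ε + L * D * ε) := by gcongr
      _ = _ := by ring)
  have hinit := (isInitialBT_iff (f := f) (x₀ := x₀) hβ₀).2 hbt
  have hde : φ' =ᵐ[volume] btRhs (rate a₀) x₀ u₁ ((1 / a₀ - a₀) - (1 / (a₀ + b) - (a₀ + b)))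
      (-(1 / (a₀ + b))) (a₀ + b) u₀ φ := by
    filter_upwards [hinit.2] with x hx
    rw [← (isInitialBT_iff_btRhs (f := f) (x₀ := x₀) hβ₀ (a := a₀ + b) (φ := φ) x).1]
    linear_combination -hx
  have c1 : |-(1 / (a₀ + b))| ≤ M := by
    rw [abs_neg, abs_of_pos (by positivity), hM]; linarith
  have c2 : |a₀ + b| ≤ M := by
    rw [abs_of_pos ap, hM]
    have : 0 < 2 / a₀ := by positivity
    linarith
  have c2' : |-(a₀ + b)| ≤ M := by rwa [abs_neg]
  have hED : 2 * (L * (D * ε)) ≤ E * ε := by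
    have : 0 < N * ε := by positivity
    have : E * ε = 2 * (L * (D * ε)) + N * ε := by rw [hE]; ring
    linarith
  have e1 : |(1 / a₀ - a₀) - (1 / (a₀ + b) - (a₀ + b))| ≤ E * ε := by
    refine le_trans ?_ hED
    rw [show (1 / a₀ - a₀) - (1 / (a₀ + b) - (a₀ + b)) = b + (1 / a₀ - 1 / (a₀ + b)) by ring]
    refine (abs_add_le _ _).trans ((add_le_add hb (a4.trans (mul_le_mul_of_nonneg_left hba (by positivity)))).trans ?_)
    have h1 : 0 ≤ D * ε := by positivity
    have h2 : 2 * (L * (D * ε)) = 2 * (D * ε) + 2 / a₀ ^ 2 * (D * ε) := by rw [hL]; ring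
    linarith
  have e2 : |2 * rate a₀ - 2 * rate (a₀ + b)| ≤ E * ε := by
    refine le_trans ?_ hED
    rw [← mul_sub, abs_mul, abs_two, abs_sub_comm, ← mul_assoc L]
    gcongr
  have hEε : ENNReal.ofReal ε ≤ ENNReal.ofReal (E * ε) := ENNReal.ofReal_le_ofReal (by nlinarith)
  have hφ0 : sobolevNorm 0 s φ ≤ ENNReal.ofReal (E * ε) :=
    (sobolevNorm_zero_le hbt.1.continuous.aestronglyMeasurable).trans
      (hφw.trans (ENNReal.ofReal_le_ofReal (by gcongr)))
  have hφ1 := hboot u₁ u₀ _ φ φ' _ _ _ (ENNReal.ofReal (E * ε))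
    ((ENNReal.ofReal_le_ofReal t6).trans hδδ) hu0ac hbt.1 c1 c2 (x1.trans hEε)
    (ENNReal.ofReal_le_ofReal e1) (x0.trans hEε) hφ0 hde
  have hφ2 : sobolevNorm (m + 1) s φ ≤ ENNReal.ofReal (P₄ * E * ε) := by
    rw [mul_assoc, ENNReal.ofReal_mul (by positivity)]
    exact hφ1.trans (mul_le_mul' hC₄P le_rfl)
  have hGε : ∀ {t : ℝ}, t ≤ G → ENNReal.ofReal (t * ε) ≤ ENNReal.ofReal (G * ε) := fun h =>
    ENNReal.ofReal_le_ofReal (by gcongr)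
  have hPG : P₄ * E ≤ G := by rw [hG]; exact le_mul_of_one_le_left (by positivity) hP₇1
  have hEG : E ≤ G := le_trans (le_mul_of_one_le_left (by positivity) hP₄1) hPG
  have hmax : max m 1 ≤ m + 1 := max_le (by linarith) (by linarith)
  have x0' : sobolevNorm m s (fun x => f.dx 0 x - 2 * lorentz β₀ * sech (lorentz β₀ * (x - x₀))) ≤
      ENNReal.ofReal (G * ε) := by
    refine (hder u₀ _ hu0ac (ne_top_of_le_ne_top (by simp) x0)).trans ((mul_le_mul' hA₇P x0).trans ?_)
    rw [← ENNReal.ofReal_mul (by positivity)]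
    refine hGε ?_
    rw [hG]
    exact le_mul_of_one_le_right (by positivity) hPE
  have hφt := hrhs _ u₀ _ φ φ' (2 * rate a₀ - 2 * rate (a₀ + b)) (-(1 / (a₀ + b))) (-(a₀ + b))
    (ENNReal.ofReal (G * ε)) (by rw [← ENNReal.ofReal_one]; exact ENNReal.ofReal_le_ofReal t7) hu0ac
    hbt.1 c1 c2' x0' ((ENNReal.ofReal_le_ofReal e2).trans (hGε hEG))
    (((sobolevNorm_mono hmax).trans x0).trans (hEε.trans (hGε hEG)))
    (((sobolevNorm_mono hmax).trans hφ2).trans (hGε hPG))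
  rw [← funext fun x => (isInitialBT_iff_btRhs (f := f) (x₀ := x₀) hβ₀ (a := a₀ + b) (φ := φ) x).2] at hφt
  have hHd : max (D * ε) (|y - x₀|) ≤ H * ε := by
    refine max_le ?_ (hy'.trans ?_)
    · gcongr; rw [hH]; exact le_add_of_nonneg_right (by positivity)
    · gcongr; rw [hH]; exact le_add_of_nonneg_left (by positivity)
  have hkd' := hkd β y (H * ε) hβ (by rw [hβa]; exact hba.trans ((le_max_left _ _).trans hHd))
    ((le_max_right _ _).trans hHd) t5
  have pos1 : 0 ≤ (2 * D + C₂ * (N + L * D)) := by positivity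
  have pos2 : 0 ≤ P₄ * E := by positivity
  have pos3 : 0 ≤ A₅.toReal * G := by positivity
  have pos4 : 0 ≤ 1 + C₃ * H := by positivity
  refine ⟨β, hβ, y, φ, φ', by rw [hβa]; exact hinit, ?_, ?_, ?_, ?_, ?_⟩
  · calc _ ≤ 2 * (D * ε) + C₂ * (N + L * D) * ε := add_le_add (hββ.trans (by gcongr)) hy'
      _ = (2 * D + C₂ * (N + L * D)) * ε := by ring
      _ ≤ _ := by gcongr; rw [hCd]; linarith
  · refine hφ2.trans (ENNReal.ofReal_le_ofReal ?_)
    gcongr; rw [hCd]; linarith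
  · rw [hβa]
    refine hφt.trans ((mul_le_mul' hA₅P le_rfl).trans ?_)
    rw [← ENNReal.ofReal_mul hA50, ← mul_assoc]
    refine ENNReal.ofReal_le_ofReal ?_
    gcongr; rw [hCd]; linarith
  -- Triangle inequality: the given distance to the old kink plus the Lipschitz dependence of kinks
  -- on their parameters.
  · have s0 : dev₀ f β y = fun x => u₀ x + (kink β₀ x₀ 0 x - kink β y 0 x) := by
      ext x; simp only [hu₀, dev₀]; ring
    have s1 : dev₁ f β y = fun x => u₁ x + (kinkDt β₀ x₀ 0 x - kinkDt β y 0 x) := by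
      ext x; simp only [hu₁, dev₁]; ring
    rw [distToKink_eq, s0, s1]
    refine (add_le_add (sobolevNorm_add_le _ _) (sobolevNorm_add_le _ _)).trans ?_
    rw [add_add_add_comm]
    refine (add_le_add hdist.le hkd').trans ?_
    rw [← ENNReal.ofReal_add hε.le (by positivity)]
    refine ENNReal.ofReal_le_ofReal ?_
    calc _ = (1 + C₃ * H) * ε := by ring
      _ ≤ _ := by gcongr; rw [hCd]; linarith
  · rw [integral_eq_orthDefect (x₀ := x₀) hβ₀ hβ, hβa]
    exact hy0

/-- Uniqueness of the solution of the Bäcklund equations at time zero near a kink. -/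
theorem exists_initialBT_unique (hm : 0 ≤ m) (hs : 0 ≤ s) (hβ₀ : β₀ ∈ Set.Ioo (-1 : ℝ) 1) (x₀ : ℝ) :
    ∃ r : ℝ, 0 < r ∧ ∀ f : EnergySpace, distToKink m s f β₀ x₀ < ENNReal.ofReal r →
      ∀ (β y : ℝ) (φ φ' : ℝ → ℝ) (β₁ y₁ : ℝ) (ψ ψ' : ℝ → ℝ),
      β ∈ Set.Ioo (-1 : ℝ) 1 → β₁ ∈ Set.Ioo (-1 : ℝ) 1 →
      IsInitialBT f (backlundParam β) φ φ' → IsInitialBT f (backlundParam β₁) ψ ψ' →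
      |β - β₀| ≤ r → |β₁ - β₀| ≤ r → |y - x₀| ≤ r → |y₁ - x₀| ≤ r →
      sobolevNorm (m + 1) s φ ≤ ENNReal.ofReal r → sobolevNorm (m + 1) s ψ ≤ ENNReal.ofReal r →
      ∫ x, (f.toFun 0 x - kink β y 0 x) * sech (lorentz β * (x - y)) = 0 →
      ∫ x, (f.toFun 0 x - kink β₁ y₁ 0 x) * sech (lorentz β₁ * (x - y₁)) = 0 →
      β = β₁ ∧ y = y₁ ∧ φ = ψ := by
  set a₀ := backlundParam β₀ with ha₀
  have h0 : 0 < a₀ := backlundParam_pos hβ₀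
  have hc := rate_pos h0
  obtain ⟨r₁, hr₁, huniq⟩ := exists_btSol_unique h0 x₀
  obtain ⟨r₂, C₂, hr₂, hC₂, htr⟩ := exists_translation hc x₀
  obtain ⟨A₆, hA₆, hsup⟩ := exists_enorm_le_sobolevNorm hs
  have hA₆P : A₆ ≤ ENNReal.ofReal A₆.toReal := (ENNReal.ofReal_toReal hA₆).ge
  set N : ℝ := A₆.toReal + 1 with hN
  have hN1 : 1 ≤ N := by have := ENNReal.toReal_nonneg (a := A₆); rw [hN]; linarith
  have hcont := continuousAt_backlundParam hβ₀
  have hcr : ContinuousAt rate a₀ := by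
    unfold rate
    exact (continuousAt_id.add (continuousAt_const.div continuousAt_id h0.ne')).div_const 2
  have hcr' : ContinuousAt (fun β => rate (backlundParam β)) β₀ := 
    ContinuousAt.comp (f := backlundParam) (g := rate) hcr hcont
  obtain ⟨d₁, hd₁, hb₁⟩ := Metric.continuousAt_iff.1 hcont r₁ hr₁
  obtain ⟨d₂, hd₂, hb₂⟩ := Metric.continuousAt_iff.1 hcr' r₂ hr₂
  refine ⟨min (min (d₁ / 2) (d₂ / 2)) 1 ⊓ min (r₁ / N) (r₂ / N), by positivity, ?_⟩
  set r := min (min (d₁ / 2) (d₂ / 2)) 1 ⊓ min (r₁ / N) (r₂ / N) with hr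
  intro f hdist β y φ φ' β₁ y₁ ψ ψ' hβ hβ₁ hφ hψ hβr hβ₁r hyr hy₁r hφr hψr hI hI₁
  have hr0 : 0 < r := by positivity
  have l1 : r < d₁ := ((min_le_left _ _).trans ((min_le_left _ _).trans (min_le_left _ _))).trans_lt (by linarith)
  have l2 : r < d₂ := ((min_le_left _ _).trans ((min_le_left _ _).trans (min_le_right _ _))).trans_lt (by linarith)
  have l3 : r ≤ 1 := (min_le_left _ _).trans (min_le_right _ _)
  have l4 : N * r ≤ r₁ := by
    have : r ≤ r₁ / N := (min_le_right _ _).trans (min_le_left _ _)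
    rw [le_div_iff₀ (by positivity)] at this; linarith
  have l5 : N * r ≤ r₂ := by
    have : r ≤ r₂ / N := (min_le_right _ _).trans (min_le_right _ _)
    rw [le_div_iff₀ (by positivity)] at this; linarith
  have sup : ∀ u u' : ℝ → ℝ, HasACDeriv u u' → sobolevNorm (m + 1) s u ≤ ENNReal.ofReal r →
      ∀ x, |u x| ≤ N * r := fun u u' hu hur x => by
    rw [← ENNReal.ofReal_le_ofReal_iff (by positivity), ← enorm_real_eq]
    calc _ ≤ A₆ * sobolevNorm 1 s u := hsup u _ hu x
      _ ≤ ENNReal.ofReal N * ENNReal.ofReal r :=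
        mul_le_mul' (hA₆P.trans (ENNReal.ofReal_le_ofReal (by linarith)))
          ((sobolevNorm_mono (by linarith)).trans hur)
      _ = _ := (ENNReal.ofReal_mul (by positivity)).symm
  have hu0ac := hasACDeriv_dev₀ f β₀ x₀
  rw [distToKink_eq] at hdist
  have su := sup _ _ hu0ac (le_self_add.trans hdist.le)
  have par : ∀ β', |β' - β₀| ≤ r → |backlundParam β' - a₀| ≤ r₁ ∧ |rate (backlundParam β') - rate a₀| ≤ r₂ :=
    fun β' h => ⟨(hb₁ (show dist β' β₀ < d₁ from h.trans_lt l1)).le,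
      (hb₂ (show dist β' β₀ < d₂ from h.trans_lt l2)).le⟩
  -- Both candidates are linearized at the same reference kink, so that one uniqueness statement
  -- compares them.
  have tosol : ∀ (β' : ℝ) (χ χ' : ℝ → ℝ), IsInitialBT f (backlundParam β') χ χ' →
      IsBTSol a₀ x₀ (dev₀ f β₀ x₀) (dev₁ f β₀ x₀) (backlundParam β' - a₀) χ χ' := fun β' χ χ' h => by
    refine (isInitialBT_iff hβ₀).1 ?_
    rwa [← ha₀, add_sub_cancel]
  obtain ⟨e1, e2⟩ := huniq _ _ hu0ac.continuous (fun x => (su x).trans l4) (memLp_dev₁ f hβ₀ x₀)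
    φ φ' ψ ψ' _ _ (tosol _ _ _ hφ) (tosol _ _ _ hψ) (fun x => (sup _ _ hφ.1 hφr x).trans l4)
    (fun x => (sup _ _ hψ.1 hψr x).trans l4) (par β hβr).1 (par β₁ hβ₁r).1
  have e3 : β = β₁ := backlundParam_injOn hβ hβ₁ (by linarith)
  subst e3
  rw [integral_eq_orthDefect (x₀ := x₀) hβ₀ hβ] at hI hI₁
  have hη : ∀ x, |dev₀ f β₀ x₀ x| ≤ N * r := su
  exact ⟨rfl, (htr _ (rate (backlundParam β)) (N * r) hu0ac.continuous hη l5 (par β hβr).2).2 y y₁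
    (hyr.trans l3) (hy₁r.trans l3) hI hI₁, e2⟩

end Initial

/-! ### Translations and increments in `L²`. -/

/-- Real-valued square integrable functions on the line. -/
abbrev L2 := Lp ℝ 2 (volume : Measure ℝ)

/-- The translation `u ↦ u (· + h)` of `L²`. -/
def trans (h : ℝ) : L2 →ₗᵢ[ℝ] L2 :=
  Lp.compMeasurePreservingₗᵢ ℝ (fun x => x + h) (measurePreserving_add_right volume h)

lemma coeFn_trans (h : ℝ) (u : L2) : trans h u =ᵐ[volume] fun x => u (x + h) :=
  Lp.coeFn_compMeasurePreserving u (measurePreserving_add_right volume h)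

lemma ae_comp_add {P : ℝ → Prop} (h : ∀ᵐ x, P x) (c : ℝ) : ∀ᵐ x : ℝ, P (x + c) :=
  (measurePreserving_add_right volume c).quasiMeasurePreserving.ae h

lemma trans_trans (h k : ℝ) (u : L2) : trans h (trans k u) = trans (h + k) u := by
  apply Lp.ext
  filter_upwards [coeFn_trans h (trans k u), coeFn_trans (h + k) u, ae_comp_add (coeFn_trans k u) h]
    with x h1 h2 h3
  rw [h1, h2, h3, add_assoc]

lemma trans_zero (u : L2) : trans 0 u = u := by
  apply Lp.ext
  filter_upwards [coeFn_trans 0 u] with x h1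
  rw [h1, add_zero]

lemma tendsto_trans {α : Type*} {l : Filter α} {h : α → ℝ} {h₀ : ℝ} {u : α → L2} {u₀ : L2}
    (hh : Tendsto h l (𝓝 h₀)) (hu : Tendsto u l (𝓝 u₀)) :
    Tendsto (fun a => trans (h a) (u a)) l (𝓝 (trans h₀ u₀)) := by
  have hc : Continuous fun c : ℝ => (⟨fun x => x + c, by fun_prop⟩ : C(ℝ, ℝ)) :=
    ContinuousMap.continuous_of_continuous_uncurry _ (by
      show Continuous fun p : ℝ × ℝ => p.2 + p.1
      fun_prop)
  exact hu.compMeasurePreservingLp ((hc.tendsto h₀).comp hh)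
    (fun a => measurePreserving_add_right volume (h a)) (measurePreserving_add_right volume h₀)
    (by simp)

lemma continuous_trans {X : Type*} [TopologicalSpace X] {h : X → ℝ} {u : X → L2}
    (hh : Continuous h) (hu : Continuous u) : Continuous fun x => trans (h x) (u x) :=
  continuous_iff_continuousAt.2 fun x => tendsto_trans (hh.tendsto x) (hu.tendsto x)

lemma inner_L2 (u v : L2) : inner ℝ u v = ∫ x, u x * v x := by
  rw [L2.inner_def]
  exact integral_congr_ae (ae_of_all _ fun x => by simp [mul_comm])

lemma L2.locallyIntegrable (u : L2) : LocallyIntegrable u := (Lp.memLp u).locallyIntegrable (by norm_num)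

/-- A test function as an element of `L²`. -/
def testL2 (χ : ℝ → ℝ) (hχ : Continuous χ) (hc : HasCompactSupport χ) : L2 :=
  (hχ.memLp_of_hasCompactSupport hc).toLp χ

lemma coeFn_testL2 {χ : ℝ → ℝ} (hχ : Continuous χ) (hc : HasCompactSupport χ) :
    testL2 χ hχ hc =ᵐ[volume] χ := MemLp.coeFn_toLp _

lemma inner_testL2 (u : L2) {χ : ℝ → ℝ} (hχ : Continuous χ) (hc : HasCompactSupport χ) :
    inner ℝ u (testL2 χ hχ hc) = ∫ x, u x * χ x := by
  rw [inner_L2]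
  exact integral_congr_ae (by filter_upwards [coeFn_testL2 hχ hc] with x hx; rw [hx])

lemma ae_eq_of_integral_test {u v : ℝ → ℝ} (hu : LocallyIntegrable u) (hv : LocallyIntegrable v)
    (h : ∀ χ : ℝ → ℝ, ContDiff ℝ ∞ χ → HasCompactSupport χ → ∫ x, u x * χ x = ∫ x, v x * χ x) :
    u =ᵐ[volume] v :=
  ae_eq_of_integral_contDiff_smul_eq hu hv fun χ hχ hc => by
    simpa only [smul_eq_mul, mul_comm] using h χ hχ hc

lemma L2.ext_test {u v : L2} (h : ∀ (χ : ℝ → ℝ) (hχ : ContDiff ℝ ∞ χ) (hc : HasCompactSupport χ),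
    inner ℝ u (testL2 χ hχ.continuous hc) = inner ℝ v (testL2 χ hχ.continuous hc)) : u = v :=
  Lp.ext (ae_eq_of_integral_test (L2.locallyIntegrable u) (L2.locallyIntegrable v) fun χ hχ hc => by
    simpa only [inner_testL2] using h χ hχ hc)

/-- The increment `g (· + h) - g` as an element of `L²`, given the derivative `v` of `g`. -/
def incr (v : L2) (h : ℝ) : L2 := ∫ k in (0 : ℝ)..h, trans k v

lemma continuous_trans_left (v : L2) : Continuous fun k => trans k v :=
  continuous_trans continuous_id continuous_const

lemma hasDerivAt_incr (v : L2) (h : ℝ) : HasDerivAt (incr v) (trans h v) h :=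
  intervalIntegral.integral_hasDerivAt_right ((continuous_trans_left v).intervalIntegrable _ _)
    (continuous_trans_left v).stronglyMeasurable.stronglyMeasurableAtFilter
    (continuous_trans_left v).continuousAt

lemma norm_incr_le (v : L2) (h : ℝ) : ‖incr v h‖ ≤ |h| * ‖v‖ := by
  have := intervalIntegral.norm_integral_le_of_norm_le_const (a := 0) (b := h)
    (f := fun k => trans k v) (C := ‖v‖) fun k _ => ((trans k).norm_map v).le
  rw [incr]
  simpa [mul_comm] using this

/-- The vector-valued integral is identified by testing and Fubini. The function `g` itself need not
be square integrable, as for a kink, yet its increments are. -/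
lemma coeFn_incr {g : ℝ → ℝ} {v : L2} (hg : HasACDeriv g v) (h : ℝ) :
    incr v h =ᵐ[volume] fun x => g (x + h) - g x := by
  have hgc := hg.continuous
  have hi : Continuous fun x => g (x + h) - g x := by fun_prop
  refine ae_eq_of_integral_test (L2.locallyIntegrable (incr v h))
    (hi.locallyIntegrable (μ := (volume : Measure ℝ))) fun χ hχ hc => ?_
  rw [← inner_testL2 (incr v h) hχ.continuous hc, incr, real_inner_comm]
  have h1 := (innerSL ℝ (testL2 χ hχ.continuous hc)).intervalIntegral_comp_comm
    ((continuous_trans_left v).intervalIntegrable (μ := (volume : Measure ℝ)) 0 h)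
  simp only [innerSL_apply_apply] at h1
  rw [← h1]
  have h2 : ∀ k, inner ℝ (testL2 χ hχ.continuous hc) (trans k v) = ∫ x, v (x + k) * χ x := fun k => by
    rw [real_inner_comm, inner_testL2]
    exact integral_congr_ae (by filter_upwards [coeFn_trans k v] with x hx; rw [hx])
  have h3 : ∀ x, (g (x + h) - g x) * χ x = ∫ k in (0 : ℝ)..h, v (x + k) * χ x := fun x => by
    rw [intervalIntegral.integral_mul_const, intervalIntegral.integral_comp_add_left (fun y => v y),
      ← hg.sub_eq_integral, add_zero]
  simp only [h2, h3]
  have hχ2 : MemLp χ 2 (volume : Measure ℝ) := hχ.continuous.memLp_of_hasCompactSupport hc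
  have hint : ∀ k, Integrable (fun x => v (x + k) * χ x) := fun k =>
    integrable_mul_of_memLp_real ((Lp.memLp v).comp_measurePreserving
      (measurePreserving_add_right volume k)) hχ2
  have hm : StronglyMeasurable (Function.uncurry fun k x : ℝ => v (x + k) * χ x) :=
    ((Lp.stronglyMeasurable v).comp_measurable (by fun_prop : Measurable fun p : ℝ × ℝ => p.2 + p.1)).mul
      (hχ.continuous.stronglyMeasurable.comp_measurable measurable_snd)
  rw [intervalIntegral_integral_swap]
  refine (integrable_prod_iff hm.aestronglyMeasurable).2 ⟨ae_of_all _ hint, ?_⟩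
  refine Measure.integrableOn_of_bounded (M := ∫ x, (v x ^ 2 + χ x ^ 2)) (by simp)
    hm.norm.integral_prod_right.aestronglyMeasurable (ae_of_all _ fun k => ?_)
  have iv := (Lp.memLp v).integrable_sq
  rw [integral_add iv hχ2.integrable_sq, ← integral_add_right_eq_self (fun x => v x ^ 2) k,
    ← integral_add (iv.comp_add_right k) hχ2.integrable_sq]
  rw [Real.norm_of_nonneg (integral_nonneg fun _ => norm_nonneg _)]
  refine integral_mono (hint k).norm ((iv.comp_add_right k).add hχ2.integrable_sq) fun x => ?_
  simp only [Function.uncurry, Real.norm_eq_abs]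
  exact abs_le.2 ⟨by nlinarith [sq_nonneg (v (x + k) + χ x), sq_nonneg (v (x + k)), sq_nonneg (χ x)],
    by nlinarith [sq_nonneg (v (x + k) - χ x), sq_nonneg (v (x + k)), sq_nonneg (χ x)]⟩

open Classical in
/-- The class of `g` in `L²`, with value `0` if `g` is not square integrable. -/
def toL2 (g : ℝ → ℝ) : L2 := if h : MemLp g 2 (volume : Measure ℝ) then h.toLp g else 0

lemma coeFn_toL2 {g : ℝ → ℝ} (h : MemLp g 2 (volume : Measure ℝ)) : toL2 g =ᵐ[volume] g := by
  rw [toL2, dif_pos h]; exact h.coeFn_toLp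

lemma eLpNorm_eq_enorm {g : ℝ → ℝ} {p : L2} (h : g =ᵐ[volume] p) :
    eLpNorm g 2 volume = ‖p‖ₑ := by
  rw [Lp.enorm_def, eLpNorm_congr_ae h]

/-- Multiplication by `cos θ` on `L²`. -/
def cosMul (θ : ℝ → ℝ) (u : L2) : L2 := toL2 fun x => Real.cos (θ x) * u x

lemma memLp_cosMul {θ : ℝ → ℝ} (hθ : Continuous θ) (u : L2) :
    MemLp (fun x => Real.cos (θ x) * u x) 2 (volume : Measure ℝ) := by
  refine (Lp.memLp u).of_le (by
    exact (Real.continuous_cos.comp hθ).aestronglyMeasurable.mul (Lp.aestronglyMeasurable u))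
    (ae_of_all _ fun x => ?_)
  rw [norm_mul]
  exact mul_le_of_le_one_left (norm_nonneg _) (Real.abs_cos_le_one _)

lemma coeFn_cosMul {θ : ℝ → ℝ} (hθ : Continuous θ) (u : L2) :
    cosMul θ u =ᵐ[volume] fun x => Real.cos (θ x) * u x := coeFn_toL2 (memLp_cosMul hθ u)

lemma norm_cosMul_le {θ : ℝ → ℝ} (hθ : Continuous θ) (u : L2) : ‖cosMul θ u‖ ≤ ‖u‖ := by
  refine Lp.norm_le_norm_of_ae_le ?_
  filter_upwards [coeFn_cosMul hθ u] with x hx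
  rw [hx, norm_mul]
  exact mul_le_of_le_one_left (norm_nonneg _) (Real.abs_cos_le_one _)

lemma cosMul_sub {θ : ℝ → ℝ} (hθ : Continuous θ) (u v : L2) :
    cosMul θ (u - v) = cosMul θ u - cosMul θ v := by
  apply Lp.ext
  filter_upwards [coeFn_cosMul hθ u, coeFn_cosMul hθ v, coeFn_cosMul hθ (u - v), Lp.coeFn_sub u v,
    Lp.coeFn_sub (cosMul θ u) (cosMul θ v)] with x h1 h2 h3 h4 h5
  rw [h3, h5, Pi.sub_apply, h1, h2, h4, Pi.sub_apply, mul_sub]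

lemma cosMul_smul {θ : ℝ → ℝ} (hθ : Continuous θ) (c : ℝ) (u : L2) :
    cosMul θ (c • u) = c • cosMul θ u := by
  apply Lp.ext
  filter_upwards [coeFn_cosMul hθ u, coeFn_cosMul hθ (c • u), Lp.coeFn_smul c u,
    Lp.coeFn_smul c (cosMul θ u)] with x h1 h2 h3 h4
  rw [h2, h4, h3]
  simp only [Pi.smul_apply, smul_eq_mul, h1]
  ring

lemma norm_cosMul_sub_le {θ η : ℝ → ℝ} (hθ : Continuous θ) (hη : Continuous η) {M : ℝ}
    (h : ∀ x, |θ x - η x| ≤ M) (u : L2) : ‖cosMul θ u - cosMul η u‖ ≤ M * ‖u‖ := by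
  refine Lp.norm_le_mul_norm_of_ae_le_mul ?_
  filter_upwards [coeFn_cosMul hθ u, coeFn_cosMul hη u, Lp.coeFn_sub (cosMul θ u) (cosMul η u)]
    with x h1 h2 h3
  rw [h3, Pi.sub_apply, h1, h2, ← sub_mul, norm_mul]
  exact mul_le_mul_of_nonneg_right ((abs_cos_sub_cos_le _ _).trans (h x)) (norm_nonneg _)

/-! ### Functions of space and time with derivatives in `C_t L²`, and the chain rules for them. -/

/-- `u : ℝ → ℝ → ℝ` has derivatives `u_x = ux` and `u_t = ut` in `C_t L²`; the curve `w` is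
`t ↦ u(t) - u(0) ∈ L²`. -/
structure Reg (u : ℝ → ℝ → ℝ) (w ux ut : ℝ → L2) : Prop where
  ac : ∀ t, HasACDeriv (u t) (ux t)
  ae : ∀ t, w t =ᵐ[volume] fun x => u t x - u 0 x
  cx : Continuous ux
  ct : Continuous ut
  dt : ∀ t, HasDerivAt w (ut t) t

namespace Reg

variable {u v : ℝ → ℝ → ℝ} {w ux ut z vx vt : ℝ → L2}

lemma continuous_w (h : Reg u w ux ut) : Continuous w :=
  continuous_iff_continuousAt.2 fun t => (h.dt t).continuousAt

lemma ae_sub (h : Reg u w ux ut) (s t : ℝ) : (w t - w s : L2) =ᵐ[volume] fun x => u t x - u s x := by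
  filter_upwards [Lp.coeFn_sub (w t) (w s), h.ae t, h.ae s] with x h1 h2 h3
  rw [h1, Pi.sub_apply, h2, h3]; ring

/-- The Sobolev embedding for the increment in time. It makes the continuity in time uniform in `x`,
which is what nonlinear functions of `u` need. -/
lemma abs_sub_le (h : Reg u w ux ut) (s t x : ℝ) :
    |u t x - u s x| ≤ 2 * (‖w t - w s‖ + ‖ux t - ux s‖) := by
  have h1 := ((h.ac t).sub (h.ac s)).enorm_le x
  rw [eLpNorm_eq_enorm (h.ae_sub s t).symm, eLpNorm_eq_enorm (g := fun x => ux t x - ux s x) (Lp.coeFn_sub (ux t) (ux s)).symm,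
    enorm_real_eq, ← ofReal_norm, ← ofReal_norm, ← ENNReal.ofReal_add (norm_nonneg _) (norm_nonneg _)] at h1
  have h2 := h1.trans_eq (congrArg (· * ENNReal.ofReal (‖w t - w s‖ + ‖ux t - ux s‖))
    (show (2 : ℝ≥0∞) = ENNReal.ofReal 2 by simp))
  simp only [← ENNReal.ofReal_mul (show (0 : ℝ) ≤ 2 by norm_num)] at h2
  exact (ENNReal.ofReal_le_ofReal_iff (by positivity)).1 h2

lemma tendsto_sup (h : Reg u w ux ut) (s : ℝ) :
    Tendsto (fun t => 2 * (‖w t - w s‖ + ‖ux t - ux s‖)) (𝓝 s) (𝓝 0) := by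
  have h1 : Continuous fun t => 2 * (‖w t - w s‖ + ‖ux t - ux s‖) := by
    have := h.continuous_w
    have := h.cx
    fun_prop
  simpa using h1.tendsto s

lemma continuous_uncurry (h : Reg u w ux ut) : Continuous (Function.uncurry u) := by
  rw [continuous_iff_continuousAt]
  rintro ⟨s, y⟩
  rw [ContinuousAt, tendsto_iff_norm_sub_tendsto_zero]
  have h1 : Tendsto (fun p : ℝ × ℝ => 2 * (‖w p.1 - w s‖ + ‖ux p.1 - ux s‖) + ‖u s p.2 - u s y‖)
      (𝓝 (s, y)) (𝓝 (0 + 0)) := by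
    refine ((h.tendsto_sup s).comp (continuous_fst.tendsto (s, y))).add ?_
    exact (tendsto_iff_norm_sub_tendsto_zero.1 ((h.ac s).continuous.tendsto y)).comp
      (continuous_snd.tendsto (s, y))
  rw [add_zero] at h1
  refine squeeze_zero (fun _ => norm_nonneg _) (fun p => ?_) h1
  calc _ = ‖(u p.1 p.2 - u s p.2) + (u s p.2 - u s y)‖ := by
        simp only [Function.uncurry]; congr 1; ring
    _ ≤ _ := (norm_add_le _ _).trans (add_le_add (h.abs_sub_le s p.1 p.2) le_rfl)

lemma sub (h : Reg u w ux ut) (h' : Reg v z vx vt) :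
    Reg (fun t x => u t x - v t x) (fun t => w t - z t) (fun t => ux t - vx t)
      (fun t => ut t - vt t) where
  ac t := ((h.ac t).sub (h'.ac t)).congr (Lp.coeFn_sub (ux t) (vx t)).symm
  ae t := by
    filter_upwards [Lp.coeFn_sub (w t) (z t), h.ae t, h'.ae t] with x h1 h2 h3
    rw [h1, Pi.sub_apply, h2, h3]; ring
  cx := h.cx.sub h'.cx
  ct := h.ct.sub h'.ct
  dt t := (h.dt t).sub (h'.dt t)

lemma const_mul (c : ℝ) (h : Reg u w ux ut) :
    Reg (fun t x => c * u t x) (fun t => c • w t) (fun t => c • ux t) (fun t => c • ut t) where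
  ac t := ((h.ac t).const_mul c).congr (by
    filter_upwards [Lp.coeFn_smul c (ux t)] with x h1; rw [h1]; rfl)
  ae t := by
    filter_upwards [Lp.coeFn_smul c (w t), h.ae t] with x h1 h2
    rw [h1, Pi.smul_apply, h2, smul_eq_mul]; ring
  cx := h.cx.const_smul c
  ct := h.ct.const_smul c
  dt t := (h.dt t).const_smul c

lemma memLp_sub (h : Reg u w ux ut) (s t : ℝ) :
    MemLp (fun x => u t x - u s x) 2 (volume : Measure ℝ) :=
  (memLp_congr_ae (h.ae_sub s t)).1 (Lp.memLp _)

lemma continuous_cosMul (h : Reg u w ux ut) {v : ℝ → L2} (hv : Continuous v) :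
    Continuous fun t => cosMul (u t) (v t) := by
  rw [continuous_iff_continuousAt]
  intro s
  rw [ContinuousAt, tendsto_iff_norm_sub_tendsto_zero]
  have h1 : Tendsto (fun t => ‖v t - v s‖ + 2 * (‖w t - w s‖ + ‖ux t - ux s‖) * ‖v s‖) (𝓝 s)
      (𝓝 (0 + 0 * ‖v s‖)) :=
    (tendsto_iff_norm_sub_tendsto_zero.1 (hv.tendsto s)).add ((h.tendsto_sup s).mul_const _)
  rw [zero_mul, add_zero] at h1
  refine squeeze_zero (fun _ => norm_nonneg _) (fun t => ?_) h1
  calc _ = ‖cosMul (u t) (v t - v s) + (cosMul (u t) (v s) - cosMul (u s) (v s))‖ := by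
        rw [cosMul_sub (h.ac t).continuous]; congr 1; abel
    _ ≤ _ := (norm_add_le _ _).trans (add_le_add (norm_cosMul_le (h.ac t).continuous _)
        (norm_cosMul_sub_le (h.ac t).continuous (h.ac s).continuous (h.abs_sub_le s t) _))

/-- The chain rule for the sine. -/
lemma sin (h : Reg u w ux ut) :
    Reg (fun t x => Real.sin (u t x)) (fun t => toL2 fun x => Real.sin (u t x) - Real.sin (u 0 x))
      (fun t => cosMul (u t) (ux t)) (fun t => cosMul (u t) (ut t)) := by
  have hm : ∀ t, MemLp (fun x => Real.sin (u t x) - Real.sin (u 0 x)) 2 (volume : Measure ℝ) := fun t =>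
    (h.memLp_sub 0 t).of_le (by
      have h1 := (h.ac t).continuous
      have h2 := (h.ac 0).continuous
      exact Continuous.aestronglyMeasurable (by fun_prop)) (ae_of_all _ fun x => abs_sin_sub_sin_le _ _)
  refine ⟨fun t => ?_, fun t => coeFn_toL2 (hm t), h.continuous_cosMul h.cx,
    h.continuous_cosMul h.ct, fun t => ?_⟩
  · exact (h.ac t).sin.congr (coeFn_cosMul (h.ac t).continuous _).symm
  set ws : ℝ → L2 := fun t => toL2 fun x => Real.sin (u t x) - Real.sin (u 0 x) with hws
  have hut := (h.ac t).continuous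
  rw [hasDerivAt_iff_isLittleO]
  -- The error splits into `cos u` times the linearization error of `w`, and the Taylor remainder of
  -- the sine. The latter is at most the sup norm of the increment, which tends to zero, times its
  -- `L²` norm, which is `O(τ - t)`.
  have e1 : (fun τ => cosMul (u t) (w τ - w t - (τ - t) • ut t)) =o[𝓝 t] fun τ => τ - t :=
    (Asymptotics.isBigO_of_le _ fun τ => norm_cosMul_le hut _).trans_isLittleO (h.dt t).isLittleO
  have e2 : (fun τ => ws τ - ws t - cosMul (u t) (w τ - w t)) =o[𝓝 t] fun τ => τ - t := by
    have b1 : (fun τ => ws τ - ws t - cosMul (u t) (w τ - w t)) =O[𝓝 t]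
        fun τ => (2 * (‖w τ - w t‖ + ‖ux τ - ux t‖)) * ‖w τ - w t‖ := by
      refine Asymptotics.isBigO_of_le _ fun τ => ?_
      rw [Real.norm_of_nonneg (by positivity)]
      refine Lp.norm_le_mul_norm_of_ae_le_mul ?_
      filter_upwards [Lp.coeFn_sub (ws τ - ws t) (cosMul (u t) (w τ - w t)), Lp.coeFn_sub (ws τ) (ws t),
        coeFn_toL2 (hm τ), coeFn_toL2 (hm t), coeFn_cosMul hut (w τ - w t), h.ae_sub t τ]
        with x h1 h2 h3 h4 h5 h6
      rw [h1, Pi.sub_apply, h2, Pi.sub_apply, h5, h6]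
      simp only [hws]
      rw [h3, h4]
      have := abs_sin_sub_sin_sub_le (u t x) (u τ x - u t x) 0 _ (h.abs_sub_le t τ x) (by simp; positivity)
      simpa using this
    refine b1.trans_isLittleO ?_
    have b2 : (fun τ => ‖w τ - w t‖) =O[𝓝 t] fun τ => τ - t := (h.dt t).isBigO_sub.norm_left
    have b3 := ((Asymptotics.isLittleO_one_iff ℝ).2 (h.tendsto_sup t)).mul_isBigO b2
    simpa using b3
  refine (e1.add e2).congr_left fun τ => ?_
  rw [cosMul_sub hut, cosMul_smul hut]
  abel

end Reg

lemma HasACDeriv.comp_add {u v : ℝ → ℝ} (h : HasACDeriv u v) (c : ℝ) :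
    HasACDeriv (fun x => u (x + c)) (fun x => v (x + c)) := by
  have hl : LocallyIntegrable fun x => v (x + c) := by
    intro x
    refine ⟨Set.Ioc (x - 1) (x + 1), Ioc_mem_nhds (by linarith) (by linarith), ?_⟩
    have h1 := (h.intervalIntegrable (x - 1 + c) (x + 1 + c)).comp_add_right c
    rwa [add_sub_cancel_right, add_sub_cancel_right,
      intervalIntegrable_iff_integrableOn_Ioc_of_le (by linarith)] at h1
  refine .of_integral hl fun x => ?_
  rw [intervalIntegral.integral_comp_add_right, ← h.sub_eq_integral]
  ring

/-- The chain rule in a moving frame; it is used with `σ = 1` to pass to characteristic coordinates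
and with `σ = -1` to return. -/
lemma Reg.comp_trans {u : ℝ → ℝ → ℝ} {w ux ut : ℝ → L2} (h : Reg u w ux ut) (σ : ℝ) :
    Reg (fun t x => u t (x + σ * t)) (fun t => trans (σ * t) (w t) + incr (ux 0) (σ * t))
      (fun t => trans (σ * t) (ux t)) (fun t => trans (σ * t) (ut t + σ • ux t)) := by
  have hσ : Continuous fun t : ℝ => σ * t := by fun_prop
  have hae : ∀ t, trans (σ * t) (w t) + incr (ux 0) (σ * t) =ᵐ[volume]
      fun x => u t (x + σ * t) - u 0 (x + σ * 0) := fun t => by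
    filter_upwards [Lp.coeFn_add (trans (σ * t) (w t)) (incr (ux 0) (σ * t)), coeFn_trans (σ * t) (w t),
      ae_comp_add (h.ae t) (σ * t), coeFn_incr (h.ac 0) (σ * t)] with x h1 h2 h3 h4
    rw [h1, Pi.add_apply, h2, h3, h4]
    simp
  refine ⟨fun t => ((h.ac t).comp_add (σ * t)).congr (coeFn_trans _ _).symm, hae,
    continuous_trans hσ h.cx, continuous_trans hσ (h.ct.add (h.cx.const_smul σ)), fun t => ?_⟩
  -- Re-centred at time `t`, the motion separates into a change of `u` in a moving frame and a pure
  -- translation of the fixed slice `u t`. Translations are only strongly continuous in `L²`, so the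
  -- first is differentiated through difference quotients.
  have e : (fun τ => trans (σ * τ) (w τ) + incr (ux 0) (σ * τ)) = fun τ =>
      (trans (σ * t) (w t) + incr (ux 0) (σ * t)) + (trans (σ * τ) (w τ - w t)
        + trans (σ * t) (incr (ux t) (σ * (τ - t)))) := by
    funext τ
    apply Lp.ext
    filter_upwards [hae τ, hae t, Lp.coeFn_add (trans (σ * t) (w t) + incr (ux 0) (σ * t))
      (trans (σ * τ) (w τ - w t) + trans (σ * t) (incr (ux t) (σ * (τ - t)))),
      Lp.coeFn_add (trans (σ * τ) (w τ - w t)) (trans (σ * t) (incr (ux t) (σ * (τ - t)))),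
      coeFn_trans (σ * τ) (w τ - w t), coeFn_trans (σ * t) (incr (ux t) (σ * (τ - t))),
      ae_comp_add (h.ae_sub t τ) (σ * τ), ae_comp_add (coeFn_incr (h.ac t) (σ * (τ - t))) (σ * t)]
      with x h1 h2 h3 h4 h5 h6 h7 h8
    rw [h1, h3, Pi.add_apply, h2, h4, Pi.add_apply, h5, h6, h7, h8]
    ring_nf
  rw [e]
  have d1 : HasDerivAt (fun τ => trans (σ * τ) (w τ - w t)) (trans (σ * t) (ut t)) t := by
    rw [hasDerivAt_iff_tendsto_slope]
    have := tendsto_trans ((hσ.tendsto t).mono_left nhdsWithin_le_nhds)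
      (hasDerivAt_iff_tendsto_slope.1 (h.dt t))
    refine this.congr fun τ => ?_
    simp [slope, map_sub]
  have d2 : HasDerivAt (fun τ => trans (σ * t) (incr (ux t) (σ * (τ - t))))
      (trans (σ * t) (σ • ux t)) t := by
    have i1 : HasDerivAt (fun τ => σ * (τ - t)) σ t := by
      simpa using ((hasDerivAt_id t).sub_const t).const_mul σ
    have i2 := HasDerivAt.scomp (g₁ := incr (ux t)) (g₁' := ux t) t (by simpa [trans_zero] using hasDerivAt_incr (ux t) (σ * (t - t))) i1
    exact (trans (σ * t)).toContinuousLinearMap.hasFDerivAt.comp_hasDerivAt t i2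
  have := (d1.add d2).const_add (trans (σ * t) (w t) + incr (ux 0) (σ * t))
  rw [map_add]
  exact this

/-- Difference quotients in time lie in `L²` only for small steps; by the triangle inequality the
set of good times is open and closed, and the line is connected. -/
lemma EnergySpace.memLp_sub (f : EnergySpace) (s t : ℝ) :
    MemLp (fun x => f.toFun t x - f.toFun s x) 2 (volume : Measure ℝ) := by
  have hloc : ∀ t, ∀ᶠ τ in 𝓝 t, MemLp (fun x => f.toFun τ x - f.toFun t x) 2 (volume : Measure ℝ) := by
    intro t
    have h1 : ∀ᶠ h : ℝ in 𝓝 0, MemLp (fun x => f.toFun (t + h) x - f.toFun t x) 2 (volume : Measure ℝ) := by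
      have h2 := (f.hasDeriv_dt t).eventually (gt_mem_nhds (zero_lt_one))
      rw [eventually_nhdsWithin_iff] at h2
      filter_upwards [h2] with h hh
      by_cases h0 : h = 0
      · simp [h0]
      have ha : AEStronglyMeasurable (fun x => (f.toFun (t + h) x - f.toFun t x) / h - f.dt t x) volume :=
        AEStronglyMeasurable.sub (Continuous.aestronglyMeasurable (by
          have := f.continuous_slice t
          have := f.continuous_slice (t + h)
          fun_prop)) (Lp.aestronglyMeasurable _)
      have h3 : MemLp (fun x => (f.toFun (t + h) x - f.toFun t x) / h - f.dt t x) 2 (volume : Measure ℝ) :=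
        ⟨ha, (hh h0).trans ENNReal.one_lt_top⟩
      have h4 := (h3.add (Lp.memLp (f.dt t))).const_mul h
      refine (memLp_congr_ae (ae_of_all _ fun x => ?_)).1 h4
      simp only [Pi.add_apply]
      field_simp
      ring
    have h5 : Tendsto (fun τ => τ - t) (𝓝 t) (𝓝 0) := by
      have : Continuous fun τ : ℝ => τ - t := by fun_prop
      simpa using this.tendsto t
    simpa using h5.eventually h1
  have htr : ∀ r τ τ', MemLp (fun x => f.toFun τ x - f.toFun r x) 2 (volume : Measure ℝ) →
      MemLp (fun x => f.toFun τ' x - f.toFun τ x) 2 (volume : Measure ℝ) →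
      MemLp (fun x => f.toFun τ' x - f.toFun r x) 2 (volume : Measure ℝ) := fun r τ τ' h1 h2 =>
    (memLp_congr_ae (ae_of_all _ fun x => by simp)).1 (h1.add h2)
  have hsy : ∀ r τ, MemLp (fun x => f.toFun τ x - f.toFun r x) 2 (volume : Measure ℝ) →
      MemLp (fun x => f.toFun r x - f.toFun τ x) 2 (volume : Measure ℝ) := fun r τ h1 =>
    (memLp_congr_ae (ae_of_all _ fun x => by simp)).1 h1.neg
  have hcl : IsClopen {t | MemLp (fun x => f.toFun t x - f.toFun s x) 2 (volume : Measure ℝ)} := by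
    constructor
    · rw [← isOpen_compl_iff, isOpen_iff_mem_nhds]
      intro τ hτ
      filter_upwards [hloc τ] with τ' h1 h2
      exact hτ (htr _ _ _ h2 (hsy _ _ h1))
    · rw [isOpen_iff_mem_nhds]
      intro τ hτ
      filter_upwards [hloc τ] with τ' h1
      exact htr _ _ _ hτ h1
  exact Set.eq_univ_iff_forall.1 (hcl.eq_univ ⟨s, by simp⟩) t

lemma EnergySpace.reg (f : EnergySpace) :
    Reg f.toFun (fun t => toL2 fun x => f.toFun t x - f.toFun 0 x) f.dx f.dt := by
  refine ⟨f.hasACDeriv, fun t => coeFn_toL2 (f.memLp_sub 0 t), f.continuous_dx, f.continuous_dt,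
    fun t => ?_⟩
  rw [hasDerivAt_iff_tendsto_slope_zero, tendsto_iff_edist_tendsto_0]
  refine (f.hasDeriv_dt t).congr fun h => ?_
  rw [Lp.edist_def]
  refine eLpNorm_congr_ae ?_
  set w : ℝ → L2 := fun t => toL2 fun x => f.toFun t x - f.toFun 0 x
  filter_upwards [coeFn_toL2 (f.memLp_sub 0 t), coeFn_toL2 (f.memLp_sub 0 (t + h)),
    Lp.coeFn_sub (w (t + h)) (w t), Lp.coeFn_smul h⁻¹ (w (t + h) - w t)] with x h1 h2 h3 h4
  rw [Pi.sub_apply, h4, Pi.smul_apply, h3, Pi.sub_apply, h1, h2, smul_eq_mul]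
  ring

/-- The element of the energy space given by a function with derivatives in `C_t L²`. -/
def Reg.toEnergySpace {u : ℝ → ℝ → ℝ} {w ux ut : ℝ → L2} (h : Reg u w ux ut)
    (h0 : MemLp (fun x => Real.sin (u 0 x / 2)) 2 (volume : Measure ℝ)) : EnergySpace where
  toFun := u
  dx := ux
  dt := ut
  continuous_slice t := (h.ac t).continuous
  isWeakDeriv_dx t := (h.ac t).isWeakDeriv
  continuous_dx := h.cx
  memLp_sin t := by
    have h1 : MemLp (fun x => Real.sin (u t x / 2) - Real.sin (u 0 x / 2)) 2 (volume : Measure ℝ) := by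
      refine (h.memLp_sub 0 t).of_le (by
        have h1 := (h.ac t).continuous
        have h2 := (h.ac 0).continuous
        exact Continuous.aestronglyMeasurable (by fun_prop)) (ae_of_all _ fun x => ?_)
      refine (abs_sin_sub_sin_le _ _).trans ?_
      rw [← sub_div, abs_div, abs_two, Real.norm_eq_abs]
      linarith [abs_nonneg (u t x - u 0 x)]
    exact (memLp_congr_ae (ae_of_all _ fun x => by simp)).1 (h1.add h0)
  continuous_sin t := by
    have h1 : Tendsto (fun τ => ‖w τ - w t‖ₑ) (𝓝 t) (𝓝 0) := by
      have := (h.continuous_w.sub (continuous_const (y := w t))).enorm.tendsto t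
      simpa using this
    refine tendsto_of_tendsto_of_tendsto_of_le_of_le tendsto_const_nhds h1 (fun _ => zero_le) fun τ => ?_
    simp only
    rw [← eLpNorm_eq_enorm (h.ae_sub t τ).symm]
    refine eLpNorm_mono fun x => ?_
    refine (abs_sin_sub_sin_le _ _).trans ?_
    rw [← sub_div, abs_div, abs_two, Real.norm_eq_abs]
    linarith [abs_nonneg (u τ x - u t x)]
  hasDeriv_dt t := by
    have h1 := h.dt t
    rw [hasDerivAt_iff_tendsto_slope_zero, tendsto_iff_edist_tendsto_0] at h1
    refine h1.congr fun k => ?_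
    rw [Lp.edist_def]
    refine eLpNorm_congr_ae ?_
    filter_upwards [h.ae_sub t (t + k), Lp.coeFn_smul k⁻¹ (w (t + k) - w t)] with x h3 h4
    rw [Pi.sub_apply, h4, Pi.smul_apply, h3, smul_eq_mul]
    ring
  continuous_dt := h.ct

lemma inner_trans_left (h : ℝ) (u v : L2) : inner ℝ (trans h u) v = inner ℝ u (trans (-h) v) := by
  rw [← (trans (-h)).inner_map_map (trans h u) v, trans_trans, neg_add_cancel, trans_zero]

lemma incr_eq_trans_sub {χ : ℝ → ℝ} (hχ : ContDiff ℝ ∞ χ) (hc : HasCompactSupport χ) (h : ℝ) :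
    incr (testL2 (deriv χ) (hχ.continuous_deriv (by simp)) hc.deriv) h =
      trans h (testL2 χ hχ.continuous hc) - testL2 χ hχ.continuous hc := by
  have h1 := coeFn_testL2 (hχ.continuous_deriv (by simp)) hc.deriv
  apply Lp.ext
  filter_upwards [coeFn_incr ((HasACDeriv.of_contDiff_infty hχ).congr h1.symm) h,
    coeFn_trans h (testL2 χ hχ.continuous hc), coeFn_testL2 hχ.continuous hc,
    ae_comp_add (coeFn_testL2 hχ.continuous hc) h,
    Lp.coeFn_sub (trans h (testL2 χ hχ.continuous hc)) (testL2 χ hχ.continuous hc)]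
    with x h1 h2 h3 h4 h5
  rw [h1, h5, Pi.sub_apply, h2, h3, h4]

/-- A function in `L²` with bounded difference quotients has a derivative in `L²`. -/
lemma exists_hasACDeriv_of_norm_trans_sub_le {u : L2} {M : ℝ}
    (h : ∀ k, ‖trans k u - u‖ ≤ M * |k|) :
    ∃ (p : ℝ → ℝ) (v : L2), HasACDeriv p v ∧ u =ᵐ[volume] p ∧ ‖v‖ ≤ M := by
  set e : ℕ → ℝ := fun n => ((n : ℝ) + 1)⁻¹ with he
  have he0 : ∀ n, 0 < e n := fun n => by positivity
  have het : Tendsto e atTop (𝓝[≠] 0) := by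
    refine tendsto_nhdsWithin_iff.2 ⟨?_, Eventually.of_forall fun n => (he0 n).ne'⟩
    simpa [he] using tendsto_one_div_add_atTop_nhds_zero_nat (𝕜 := ℝ)
  set d : ℕ → WeakDual ℝ L2 := fun n =>
    StrongDual.toWeakDual (InnerProductSpace.toDual ℝ L2 ((e n)⁻¹ • (trans (e n) u - u))) with hd
  have hball : ∀ n, d n ∈ WeakDual.toStrongDual ⁻¹' Metric.closedBall (0 : StrongDual ℝ L2) M := fun n => by
    have h1 : ‖(e n)⁻¹ • (trans (e n) u - u)‖ ≤ M := by
      rw [norm_smul, norm_inv, Real.norm_of_nonneg (he0 n).le, inv_mul_le_iff₀ (he0 n), mul_comm]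
      simpa [abs_of_pos (he0 n)] using h (e n)
    rw [Set.mem_preimage, mem_closedBall_zero_iff]
    refine le_trans (le_of_eq ?_) h1
    exact (InnerProductSpace.toDual ℝ L2).norm_map _
  -- Banach–Alaoglu: the bounded difference quotients converge weakly along an ultrafilter, and
  -- moving them onto test functions shows that the limit is the weak derivative.
  obtain ⟨x, hx, hlim⟩ := (WeakDual.isCompact_closedBall (𝕜 := ℝ) (0 : StrongDual ℝ L2) M).ultrafilter_le_nhds'
    ((Ultrafilter.of atTop).map d) (Eventually.of_forall (f := (Ultrafilter.of (atTop : Filter ℕ) : Filter ℕ)) hball)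
  set v : L2 := (InnerProductSpace.toDual ℝ L2).symm (WeakDual.toStrongDual x) with hv
  have hvn : ‖v‖ ≤ M := by
    rw [hv, LinearIsometryEquiv.norm_map]
    simpa using hx
  have hw : IsWeakDeriv u v := fun χ hχ hc => by
    set X := testL2 χ hχ.continuous hc with hX
    set X' := testL2 (deriv χ) (hχ.continuous_deriv (by simp)) hc.deriv with hX'
    have l1 : Tendsto (fun n => d n X) (Ultrafilter.of (atTop : Filter ℕ) : Filter ℕ) (𝓝 (x X)) :=
      ((WeakDual.eval_continuous X).tendsto x).comp hlim
    have l2 : x X = inner ℝ v X := by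
      rw [hv, InnerProductSpace.toDual_symm_apply]; rfl
    have l3 : ∀ n, d n X = - inner ℝ u ((-e n)⁻¹ • (incr X' (-e n))) := fun n => by
      have : d n X = inner ℝ ((e n)⁻¹ • (trans (e n) u - u)) X := rfl
      rw [this, hX', incr_eq_trans_sub hχ hc, real_inner_smul_left, inner_sub_left, inner_trans_left,
        real_inner_smul_right, inner_sub_right, inv_neg]
      ring
    have l4 : Tendsto (fun n => - inner ℝ u ((-e n)⁻¹ • (incr X' (-e n)))) atTop
        (𝓝 (- inner ℝ u X')) := by
      have h1 := (hasDerivAt_iff_tendsto_slope_zero.1 (hasDerivAt_incr X' 0)).comp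
        (show Tendsto (fun n => - e n) atTop (𝓝[≠] 0) from by
          refine tendsto_nhdsWithin_iff.2 ⟨?_, Eventually.of_forall fun n => by simpa using (he0 n).ne'⟩
          simpa using (tendsto_nhdsWithin_iff.1 het).1.neg)
      have h2 : incr X' 0 = 0 := by simp [incr]
      simp only [Function.comp_def, zero_add, h2, sub_zero, trans_zero] at h1
      exact (((innerSL ℝ u).continuous.tendsto X').comp h1).neg
    have l5 := tendsto_nhds_unique (l1.congr l3) (l4.mono_left (Ultrafilter.of_le atTop))
    rw [l2, hX, hX', inner_testL2, inner_testL2] at l5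
    linarith
  obtain ⟨p, hp, he⟩ := hw.exists_hasACDeriv (L2.locallyIntegrable u) (L2.locallyIntegrable v)
  exact ⟨p, v, hp, he, hvn⟩

/-! ### Ordinary differential equations in Banach spaces. -/

section ODE

variable {E : Type*} [NormedAddCommGroup E] [NormedSpace ℝ E]

/-- A two-sided Grönwall inequality. -/
lemma norm_le_of_norm_deriv_le {D D' : ℝ → E} (hD : ∀ t, HasDerivAt D (D' t) t) {K ε T : ℝ}
    (hK : 0 ≤ K) (hε : 0 ≤ ε) (hb : ∀ t, |t| ≤ T → ‖D' t‖ ≤ K * ‖D t‖ + ε) {t : ℝ} (ht : |t| ≤ T) :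
    ‖D t‖ ≤ (‖D 0‖ + ε) * Real.exp ((K + 1) * T) := by
  have key : ∀ {D D' : ℝ → E}, (∀ t, HasDerivAt D (D' t) t) →
      (∀ t, |t| ≤ T → ‖D' t‖ ≤ K * ‖D t‖ + ε) → ∀ t, 0 ≤ t → t ≤ T →
      ‖D t‖ ≤ (‖D 0‖ + ε) * Real.exp ((K + 1) * T) := by
    intro D D' hD hb t h0 hT
    -- Using `K + 1` instead of `K` avoids the separate Grönwall formula for `K = 0`.
    have h1 := norm_le_gronwallBound_of_norm_deriv_right_le (f := D) (f' := D') (δ := ‖D 0‖) (K := K + 1)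
      (ε := ε) (a := 0) (b := T) (fun s _ => (hD s).continuousAt.continuousWithinAt)
      (fun s _ => (hD s).hasDerivWithinAt) le_rfl (fun s hs => by
        have := hb s (by rw [abs_of_nonneg hs.1]; exact hs.2.le)
        linarith [norm_nonneg (D s)]) t ⟨h0, hT⟩
    refine h1.trans ?_
    rw [gronwallBound_of_K_ne_0 (by positivity), sub_zero]
    have h2 : Real.exp ((K + 1) * t) ≤ Real.exp ((K + 1) * T) := Real.exp_le_exp.2 (mul_le_mul_of_nonneg_left hT (by linarith))
    have h3 : ε / (K + 1) ≤ ε := div_le_self hε (by linarith)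
    have h4 : 1 ≤ Real.exp ((K + 1) * t) := Real.one_le_exp (by positivity)
    calc _ ≤ ‖D 0‖ * Real.exp ((K + 1) * t) + ε * Real.exp ((K + 1) * t) := by
          have : ε / (K + 1) * (Real.exp ((K + 1) * t) - 1) ≤ ε * (Real.exp ((K + 1) * t) - 1) :=
            mul_le_mul_of_nonneg_right h3 (by linarith)
          linarith
      _ = (‖D 0‖ + ε) * Real.exp ((K + 1) * t) := by ring
      _ ≤ _ := mul_le_mul_of_nonneg_left h2 (by positivity)
  rcases le_total 0 t with h | h
  · exact key hD hb t h ((le_abs_self t).trans ht)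
  · have h1 : ∀ s, HasDerivAt (fun s => D (-s)) (- D' (-s)) s := fun s => by
      simpa [Function.comp_def] using HasDerivAt.scomp s (hD (-s)) (hasDerivAt_neg s)
    have := key h1 (fun s hs => by simpa using hb (-s) (by simpa using hs)) (-t) (by linarith)
      ((neg_le_abs t).trans ht)
    simpa using this

lemma norm_intervalIntegral_le_of_abs {g : ℝ → E} {h : ℝ → ℝ} (hg : Continuous g) (hh : Continuous h)
    (hb : ∀ τ, ‖g τ‖ ≤ h |τ|) (t : ℝ) : ‖∫ τ in (0 : ℝ)..t, g τ‖ ≤ ∫ τ in (0 : ℝ)..|t|, h τ := by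
  have key : ∀ g : ℝ → E, Continuous g → (∀ τ, ‖g τ‖ ≤ h |τ|) → ∀ t, 0 ≤ t →
      ‖∫ τ in (0 : ℝ)..t, g τ‖ ≤ ∫ τ in (0 : ℝ)..t, h τ := fun g hg hb t ht =>
    intervalIntegral.norm_integral_le_of_norm_le ht (ae_of_all _ fun τ hτ => by
      simpa [abs_of_pos hτ.1] using hb τ) (hh.intervalIntegrable _ _)
  rcases le_total 0 t with ht | ht
  · rw [abs_of_nonneg ht]; exact key g hg hb t ht
  · rw [abs_of_nonpos ht]
    have := key (fun τ => g (-τ)) (hg.comp continuous_neg) (fun τ => by simpa using hb (-τ)) (-t)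
      (by linarith)
    rwa [intervalIntegral.integral_comp_neg, neg_neg, neg_zero, intervalIntegral.integral_symm,
      norm_neg] at this

open scoped BoundedContinuousFunction in
/-- Global existence for ordinary differential equations with a Lipschitz right-hand side. -/
lemma exists_forall_hasDerivAt [CompleteSpace E] {V : ℝ → E → E} (hV : Continuous (Function.uncurry V))
    {K : ℝ} (hK : 0 < K) (hL : ∀ t x y, ‖V t x - V t y‖ ≤ K * ‖x - y‖) :
    ∃ Y : ℝ → E, Y 0 = 0 ∧ ∀ t, HasDerivAt Y (V t (Y t)) t := by
  set n : ℝ → ℝ := fun s => ‖V s 0‖ + ‖V (-s) 0‖ with hn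
  have hV0 : Continuous fun s => V s 0 := hV.comp (by fun_prop : Continuous fun s : ℝ => (s, (0 : E)))
  have hnc : Continuous n := (hV0.norm).add (hV0.comp continuous_neg).norm
  have hn0 : ∀ s, 0 ≤ n s := fun s => by positivity
  set N : ℝ → ℝ := fun s => ∫ τ in (0 : ℝ)..s, n τ with hN
  have hNd : ∀ s, HasDerivAt N (n s) s := fun s =>
    intervalIntegral.integral_hasDerivAt_right (hnc.intervalIntegrable _ _)
      hnc.stronglyMeasurable.stronglyMeasurableAtFilter hnc.continuousAt
  have hNc : Continuous N := continuous_iff_continuousAt.2 fun s => (hNd s).continuousAt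
  have hN0 : ∀ s, 0 ≤ s → 0 ≤ N s := fun s hs => intervalIntegral.integral_nonneg hs fun _ _ => hn0 _
  -- A Bielecki weight. The exponential gives `2K ∫ Ω ≤ Ω`, hence contraction factor `1/2` on all of
  -- `ℝ` at once; the factor `1 + N` dominates the possibly growing field at zero.
  set Ω : ℝ → ℝ := fun s => Real.exp (2 * K * s) * (1 + N s) with hΩ
  have hΩc : Continuous Ω := by fun_prop
  have hNΩ : ∀ s, 0 ≤ s → 1 + N s ≤ Ω s := fun s hs =>
    le_mul_of_one_le_left (by linarith [hN0 s hs]) (Real.one_le_exp (by positivity))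
  have hΩ1 : ∀ s, 0 ≤ s → 1 ≤ Ω s := fun s hs => by linarith [hN0 s hs, hNΩ s hs]
  have hΩi : ∀ s, 0 ≤ s → 2 * K * ∫ τ in (0 : ℝ)..s, Ω τ ≤ Ω s := fun s hs => by
    have hd : ∀ τ, HasDerivAt Ω (2 * K * Ω τ + Real.exp (2 * K * τ) * n τ) τ := fun τ => by
      have h1 := (((hasDerivAt_id τ).const_mul (2 * K)).exp).mul ((hNd τ).const_add 1)
      exact h1.congr_deriv (by simp only [hΩ, id]; ring)
    have h1 := intervalIntegral.integral_eq_sub_of_hasDerivAt (a := 0) (b := s) (fun τ _ => hd τ)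
      (Continuous.intervalIntegrable (by fun_prop) _ _)
    have h2 : (∫ τ in (0 : ℝ)..s, 2 * K * Ω τ) ≤
        ∫ τ in (0 : ℝ)..s, (2 * K * Ω τ + Real.exp (2 * K * τ) * n τ) :=
      intervalIntegral.integral_mono_on hs (Continuous.intervalIntegrable (by fun_prop) _ _)
        (Continuous.intervalIntegrable (by fun_prop) _ _) fun τ _ => by
          have := mul_nonneg (Real.exp_pos (2 * K * τ)).le (hn0 τ)
          linarith
    rw [intervalIntegral.integral_const_mul, h1] at h2
    linarith [hΩ1 0 le_rfl]
  clear_value Ω N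
  have hΩp : ∀ t, 0 < Ω |t| := fun t => one_pos.trans_le (hΩ1 _ (abs_nonneg t))
  have hΩa : Continuous fun t : ℝ => Ω |t| := hΩc.comp continuous_abs
  have hΩai : Continuous fun t : ℝ => (Ω |t|)⁻¹ := hΩa.inv₀ fun t => (hΩp t).ne'
  -- The unknown is `y = Y / Ω`, a bounded function, so that the fixed point lives in a complete
  -- space.
  set G : (ℝ →ᵇ E) → ℝ → E := fun y τ => V τ (Ω |τ| • y τ) with hG
  have hGc : ∀ y, Continuous (G y) := fun y =>
    hV.comp (continuous_id.prodMk (hΩa.smul y.continuous))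
  have hint : ∀ y : ℝ →ᵇ E, Continuous fun t => ∫ τ in (0 : ℝ)..t, G y τ := fun y =>
    intervalIntegral.continuous_primitive (fun a b => (hGc y).intervalIntegrable a b) 0
  have hGb : ∀ (y : ℝ →ᵇ E) τ, ‖G y τ‖ ≤ n |τ| + K * ‖y‖ * Ω |τ| := fun y τ => by
    have h1 := hL τ (Ω |τ| • y τ) 0
    rw [sub_zero, norm_smul, Real.norm_of_nonneg (hΩp τ).le] at h1
    have h2 : ‖V τ 0‖ ≤ n |τ| := by
      rcases abs_choice τ with h | h <;> rw [h] <;> simp [hn]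
    have h3 : K * (Ω |τ| * ‖y τ‖) ≤ K * ‖y‖ * Ω |τ| := by
      have := mul_le_mul_of_nonneg_left (mul_le_mul_of_nonneg_left (y.norm_coe_le_norm τ) (hΩp τ).le) hK.le
      linarith
    calc ‖G y τ‖ = ‖V τ 0 + (V τ (Ω |τ| • y τ) - V τ 0)‖ := by simp [hG]
      _ ≤ _ := (norm_add_le _ _).trans (by linarith)
  have hΦb : ∀ (y : ℝ →ᵇ E) t, ‖(Ω |t|)⁻¹ • ∫ τ in (0 : ℝ)..t, G y τ‖ ≤ 1 + ‖y‖ := fun y t => by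
    have h1 := norm_intervalIntegral_le_of_abs (hGc y) (h := fun s => n s + K * ‖y‖ * Ω s)
      (by fun_prop) (hGb y) t
    rw [intervalIntegral.integral_add (hnc.intervalIntegrable _ _)
      (Continuous.intervalIntegrable (by fun_prop) _ _), intervalIntegral.integral_const_mul] at h1
    rw [norm_smul, norm_inv, Real.norm_of_nonneg (hΩp t).le, inv_mul_le_iff₀ (hΩp t)]
    refine h1.trans ?_
    have h2 := hNΩ _ (abs_nonneg t)
    have h3 := mul_le_mul_of_nonneg_left (hΩi _ (abs_nonneg t)) (norm_nonneg y)
    have h4 : N |t| = ∫ τ in (0 : ℝ)..|t|, n τ := by rw [hN]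
    nlinarith [norm_nonneg y, hΩp t, mul_nonneg (norm_nonneg y) (hΩp t).le]
  set Φ : (ℝ →ᵇ E) → (ℝ →ᵇ E) := fun y =>
    BoundedContinuousFunction.ofNormedAddCommGroup (fun t => (Ω |t|)⁻¹ • ∫ τ in (0 : ℝ)..t, G y τ)
      (hΩai.smul (hint y)) (1 + ‖y‖) (hΦb y) with hΦ
  have hcon : ContractingWith (1 / 2) Φ := by
    refine ⟨by rw [← NNReal.coe_lt_coe]; norm_num, LipschitzWith.of_dist_le_mul fun y z => ?_⟩
    rw [BoundedContinuousFunction.dist_le (by positivity)]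
    intro t
    have h1 := norm_intervalIntegral_le_of_abs ((hGc y).sub (hGc z)) (h := fun s => K * ‖y - z‖ * Ω s)
      (by fun_prop) (fun τ => by
        refine (hL _ _ _).trans ?_
        rw [← smul_sub, norm_smul, Real.norm_of_nonneg (hΩp τ).le]
        have := mul_le_mul_of_nonneg_left (mul_le_mul_of_nonneg_left
          ((y - z).norm_coe_le_norm τ) (hΩp τ).le) hK.le
        rw [BoundedContinuousFunction.coe_sub, Pi.sub_apply] at this
        linarith) t
    rw [intervalIntegral.integral_const_mul] at h1
    have h2 : Φ y t - Φ z t = (Ω |t|)⁻¹ • ∫ τ in (0 : ℝ)..t, (G y - G z) τ := by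
      simp only [hΦ, BoundedContinuousFunction.coe_ofNormedAddCommGroup, Pi.sub_apply]
      rw [intervalIntegral.integral_sub ((hGc y).intervalIntegrable _ _) ((hGc z).intervalIntegrable _ _),
        smul_sub]
    rw [dist_eq_norm, dist_eq_norm, h2, norm_smul, norm_inv, Real.norm_of_nonneg (hΩp t).le,
      inv_mul_le_iff₀ (hΩp t)]
    refine h1.trans ?_
    have h3 := mul_le_mul_of_nonneg_left (hΩi _ (abs_nonneg t)) (norm_nonneg (y - z))
    push_cast
    linarith
  set y := hcon.fixedPoint Φ with hy
  have hfix : ∀ t, Ω |t| • y t = ∫ τ in (0 : ℝ)..t, G y τ := fun t => by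
    have h1 : Φ y = y := hcon.fixedPoint_isFixedPt
    have h2 : Φ y t = (Ω |t|)⁻¹ • ∫ τ in (0 : ℝ)..t, G y τ := rfl
    rw [h1] at h2
    rw [h2, smul_inv_smul₀ (hΩp t).ne']
  refine ⟨fun t => Ω |t| • y t, by simpa using hfix 0, fun t => ?_⟩
  have h1 : HasDerivAt (fun t => ∫ τ in (0 : ℝ)..t, G y τ) (G y t) t :=
    intervalIntegral.integral_hasDerivAt_right ((hGc y).intervalIntegrable _ _)
      ((hGc y).stronglyMeasurableAtFilter _ _) (hGc y).continuousAt
  rw [← show (fun t => Ω |t| • y t) = fun t => ∫ τ in (0 : ℝ)..t, G y τ from funext hfix] at h1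
  exact h1

end ODE

/-! ### The flow `A_t = c sin (F - A/2)` and its spatial regularity. -/

section Flow

variable {F : ℝ → ℝ → ℝ} {w Fx Ft : ℝ → L2} {A₀ : ℝ → ℝ} {A₀' : L2} {c : ℝ}

/-- The right-hand side of the equation `A_t = c sin (F - A / 2)`, as a function of `A - A₀ ∈ L²`. -/
def flowField (F : ℝ → ℝ → ℝ) (A₀ : ℝ → ℝ) (c t : ℝ) (Y : L2) : L2 :=
  toL2 fun x => c * Real.sin (F t x - (A₀ x + Y x) / 2)

lemma memLp_flowField (hF : Reg F w Fx Ft) (hA : HasACDeriv A₀ A₀')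
    (h0 : MemLp (fun x => Real.sin (F 0 x - A₀ x / 2)) 2 (volume : Measure ℝ)) (t : ℝ) (Y : L2) :
    MemLp (fun x => c * Real.sin (F t x - (A₀ x + Y x) / 2)) 2 (volume : Measure ℝ) := by
  have h1 : MemLp (fun x => Real.sin (F t x - (A₀ x + Y x) / 2) - Real.sin (F 0 x - A₀ x / 2)) 2
      (volume : Measure ℝ) := by
    refine ((hF.memLp_sub 0 t).sub ((Lp.memLp Y).const_mul (1 / 2))).of_le ?_ (ae_of_all _ fun x => ?_)
    · refine AEStronglyMeasurable.sub (Real.continuous_sin.comp_aestronglyMeasurable ?_) h0.1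
      refine (hF.ac t).continuous.aestronglyMeasurable.sub ?_
      simp only [div_eq_mul_inv]
      exact (hA.continuous.aestronglyMeasurable.add (Lp.aestronglyMeasurable Y)).mul_const _
    · refine (abs_sin_sub_sin_le _ _).trans (le_of_eq ?_)
      rw [Real.norm_eq_abs]
      congr 1
      simp only [Pi.sub_apply]
      ring
  exact ((memLp_congr_ae (ae_of_all _ fun x => by simp)).1 (h1.add h0)).const_mul c

lemma coeFn_flowField (hF : Reg F w Fx Ft) (hA : HasACDeriv A₀ A₀')
    (h0 : MemLp (fun x => Real.sin (F 0 x - A₀ x / 2)) 2 (volume : Measure ℝ)) (t : ℝ) (Y : L2) :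
    flowField F A₀ c t Y =ᵐ[volume] fun x => c * Real.sin (F t x - (A₀ x + Y x) / 2) :=
  coeFn_toL2 (memLp_flowField hF hA h0 t Y)

lemma norm_flowField_sub_le (hF : Reg F w Fx Ft) (hA : HasACDeriv A₀ A₀') (hc : 0 < c)
    (h0 : MemLp (fun x => Real.sin (F 0 x - A₀ x / 2)) 2 (volume : Measure ℝ)) (t s : ℝ) (Y Z : L2) :
    ‖flowField F A₀ c t Y - flowField F A₀ c s Z‖ ≤ c * ‖(w t - w s) - (1 / 2 : ℝ) • (Y - Z)‖ := by
  refine Lp.norm_le_mul_norm_of_ae_le_mul ?_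
  filter_upwards [Lp.coeFn_sub (flowField F A₀ c t Y) (flowField F A₀ c s Z),
    coeFn_flowField (c := c) hF hA h0 t Y, coeFn_flowField (c := c) hF hA h0 s Z,
    Lp.coeFn_sub (w t - w s) ((1 / 2 : ℝ) • (Y - Z)), hF.ae_sub s t, Lp.coeFn_smul (1 / 2 : ℝ) (Y - Z),
    Lp.coeFn_sub Y Z] with x h1 h2 h3 h4 h5 h6 h7
  rw [h1, Pi.sub_apply, h2, h3, h4, Pi.sub_apply, h5, h6, Pi.smul_apply, h7,
    Pi.sub_apply, ← mul_sub, norm_mul, Real.norm_of_nonneg hc.le]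
  refine mul_le_mul_of_nonneg_left ((abs_sin_sub_sin_le _ _).trans (le_of_eq ?_)) hc.le
  rw [Real.norm_eq_abs, smul_eq_mul]
  congr 1
  ring

/-- The field depends on `x` only through `F` and `A`, so its increment in space is controlled by
the increments of these two. -/
lemma norm_trans_flowField_sub_le (hF : Reg F w Fx Ft) (hA : HasACDeriv A₀ A₀') (hc : 0 < c)
    (h0 : MemLp (fun x => Real.sin (F 0 x - A₀ x / 2)) 2 (volume : Measure ℝ)) (t k : ℝ) (Y : L2) :
    ‖trans k (flowField F A₀ c t Y) - flowField F A₀ c t Y‖ ≤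
      c * ‖incr (Fx t) k - (1 / 2 : ℝ) • (incr A₀' k + (trans k Y - Y))‖ := by
  refine Lp.norm_le_mul_norm_of_ae_le_mul ?_
  have hm := coeFn_flowField (c := c) hF hA h0 t Y
  filter_upwards [Lp.coeFn_sub (trans k (flowField F A₀ c t Y)) (flowField F A₀ c t Y),
    coeFn_trans k (flowField F A₀ c t Y), hm, ae_comp_add hm k,
    Lp.coeFn_sub (incr (Fx t) k) ((1 / 2 : ℝ) • (incr A₀' k + (trans k Y - Y))),
    coeFn_incr (hF.ac t) k, Lp.coeFn_smul (1 / 2 : ℝ) (incr A₀' k + (trans k Y - Y)),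
    Lp.coeFn_add (incr A₀' k) (trans k Y - Y), coeFn_incr hA k, Lp.coeFn_sub (trans k Y) Y,
    coeFn_trans k Y] with x h1 h2 h3 h4 h5 h6 h7 h8 h9 h10 h11
  rw [h1, Pi.sub_apply, h2, h4, h3, h5, Pi.sub_apply, h6, h7, Pi.smul_apply, h8, Pi.add_apply,
    h9, h10, Pi.sub_apply, h11, ← mul_sub, norm_mul, Real.norm_of_nonneg hc.le]
  refine mul_le_mul_of_nonneg_left ((abs_sin_sub_sin_le _ _).trans (le_of_eq ?_)) hc.le
  rw [Real.norm_eq_abs, smul_eq_mul]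
  congr 1
  ring

lemma continuous_flowField (hF : Reg F w Fx Ft) (hA : HasACDeriv A₀ A₀') (hc : 0 < c)
    (h0 : MemLp (fun x => Real.sin (F 0 x - A₀ x / 2)) 2 (volume : Measure ℝ)) :
    Continuous (Function.uncurry (flowField F A₀ c)) := by
  rw [continuous_iff_continuousAt]
  rintro ⟨s, Z⟩
  rw [ContinuousAt, tendsto_iff_norm_sub_tendsto_zero]
  have h1 : Continuous fun p : ℝ × L2 => c * ‖(w p.1 - w s) - (1 / 2 : ℝ) • (p.2 - Z)‖ := by
    have := hF.continuous_w
    fun_prop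
  have h2 := h1.tendsto (s, Z)
  simp only [sub_self, smul_zero, norm_zero, mul_zero] at h2
  exact squeeze_zero (fun _ => norm_nonneg _)
    (fun p => norm_flowField_sub_le hF hA hc h0 p.1 s p.2 Z) h2

/-- Spatial difference quotients of solutions of `A_t = c sin (F - A / 2)` are bounded and Lipschitz in
time. -/
lemma exists_trans_flow_bounds (hF : Reg F w Fx Ft) (hA : HasACDeriv A₀ A₀') (hc : 0 < c)
    (h0 : MemLp (fun x => Real.sin (F 0 x - A₀ x / 2)) 2 (volume : Measure ℝ)) {Y : ℝ → L2}
    (hY0 : Y 0 = 0) (hY : ∀ t, HasDerivAt Y (flowField F A₀ c t (Y t)) t) (T : ℝ) :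
    ∃ M L : ℝ, ∀ t s, |t| ≤ T → |s| ≤ T → ∀ k, ‖trans k (Y t) - Y t‖ ≤ M * |k| ∧
      ‖trans k (Y t - Y s) - (Y t - Y s)‖ ≤ L * |t - s| * |k| := by
  obtain ⟨m, hm⟩ := (isCompact_Icc (a := -T) (b := T)).exists_bound_of_continuousOn hF.cx.continuousOn
  have hm0 : 0 ≤ max m 0 := le_max_right _ _
  set e := Real.exp ((c + 1) * T) with he
  have he0 : 0 < e := Real.exp_pos _
  set B := (‖A₀'‖ + c * max m 0) * e with hB
  have hB0 : 0 ≤ B := by positivity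
  have key : ∀ k, ∃ D : ℝ → L2, (∀ t, D t = incr A₀' k + (trans k (Y t) - Y t)) ∧
      (∀ t, |t| ≤ T → ‖D t‖ ≤ B * |k|) ∧
      ∀ t s, |t| ≤ T → |s| ≤ T → ‖D t - D s‖ ≤ (c * (max m 0 + B)) * |k| * |t - s| := by
    intro k
    -- This is `A(t, x + k) - A(t, x)`. Its time derivative is at most linear in itself plus
    -- `O(|k|)`, so Grönwall gives a bound of size `|k|`, and then the derivative gives the
    -- Lipschitz bound in time.
    set D : ℝ → L2 := fun t => incr A₀' k + (trans k (Y t) - Y t) with hD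
    set D' : ℝ → L2 := fun t => trans k (flowField F A₀ c t (Y t)) - flowField F A₀ c t (Y t) with hD'
    have hDd : ∀ t, HasDerivAt D (D' t) t := fun t =>
      (((trans k).toContinuousLinearMap.hasFDerivAt.comp_hasDerivAt t (hY t)).sub (hY t)).const_add _
    have hD1 : ∀ t, |t| ≤ T → ‖D' t‖ ≤ c * ‖D t‖ + c * (|k| * max m 0) := fun t ht => by
      have h1 := norm_trans_flowField_sub_le hF hA hc h0 t k (Y t)
      have h2 : ‖incr (Fx t) k‖ ≤ |k| * max m 0 := (norm_incr_le _ _).trans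
        (mul_le_mul_of_nonneg_left ((hm t (abs_le.1 ht)).trans (le_max_left _ _)) (abs_nonneg k))
      have h3 : ‖incr (Fx t) k - (1 / 2 : ℝ) • D t‖ ≤ |k| * max m 0 + ‖D t‖ := by
        refine (norm_sub_le _ _).trans (add_le_add h2 ?_)
        rw [norm_smul]
        norm_num
        linarith [norm_nonneg (D t)]
      calc ‖D' t‖ ≤ c * ‖incr (Fx t) k - (1 / 2 : ℝ) • D t‖ := h1
        _ ≤ c * (|k| * max m 0 + ‖D t‖) := mul_le_mul_of_nonneg_left h3 hc.le
        _ = _ := by ring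
    have hD2 : ∀ t, |t| ≤ T → ‖D t‖ ≤ B * |k| := fun t ht => by
      refine (norm_le_of_norm_deriv_le hDd hc.le (by positivity) hD1 ht).trans ?_
      have h1 : ‖D 0‖ ≤ |k| * ‖A₀'‖ := by
        simpa [hD, hY0] using norm_incr_le A₀' k
      calc _ ≤ (|k| * ‖A₀'‖ + c * (|k| * max m 0)) * e := by gcongr
        _ = _ := by rw [hB]; ring
    refine ⟨D, fun t => rfl, hD2, fun t s ht hs => ?_⟩
    have := (convex_Icc (-T) T).norm_image_sub_le_of_norm_hasDerivWithin_le (f := D) (f' := D')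
      (C := (c * (max m 0 + B)) * |k|) (fun τ _ => (hDd τ).hasDerivWithinAt) (fun τ hτ => by
        have h1 := hD1 τ (abs_le.2 hτ)
        have h2 := mul_le_mul_of_nonneg_left (hD2 τ (abs_le.2 hτ)) hc.le
        linarith) (abs_le.1 hs) (abs_le.1 ht)
    simpa using this
  refine ⟨B + ‖A₀'‖, c * (max m 0 + B), fun t s ht hs k => ?_⟩
  obtain ⟨D, hD, h1, h2⟩ := key k
  constructor
  · have : trans k (Y t) - Y t = D t - incr A₀' k := by rw [hD]; abel
    rw [this]
    refine (norm_sub_le _ _).trans ?_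
    linarith [h1 t ht, norm_incr_le A₀' k]
  · have : trans k (Y t - Y s) - (Y t - Y s) = D t - D s := by rw [hD, hD, map_sub]; abel
    rw [this]
    linarith [h2 t s ht hs]

set_option maxHeartbeats 400000 in
-- The equation is solved in `L²` only. Bounded difference quotients of `Y t` give the spatial
-- derivative, and those of `Y t - Y s`, being Lipschitz in time, give its continuity.
lemma exists_flow_hasACDeriv (hF : Reg F w Fx Ft) (hA : HasACDeriv A₀ A₀') (hc : 0 < c)
    (h0 : MemLp (fun x => Real.sin (F 0 x - A₀ x / 2)) 2 (volume : Measure ℝ)) :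
    ∃ (Y : ℝ → L2) (p : ℝ → ℝ → ℝ) (v : ℝ → L2), Y 0 = 0 ∧
      (∀ t, HasDerivAt Y (flowField F A₀ c t (Y t)) t) ∧ (∀ t, HasACDeriv (p t) (v t)) ∧
      (∀ t, Y t =ᵐ[volume] p t) ∧ Continuous v := by
  obtain ⟨Y, hY0, hY⟩ := exists_forall_hasDerivAt (continuous_flowField hF hA hc h0) hc
    (fun t x y => by
      refine (norm_flowField_sub_le hF hA hc h0 t t x y).trans
        (mul_le_mul_of_nonneg_left ?_ hc.le)
      rw [sub_self, zero_sub, norm_neg, norm_smul]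
      norm_num
      linarith [norm_nonneg (x - y)])
  have hYc : Continuous Y := continuous_iff_continuousAt.2 fun t => (hY t).continuousAt
  have hbd := exists_trans_flow_bounds hF hA hc h0 hY0 hY
  have hp : ∀ t, ∃ (p : ℝ → ℝ) (v : L2), HasACDeriv p v ∧ Y t =ᵐ[volume] p := fun t => by
    obtain ⟨M, L, h⟩ := hbd |t|
    obtain ⟨p, v, h1, h2, -⟩ := exists_hasACDeriv_of_norm_trans_sub_le
      fun k => (h t t le_rfl le_rfl k).1
    exact ⟨p, v, h1, h2⟩
  choose p v hpv hYp using hp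
  have hsub : ∀ T t s, |t| ≤ T → |s| ≤ T → ∀ L : ℝ, (∀ k, ‖trans k (Y t - Y s) - (Y t - Y s)‖ ≤ L * |k|) →
      ‖v t - v s‖ ≤ L := fun T t s ht hs L hL => by
    obtain ⟨q, u, hq, hYq, hu⟩ := exists_hasACDeriv_of_norm_trans_sub_le hL
    have h1 : q = fun x => p t x - p s x := by
      refine (hq.continuous.ae_eq_iff_eq volume ((hpv t).continuous.sub (hpv s).continuous)).1 ?_
      filter_upwards [hYq, hYp t, hYp s, Lp.coeFn_sub (Y t) (Y s)] with x h1 h2 h3 h4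
      rw [← h1, h4, Pi.sub_apply, h2, h3]; rfl
    have h2 : u = v t - v s := by
      apply Lp.ext
      refine hq.unique ?_
      rw [h1]
      exact ((hpv t).sub (hpv s)).congr (Lp.coeFn_sub (v t) (v s)).symm
    rw [← h2]; exact hu
  have hvc : Continuous v := by
    rw [continuous_iff_continuousAt]
    intro s
    obtain ⟨M, L, h⟩ := hbd (|s| + 1)
    rw [ContinuousAt, tendsto_iff_norm_sub_tendsto_zero]
    have h1 : Tendsto (fun t => L * |t - s|) (𝓝 s) (𝓝 0) := by
      have : Continuous fun t => L * |t - s| := by fun_prop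
      simpa using this.tendsto s
    refine squeeze_zero' (Eventually.of_forall fun _ => norm_nonneg _) ?_ h1
    filter_upwards [Metric.ball_mem_nhds s one_pos] with t ht
    have ht' : |t| ≤ |s| + 1 := by
      have h2 : |t - s| < 1 := ht
      have h3 := abs_add_le (t - s) s
      rw [sub_add_cancel] at h3
      linarith
    exact hsub (|s| + 1) t s ht' (by linarith) _ fun k => (h t s ht' (by linarith) k).2
  exact ⟨Y, p, v, hY0, hY, hpv, hYp, hvc⟩

lemma exists_reg_flow (hF : Reg F w Fx Ft) (hA : HasACDeriv A₀ A₀') (hc : 0 < c)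
    (h0 : MemLp (fun x => Real.sin (F 0 x - A₀ x / 2)) 2 (volume : Measure ℝ)) :
    ∃ (A : ℝ → ℝ → ℝ) (wA Ax At : ℝ → L2), Reg A wA Ax At ∧ A 0 = A₀ ∧
      ∀ t, At t =ᵐ[volume] fun x => c * Real.sin (F t x - A t x / 2) := by
  obtain ⟨Y, p, v, hY0, hY, hpv, hYp, hvc⟩ := exists_flow_hasACDeriv hF hA hc h0
  have hYc : Continuous Y := continuous_iff_continuousAt.2 fun t => (hY t).continuousAt
  have hp0 : p 0 = fun _ => 0 := by
    refine ((hpv 0).continuous.ae_eq_iff_eq volume continuous_const).1 ?_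
    filter_upwards [hYp 0, Lp.coeFn_zero ℝ 2 (volume : Measure ℝ)] with x h1 h2
    rw [← h1, hY0, h2]; rfl
  have hm := fun t => coeFn_flowField (c := c) hF hA h0 t (Y t)
  have hAx : ∀ t, HasACDeriv (fun x => A₀ x + p t x) (A₀' + v t : L2) := fun t =>
    (hA.add (hpv t)).congr (Lp.coeFn_add A₀' (v t)).symm
  have hw : ∀ t, Y t =ᵐ[volume] fun x => (A₀ x + p t x) - (A₀ x + p 0 x) := fun t => by
    filter_upwards [hYp t] with x h1
    rw [h1, hp0]; ring
  have hAtc : Continuous fun t => flowField F A₀ c t (Y t) := by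
    have h1 : Continuous fun t => (t, Y t) := by fun_prop
    have h2 := (continuous_flowField (c := c) hF hA hc h0).comp h1
    simpa only [Function.comp_def, Function.uncurry_apply_pair] using h2
  refine ⟨fun t x => A₀ x + p t x, Y, fun t => A₀' + v t, fun t => flowField F A₀ c t (Y t),
    ⟨hAx, hw, continuous_const.add hvc, hAtc, hY⟩, ?_, fun t => ?_⟩
  · funext x; simp [hp0]
  · filter_upwards [hYp t, hm t] with x h1 h2
    rw [h2, h1]

end Flow

/-! ### Test functions on space-time as curves in `L²`. -/

/-- The derivative of `Ψ` in the direction `v`. -/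
def dir (v : ℝ × ℝ) (Ψ : ℝ × ℝ → ℝ) (p : ℝ × ℝ) : ℝ := fderiv ℝ Ψ p v

section Test

variable {Ψ : ℝ × ℝ → ℝ}

lemma contDiff_dir (hΨ : ContDiff ℝ ∞ Ψ) (v : ℝ × ℝ) : ContDiff ℝ ∞ (dir v Ψ) :=
  (hΨ.fderiv_right (m := ∞) (by simp)).clm_apply contDiff_const

lemma hasCompactSupport_dir (hc : HasCompactSupport Ψ) (v : ℝ × ℝ) : HasCompactSupport (dir v Ψ) :=
  hc.fderiv_apply (𝕜 := ℝ) v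

lemma hasDerivAt_along (hΨ : ContDiff ℝ ∞ Ψ) {g : ℝ → ℝ × ℝ} {v : ℝ × ℝ} {t : ℝ}
    (hg : HasDerivAt g v t) : HasDerivAt (fun τ => Ψ (g τ)) (dir v Ψ (g t)) t :=
  ((hΨ.differentiable (by simp)) (g t)).hasFDerivAt.comp_hasDerivAt t hg

lemma dir_dir (hΨ : ContDiff ℝ ∞ Ψ) (v w : ℝ × ℝ) (p : ℝ × ℝ) :
    dir v (dir w Ψ) p = fderiv ℝ (fderiv ℝ Ψ) p v w := by
  have h := ((hΨ.fderiv_right (m := ∞) (by simp)).differentiable (by simp) p).hasFDerivAt.clm_apply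
    (hasFDerivAt_const w p)
  have h2 : HasFDerivAt (dir w Ψ) _ p := h
  rw [dir, h2.fderiv]
  simp

lemma hasDerivAt_slice_fst (hΨ : ContDiff ℝ ∞ Ψ) (t x : ℝ) :
    HasDerivAt (fun τ => Ψ (τ, x)) (dir (1, 0) Ψ (t, x)) t :=
  hasDerivAt_along hΨ ((hasDerivAt_id t).prodMk (hasDerivAt_const t x))

lemma hasDerivAt_slice_snd (hΨ : ContDiff ℝ ∞ Ψ) (t x : ℝ) :
    HasDerivAt (fun y => Ψ (t, y)) (dir (0, 1) Ψ (t, x)) x :=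
  hasDerivAt_along hΨ ((hasDerivAt_const x t).prodMk (hasDerivAt_id x))

lemma contDiff_slice (hΨ : ContDiff ℝ ∞ Ψ) (t : ℝ) : ContDiff ℝ ∞ fun x => Ψ (t, x) :=
  hΨ.comp (contDiff_const.prodMk contDiff_id)

lemma exists_radius (hc : HasCompactSupport Ψ) :
    ∃ R : ℝ, ∀ t x, Ψ (t, x) ≠ 0 → t ∈ Set.Icc (-R) R ∧ x ∈ Set.Icc (-R) R := by
  obtain ⟨R, hR⟩ := hc.isCompact.isBounded.subset_closedBall (0 : ℝ × ℝ)
  refine ⟨R, fun t x h => ?_⟩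
  have h1 := hR (subset_tsupport Ψ h)
  rw [mem_closedBall_zero_iff, Prod.norm_def, max_le_iff] at h1
  exact ⟨abs_le.1 h1.1, abs_le.1 h1.2⟩

lemma hasCompactSupport_slice (hc : HasCompactSupport Ψ) (t : ℝ) :
    HasCompactSupport fun x => Ψ (t, x) := by
  obtain ⟨R, hR⟩ := exists_radius hc
  refine HasCompactSupport.intro (isCompact_Icc (a := -R) (b := R)) fun x hx => ?_
  by_contra h
  exact hx (hR t x h).2

/-- The curve `t ↦ Ψ(t, ·)` in `L²`. -/
def testCurve (Ψ : ℝ × ℝ → ℝ) (t : ℝ) : L2 := toL2 fun x => Ψ (t, x)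

lemma coeFn_testCurve (hΨ : ContDiff ℝ ∞ Ψ) (hc : HasCompactSupport Ψ) (t : ℝ) :
    testCurve Ψ t =ᵐ[volume] fun x => Ψ (t, x) :=
  coeFn_toL2 ((contDiff_slice hΨ t).continuous.memLp_of_hasCompactSupport (hasCompactSupport_slice hc t))

lemma inner_testCurve (hΨ : ContDiff ℝ ∞ Ψ) (hc : HasCompactSupport Ψ) (u : L2) (t : ℝ) :
    inner ℝ u (testCurve Ψ t) = ∫ x, u x * Ψ (t, x) := by
  rw [inner_L2]
  exact integral_congr_ae (by filter_upwards [coeFn_testCurve hΨ hc t] with x hx; rw [hx])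

lemma memLp_indicator_Icc {g : ℝ → ℝ} (hg : Continuous g) (R : ℝ) :
    MemLp ((Set.Icc (-R) R).indicator g) 2 (volume : Measure ℝ) := by
  rw [memLp_indicator_iff_restrict measurableSet_Icc]
  obtain ⟨C, hC⟩ := (isCompact_Icc (a := -R) (b := R)).exists_bound_of_continuousOn hg.continuousOn
  exact .of_bound hg.aestronglyMeasurable C
    ((ae_restrict_iff' measurableSet_Icc).2 (ae_of_all _ hC))

/-- A second-order Taylor bound uniform in `x`, multiplied by the indicator of an interval outside
which all terms vanish, is an `L²` bound. -/
lemma hasDerivAt_testCurve (hΨ : ContDiff ℝ ∞ Ψ) (hc : HasCompactSupport Ψ) (t : ℝ) :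
    HasDerivAt (testCurve Ψ) (testCurve (dir (1, 0) Ψ) t) t := by
  have hΨ1 := contDiff_dir hΨ (1, 0)
  have hc1 := hasCompactSupport_dir hc (1, 0)
  have hΨ2 := contDiff_dir hΨ1 (1, 0)
  obtain ⟨M, hM⟩ := (hasCompactSupport_dir hc1 (1, 0)).exists_bound_of_continuous hΨ2.continuous
  obtain ⟨R, hR⟩ := exists_radius hc
  obtain ⟨R₁, hR₁⟩ := exists_radius hc1
  have hM0 : 0 ≤ M := (norm_nonneg _).trans (hM 0)
  set S := max R R₁ with hS
  set I : L2 := toL2 ((Set.Icc (-S) S).indicator fun _ => 1) with hI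
  have hIae := coeFn_toL2 (memLp_indicator_Icc (continuous_const (y := (1 : ℝ))) S)
  have hb1 : ∀ s x, ‖dir (1, 0) Ψ (s, x) - dir (1, 0) Ψ (t, x)‖ ≤ M * ‖s - t‖ := fun s x =>
    convex_univ.norm_image_sub_le_of_norm_hasDerivWithin_le (f := fun τ => dir (1, 0) Ψ (τ, x))
      (fun τ _ => (hasDerivAt_slice_fst hΨ1 τ x).hasDerivWithinAt) (fun τ _ => hM _)
      (Set.mem_univ t) (Set.mem_univ s)
  have hb2 : ∀ s x, ‖Ψ (s, x) - Ψ (t, x) - (s - t) * dir (1, 0) Ψ (t, x)‖ ≤ M * ‖s - t‖ ^ 2 := fun s x => by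
    have := (convex_uIcc t s).norm_image_sub_le_of_norm_hasDerivWithin_le
      (f := fun τ => Ψ (τ, x) - τ * dir (1, 0) Ψ (t, x))
      (f' := fun τ => dir (1, 0) Ψ (τ, x) - dir (1, 0) Ψ (t, x)) (C := M * ‖s - t‖)
      (fun τ _ => (((hasDerivAt_slice_fst hΨ τ x).sub
        ((hasDerivAt_id τ).mul_const (dir (1, 0) Ψ (t, x)))).congr_deriv (by simp)).hasDerivWithinAt)
      (fun τ hτ => (hb1 τ x).trans (mul_le_mul_of_nonneg_left (by
        rw [Real.norm_eq_abs, Real.norm_eq_abs]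
        exact Set.abs_sub_left_of_mem_uIcc hτ) hM0)) Set.left_mem_uIcc Set.right_mem_uIcc
    rw [pow_two, ← mul_assoc]
    refine le_trans (le_of_eq ?_) this
    congr 1
    ring
  rw [hasDerivAt_iff_isLittleO]
  refine Asymptotics.IsBigO.trans_isLittleO ?_ (Asymptotics.isLittleO_pow_sub_sub t one_lt_two)
  refine Asymptotics.IsBigO.of_bound (M * ‖I‖) (Eventually.of_forall fun s => ?_)
  rw [norm_pow, norm_norm, mul_right_comm]
  refine Lp.norm_le_mul_norm_of_ae_le_mul ?_
  filter_upwards [coeFn_testCurve hΨ hc s, coeFn_testCurve hΨ hc t, coeFn_testCurve hΨ1 hc1 t,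
    Lp.coeFn_sub (testCurve Ψ s - testCurve Ψ t) ((s - t) • testCurve (dir (1, 0) Ψ) t),
    Lp.coeFn_sub (testCurve Ψ s) (testCurve Ψ t), Lp.coeFn_smul (s - t) (testCurve (dir (1, 0) Ψ) t),
    hIae] with x h1 h2 h3 h4 h5 h6 h7
  rw [h4, Pi.sub_apply, h5, Pi.sub_apply, h6, Pi.smul_apply, h1, h2, h3, smul_eq_mul, hI, h7]
  by_cases hx : x ∈ Set.Icc (-S) S
  · rw [Set.indicator_of_mem hx]
    simpa using hb2 s x
  · have hx' : ∀ τ, Ψ (τ, x) = 0 := fun τ => by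
      by_contra h
      have := (hR τ x h).2
      exact hx ⟨(neg_le_neg (le_max_left _ _)).trans this.1, this.2.trans (le_max_left _ _)⟩
    have hx1 : dir (1, 0) Ψ (t, x) = 0 := by
      by_contra h
      have := (hR₁ t x h).2
      exact hx ⟨(neg_le_neg (le_max_right _ _)).trans this.1, this.2.trans (le_max_right _ _)⟩
    simp [hx', hx1, Set.indicator_of_notMem hx]

lemma continuous_testCurve (hΨ : ContDiff ℝ ∞ Ψ) (hc : HasCompactSupport Ψ) :
    Continuous (testCurve Ψ) :=
  continuous_iff_continuousAt.2 fun t => (hasDerivAt_testCurve hΨ hc t).continuousAt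

lemma integrable_inner_testCurve (hΨ : ContDiff ℝ ∞ Ψ) (hc : HasCompactSupport Ψ) {v : ℝ → L2}
    (hv : Continuous v) : Integrable fun t => inner ℝ (v t) (testCurve Ψ t) := by
  obtain ⟨R, hR⟩ := exists_radius hc
  refine (hv.inner (continuous_testCurve hΨ hc)).integrable_of_hasCompactSupport
    (HasCompactSupport.intro (isCompact_Icc (a := -R) (b := R)) fun t ht => ?_)
  rw [inner_testCurve hΨ hc]
  have : ∀ x, Ψ (t, x) = 0 := fun x => by
    by_contra h
    exact ht (hR t x h).1
  simp [this]

/-- Integration by parts in time. -/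
lemma integral_inner_testCurve (hΨ : ContDiff ℝ ∞ Ψ) (hc : HasCompactSupport Ψ) {v v' : ℝ → L2}
    (hv : ∀ t, HasDerivAt v (v' t) t) (hv' : Continuous v') :
    ∫ t, inner ℝ (v t) (testCurve (dir (1, 0) Ψ) t) = - ∫ t, inner ℝ (v' t) (testCurve Ψ t) := by
  have hvc : Continuous v := continuous_iff_continuousAt.2 fun t => (hv t).continuousAt
  have i1 := integrable_inner_testCurve (contDiff_dir hΨ (1, 0)) (hasCompactSupport_dir hc (1, 0)) hvc
  have i2 := integrable_inner_testCurve hΨ hc hv'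
  have h := integral_eq_zero_of_hasDerivAt_of_integrable
    (fun t => (hv t).inner ℝ (hasDerivAt_testCurve hΨ hc t)) (i1.add i2)
    (integrable_inner_testCurve hΨ hc hvc)
  rw [integral_add i1 i2] at h
  linarith

lemma Reg.integral_mul_dir_fst {F : ℝ → ℝ → ℝ} {w Fx Ft : ℝ → L2} (hF : Reg F w Fx Ft)
    (hΨ : ContDiff ℝ ∞ Ψ) (hc : HasCompactSupport Ψ) :
    ∫ t, ∫ x, F t x * dir (1, 0) Ψ (t, x) = - ∫ t, inner ℝ (Ft t) (testCurve Ψ t) := by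
  have hΨ1 := contDiff_dir hΨ (1, 0)
  have hc1 := hasCompactSupport_dir hc (1, 0)
  obtain ⟨R, hR⟩ := exists_radius hc1
  -- The slice `F 0` need not be square integrable; it is cut off to the spatial support of the test
  -- function, where this changes nothing.
  set e : L2 := toL2 ((Set.Icc (-R) R).indicator (F 0)) with he
  have hea := coeFn_toL2 (memLp_indicator_Icc (hF.ac 0).continuous R)
  rw [← integral_inner_testCurve hΨ hc (v := fun t => e + w t) (fun t => (hF.dt t).const_add e) hF.ct]
  congr 1
  funext t
  rw [inner_testCurve hΨ1 hc1]
  refine integral_congr_ae ?_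
  filter_upwards [hea, Lp.coeFn_add e (w t), hF.ae t] with x h1 h2 h3
  rw [h2, Pi.add_apply, he, h1, h3]
  by_cases hx : dir (1, 0) Ψ (t, x) = 0
  · simp [hx]
  · rw [Set.indicator_of_mem (hR t x hx).2]
    ring

lemma Reg.integral_mul_dir_snd {F : ℝ → ℝ → ℝ} {w Fx Ft : ℝ → L2} (hF : Reg F w Fx Ft)
    (hΨ : ContDiff ℝ ∞ Ψ) (hc : HasCompactSupport Ψ) (t : ℝ) :
    ∫ x, F t x * dir (0, 1) Ψ (t, x) = - inner ℝ (Fx t) (testCurve Ψ t) := by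
  rw [inner_testCurve hΨ hc, ← (hF.ac t).isWeakDeriv _ (contDiff_slice hΨ t) (hasCompactSupport_slice hc t)]
  congr 1
  funext x
  rw [(hasDerivAt_slice_snd hΨ t x).deriv]

end Test

/-! ### The sine-Gordon equation in characteristic coordinates. -/

section Characteristic

variable {Ψ : ℝ × ℝ → ℝ} {F : ℝ → ℝ → ℝ} {w Fx Ft q : ℝ → L2}

lemma iteratedDeriv_two_along (hΨ : ContDiff ℝ ∞ Ψ) {g : ℝ → ℝ × ℝ} {v : ℝ × ℝ}
    (hg : ∀ t, HasDerivAt g v t) (t : ℝ) :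
    iteratedDeriv 2 (fun τ => Ψ (g τ)) t = dir v (dir v Ψ) (g t) := by
  rw [iteratedDeriv_succ, iteratedDeriv_one]
  have : deriv (fun τ => Ψ (g τ)) = fun τ => dir v Ψ (g τ) :=
    funext fun τ => (hasDerivAt_along hΨ (hg τ)).deriv
  rw [this]
  exact (hasDerivAt_along (contDiff_dir hΨ v) (hg t)).deriv

/-- In the coordinates `(t, x - t)` the pure second derivative in space cancels from the wave
operator, and a time derivative can be factored out. -/
lemma dir_dir_sub_dir_dir (hΨ : ContDiff ℝ ∞ Ψ) (p : ℝ × ℝ) :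
    dir (1, -1) (dir (1, -1) Ψ) p - dir (0, 1) (dir (0, 1) Ψ) p =
      dir (1, 0) (dir (1, 0) Ψ) p - 2 * dir (0, 1) (dir (1, 0) Ψ) p := by
  have hs : IsSymmSndFDerivAt ℝ Ψ p := hΨ.contDiffAt.isSymmSndFDerivAt (by
    rw [minSmoothness_of_isRCLikeNormedField]; exact ENat.LEInfty.out)
  simp only [dir_dir hΨ]
  have e : ((1, -1) : ℝ × ℝ) = (1, 0) - (0, 1) := by simp
  rw [e]
  simp only [map_sub, sub_apply, hs (1, 0) (0, 1)]
  ring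

lemma integrable_mul_of_hasCompactSupport (hF : Continuous (Function.uncurry F)) {Θ : ℝ × ℝ → ℝ}
    (hΘ : Continuous Θ) (hc : HasCompactSupport Θ) :
    Integrable (fun p : ℝ × ℝ => F p.1 p.2 * Θ p) :=
  (hF.mul hΘ).integrable_of_hasCompactSupport (hc.mul_left)

/-- The weak form of the sine-Gordon operator in the characteristic coordinates `(t, x - t)`. -/
lemma integral_sineGordon_eq (hF : Reg F w Fx Ft)
    (hqF : ∀ t, q t =ᵐ[volume] fun x => Real.sin (F t x)) {u : ℝ → ℝ → ℝ}
    (hu : ∀ t x, u t x = F t (x - t)) (hΨ : ContDiff ℝ ∞ Ψ) (hc : HasCompactSupport Ψ) :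
    ∫ p : ℝ × ℝ, (u p.1 p.2 *
        (iteratedDeriv 2 (fun t => Ψ (t, p.2 - t)) p.1 - iteratedDeriv 2 (fun x => Ψ (p.1, x - p.1)) p.2)
      + Real.sin (u p.1 p.2) * Ψ (p.1, p.2 - p.1)) =
    (∫ t, inner ℝ (q t) (testCurve Ψ t))
      - ∫ t, inner ℝ (Ft t - (2 : ℝ) • Fx t) (testCurve (dir (1, 0) Ψ) t) := by
  have hΨ1 := contDiff_dir hΨ (1, 0)
  have hc1 := hasCompactSupport_dir hc (1, 0)
  have hΨ11 := contDiff_dir hΨ1 (1, 0)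
  have hc11 := hasCompactSupport_dir hc1 (1, 0)
  have hΨ21 := contDiff_dir hΨ1 (0, 1)
  have hc21 := hasCompactSupport_dir hc1 (0, 1)
  have hFc := hF.continuous_uncurry
  set H : ℝ × ℝ → ℝ := fun p => F p.1 p.2 * dir (1, 0) (dir (1, 0) Ψ) p
    - 2 * (F p.1 p.2 * dir (0, 1) (dir (1, 0) Ψ) p) + Real.sin (F p.1 p.2) * Ψ p with hH
  have i1 := integrable_mul_of_hasCompactSupport hFc hΨ11.continuous hc11
  have i2 := (integrable_mul_of_hasCompactSupport hFc hΨ21.continuous hc21).const_mul 2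
  have i3 := integrable_mul_of_hasCompactSupport (F := fun t x => Real.sin (F t x))
    (Real.continuous_sin.comp hFc) hΨ.continuous hc
  have e1 : ∀ p : ℝ × ℝ, (u p.1 p.2 *
        (iteratedDeriv 2 (fun t => Ψ (t, p.2 - t)) p.1 - iteratedDeriv 2 (fun x => Ψ (p.1, x - p.1)) p.2)
      + Real.sin (u p.1 p.2) * Ψ (p.1, p.2 - p.1)) = H (p.1, p.2 - p.1) := by
    rintro ⟨t, x⟩
    have d1 : ∀ τ, HasDerivAt (fun τ => ((τ, x - τ) : ℝ × ℝ)) (1, -1) τ := fun τ =>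
      (hasDerivAt_id τ).prodMk ((hasDerivAt_id τ).const_sub x)
    have d2 : ∀ y, HasDerivAt (fun y => ((t, y - t) : ℝ × ℝ)) (0, 1) y := fun y =>
      (hasDerivAt_const y t).prodMk ((hasDerivAt_id y).sub_const t)
    rw [iteratedDeriv_two_along hΨ d1, iteratedDeriv_two_along hΨ d2, dir_dir_sub_dir_dir hΨ]
    simp only [hu, hH]
    ring
  -- The change to characteristic coordinates is a shear and hence preserves the measure.
  have hsh : MeasurePreserving (fun p : ℝ × ℝ => (p.1, p.2 - p.1)) (volume.prod volume)
      (volume.prod volume) :=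
    MeasurePreserving.skew_product (g := fun t x => x - t) (MeasurePreserving.id _) (by fun_prop)
      (ae_of_all _ fun t => (measurePreserving_sub_right volume t).map_eq)
  have hHi : Integrable H (volume.prod volume) := (i1.sub i2).add i3
  simp only [e1]
  have e2 : ∫ p : ℝ × ℝ, H (p.1, p.2 - p.1) = ∫ p, H p := by
    have h1 : AEStronglyMeasurable H (Measure.map (fun p : ℝ × ℝ => (p.1, p.2 - p.1)) (volume.prod volume)) := by
      rw [hsh.map_eq]; exact hHi.1
    have h2 := integral_map hsh.aemeasurable h1
    rw [hsh.map_eq] at h2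
    exact h2.symm
  have i12 : Integrable (fun p : ℝ × ℝ => F p.1 p.2 * dir (1, 0) (dir (1, 0) Ψ) p
    - 2 * (F p.1 p.2 * dir (0, 1) (dir (1, 0) Ψ) p)) := i1.sub i2
  rw [e2]
  simp only [hH]
  rw [integral_add i12 i3, integral_sub i1 i2, integral_const_mul]
  have f1 : ∫ p : ℝ × ℝ, F p.1 p.2 * dir (1, 0) (dir (1, 0) Ψ) p =
      - ∫ t, inner ℝ (Ft t) (testCurve (dir (1, 0) Ψ) t) := by
    rw [← hF.integral_mul_dir_fst hΨ1 hc1]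
    exact integral_prod _ i1
  have f2 : ∫ p : ℝ × ℝ, F p.1 p.2 * dir (0, 1) (dir (1, 0) Ψ) p =
      - ∫ t, inner ℝ (Fx t) (testCurve (dir (1, 0) Ψ) t) := by
    rw [← integral_neg]
    refine (integral_prod _ (integrable_mul_of_hasCompactSupport hFc hΨ21.continuous hc21)).trans ?_
    congr 1
    funext t
    exact hF.integral_mul_dir_snd hΨ1 hc1 t
  have f3 : ∫ p : ℝ × ℝ, Real.sin (F p.1 p.2) * Ψ p = ∫ t, inner ℝ (q t) (testCurve Ψ t) := by
    refine (integral_prod _ i3).trans ?_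
    congr 1
    funext t
    rw [inner_testCurve hΨ hc]
    exact integral_congr_ae (by filter_upwards [hqF t] with x hx; rw [hx])
  rw [f1, f2, f3]
  have j1 := integrable_inner_testCurve hΨ1 hc1 hF.ct
  have j2 := integrable_inner_testCurve hΨ1 hc1 hF.cx
  simp only [inner_sub_left, real_inner_smul_left]
  rw [integral_sub j1 (j2.const_mul 2), integral_const_mul]
  ring

/-- In characteristic coordinates the sine-Gordon equation reads `∂_t (F_t - 2 F_x) = - sin F`. -/
lemma isSolution_of_hasDerivAt (hF : Reg F w Fx Ft) (hq : Continuous q)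
    (hqF : ∀ t, q t =ᵐ[volume] fun x => Real.sin (F t x)) {f : EnergySpace}
    (hf : ∀ t x, f.toFun t x = F t (x - t))
    (h : ∀ t, HasDerivAt (fun t => Ft t - (2 : ℝ) • Fx t) (- q t) t) : IsSolution f := by
  intro ψ hψ hc
  set Ψ : ℝ × ℝ → ℝ := fun p => ψ (p.1, p.2 + p.1) with hΨd
  have hΨ : ContDiff ℝ ∞ Ψ := hψ.comp (contDiff_fst.prodMk (contDiff_snd.add contDiff_fst))
  have hΨc : HasCompactSupport Ψ := by
    obtain ⟨R, hR⟩ := exists_radius hc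
    refine HasCompactSupport.intro ((isCompact_Icc (a := -R) (b := R)).prod
      (isCompact_Icc (a := -R - R) (b := R + R))) fun p hp => ?_
    by_contra hne
    have h1 := hR _ _ hne
    exact hp ⟨h1.1, by constructor <;> linarith [h1.1.1, h1.1.2, h1.2.1, h1.2.2]⟩
  have h1 := integral_sineGordon_eq hF hqF hf hΨ hΨc
  simp only [hΨd, sub_add_cancel] at h1
  refine h1.trans ?_
  have h2 := integral_inner_testCurve hΨ hΨc h hq.neg
  rw [hΨd] at h2
  rw [h2]
  simp only [inner_neg_left, integral_neg]
  ring

/-- Product test functions `κ(t) χ(x)` reduce the distributional equation to a scalar weak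
derivative in time for each fixed `χ`. -/
lemma IsSolution.isWeakDeriv (hF : Reg F w Fx Ft)
    (hqF : ∀ t, q t =ᵐ[volume] fun x => Real.sin (F t x)) {f : EnergySpace}
    (hf : ∀ t x, f.toFun t x = F t (x - t)) (hsol : IsSolution f) {χ : ℝ → ℝ} (hχ : ContDiff ℝ ∞ χ)
    (hχc : HasCompactSupport χ) : IsWeakDeriv
      (fun t => inner ℝ (Ft t - (2 : ℝ) • Fx t) (testL2 χ hχ.continuous hχc))
      (fun t => - inner ℝ (q t) (testL2 χ hχ.continuous hχc)) := by
  set X := testL2 χ hχ.continuous hχc with hX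
  intro κ hκ hκc
  obtain ⟨Ψ, hΨd⟩ : ∃ Ψ : ℝ × ℝ → ℝ, ∀ z, Ψ z = κ z.1 * χ z.2 := ⟨_, fun _ => rfl⟩
  have hΨ : ContDiff ℝ ∞ Ψ := by
    rw [funext hΨd]
    exact (hκ.comp contDiff_fst).mul (hχ.comp contDiff_snd)
  have hΨc : HasCompactSupport Ψ := by
    refine HasCompactSupport.intro (hκc.isCompact.prod hχc.isCompact) fun z hz => ?_
    by_contra hne
    rw [hΨd] at hne
    exact hz ⟨subset_tsupport _ (left_ne_zero_of_mul hne), subset_tsupport _ (right_ne_zero_of_mul hne)⟩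
  have hψ : ContDiff ℝ ∞ fun z : ℝ × ℝ => Ψ (z.1, z.2 - z.1) :=
    hΨ.comp (contDiff_fst.prodMk (contDiff_snd.sub contDiff_fst))
  have hψc : HasCompactSupport fun z : ℝ × ℝ => Ψ (z.1, z.2 - z.1) := by
    obtain ⟨R, hR⟩ := exists_radius hΨc
    refine HasCompactSupport.intro ((isCompact_Icc (a := -R) (b := R)).prod
      (isCompact_Icc (a := -R - R) (b := R + R))) fun z hz => ?_
    by_contra hne
    have h1 := hR _ _ hne
    exact hz ⟨h1.1, by constructor <;> linarith [h1.1.1, h1.1.2, h1.2.1, h1.2.2]⟩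
  have h1 := hsol _ hψ hψc
  dsimp only at h1
  rw [integral_sineGordon_eq hF hqF hf hΨ hΨc] at h1
  have e1 : ∀ t, testCurve Ψ t = κ t • X := fun t => by
    apply Lp.ext
    filter_upwards [coeFn_testCurve hΨ hΨc t, Lp.coeFn_smul (κ t) X, coeFn_testL2 hχ.continuous hχc]
      with x h1 h2 h3
    rw [h1, h2, Pi.smul_apply, h3, hΨd, smul_eq_mul]
  have e2 : ∀ t, testCurve (dir (1, 0) Ψ) t = deriv κ t • X := fun t => by
    apply Lp.ext
    filter_upwards [coeFn_testCurve (contDiff_dir hΨ (1, 0)) (hasCompactSupport_dir hΨc (1, 0)) t,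
      Lp.coeFn_smul (deriv κ t) X, coeFn_testL2 hχ.continuous hχc] with x h1 h2 h3
    rw [h1, h2, Pi.smul_apply, h3, ← (hasDerivAt_slice_fst hΨ t x).deriv]
    simp [hΨd]
  simp only [e1, e2, real_inner_smul_right] at h1
  simp only [neg_mul, integral_neg, neg_neg, mul_comm (inner ℝ _ _)]
  linarith

/-- Although `F_t` and `F_x` are merely continuous in time, the combination `F_t - 2 F_x` is
differentiable: it is continuous, and its scalar weak derivatives integrate to those of a `C¹` curve
in `L²`. -/
lemma IsSolution.hasDerivAt (hF : Reg F w Fx Ft) (hq : Continuous q)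
    (hqF : ∀ t, q t =ᵐ[volume] fun x => Real.sin (F t x)) {f : EnergySpace}
    (hf : ∀ t x, f.toFun t x = F t (x - t)) (hsol : IsSolution f) (t : ℝ) :
    HasDerivAt (fun t => Ft t - (2 : ℝ) • Fx t) (- q t) t := by
  set p : ℝ → L2 := fun t => Ft t - (2 : ℝ) • Fx t with hp
  have hpc : Continuous p := by
    have h1 := hF.ct
    have h2 := hF.cx
    fun_prop
  have key : ∀ t, p t = p 0 + ∫ τ in (0 : ℝ)..t, - q τ := by
    intro t
    refine L2.ext_test fun χ hχ hχc => ?_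
    set X := testL2 χ hχ.continuous hχc with hX
    have hw : IsWeakDeriv (fun t => inner ℝ (p t) X) (fun t => - inner ℝ (q t) X) :=
      hsol.isWeakDeriv hF hqF hf hχ hχc
    have hac := hw.hasACDeriv (hpc.inner continuous_const) (hq.inner continuous_const).neg.locallyIntegrable
    have h1 := hac.sub_eq_integral 0 t
    have h2 := (innerSL ℝ X).intervalIntegral_comp_comm
      ((hq.neg).intervalIntegrable (μ := (volume : Measure ℝ)) 0 t)
    simp only [innerSL_apply_apply, Pi.neg_apply, inner_neg_right] at h2
    rw [inner_add_left, real_inner_comm X (∫ τ in (0 : ℝ)..t, - q τ), ← h2]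
    simp only [real_inner_comm _ X]
    linarith
  have hd : HasDerivAt (fun t => ∫ τ in (0 : ℝ)..t, - q τ) (- q t) t :=
    intervalIntegral.integral_hasDerivAt_right (hq.neg.intervalIntegrable _ _)
      (hq.neg.stronglyMeasurableAtFilter _ _) hq.neg.continuousAt
  have := hd.const_add (p 0)
  rwa [← funext key] at this

end Characteristic

/-- Since `g` is continuous in norm, the fundamental theorem of calculus can be checked against test
functions and then differentiated in norm. -/
lemma hasDerivAt_of_inner_test {v g : ℝ → L2} (hg : Continuous g)
    (h : ∀ (χ : ℝ → ℝ) (hχ : ContDiff ℝ ∞ χ) (hc : HasCompactSupport χ) (t : ℝ),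
      HasDerivAt (fun t => inner ℝ (v t) (testL2 χ hχ.continuous hc))
        (inner ℝ (g t) (testL2 χ hχ.continuous hc)) t) (t : ℝ) : HasDerivAt v (g t) t := by
  have key : ∀ t, v t = v 0 + ∫ τ in (0 : ℝ)..t, g τ := by
    intro t
    refine L2.ext_test fun χ hχ hc => ?_
    have h1 := intervalIntegral.integral_eq_sub_of_hasDerivAt (a := 0) (b := t)
      (fun τ _ => h χ hχ hc τ) ((hg.inner continuous_const).intervalIntegrable _ _)
    have h2 := (innerSL ℝ (testL2 χ hχ.continuous hc)).intervalIntegral_comp_comm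
      (hg.intervalIntegrable (μ := (volume : Measure ℝ)) 0 t)
    simp only [innerSL_apply_apply] at h2
    rw [inner_add_left, real_inner_comm _ (∫ τ in (0 : ℝ)..t, g τ), ← h2]
    simp only [real_inner_comm _ (testL2 χ hχ.continuous hc)] at h1 ⊢
    linarith
  have hd : HasDerivAt (fun t => ∫ τ in (0 : ℝ)..t, g τ) (g t) t :=
    intervalIntegral.integral_hasDerivAt_right (hg.intervalIntegrable _ _)
      (hg.stronglyMeasurableAtFilter _ _) hg.continuousAt
  have := hd.const_add (v 0)
  rwa [← funext key] at this

namespace Reg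

variable {u : ℝ → ℝ → ℝ} {w ux ut : ℝ → L2}

lemma w_zero (h : Reg u w ux ut) : w 0 = 0 := by
  apply Lp.ext
  filter_upwards [h.ae 0, Lp.coeFn_zero ℝ 2 (volume : Measure ℝ)] with x h1 h2
  rw [h1, h2]; simp

/-- Exchange of derivatives: `∂_t u_x = ∂_x u_t`. -/
lemma hasDerivAt_dx (h : Reg u w ux ut) {g : ℝ → ℝ → ℝ} {g' : ℝ → L2} (hg : ∀ t, HasACDeriv (g t) (g' t))
    (hut : ∀ t, ut t =ᵐ[volume] g t) (hg' : Continuous g') (t : ℝ) : HasDerivAt ux (g' t) t := by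
  refine hasDerivAt_of_inner_test hg' (fun χ hχ hc t => ?_) t
  have hd := hχ.continuous_deriv (by simp)
  set X' := testL2 (deriv χ) hd hc.deriv with hX'
  have e : ∀ t, inner ℝ (ux t) (testL2 χ hχ.continuous hc) =
      inner ℝ (ux 0) (testL2 χ hχ.continuous hc) - inner ℝ (w t) X' := fun t => by
    have h1 := ((h.ac t).sub (h.ac 0)).isWeakDeriv χ hχ hc
    have i1 := fun t => integrable_mul_test (L2.locallyIntegrable (ux t)) hχ.continuous hc
    simp only [sub_mul (ux t _ : ℝ)] at h1
    rw [integral_sub (i1 t) (i1 0)] at h1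
    rw [inner_testL2, inner_testL2, inner_testL2,
      show ∫ x, w t x * deriv χ x = ∫ x, (u t x - u 0 x) * deriv χ x from
        integral_congr_ae (by filter_upwards [h.ae t] with x hx; rw [hx])]
    linarith
  have h2 : HasDerivAt (fun t => inner ℝ (ux 0) (testL2 χ hχ.continuous hc) - inner ℝ (w t) X')
      (- inner ℝ (ut t) X') t := by
    have := ((h.dt t).inner ℝ (hasDerivAt_const t X')).const_sub (inner ℝ (ux 0) (testL2 χ hχ.continuous hc))
    simpa using this
  rw [← funext e] at h2
  refine h2.congr_deriv ?_
  rw [inner_testL2, inner_testL2, show ∫ x, ut t x * deriv χ x = ∫ x, g t x * deriv χ x from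
    integral_congr_ae (by filter_upwards [hut t] with x hx; rw [hx]), (hg t).isWeakDeriv χ hχ hc, neg_neg]

/-- Increments of `sin u` are always square integrable, so it suffices that the initial slice is;
then `sin u` itself, and not only its increment, is a differentiable curve in `L²`. -/
lemma exists_sin_curve (h : Reg u w ux ut) (h0 : MemLp (fun x => Real.sin (u 0 x)) 2 (volume : Measure ℝ)) :
    ∃ q : ℝ → L2, (∀ t, q t =ᵐ[volume] fun x => Real.sin (u t x)) ∧
      ∀ t, HasDerivAt q (cosMul (u t) (ut t)) t := by
  refine ⟨fun t => toL2 (fun x => Real.sin (u 0 x)) + toL2 fun x => Real.sin (u t x) - Real.sin (u 0 x),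
    fun t => ?_, fun t => (h.sin.dt t).const_add _⟩
  filter_upwards [Lp.coeFn_add (toL2 fun x => Real.sin (u 0 x))
    (toL2 fun x => Real.sin (u t x) - Real.sin (u 0 x)), coeFn_toL2 h0, h.sin.ae t] with x h1 h2 h3
  rw [h1, Pi.add_apply, h2, h3]
  ring

end Reg

lemma cosMul_add {θ : ℝ → ℝ} (hθ : Continuous θ) (u v : L2) :
    cosMul θ (u + v) = cosMul θ u + cosMul θ v := by
  have h := cosMul_sub hθ (u + v) v
  rw [add_sub_cancel_right] at h
  rw [h, sub_add_cancel]

lemma continuous_of_hasDerivAt {q q' : ℝ → L2} (h : ∀ t, HasDerivAt q (q' t) t) : Continuous q :=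
  continuous_iff_continuousAt.2 fun t => (h t).continuousAt

/-! ### Propagation of the Bäcklund equations in time. -/

section Backlund

variable {F A : ℝ → ℝ → ℝ} {wF Fx Ft wA Ax At qF sb sα : ℝ → L2} {a : ℝ}

lemma half_reg (hF : Reg F wF Fx Ft) (hA : Reg A wA Ax At) :
    Reg (fun t x => F t x - 1 / 2 * A t x) (fun t => wF t - (1 / 2 : ℝ) • wA t)
      (fun t => Fx t - (1 / 2 : ℝ) • Ax t) (fun t => Ft t - (1 / 2 : ℝ) • At t) :=
  hF.sub (hA.const_mul (1 / 2))

/-- The defect of the second Bäcklund equation satisfies a linear equation along characteristics. -/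
lemma hasDerivAt_defect (ha : 0 < a) (hF : Reg F wF Fx Ft) (hA : Reg A wA Ax At)
    (hqF : ∀ t, qF t =ᵐ[volume] fun x => Real.sin (F t x))
    (hp : ∀ t, HasDerivAt (fun t => Ft t - (2 : ℝ) • Fx t) (- qF t) t)
    (hsb : ∀ t, sb t =ᵐ[volume] fun x => Real.sin (F t x - 1 / 2 * A t x))
    (hsb' : ∀ t, HasDerivAt sb (cosMul (fun x => F t x - 1 / 2 * A t x) (Ft t - (1 / 2 : ℝ) • At t)) t)
    (hsα : ∀ t, sα t =ᵐ[volume] fun x => Real.sin (1 / 2 * A t x))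
    (hsα' : ∀ t, HasDerivAt sα (cosMul (fun x => 1 / 2 * A t x) ((1 / 2 : ℝ) • At t)) t)
    (hAt : ∀ t, At t = (2 / a) • sb t) (t : ℝ) :
    HasDerivAt (fun t => (2 : ℝ) • (Ft t - (2 : ℝ) • Fx t) - (2 / a) • sb t + (2 : ℝ) • Ax t
        + (2 * a) • sα t)
      (-(1 / a) • cosMul (fun x => F t x - 1 / 2 * A t x) ((2 : ℝ) • (Ft t - (2 : ℝ) • Fx t)
        - (2 / a) • sb t + (2 : ℝ) • Ax t + (2 * a) • sα t)) t := by
  have hb := half_reg hF hA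
  have hα := hA.const_mul (1 / 2)
  have hbc := (hb.ac t).continuous
  have hαc := (hα.ac t).continuous
  -- Derivatives are exchanged: `∂_t A_x = ∂_x A_t`, and `A_t` is an explicit sine.
  have hAx : HasDerivAt Ax ((2 / a) • cosMul (fun x => F t x - 1 / 2 * A t x)
      (Fx t - (1 / 2 : ℝ) • Ax t)) t :=
    hA.hasDerivAt_dx (g := fun t x => 2 / a * Real.sin (F t x - 1 / 2 * A t x))
      (g' := fun t => (2 / a) • cosMul (fun x => F t x - 1 / 2 * A t x) (Fx t - (1 / 2 : ℝ) • Ax t))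
      (fun t => (hb.sin.const_mul (2 / a)).ac t) (fun t => by
        filter_upwards [hsb t, Lp.coeFn_smul (2 / a) (sb t)] with x h1 h2
        rw [hAt, h2, Pi.smul_apply, h1, smul_eq_mul])
      ((hb.sin.const_mul (2 / a)).cx) t
  refine (((((hp t).const_smul (2 : ℝ)).sub ((hsb' t).const_smul (2 / a))).add
    (hAx.const_smul (2 : ℝ))).add ((hsα' t).const_smul (2 * a))).congr_deriv ?_
  -- The addition formula for `F = (F - A/2) + A/2`. With it the `cos (A/2)` terms cancel, and what
  -- remains is a multiple of the defect.
  have hq : qF t = cosMul (fun x => 1 / 2 * A t x) (sb t)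
      + cosMul (fun x => F t x - 1 / 2 * A t x) (sα t) := by
    apply Lp.ext
    filter_upwards [hqF t, Lp.coeFn_add (cosMul (fun x => 1 / 2 * A t x) (sb t))
      (cosMul (fun x => F t x - 1 / 2 * A t x) (sα t)), coeFn_cosMul hαc (sb t), coeFn_cosMul hbc (sα t),
      hsb t, hsα t] with x h1 h2 h3 h4 h5 h6
    rw [h1, h2, Pi.add_apply, h3, h4, h5, h6]
    conv_lhs => rw [← sub_add_cancel (F t x) (1 / 2 * A t x), Real.sin_add]
    ring
  simp only [cosMul_add hbc, cosMul_sub hbc, cosMul_smul hbc, cosMul_smul hαc, hAt, hq]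
  have := ha.ne'
  match_scalars <;> field_simp <;> ring

/-- The Bäcklund transform of a solution `F` in characteristic coordinates. -/
lemma exists_backlund_flow (ha : 0 < a) (hF : Reg F wF Fx Ft)
    (hqF : ∀ t, qF t =ᵐ[volume] fun x => Real.sin (F t x))
    (hp : ∀ t, HasDerivAt (fun t => Ft t - (2 : ℝ) • Fx t) (- qF t) t)
    {φ₀ : ℝ → ℝ} {φ₀' : L2} (hφ : HasACDeriv φ₀ φ₀') (hφm : MemLp φ₀ 2 (volume : Measure ℝ))
    (hF0 : MemLp (fun x => Real.sin (F 0 x / 2)) 2 (volume : Measure ℝ))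
    (h0 : ∀ᵐ x, Ft 0 x - Fx 0 x - φ₀' x - 1 / a * Real.sin ((F 0 x + φ₀ x) / 2)
      + a * Real.sin ((F 0 x - φ₀ x) / 2) = 0) :
    ∃ (A : ℝ → ℝ → ℝ) (wA Ax At sb sα : ℝ → L2), Reg A wA Ax At ∧ (∀ x, A 0 x = F 0 x - φ₀ x) ∧
      (∀ t, sb t =ᵐ[volume] fun x => Real.sin (F t x - 1 / 2 * A t x)) ∧
      (∀ t, sα t =ᵐ[volume] fun x => Real.sin (1 / 2 * A t x)) ∧
      (∀ t, HasDerivAt sα (cosMul (fun x => 1 / 2 * A t x) ((1 / a) • sb t)) t) ∧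
      (∀ t, At t = (2 / a) • sb t) ∧
      ∀ t, (2 : ℝ) • (Ft t - (2 : ℝ) • Fx t) - (2 / a) • sb t + (2 : ℝ) • Ax t + (2 * a) • sα t = 0 := by
  have hA₀ : HasACDeriv (fun x => F 0 x - φ₀ x) (Fx 0 - φ₀' : L2) :=
    ((hF.ac 0).sub hφ).congr (Lp.coeFn_sub (Fx 0) φ₀').symm
  have hm : ∀ σ : ℝ, |σ| ≤ 1 → MemLp (fun x => Real.sin ((F 0 x + σ * φ₀ x) / 2)) 2 (volume : Measure ℝ) := by
    intro σ hσ
    have h1 : MemLp (fun x => Real.sin ((F 0 x + σ * φ₀ x) / 2) - Real.sin (F 0 x / 2)) 2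
        (volume : Measure ℝ) := by
      refine hφm.of_le ?_ (ae_of_all _ fun x => ?_)
      · have h2 := (hF.ac 0).continuous
        have h3 := hφ.continuous
        exact Continuous.aestronglyMeasurable (by fun_prop)
      · refine (abs_sin_sub_sin_le _ _).trans ?_
        rw [show (F 0 x + σ * φ₀ x) / 2 - F 0 x / 2 = σ * φ₀ x / 2 by ring, abs_div, abs_mul, abs_two,
          Real.norm_eq_abs]
        have := mul_le_mul_of_nonneg_right hσ (abs_nonneg (φ₀ x))
        linarith [abs_nonneg (φ₀ x)]
    exact (memLp_congr_ae (ae_of_all _ fun x => by simp)).1 (h1.add hF0)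
  have hm1 := hm 1 (by simp)
  have hm2 := hm (-1) (by simp)
  -- The sum of the Bäcklund equations is imposed as the evolution equation for `A`; the difference
  -- of the two must then be proved.
  obtain ⟨A, wA, Ax, At, hA, hA0, hAt⟩ := exists_reg_flow hF hA₀ (show 0 < 2 / a by positivity)
    ((memLp_congr_ae (ae_of_all _ fun x => by
      show _ = Real.sin (F 0 x - (F 0 x - φ₀ x) / 2)
      congr 1; ring)).1 hm1)
  have hA0' : ∀ x, A 0 x = F 0 x - φ₀ x := fun x => by rw [hA0]
  have hb := half_reg hF hA
  have hα := hA.const_mul (1 / 2)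
  obtain ⟨sb, hsb, hsb'⟩ := hb.exists_sin_curve ((memLp_congr_ae (ae_of_all _ fun x => by
      show _ = Real.sin (F 0 x - 1 / 2 * A 0 x)
      rw [hA0']; congr 1; ring)).1 hm1)
  obtain ⟨sα, hsα, hsα'⟩ := hα.exists_sin_curve ((memLp_congr_ae (ae_of_all _ fun x => by
      show _ = Real.sin (1 / 2 * A 0 x)
      rw [hA0']; congr 1; ring)).1 hm2)
  have hAt' : ∀ t, At t = (2 / a) • sb t := fun t => by
    apply Lp.ext
    filter_upwards [hAt t, hsb t, Lp.coeFn_smul (2 / a) (sb t)] with x h1 h2 h3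
    rw [h1, h3, Pi.smul_apply, h2, smul_eq_mul]
    congr 2; ring
  refine ⟨A, wA, Ax, At, sb, sα, hA, hA0', hsb, hsα, fun t => ?_, hAt', fun t => ?_⟩
  · refine (hsα' t).congr_deriv ?_
    rw [hAt', smul_smul]
    congr 2; ring
  set r : ℝ → L2 := fun t => (2 : ℝ) • (Ft t - (2 : ℝ) • Fx t) - (2 / a) • sb t + (2 : ℝ) • Ax t
    + (2 * a) • sα t with hr
  have hr' := hasDerivAt_defect ha hF hA hqF hp hsb hsb' hsα hsα' hAt'
  -- At time zero the defect is twice the initial Bäcklund equation.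
  have hr0 : r 0 = 0 := by
    apply Lp.ext
    have hAx0 : Ax 0 = Fx 0 - φ₀' := by
      apply Lp.ext
      refine HasACDeriv.unique (u := A 0) (hA.ac 0) ?_
      rw [hA0]; exact hA₀
    simp only [hr]
    rw [hAx0]
    filter_upwards [h0, hsb 0, hsα 0, Lp.coeFn_zero ℝ 2 (volume : Measure ℝ),
      Lp.coeFn_add ((2 : ℝ) • (Ft 0 - (2 : ℝ) • Fx 0) - (2 / a) • sb 0 + (2 : ℝ) • (Fx 0 - φ₀'))
        ((2 * a) • sα 0),
      Lp.coeFn_add ((2 : ℝ) • (Ft 0 - (2 : ℝ) • Fx 0) - (2 / a) • sb 0) ((2 : ℝ) • (Fx 0 - φ₀')),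
      Lp.coeFn_sub ((2 : ℝ) • (Ft 0 - (2 : ℝ) • Fx 0)) ((2 / a) • sb 0),
      Lp.coeFn_smul (2 : ℝ) (Ft 0 - (2 : ℝ) • Fx 0), Lp.coeFn_sub (Ft 0) ((2 : ℝ) • Fx 0),
      Lp.coeFn_smul (2 : ℝ) (Fx 0), Lp.coeFn_smul (2 / a) (sb 0), Lp.coeFn_smul (2 : ℝ) (Fx 0 - φ₀'),
      Lp.coeFn_sub (Fx 0) φ₀', Lp.coeFn_smul (2 * a) (sα 0)]
      with x e0 e1 e2 e3 e4 e5 e6 e7 e8 e9 e10 e11 e12 e13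
    rw [e4, Pi.add_apply, e5, Pi.add_apply, e6, Pi.sub_apply, e7, Pi.smul_apply, e8, Pi.sub_apply, e9,
      Pi.smul_apply, e10, Pi.smul_apply, e11, Pi.smul_apply, e12, Pi.sub_apply, e13, Pi.smul_apply,
      e1, e2, e3, hA0']
    simp only [smul_eq_mul, Pi.zero_apply]
    have i1 : F 0 x - 1 / 2 * (F 0 x - φ₀ x) = (F 0 x + φ₀ x) / 2 := by ring
    have i2 : 1 / 2 * (F 0 x - φ₀ x) = (F 0 x - φ₀ x) / 2 := by ring
    rw [i1, i2]
    linear_combination 2 * e0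
  -- The equation for the defect is homogeneous and linear with a bounded coefficient, so Grönwall
  -- keeps it at zero.
  have hbound := norm_le_of_norm_deriv_le (T := |t|) (K := 1 / a) (ε := 0) hr' (by positivity) le_rfl
    (fun s _ => by
      rw [norm_smul, norm_neg, Real.norm_of_nonneg (by positivity), add_zero]
      exact mul_le_mul_of_nonneg_left (norm_cosMul_le (hb.ac s).continuous _) (by positivity)) le_rfl
  have hr0' : ‖r 0‖ = 0 := by rw [hr0, norm_zero]
  simp only [hr] at hr0'
  rw [hr0', zero_add, zero_mul] at hbound
  exact norm_le_zero_iff.1 hbound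

end Backlund

/-- The Bäcklund transform of a solution exists for all times. -/
theorem exists_isBacklund {f : EnergySpace} (hf : IsSolution f) {a : ℝ} (ha : 0 < a) {φ₀ φ₀' : ℝ → ℝ}
    (hi : IsInitialBT f a φ₀ φ₀') (hm : MemLp φ₀ 2 (volume : Measure ℝ))
    (hm' : MemLp φ₀' 2 (volume : Measure ℝ)) :
    ∃ φ : EnergySpace, IsSolution φ ∧ IsBacklund a φ f ∧ φ.toFun 0 = φ₀ := by
  have hm'e := coeFn_toL2 hm'
  -- Along the direction `∂_t + ∂_x` the sum of the Bäcklund equations contains no spatial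
  -- derivatives.
  have hF := f.reg.comp_trans 1
  set F : ℝ → ℝ → ℝ := fun t x => f.toFun t (x + 1 * t) with hFd
  set Fx : ℝ → L2 := fun t => trans (1 * t) (f.dx t) with hFx
  set Ft : ℝ → L2 := fun t => trans (1 * t) (f.dt t + (1 : ℝ) • f.dx t) with hFt
  have hF0 : ∀ x, F 0 x = f.toFun 0 x := fun x => by simp [hFd]
  have hFsin2 : MemLp (fun x => Real.sin (F 0 x / 2)) 2 (volume : Measure ℝ) := by
    simp only [hF0]; exact f.memLp_sin 0
  -- The energy space controls `sin (g/2)`, while the equation contains `sin g`; the double-angle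
  -- formula connects them.
  have hsin : ∀ {g : ℝ → ℝ}, Continuous g → MemLp (fun x => Real.sin (g x / 2)) 2 (volume : Measure ℝ) →
      MemLp (fun x => Real.sin (g x)) 2 (volume : Measure ℝ) := fun {g} hg h => by
    refine (h.const_mul 2).of_le (Continuous.aestronglyMeasurable (by fun_prop)) (ae_of_all _ fun x => ?_)
    rw [show g x = 2 * (g x / 2) by ring, Real.sin_two_mul, norm_mul,
      show 2 * (g x / 2) / 2 = g x / 2 by ring]
    exact mul_le_of_le_one_right (norm_nonneg _) (Real.abs_cos_le_one _)
  obtain ⟨qF, hqF, hqF'⟩ := hF.exists_sin_curve (hsin (hF.ac 0).continuous hFsin2)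
  have hp := hf.hasDerivAt hF (continuous_of_hasDerivAt hqF') hqF (fun t x => by simp [hFd])
  have hinit : ∀ᵐ x, Ft 0 x - Fx 0 x - toL2 φ₀' x - 1 / a * Real.sin ((F 0 x + φ₀ x) / 2)
      + a * Real.sin ((F 0 x - φ₀ x) / 2) = 0 := by
    have e1 : Fx 0 = f.dx 0 := by simp [hFx, trans_zero]
    have e2 : Ft 0 = f.dt 0 + f.dx 0 := by simp [hFt, trans_zero]
    rw [e1, e2]
    filter_upwards [hi.2, hm'e, Lp.coeFn_add (f.dt 0) (f.dx 0)] with x h1 h2 h3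
    rw [h3, Pi.add_apply, h2, hF0, add_sub_cancel_right]
    exact h1
  obtain ⟨A, wA, Ax, At, sb, sα, hA, hA0, hsb, hsα, hsα', hAt, hr⟩ := exists_backlund_flow ha hF hqF hp
    (hi.1.congr hm'e.symm) hm hFsin2 hinit
  have hG := hF.sub hA
  have hφ := hG.comp_trans (-1)
  have hG0 : ∀ x, F 0 x - A 0 x = φ₀ x := fun x => by rw [hA0]; ring
  have hφ₀sin2 : MemLp (fun x => Real.sin (φ₀ x / 2)) 2 (volume : Measure ℝ) := by
    have hc := hi.1.continuous
    refine hm.of_le (Continuous.aestronglyMeasurable (by fun_prop)) (ae_of_all _ fun x => ?_)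
    refine (Real.abs_sin_le_abs).trans ?_
    rw [abs_div, abs_two, Real.norm_eq_abs]
    linarith [abs_nonneg (φ₀ x)]
  let φ : EnergySpace := hφ.toEnergySpace (by simpa [hG0] using hφ₀sin2)
  have hr1 : ∀ t, Ax t = (1 / a) • sb t - Ft t + (2 : ℝ) • Fx t - a • sα t := fun t => by
    have h1 := hr t
    have h2 : Ax t = (1 / 2 : ℝ) • ((2 : ℝ) • (Ft t - (2 : ℝ) • Fx t) - (2 / a) • sb t + (2 : ℝ) • Ax t
      + (2 * a) • sα t) + ((1 / a) • sb t - Ft t + (2 : ℝ) • Fx t - a • sα t) := by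
      have := ha.ne'
      module
    rw [h1, smul_zero, zero_add] at h2
    exact h2
  have hneg : ∀ t : ℝ, -1 * t + 1 * t = 0 := fun t => by ring
  have hfx : ∀ t, f.dx t = trans (-1 * t) (Fx t) := fun t => by
    rw [hFx, trans_trans, hneg, trans_zero]
  have hft : ∀ t, f.dt t = trans (-1 * t) (Ft t - Fx t) := fun t => by
    rw [hFx, hFt, ← map_sub, trans_trans, hneg, trans_zero, one_smul, add_sub_cancel_right]
  refine ⟨φ, ?_, fun t => ?_, ?_⟩
  · obtain ⟨qG, hqG, hqG'⟩ := hG.exists_sin_curve (hsin (hG.ac 0).continuous (by simpa [hG0] using hφ₀sin2))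
    refine isSolution_of_hasDerivAt hG (continuous_of_hasDerivAt hqG') hqG (f := φ) (fun t x => ?_)
      fun t => ?_
    · show F t (x + -1 * t) - A t (x + -1 * t) = F t (x - t) - A t (x - t)
      rw [neg_one_mul, ← sub_eq_add_neg]
    -- The vanishing defect eliminates `A_x`, so the right-hand side is visibly differentiable; its
    -- derivative is `sin F - 2 cos(A/2) sin(F - A/2) = -sin(F - A)`.
    · have e1 : (fun t => Ft t - At t - (2 : ℝ) • (Fx t - Ax t)) =
          fun t => -(Ft t - (2 : ℝ) • Fx t) - (2 * a) • sα t := by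
        funext t
        rw [hAt, hr1]
        have := ha.ne'
        module
      rw [e1]
      refine ((hp t).neg.sub ((hsα' t).const_smul (2 * a))).congr_deriv ?_
      have hαc := ((hA.const_mul (1 / 2)).ac t).continuous
      rw [cosMul_smul hαc, smul_smul, show 2 * a * (1 / a) = 2 by field_simp, neg_neg]
      apply Lp.ext
      filter_upwards [Lp.coeFn_sub (qF t) ((2 : ℝ) • cosMul (fun x => 1 / 2 * A t x) (sb t)),
        Lp.coeFn_smul (2 : ℝ) (cosMul (fun x => 1 / 2 * A t x) (sb t)), coeFn_cosMul hαc (sb t), hqF t,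
        hsb t, Lp.coeFn_neg (qG t), hqG t] with x h1 h2 h3 h4 h5 h6 h7
      rw [h1, Pi.sub_apply, h2, Pi.smul_apply, h3, h4, h5, h6, Pi.neg_apply, h7, smul_eq_mul]
      have k1 : Real.sin (F t x) = Real.sin (F t x - 1 / 2 * A t x) * Real.cos (1 / 2 * A t x)
          + Real.cos (F t x - 1 / 2 * A t x) * Real.sin (1 / 2 * A t x) := by
        rw [← Real.sin_add]; congr 1; ring
      have k2 : Real.sin (F t x - A t x) = Real.sin (F t x - 1 / 2 * A t x) * Real.cos (1 / 2 * A t x)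
          - Real.cos (F t x - 1 / 2 * A t x) * Real.sin (1 / 2 * A t x) := by
        rw [← Real.sin_sub]; congr 1; ring
      rw [k1, k2]
      ring
  -- Back in the original coordinates the evolution equation and the vanishing defect become the two
  -- Bäcklund equations.
  · have d1 : f.dx t - φ.dt t = trans (-1 * t) ((1 / a) • sb t + a • sα t) := by
      rw [hfx]
      show _ - trans (-1 * t) (Ft t - At t + (-1 : ℝ) • (Fx t - Ax t)) = _
      rw [← map_sub, hAt, hr1]
      congr 1
      module
    have d2 : f.dt t - φ.dx t = trans (-1 * t) ((1 / a) • sb t - a • sα t) := by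
      rw [hft]
      show _ - trans (-1 * t) (Fx t - Ax t) = _
      rw [← map_sub, hr1]
      congr 1
      module
    have e1 : ∀ y, (f.toFun t y + φ.toFun t y) / 2 =
        F t (y + -1 * t) - 1 / 2 * A t (y + -1 * t) := fun y => by
      have : f.toFun t y = F t (y + -1 * t) := by simp [hFd]
      rw [this]
      show (F t (y + -1 * t) + (F t (y + -1 * t) - A t (y + -1 * t))) / 2 = _
      ring
    have e2 : ∀ y, (f.toFun t y - φ.toFun t y) / 2 = 1 / 2 * A t (y + -1 * t) := fun y => by
      have : f.toFun t y = F t (y + -1 * t) := by simp [hFd]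
      rw [this]
      show (F t (y + -1 * t) - (F t (y + -1 * t) - A t (y + -1 * t))) / 2 = _
      ring
    filter_upwards [Lp.coeFn_sub (f.dx t) (φ.dt t), Lp.coeFn_sub (f.dt t) (φ.dx t),
      coeFn_trans (-1 * t) ((1 / a) • sb t + a • sα t), coeFn_trans (-1 * t) ((1 / a) • sb t - a • sα t),
      ae_comp_add (Lp.coeFn_add ((1 / a) • sb t) (a • sα t)) (-1 * t),
      ae_comp_add (Lp.coeFn_sub ((1 / a) • sb t) (a • sα t)) (-1 * t),
      ae_comp_add (Lp.coeFn_smul (1 / a) (sb t)) (-1 * t), ae_comp_add (Lp.coeFn_smul a (sα t)) (-1 * t),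
      ae_comp_add (hsb t) (-1 * t), ae_comp_add (hsα t) (-1 * t)]
      with y h1 h2 h3 h4 h5 h6 h7 h8 h9 h10
    rw [d1, h3, h5, Pi.add_apply, Pi.sub_apply, h7, h8, Pi.smul_apply, Pi.smul_apply, h9, h10,
      smul_eq_mul, smul_eq_mul] at h1
    rw [d2, h4, h6, Pi.sub_apply, Pi.sub_apply, h7, h8, Pi.smul_apply, Pi.smul_apply, h9, h10,
      smul_eq_mul, smul_eq_mul] at h2
    rw [e1, e2, ← h1, ← h2]
    constructor <;> ring
  · funext x
    show F 0 (x + -1 * 0) - A 0 (x + -1 * 0) = φ₀ x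
    rw [hG0]; simp

/-- The recorded derivatives are unique as `L²` classes. This makes equality of triples in the main
theorem an equality of functions. -/
lemma EnergySpace.ext_toFun {φ ψ : EnergySpace} (h : φ.toFun = ψ.toFun) : φ = ψ := by
  have hx : φ.dx = ψ.dx := by
    funext t
    apply Lp.ext
    have h1 := φ.hasACDeriv t
    rw [h] at h1
    exact h1.unique (ψ.hasACDeriv t)
  have ht : φ.dt = ψ.dt := by
    funext t
    have h1 := φ.reg.dt t
    rw [h] at h1
    exact h1.unique (ψ.reg.dt t)
  cases φ
  cases ψ
  simp only [EnergySpace.mk.injEq]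
  exact ⟨h, hx, ht⟩

/-- The function `φ` of which `f` is the Bäcklund transform is determined by its initial value. -/
theorem IsBacklund.unique {f φ ψ : EnergySpace} {a : ℝ} (ha : 0 < a) (hφ : IsBacklund a φ f)
    (hψ : IsBacklund a ψ f) (h0 : φ.toFun 0 = ψ.toFun 0) : φ = ψ := by
  have hD := φ.reg.sub ψ.reg
  have hW : ∀ t, HasDerivAt _ (φ.dt t - ψ.dt t) t := hD.dt
  set W : ℝ → L2 := fun t => (toL2 fun x => φ.toFun t x - φ.toFun 0 x)
    - toL2 fun x => ψ.toFun t x - ψ.toFun 0 x with hWd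
  have hae : ∀ t, W t =ᵐ[volume] fun x => φ.toFun t x - ψ.toFun t x := fun t => by
    filter_upwards [hD.ae t] with x hx
    rw [hx, h0]; ring
  have hb : ∀ t, ‖φ.dt t - ψ.dt t‖ ≤ (1 / a + a) * ‖W t‖ := fun t => by
    refine Lp.norm_le_mul_norm_of_ae_le_mul ?_
    filter_upwards [hae t, Lp.coeFn_sub (φ.dt t) (ψ.dt t), hφ t, hψ t] with x h1 h2 h3 h4
    rw [h2, Pi.sub_apply, h1]
    -- The term `f_x` drops out of the difference of the first Bäcklund equations, which is thus an
    -- ordinary differential inequality in `L²`.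
    have e : φ.dt t x - ψ.dt t x = - (1 / a * (Real.sin ((f.toFun t x + φ.toFun t x) / 2)
        - Real.sin ((f.toFun t x + ψ.toFun t x) / 2))) - a * (Real.sin ((f.toFun t x - φ.toFun t x) / 2)
        - Real.sin ((f.toFun t x - ψ.toFun t x) / 2)) := by linear_combination h4.1 - h3.1
    have b1 := abs_sin_sub_sin_le ((f.toFun t x + φ.toFun t x) / 2) ((f.toFun t x + ψ.toFun t x) / 2)
    have b2 := abs_sin_sub_sin_le ((f.toFun t x - φ.toFun t x) / 2) ((f.toFun t x - ψ.toFun t x) / 2)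
    have c1 : |(f.toFun t x + φ.toFun t x) / 2 - (f.toFun t x + ψ.toFun t x) / 2| ≤
        |φ.toFun t x - ψ.toFun t x| := by
      rw [show (f.toFun t x + φ.toFun t x) / 2 - (f.toFun t x + ψ.toFun t x) / 2 =
        (φ.toFun t x - ψ.toFun t x) / 2 by ring, abs_div, abs_two]
      linarith [abs_nonneg (φ.toFun t x - ψ.toFun t x)]
    have c2 : |(f.toFun t x - φ.toFun t x) / 2 - (f.toFun t x - ψ.toFun t x) / 2| ≤
        |φ.toFun t x - ψ.toFun t x| := by
      rw [show (f.toFun t x - φ.toFun t x) / 2 - (f.toFun t x - ψ.toFun t x) / 2 =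
        -((φ.toFun t x - ψ.toFun t x) / 2) by ring, abs_neg, abs_div, abs_two]
      linarith [abs_nonneg (φ.toFun t x - ψ.toFun t x)]
    rw [e, Real.norm_eq_abs, Real.norm_eq_abs, add_mul]
    refine (abs_sub _ _).trans (add_le_add ?_ ?_)
    · rw [abs_neg, abs_mul, abs_of_pos (by positivity : 0 < 1 / a)]
      exact mul_le_mul_of_nonneg_left (b1.trans c1) (by positivity)
    · rw [abs_mul, abs_of_pos ha]
      exact mul_le_mul_of_nonneg_left (b2.trans c2) ha.le
  have hW0 : W 0 = 0 := hD.w_zero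
  refine EnergySpace.ext_toFun (funext fun t => ?_)
  have h1 := norm_le_of_norm_deriv_le (T := |t|) (K := 1 / a + a) (ε := 0) hW (by positivity) le_rfl
    (fun s _ => by rw [add_zero]; exact hb s) le_rfl
  rw [hW0, norm_zero, zero_add, zero_mul] at h1
  refine ((φ.continuous_slice t).ae_eq_iff_eq volume (ψ.continuous_slice t)).1 ?_
  filter_upwards [hae t, Lp.coeFn_zero ℝ 2 (volume : Measure ℝ)] with x h2 h3
  rw [norm_le_zero_iff.1 h1, h3] at h2
  exact (sub_eq_zero.1 h2.symm)

end SineGordon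

end

/-! ### The main theorem. -/

theorem mainTheorem5 (m s : ℝ) (hm : 0 ≤ m) (hs : 0 ≤ s)
    (β₀ x₀ : ℝ) (hβ₀ : β₀ ∈ Set.Ioo (-1 : ℝ) 1) :
    ∃ C₀ : ℝ, 0 < C₀ ∧ ∀ C : ℝ, C₀ ≤ C → ∃ δ : ℝ, 0 < δ ∧ ∀ ε₀ : ℝ, ε₀ < δ →
      ∀ f : SineGordon.EnergySpace, SineGordon.IsSolution f →
        SineGordon.distToKink m s f β₀ x₀ < ENNReal.ofReal ε₀ →
        ∃! p : ℝ × ℝ × SineGordon.EnergySpace,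
          match p with
          | (β, y₀, φ) =>
            β ∈ Set.Ioo (-1 : ℝ) 1 ∧
            SineGordon.IsSolution φ ∧
            SineGordon.IsBacklund (SineGordon.backlundParam β) φ f ∧
            ENNReal.ofReal (|β - β₀| + |y₀ - x₀|)
                + SineGordon.pairNorm m s (φ.toFun 0) (φ.dt 0) ≤ ENNReal.ofReal (C * ε₀) ∧
            SineGordon.distToKink m s f β y₀ ≤ ENNReal.ofReal (C * ε₀) ∧
            ∫ x, (f.toFun 0 x - SineGordon.kink β y₀ 0 x)
              * SineGordon.sech (SineGordon.lorentz β * (x - y₀)) = 0 := by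
  obtain ⟨C₁, r₁, hC₁, hr₁, hex⟩ := SineGordon.exists_initialBT hm hs hβ₀ x₀
  obtain ⟨r₂, hr₂, hun⟩ := SineGordon.exists_initialBT_unique hm hs hβ₀ x₀
  -- The first bound of the theorem is a sum of three quantities, for the parameters, `φ(0)` and
  -- `φ_t(0)`, each at most `C₁ ε₀`.
  refine ⟨3 * C₁, by positivity, fun C hC => ?_⟩
  have hC0 : 0 < C := by linarith
  -- The entry `r₂ / C` places every competitor within `C ε₀` inside the uniqueness radius `r₂`;
  -- this is where `δ` depends on `C`.
  refine ⟨min r₁ (min r₂ (r₂ / C)), by positivity, fun ε₀ hε f hf hd => ?_⟩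
  have hε0 : 0 < ε₀ := by
    by_contra h
    rw [ENNReal.ofReal_of_nonpos (not_lt.1 h)] at hd
    exact not_lt_zero hd
  have l1 : ε₀ < r₁ := hε.trans_le (min_le_left _ _)
  have l2 : ε₀ < r₂ := hε.trans_le ((min_le_right _ _).trans (min_le_left _ _))
  have l3 : C * ε₀ ≤ r₂ := by
    have h := (hε.trans_le ((min_le_right _ _).trans (min_le_right _ _))).le
    rwa [le_div_iff₀ hC0, mul_comm] at h
  have hlast : ∀ {β y : ℝ} {φ : SineGordon.EnergySpace},
      SineGordon.IsBacklund (SineGordon.backlundParam β) φ f →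
      ENNReal.ofReal (|β - β₀| + |y - x₀|)
        + SineGordon.pairNorm m s (φ.toFun 0) (φ.dt 0) ≤ ENNReal.ofReal (C * ε₀) →
      SineGordon.IsInitialBT f (SineGordon.backlundParam β) (φ.toFun 0) (φ.dx 0) ∧
      |β - β₀| ≤ r₂ ∧ |y - x₀| ≤ r₂ ∧
      SineGordon.sobolevNorm (m + 1) s (φ.toFun 0) ≤ ENNReal.ofReal r₂ := fun {β y φ} hB hb => by
    have h1 := (le_self_add.trans hb).trans (ENNReal.ofReal_le_ofReal l3)
    rw [ENNReal.ofReal_le_ofReal_iff hr₂.le] at h1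
    have h2 : SineGordon.sobolevNorm (m + 1) s (φ.toFun 0) ≤ ENNReal.ofReal r₂ :=
      ((le_self_add.trans (le_add_self.trans hb))).trans (ENNReal.ofReal_le_ofReal l3)
    refine ⟨⟨φ.hasACDeriv 0, ?_⟩, by linarith [abs_nonneg (y - x₀)], by linarith [abs_nonneg (β - β₀)], h2⟩
    filter_upwards [hB 0] with x hx using hx.2
  obtain ⟨β, hβ, y, φ₀, φ₀', hi, hby, hs0, hs1, hdist, hint⟩ := hex f ε₀ hε0 l1 hd
  have hC1 : C₁ * ε₀ ≤ C * ε₀ := mul_le_mul_of_nonneg_right (by linarith) hε0.le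
  have hφm : MeasureTheory.MemLp φ₀ 2 MeasureTheory.volume :=
    ⟨hi.1.continuous.aestronglyMeasurable,
      ((SineGordon.eLpNorm_le_sobolevNorm hs (by linarith)).trans hs0).trans_lt ENNReal.ofReal_lt_top⟩
  have hφm' : MeasureTheory.MemLp φ₀' 2 MeasureTheory.volume := by
    obtain ⟨A, hA, hd⟩ := SineGordon.exists_sobolevNorm_deriv_le s hm
    refine ⟨hi.1.aestronglyMeasurable, ((SineGordon.eLpNorm_le_sobolevNorm hs hm).trans
      (hd φ₀ φ₀' hi.1 (hs0.trans_lt ENNReal.ofReal_lt_top).ne)).trans_lt ?_⟩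
    exact ENNReal.mul_lt_top hA.lt_top (hs0.trans_lt ENNReal.ofReal_lt_top)
  obtain ⟨φ, hφsol, hφB, hφ0⟩ :=
    SineGordon.exists_isBacklund hf (SineGordon.backlundParam_pos hβ) hi hφm hφm'
  have hbound : ENNReal.ofReal (|β - β₀| + |y - x₀|)
      + SineGordon.pairNorm m s (φ.toFun 0) (φ.dt 0) ≤ ENNReal.ofReal (C * ε₀) := by
    -- The first Bäcklund equation at time zero expresses `φ_t(0)` by quantities already estimated.
    have h1 : SineGordon.sobolevNorm m s (φ.dt 0) ≤ ENNReal.ofReal (C₁ * ε₀) := by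
      refine le_of_eq_of_le (SineGordon.sobolevNorm_congr ?_) hs1
      filter_upwards [hφB 0] with x hx
      rw [← hφ0]
      linear_combination -hx.1
    have h0 : 0 ≤ C₁ * ε₀ := by positivity
    calc _ ≤ ENNReal.ofReal (C₁ * ε₀) + (ENNReal.ofReal (C₁ * ε₀) + ENNReal.ofReal (C₁ * ε₀)) := by
          refine add_le_add (ENNReal.ofReal_le_ofReal hby) (add_le_add ?_ h1)
          rw [hφ0]; exact hs0
      _ = ENNReal.ofReal (3 * C₁ * ε₀) := by
          rw [← ENNReal.ofReal_add h0 h0, ← ENNReal.ofReal_add h0 (by linarith)]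
          congr 1; ring
      _ ≤ _ := ENNReal.ofReal_le_ofReal (mul_le_mul_of_nonneg_right hC hε0.le)
  refine ⟨(β, y, φ), ⟨hβ, hφsol, hφB, hbound, hdist.trans (ENNReal.ofReal_le_ofReal hC1), hint⟩, ?_⟩
  rintro ⟨β₁, y₁, ψ⟩ ⟨hβ₁, -, hψB, hψb, -, hψint⟩
  obtain ⟨i1, b1, b2, b3⟩ := hlast hφB hbound
  obtain ⟨j1, c1, c2, c3⟩ := hlast hψB hψb
  -- The competitor is compared at time zero only; the Bäcklund equations carry the equality to all
  -- times.
  obtain ⟨e1, e2, e3⟩ := hun f (hd.trans_le (ENNReal.ofReal_le_ofReal l2.le)) _ _ _ _ _ _ _ _ hβ₁ hβ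
    j1 i1 c1 b1 c2 b2 c3 b3 hψint hint
  subst e1 e2
  rw [hψB.unique (SineGordon.backlundParam_pos hβ) hφB e3]
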